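/- **Conventions.** Let $k$ be a field complete with respect to a non-Archimedean absolute value. Banach spaces over $k$ have ultrametric norms, morphisms are bounded linear maps, $\hat\otimes$ is the completed projective tensor product, and $\coprod^{\leq 1}_{i} k\cdot e_i$ with prescribed $\|e_i\|=w_i>0$ is the Banach space of families $(a_i)$ with $|a_i|w_i\to 0$, under the sup norm. Let $q\in k$ with $|q|=1$ be not a root of unity. **Root datum.** Let $\Phi$ be a free $\mathbb Z$-module, $(\alpha_i)_{i\in I}$ a linearly independent family in $\Phi$ (the simple roots; $I$ is any set), $(\cdot,\cdot):\Phi\times\Phi\to\mathbb Q$ a symmetric bilinear form with $d_i:=(\alpha_i,\alpha_i)/2\in\{1,2,\dots\}$ and $(\alpha_i,\alpha_j)\le 0$ for $i\ne j$, and $\lambda_i\in\Phi^*=\mathrm{Hom}(\Phi,\mathbb Z)$ with $\lambda_i(x)=2(\alpha_i,x)/(\alpha_i,\alpha_i)$ for all $x\in\Phi$. Put $q_i=q^{d_i}$. **Cartan part.** $H=\coprod^{\le1}_{\lambda\in\Phi^*}k\cdot K_\lambda$ and $H'=\coprod^{\le1}_{n\in\mathbb Z^{(I)}}k\cdot t^n$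 are the Banach group Hopf algebras ($\|K_\lambda\|=\|t^n\|=1$, the $K_\lambda$ and $t^n$ group-like). They are paired by $\langle K_\lambda,t^n\rangle=q^{\lambda(\sum n_i\alpha_i)}$, and $\mathscr R,\overline{\mathscr R}:H'\to H$ are the algebra maps with $\mathscr R(t_i)=t_i:=K_{d_i\lambda_i}$ and $\overline{\mathscr R}(t_i)=t_i^{-1}$. An $H'$-comodule with coaction $x\mapsto x_{(-1)}\otimes x_{(0)}$ is an $H$-module on either side by $h\triangleright x=x\triangleleft h=\langle h,x_{(-1)}\rangle x_{(0)}$. The category of $H'$-comodules is braided by $\Psi(x\otimes y)=\langle\mathscr R(x_{(-1)}),y_{(-1)}\rangle\,y_{(0)}\otimes x_{(0)}$. **Nichols algebras.** For $r>0$ let $T_r=\coprod^{\le 1}k\cdot v_{i_1}\cdots v_{i_n}$, over all words in $I$, with $\|v_{i_1}\cdots v_{i_n}\|=r^n$. Its product is concatenation, its $H'$-coaction is multiplicative with $v_i\mapsto t_i\otimes v_i$, and its comultiplication is the one with $\Delta(v_i)=v_i\otimes1+1\otimes v_i$ that is multiplicative for the braiding $v_i\otimes v_j\mapsto q^{(\alpha_i,\alpha_j)}v_j\otimes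 v_i$. Let $\mathbf f^{an}_r$ be the Banach quotient of $T_r$ by the closure of the sum of all homogeneous ideals $J$ that are concentrated in degrees $\ge2$ and satisfy $\Delta(J)\subset\overline{J\otimes T_r+T_r\otimes J}$. It is considered with the unit, multiplication, comultiplication and coaction induced from $T_r$. **Double bosonisation.** Let $r,s>0$ with $|q_i-q_i^{-1}|\,rs\ge1$ for all $i\in I$, and let $C=\mathbf f_r^{an}$, $B=\mathbf f_s^{an}$ be braided Banach Hopf algebras in $H'$-comodules, with invertible antipodes, by these structure maps. Let $\langle\cdot,\cdot\rangle:B\hat\otimes C\to k$ be an $H$-equivariant duality pairing of Hopf algebras with $\langle v_i,v_j\rangle=\delta_{ij}(q_i-q_i^{-1})^{-1}$; explicitly, $\langle bb',c\rangle=\langle b,c_1\rangle\langle b',c_2\rangle$, $\langle b,cc'\rangle=\langle b_1,c\rangle\langle b_2,c'\rangle$, and the pairing is compatible with units, counits and antipodes. Let $\overline C$ be the algebra $C$ with comultiplication $\Psi^{-1}\Delta_C$ and antipode $\overline S=S_C^{-1}$, and let $\overline H$ be $H$ with the weakly quasi-triangular structure inverse to that of $H$. By the analytic quantum group $U_q(\mathfrak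 g)^{an}_{r,s}=U(C,H,B)$ we mean a Banach Hopf algebra structure on $C\hat\otimes H\hat\otimes B$ with unit $1\otimes1\otimes1$ such that * $C\hat\otimes H\to C\hat\otimes H\hat\otimes B$ and $H\hat\otimes B\to C\hat\otimes H\hat\otimes B$ are morphisms from the bosonisations $\overline C\rtimes\overline H$ and $H\ltimes B$. In these the products are $(c\otimes h)(c'\otimes h')=c(h_1\triangleright c')\otimes h_2h'$ and $(h\otimes b)(h'\otimes b')=hh'_1\otimes(b\triangleleft h'_2)b'$. The coproducts are $\Delta_{\overline C}\otimes\Delta_H$ and $\Delta_H\otimes\Delta_B$ followed, in the middle two factors, by $c\otimes h\mapsto\overline{\mathscr R}(c_{(-1)})h\otimes c_{(0)}$ and by $h\otimes b\mapsto b_{(0)}\otimes h\mathscr R(b_{(-1)})$, respectively. The counits are the tensor products of the counits of the factors; * $(c\otimes h\otimes1)(1\otimes1\otimes b)=c\otimes h\otimes b$; * for $b\in B$, $c\in\overline C$ (with iterated coproducts those of $B$ and $\overline C$), writing $\mathscr R(x)\otimes x$ for $\mathscr R(x_{(-1)})\otimes x_{(0)}$ and likewise for $\overline{\mathscr R}$,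 $$b\cdot c=\langle b_1,c_1\rangle\,\langle b_3,\overline S c_3\rangle\;\bigl(\mathscr R(c_1)\triangleright c_2\bigr)\cdot\mathscr R(b_1)\,\overline{\mathscr R}(c_3)\cdot\bigl(b_2\triangleleft\overline{\mathscr R}(b_3)\bigr).$$ Write $F_i=v_i\otimes1\otimes1$, $E_i=1\otimes1\otimes v_i$, and $K_\lambda=1\otimes K_\lambda\otimes1$. **The quantum enveloping algebra.** Let $U_q(\mathfrak g)$ (Lusztig's form) be the unital $k$-algebra with generators $\mathsf E_i,\mathsf F_i$ $(i\in I)$, $\mathsf K_\lambda$ $(\lambda\in\Phi^*)$ and relations $\mathsf K_0=1$, $\mathsf K_\lambda \mathsf K_\mu=\mathsf K_{\lambda+\mu}$, $\mathsf K_\lambda \mathsf E_i=q^{\lambda(\alpha_i)}\mathsf E_i\mathsf K_\lambda$, $\mathsf K_\lambda \mathsf F_i=q^{-\lambda(\alpha_i)}\mathsf F_i\mathsf K_\lambda$, $\mathsf E_i\mathsf F_j-\mathsf F_j\mathsf E_i=\delta_{ij}(\mathsf t_i-\mathsf t_i^{-1})/(q_i-q_i^{-1})$ with $\mathsf t_i=\mathsf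 K_{d_i\lambda_i}$, and $x(\mathsf E)=0=x(\mathsf F)$ for all $x$ in the radical of Lusztig's form on the free algebra $k\langle\theta_i\mid i\in I\rangle$. That form is the one with $(1,1)=1$, $(1,\theta_jy)=0$ and $(\theta_ix,y)=(q_i-q_i^{-1})^{-1}(x,\partial_iy)$, where $\partial_i(1)=0$ and $\partial_i(\theta_jy)=\delta_{ij}y+q^{(\alpha_i,\alpha_j)}\theta_j\partial_i(y)$. Its usual Hopf structure is $\Delta \mathsf E_i=\mathsf E_i\otimes1+\mathsf t_i\otimes \mathsf E_i$, $\Delta \mathsf F_i=\mathsf F_i\otimes \mathsf t_i^{-1}+1\otimes \mathsf F_i$, $\Delta \mathsf K_\lambda=\mathsf K_\lambda\otimes \mathsf K_\lambda$, $\varepsilon(\mathsf E_i)=\varepsilon(\mathsf F_i)=0$, $\varepsilon(\mathsf K_\lambda)=1$, $S\mathsf E_i=-\mathsf t_i^{-1}\mathsf E_i$, $S\mathsf F_i=-\mathsf F_i\mathsf t_i$, $S\mathsf K_\lambda=\mathsf K_{-\lambda}$. **Proposition.** For all $r,s>0$ with $|q_i-q_i^{-1}|\,rs\ge1$ for every $i\in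 I$, the analytic quantum group $U_q(\mathfrak g)^{an}_{r,s}$ exists and is unique: there is exactly one choice of the remaining structure maps of $C=\mathbf f_r^{an}$ and $B=\mathbf f_s^{an}$, of the pairing, and of the Hopf structure on $\mathbf f_r^{an}\hat\otimes H\hat\otimes\mathbf f_s^{an}$. The usual Hopf structure on $U_q(\mathfrak g)$ exists. There is an injective unital algebra homomorphism $\iota:U_q(\mathfrak g)\to U_q(\mathfrak g)^{an}_{r,s}$ with $$\iota(\mathsf K_\lambda)=K_{-\lambda},\qquad \iota(\mathsf E_i)=E_it_i^{-1},\qquad\iota(\mathsf F_i)=-t_iF_i,$$ whose image is dense and which carries the usual comultiplication, counit and antipode of $U_q(\mathfrak g)$ to those of $U_q(\mathfrak g)^{an}_{r,s}$. So $U_q(\mathfrak g)$ is dense in $U_q(\mathfrak g)^{an}_{r,s}$ and the Hopf structure restricts to the usual one. -/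

import Mathlib

set_option linter.unusedSectionVars false

open scoped TensorProduct NNReal

noncomputable section

namespace QAn

/-! ### Bounded linear maps, completions -/

/-- Bounded `k`-linear maps.  Over a trivially valued field a continuous linear map need not be
bounded, so boundedness is required explicitly. -/
structure BMap (k X Y : Type*) [NormedField k] [SeminormedAddCommGroup X] [NormedSpace k X]
    [SeminormedAddCommGroup Y] [NormedSpace k Y] extends X →ₗ[k] Y where
  bound' : ∃ C : ℝ, ∀ x, ‖toFun x‖ ≤ C * ‖x‖

section Basic

variable {k : Type*} [NormedField k]

section
variable {X Y Z : Type*} [SeminormedAddCommGroup X] [NormedSpace k X]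
  [SeminormedAddCommGroup Y] [NormedSpace k Y] [SeminormedAddCommGroup Z] [NormedSpace k Z]

instance : FunLike (BMap k X Y) X Y where
  coe f := f.toFun
  coe_injective f g h := by
    cases f; cases g; congr; exact DFunLike.coe_injective h

instance : LinearMapClass (BMap k X Y) k X Y where
  map_add f := f.map_add'
  map_smulₛₗ f := f.map_smul'

@[ext] theorem BMap.ext {f g : BMap k X Y} (h : ∀ x, f x = g x) : f = g := DFunLike.ext f g h

theorem BMap.bound (f : BMap k X Y) : ∃ C : ℝ, 0 ≤ C ∧ ∀ x, ‖f x‖ ≤ C * ‖x‖ := by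
  obtain ⟨C, hC⟩ := f.bound'
  exact ⟨max C 0, le_max_right _ _, fun x => (hC x).trans
    (mul_le_mul_of_nonneg_right (le_max_left _ _) (norm_nonneg _))⟩

theorem BMap.continuous (f : BMap k X Y) : Continuous f := by
  obtain ⟨C, -, hC⟩ := f.bound
  exact AddMonoidHomClass.continuous_of_bound f C hC

/-- The identity. -/
def BMap.id (k X : Type*) [NormedField k] [SeminormedAddCommGroup X] [NormedSpace k X] :
    BMap k X X where
  toLinearMap := LinearMap.id
  bound' := ⟨1, fun x => by simp⟩

/-- Composition `g ∘ f`. -/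
def BMap.comp (g : BMap k Y Z) (f : BMap k X Y) : BMap k X Z where
  toLinearMap := g.toLinearMap.comp f.toLinearMap
  bound' := by
    obtain ⟨C, hC0, hC⟩ := g.bound
    obtain ⟨D, -, hD⟩ := f.bound
    refine ⟨C * D, fun x => (hC (f x)).trans ?_⟩
    rw [mul_assoc]
    exact mul_le_mul_of_nonneg_left (hD x) hC0

@[simp] theorem BMap.id_apply (x : X) : BMap.id k X x = x := rfl
@[simp] theorem BMap.comp_apply (g : BMap k Y Z) (f : BMap k X Y) (x : X) :
    g.comp f x = g (f x) := rfl

end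

section
variable {X Y : Type*} [SeminormedAddCommGroup X] [NormedSpace k X]
  [NormedAddCommGroup Y] [NormedSpace k Y]

/-- Extension of a bounded linear map to the completion of its source. -/
def BMap.extend [CompleteSpace Y] (f : BMap k X Y) : BMap k (UniformSpace.Completion X) Y where
  toFun := UniformSpace.Completion.extension f
  map_add' x y := by
    have hu := uniformContinuous_addMonoidHom_of_continuous (f := f) f.continuous
    refine UniformSpace.Completion.induction_on₂ x y (isClosed_eq ?_ ?_) fun a b => ?_
    · exact UniformSpace.Completion.continuous_extension.comp continuous_add
    · exact (UniformSpace.Completion.continuous_extension.comp continuous_fst).add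
        (UniformSpace.Completion.continuous_extension.comp continuous_snd)
    · rw [← UniformSpace.Completion.coe_add]
      simp only [UniformSpace.Completion.extension_coe hu, map_add]
  map_smul' c x := by
    have hu := uniformContinuous_addMonoidHom_of_continuous (f := f) f.continuous
    refine UniformSpace.Completion.induction_on x (isClosed_eq ?_ ?_) fun a => ?_
    · exact UniformSpace.Completion.continuous_extension.comp (continuous_const_smul c)
    · exact UniformSpace.Completion.continuous_extension.const_smul c
    · rw [← UniformSpace.Completion.coe_smul]
      simp only [UniformSpace.Completion.extension_coe hu, map_smul, RingHom.id_apply]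
  bound' := by
    have hu := uniformContinuous_addMonoidHom_of_continuous (f := f) f.continuous
    obtain ⟨C, -, hC⟩ := f.bound
    refine ⟨C, fun x => UniformSpace.Completion.induction_on x (isClosed_le ?_ ?_) fun a => ?_⟩
    · exact UniformSpace.Completion.continuous_extension.norm
    · exact continuous_const.mul continuous_norm
    · simpa only [UniformSpace.Completion.extension_coe hu, UniformSpace.Completion.norm_coe]
        using hC a

@[simp] theorem BMap.extend_coe [CompleteSpace Y] (f : BMap k X Y) (x : X) :
    f.extend (x : UniformSpace.Completion X) = f x :=
  UniformSpace.Completion.extension_coe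
    (uniformContinuous_addMonoidHom_of_continuous (f := f) f.continuous) x

/-- The norm bound of an extension is the norm bound of the map. -/
theorem BMap.extend_bound [CompleteSpace Y] (f : BMap k X Y) {C : ℝ} (hC : ∀ x, ‖f x‖ ≤ C * ‖x‖)
    (x : UniformSpace.Completion X) : ‖f.extend x‖ ≤ C * ‖x‖ := by
  refine UniformSpace.Completion.induction_on x (isClosed_le ?_ ?_) fun a => ?_
  · exact f.extend.continuous.norm
  · exact continuous_const.mul continuous_norm
  · simpa only [BMap.extend_coe, UniformSpace.Completion.norm_coe] using hC a

end

instance {X : Type*} [SeminormedAddCommGroup X] [IsUltrametricDist X] :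
    IsUltrametricDist (UniformSpace.Completion X) := by
  refine IsUltrametricDist.isUltrametricDist_of_forall_norm_add_le_max_norm fun x y => ?_
  refine UniformSpace.Completion.induction_on₂ x y (isClosed_le ?_ ?_) fun a b => ?_
  · exact continuous_add.norm
  · exact continuous_fst.norm.max continuous_snd.norm
  · rw [← UniformSpace.Completion.coe_add]
    simp only [UniformSpace.Completion.norm_coe]
    exact IsUltrametricDist.norm_add_le_max a b

/-! ### The completed tensor product of non-Archimedean Banach spaces -/

section
variable (k) (X Y : Type*) [NormedAddCommGroup X] [NormedSpace k X]
  [NormedAddCommGroup Y] [NormedSpace k Y]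

/-- The algebraic tensor product, to be given the non-Archimedean projective seminorm. -/
def NAT : Type _ := X ⊗[k] Y

instance : AddCommGroup (NAT k X Y) := inferInstanceAs (AddCommGroup (X ⊗[k] Y))
instance : Module k (NAT k X Y) := inferInstanceAs (Module k (X ⊗[k] Y))

variable {k X Y}

/-- The values `max ‖xᵢ‖ ‖yᵢ‖` (and all upper bounds of them) over the finite representations
`z = ∑ xᵢ ⊗ yᵢ`. -/
def NAT.reps (z : NAT k X Y) : Set ℝ :=
  {c | 0 ≤ c ∧ ∃ l : List (X × Y), (l.map fun p => p.1 ⊗ₜ[k] p.2).sum = z ∧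
    ∀ p ∈ l, ‖p.1‖ * ‖p.2‖ ≤ c}

theorem NAT.reps_nonempty (z : NAT k X Y) : z.reps.Nonempty := by
  have key : ∃ l : List (X × Y), (l.map fun p => p.1 ⊗ₜ[k] p.2).sum = (z : X ⊗[k] Y) := by
    induction (z : X ⊗[k] Y) using TensorProduct.induction_on with
    | zero => exact ⟨[], by simp⟩
    | tmul x y => exact ⟨[(x, y)], by simp⟩
    | add a b ha hb =>
      obtain ⟨l, rfl⟩ := ha
      obtain ⟨m, rfl⟩ := hb
      exact ⟨l ++ m, by simp⟩
  obtain ⟨l, hl⟩ := key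
  refine ⟨(l.map fun p => ‖p.1‖ * ‖p.2‖).sum, ?_, l, hl, fun p hp => ?_⟩
  · exact List.sum_nonneg (by simp only [List.mem_map]; rintro _ ⟨p, -, rfl⟩; positivity)
  · exact List.single_le_sum (by simp only [List.mem_map]; rintro _ ⟨p, -, rfl⟩; positivity) _
      (List.mem_map_of_mem (f := fun p : X × Y => ‖p.1‖ * ‖p.2‖) hp)

theorem NAT.reps_bddBelow (z : NAT k X Y) : BddBelow z.reps := ⟨0, fun _ hc => hc.1⟩

/-- `‖z‖ = inf max ‖xᵢ‖ ‖yᵢ‖` over the finite representations `z = ∑ xᵢ ⊗ yᵢ`. -/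
instance : Norm (NAT k X Y) := ⟨fun z => sInf z.reps⟩

theorem NAT.norm_def (z : NAT k X Y) : ‖z‖ = sInf z.reps := rfl

theorem NAT.norm_nonneg' (z : NAT k X Y) : 0 ≤ ‖z‖ := Real.sInf_nonneg fun _ hc => hc.1

theorem NAT.norm_add_le_max (z w : NAT k X Y) : ‖z + w‖ ≤ max ‖z‖ ‖w‖ := by
  refine le_of_forall_pos_le_add fun e he => ?_
  obtain ⟨c, ⟨hc0, l, hl, hlc⟩, hc⟩ := exists_lt_of_csInf_lt z.reps_nonempty
    (show sInf z.reps < ‖z‖ + e by rw [← NAT.norm_def]; linarith)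
  obtain ⟨d, ⟨hd0, m, hm, hmd⟩, hd⟩ := exists_lt_of_csInf_lt w.reps_nonempty
    (show sInf w.reps < ‖w‖ + e by rw [← NAT.norm_def]; linarith)
  have : max c d ∈ (z + w).reps := by
    refine ⟨le_max_of_le_left hc0, l ++ m, ?_, fun p hp => ?_⟩
    · rw [List.map_append, List.sum_append, hl, hm]; rfl
    · rcases List.mem_append.1 hp with h | h
      · exact le_max_of_le_left (hlc p h)
      · exact le_max_of_le_right (hmd p h)
  refine (csInf_le (z + w).reps_bddBelow this).trans ?_
  rw [← max_add_add_right]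
  exact max_le_max hc.le hd.le

theorem NAT.norm_smul_le' (a : k) (z : NAT k X Y) : ‖a • z‖ ≤ ‖a‖ * ‖z‖ := by
  have h : ∀ c ∈ z.reps, ‖a • z‖ ≤ ‖a‖ * c := by
    rintro c ⟨hc0, l, hl, hlc⟩
    refine csInf_le (NAT.reps_bddBelow _) ⟨by positivity, l.map fun p => (a • p.1, p.2), ?_, ?_⟩
    · rw [List.map_map, ← hl]
      have : ∀ l : List (X × Y), ((l.map ((fun p : X × Y => p.1 ⊗ₜ[k] p.2) ∘
          fun p : X × Y => (a • p.1, p.2))).sum : X ⊗[k] Y) =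
          a • (l.map fun p => p.1 ⊗ₜ[k] p.2).sum := by
        intro l
        induction l with
        | nil => simp
        | cons p l ih => simp only [List.map_cons, List.sum_cons, ih, smul_add]; rfl
      exact this l
    · intro p hp
      obtain ⟨p', hp', rfl⟩ := List.mem_map.1 hp
      simp only [norm_smul, mul_assoc]
      exact mul_le_mul_of_nonneg_left (hlc p' hp') (norm_nonneg _)
  rcases (norm_nonneg a).eq_or_lt with ha | ha
  · obtain ⟨c, hc⟩ := z.reps_nonempty
    simpa [← ha] using h c hc
  · rw [mul_comm, ← div_le_iff₀ ha]
    refine le_csInf z.reps_nonempty fun c hc => ?_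
    rw [div_le_iff₀ ha, mul_comm]
    exact h c hc

instance : SeminormedAddCommGroup (NAT k X Y) :=
  AddGroupSeminorm.toSeminormedAddCommGroup
    { toFun := fun z => ‖z‖
      map_zero' := by
        refine le_antisymm (csInf_le (NAT.reps_bddBelow _) ⟨le_rfl, [], by simp; rfl, by simp⟩)
          (NAT.norm_nonneg' _)
      add_le' := fun z w => (NAT.norm_add_le_max z w).trans
        (max_le_add_of_nonneg (NAT.norm_nonneg' z) (NAT.norm_nonneg' w))
      neg' := by
        have h : ∀ z : NAT k X Y, ‖-z‖ ≤ ‖z‖ := fun z => by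
          simpa using NAT.norm_smul_le' (-1 : k) z
        exact fun z => le_antisymm (h z) (by simpa using h (-z)) }

instance : NormedSpace k (NAT k X Y) where
  norm_smul_le := NAT.norm_smul_le'

instance : IsUltrametricDist (NAT k X Y) :=
  IsUltrametricDist.isUltrametricDist_of_forall_norm_add_le_max_norm NAT.norm_add_le_max

variable (k X Y) in
/-- The completed tensor product `X ⊗̂ Y`. -/
abbrev CT : Type _ := UniformSpace.Completion (NAT k X Y)

/-- The canonical map from the algebraic to the completed tensor product. -/
def CT.ofAlg : X ⊗[k] Y →ₗ[k] CT k X Y where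
  toFun z := UniformSpace.Completion.coe' (α := NAT k X Y) z
  map_add' z w := UniformSpace.Completion.coe_add (α := NAT k X Y) z w
  map_smul' c z := UniformSpace.Completion.coe_smul (X := NAT k X Y) c z

variable (k) in
/-- Pure tensors. -/
def tm (x : X) (y : Y) : CT k X Y := CT.ofAlg (x ⊗ₜ[k] y)

theorem tm_add_left (x x' : X) (y : Y) : tm k (x + x') y = tm k x y + tm k x' y := by
  simp [tm, TensorProduct.add_tmul]
theorem tm_add_right (x : X) (y y' : Y) : tm k x (y + y') = tm k x y + tm k x y' := by
  simp [tm, TensorProduct.tmul_add]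
theorem tm_smul_left (c : k) (x : X) (y : Y) : tm k (c • x) y = c • tm k x y := by
  rw [tm, ← TensorProduct.smul_tmul', map_smul, tm]
theorem tm_smul_right (c : k) (x : X) (y : Y) : tm k x (c • y) = c • tm k x y := by
  simp [tm]

theorem norm_tm_le (x : X) (y : Y) : ‖tm k x y‖ ≤ ‖x‖ * ‖y‖ := by
  have : ‖tm k x y‖ = sInf (NAT.reps (x ⊗ₜ[k] y : NAT k X Y)) :=
    UniformSpace.Completion.norm_coe (E := NAT k X Y) (x ⊗ₜ[k] y)
  rw [this]
  exact csInf_le (NAT.reps_bddBelow _) ⟨by positivity, [(x, y)], by simp, by simp⟩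

/-- Two bounded maps out of `X ⊗̂ Y` which agree on pure tensors are equal. -/
theorem CT.hom_ext {Z : Type*} [NormedAddCommGroup Z] [NormedSpace k Z]
    {f g : BMap k (CT k X Y) Z} (h : ∀ x y, f (tm k x y) = g (tm k x y)) : f = g := by
  ext z
  refine UniformSpace.Completion.induction_on z (isClosed_eq f.continuous g.continuous) fun a => ?_
  change f (CT.ofAlg (a : X ⊗[k] Y)) = g (CT.ofAlg (a : X ⊗[k] Y))
  induction (a : X ⊗[k] Y) using TensorProduct.induction_on with
  | zero => simp
  | tmul x y => exact h x y
  | add a b ha hb => simp only [map_add, ha, hb]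

theorem NAT.lift_bound {Z : Type*} [NormedAddCommGroup Z] [NormedSpace k Z]
    [IsUltrametricDist Z] (f : X →ₗ[k] Y →ₗ[k] Z) {C : ℝ} (hC0 : 0 ≤ C)
    (hC : ∀ x y, ‖f x y‖ ≤ C * (‖x‖ * ‖y‖)) (z : NAT k X Y) :
    ‖(TensorProduct.lift f : X ⊗[k] Y →ₗ[k] Z) z‖ ≤ C * ‖z‖ := by
  have h : ∀ c ∈ z.reps, ‖(TensorProduct.lift f : X ⊗[k] Y →ₗ[k] Z) z‖ ≤ C * c := by
    rintro c ⟨hc0, l, rfl, hlc⟩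
    induction l with
    | nil => simpa using mul_nonneg hC0 hc0
    | cons p l ih =>
      rw [List.map_cons, List.sum_cons, map_add]
      refine (IsUltrametricDist.norm_add_le_max _ _).trans (max_le ?_ ?_)
      · rw [TensorProduct.lift.tmul]
        exact (hC _ _).trans (mul_le_mul_of_nonneg_left (hlc p (by simp)) hC0)
      · exact ih fun p hp => hlc p (by simp [hp])
  rcases hC0.eq_or_lt with h0 | h0
  · obtain ⟨c, hc⟩ := z.reps_nonempty
    simpa [← h0] using h c hc
  · rw [mul_comm, ← div_le_iff₀ h0]
    refine le_csInf z.reps_nonempty fun c hc => ?_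
    rw [div_le_iff₀ h0, mul_comm]
    exact h c hc

/-- The universal property: a bounded bilinear map extends to `X ⊗̂ Y`. -/
def CT.lift {Z : Type*} [NormedAddCommGroup Z] [NormedSpace k Z] [CompleteSpace Z]
    [IsUltrametricDist Z] (f : X →ₗ[k] Y →ₗ[k] Z) (hf : ∃ C : ℝ, 0 ≤ C ∧
      ∀ x y, ‖f x y‖ ≤ C * (‖x‖ * ‖y‖)) : BMap k (CT k X Y) Z :=
  BMap.extend (X := NAT k X Y)
    { toLinearMap := (TensorProduct.lift f : X ⊗[k] Y →ₗ[k] Z)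
      bound' := by
        obtain ⟨C, hC0, hC⟩ := hf
        exact ⟨C, fun z => NAT.lift_bound f hC0 hC z⟩ }

theorem CT.lift_bound {Z : Type*} [NormedAddCommGroup Z] [NormedSpace k Z] [CompleteSpace Z]
    [IsUltrametricDist Z] (f : X →ₗ[k] Y →ₗ[k] Z) (hf) {C : ℝ} (hC0 : 0 ≤ C)
    (hC : ∀ x y, ‖f x y‖ ≤ C * (‖x‖ * ‖y‖)) (z : CT k X Y) : ‖CT.lift f hf z‖ ≤ C * ‖z‖ :=
  BMap.extend_bound (X := NAT k X Y) _ (fun z => NAT.lift_bound f hC0 hC z) z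

@[simp] theorem CT.lift_tm {Z : Type*} [NormedAddCommGroup Z] [NormedSpace k Z] [CompleteSpace Z]
    [IsUltrametricDist Z] (f : X →ₗ[k] Y →ₗ[k] Z) (hf) (x : X) (y : Y) :
    CT.lift f hf (tm k x y) = f x y := by
  refine (BMap.extend_coe (X := NAT k X Y) _ (x ⊗ₜ[k] y)).trans ?_
  exact TensorProduct.lift.tmul x y

end
end Basic

/-! ### Structural maps between completed tensor products -/

section Struct

variable {k : Type*} [NormedField k]
variable {X Y Z W X' Y' : Type*}
  [NormedAddCommGroup X] [NormedSpace k X] [NormedAddCommGroup Y] [NormedSpace k Y]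
  [NormedAddCommGroup Z] [NormedSpace k Z] [NormedAddCommGroup W] [NormedSpace k W]
  [NormedAddCommGroup X'] [NormedSpace k X'] [NormedAddCommGroup Y'] [NormedSpace k Y']

/-- `f ⊗ g`. -/
def CT.map (f : BMap k X X') (g : BMap k Y Y') : BMap k (CT k X Y) (CT k X' Y') :=
  CT.lift (LinearMap.mk₂ k (fun x y => tm k (f x) (g y))
    (fun x x' y => by rw [map_add, tm_add_left]) (fun c x y => by rw [map_smul, tm_smul_left])
    (fun x y y' => by rw [map_add, tm_add_right]) (fun c x y => by rw [map_smul, tm_smul_right]))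
    (by
      obtain ⟨C, hC0, hC⟩ := f.bound
      obtain ⟨D, hD0, hD⟩ := g.bound
      refine ⟨C * D, by positivity, fun x y => (norm_tm_le _ _).trans ?_⟩
      calc ‖f x‖ * ‖g y‖ ≤ (C * ‖x‖) * (D * ‖y‖) := by gcongr <;> apply_assumption
        _ = C * D * (‖x‖ * ‖y‖) := by ring)

@[simp] theorem CT.map_tm (f : BMap k X X') (g : BMap k Y Y') (x : X) (y : Y) :
    CT.map f g (tm k x y) = tm k (f x) (g y) := by simp [CT.map]

theorem CT.map_bound (f : BMap k X X') (g : BMap k Y Y') {C D : ℝ} (hC0 : 0 ≤ C) (hD0 : 0 ≤ D)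
    (hC : ∀ x, ‖f x‖ ≤ C * ‖x‖) (hD : ∀ y, ‖g y‖ ≤ D * ‖y‖) (z : CT k X Y) :
    ‖CT.map f g z‖ ≤ C * D * ‖z‖ := by
  refine CT.lift_bound _ _ (by positivity) (fun x y => (norm_tm_le _ _).trans ?_) z
  calc ‖f x‖ * ‖g y‖ ≤ (C * ‖x‖) * (D * ‖y‖) := by gcongr <;> apply_assumption
    _ = C * D * (‖x‖ * ‖y‖) := by ring

/-- `y ↦ x ⊗ y`. -/
def CT.inr (x : X) : BMap k Y (CT k X Y) where
  toFun := tm k x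
  map_add' := tm_add_right x
  map_smul' c y := tm_smul_right c x y
  bound' := ⟨‖x‖, fun y => norm_tm_le x y⟩

/-- `x ↦ x ⊗ y`. -/
def CT.inl (y : Y) : BMap k X (CT k X Y) where
  toFun x := tm k x y
  map_add' x x' := tm_add_left x x' y
  map_smul' c x := tm_smul_left c x y
  bound' := ⟨‖y‖, fun x => by rw [mul_comm]; exact norm_tm_le x y⟩

@[simp] theorem CT.inr_apply (x : X) (y : Y) : CT.inr x y = tm k x y := rfl
@[simp] theorem CT.inl_apply (x : X) (y : Y) : CT.inl y x = tm k x y := rfl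

theorem CT.induction_eq {f g : BMap k (CT k X Y) Z} (h : ∀ x y, f (tm k x y) = g (tm k x y))
    (z : CT k X Y) : f z = g z := by rw [CT.hom_ext h]

theorem CT.map_add_right (f : BMap k X X') (g g' h : BMap k Y Y') (hh : ∀ y, h y = g y + g' y)
    (z : CT k X Y) : CT.map f h z = CT.map f g z + CT.map f g' z := by
  refine UniformSpace.Completion.induction_on z (isClosed_eq (BMap.continuous _)
    ((BMap.continuous _).add (BMap.continuous _))) fun a => ?_
  change (CT.map f h) (CT.ofAlg a) = (CT.map f g) (CT.ofAlg a) + (CT.map f g') (CT.ofAlg a)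
  induction (show X ⊗[k] Y from a) using TensorProduct.induction_on with
  | zero => simp
  | tmul x y =>
    change CT.map f h (tm k x y) = CT.map f g (tm k x y) + CT.map f g' (tm k x y)
    simp [hh, tm_add_right]
  | add a b ha hb => simp only [map_add, ha, hb]; abel

theorem CT.map_smul_right (f : BMap k X X') (g h : BMap k Y Y') (c : k) (hh : ∀ y, h y = c • g y)
    (z : CT k X Y) : CT.map f h z = c • CT.map f g z := by
  refine UniformSpace.Completion.induction_on z (isClosed_eq (BMap.continuous _)
    ((BMap.continuous _).const_smul c)) fun a => ?_
  change (CT.map f h) (CT.ofAlg a) = c • (CT.map f g) (CT.ofAlg a)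
  induction (show X ⊗[k] Y from a) using TensorProduct.induction_on with
  | zero => simp
  | tmul x y =>
    change CT.map f h (tm k x y) = c • CT.map f g (tm k x y)
    simp [hh, tm_smul_right]
  | add a b ha hb => simp only [map_add, ha, hb, smul_add]

/-- The symmetry `τ : x ⊗ y ↦ y ⊗ x`. -/
def CT.swap (k X Y : Type*) [NormedField k] [NormedAddCommGroup X] [NormedSpace k X]
    [NormedAddCommGroup Y] [NormedSpace k Y] : BMap k (CT k X Y) (CT k Y X) :=
  CT.lift (LinearMap.mk₂ k (fun x y => tm k y x)
    (fun x x' y => tm_add_right _ _ _) (fun c x y => tm_smul_right _ _ _)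
    (fun x y y' => tm_add_left _ _ _) (fun c x y => tm_smul_left _ _ _))
    ⟨1, zero_le_one, fun x y => by rw [one_mul, mul_comm]; exact norm_tm_le y x⟩

@[simp] theorem CT.swap_tm (x : X) (y : Y) : CT.swap k X Y (tm k x y) = tm k y x := by
  simp [CT.swap]

/-- The associativity constraint `(x ⊗ y) ⊗ z ↦ x ⊗ (y ⊗ z)`. -/
def CT.assoc (k X Y Z : Type*) [NormedField k] [NormedAddCommGroup X] [NormedSpace k X]
    [NormedAddCommGroup Y] [NormedSpace k Y] [NormedAddCommGroup Z] [NormedSpace k Z] :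
    BMap k (CT k (CT k X Y) Z) (CT k X (CT k Y Z)) :=
  CT.lift (LinearMap.mk₂ k (fun w z => CT.map (BMap.id k X) (CT.inl z) w)
    (fun w w' z => map_add _ _ _) (fun c w z => map_smul _ _ _)
    (fun w z z' => CT.map_add_right _ _ _ _ (fun y => tm_add_right y z z') w)
    (fun c w z => CT.map_smul_right _ _ _ c (fun y => tm_smul_right c y z) w))
    ⟨1, zero_le_one, fun w z => by
      refine (CT.map_bound (C := 1) (D := ‖z‖) _ _ zero_le_one (norm_nonneg _)
        (fun x => by simp) (fun y => ?_) w).trans (by rw [one_mul, one_mul, mul_comm])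
      rw [mul_comm]
      exact norm_tm_le y z⟩

@[simp] theorem CT.assoc_tm (x : X) (y : Y) (z : Z) :
    CT.assoc k X Y Z (tm k (tm k x y) z) = tm k x (tm k y z) := by simp [CT.assoc]

/-- The inverse associativity constraint `x ⊗ (y ⊗ z) ↦ (x ⊗ y) ⊗ z`. -/
def CT.assocInv (k X Y Z : Type*) [NormedField k] [NormedAddCommGroup X] [NormedSpace k X]
    [NormedAddCommGroup Y] [NormedSpace k Y] [NormedAddCommGroup Z] [NormedSpace k Z] :
    BMap k (CT k X (CT k Y Z)) (CT k (CT k X Y) Z) :=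
  (CT.swap k Z (CT k X Y)).comp <| (CT.map (BMap.id k Z) (CT.swap k Y X)).comp <|
    (CT.assoc k Z Y X).comp <| (CT.swap k X (CT k Z Y)).comp <|
      CT.map (BMap.id k X) (CT.swap k Y Z)

@[simp] theorem CT.assocInv_tm (x : X) (y : Y) (z : Z) :
    CT.assocInv k X Y Z (tm k x (tm k y z)) = tm k (tm k x y) z := by simp [CT.assocInv]

/-- `Id ⊗ c ⊗ Id` on the four-fold tensor product `(X ⊗ Y) ⊗ (Z ⊗ W)`. -/
def CT.midWith (c : BMap k (CT k Y Z) (CT k X' Y')) :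
    BMap k (CT k (CT k X Y) (CT k Z W)) (CT k (CT k X X') (CT k Y' W)) :=
  (CT.assocInv k X X' (CT k Y' W)).comp <|
    (CT.map (BMap.id k X) ((CT.assoc k X' Y' W).comp <|
      (CT.map c (BMap.id k W)).comp (CT.assocInv k Y Z W))).comp
    (CT.assoc k X Y (CT k Z W))

/-- The interchange of the two middle factors,
`(x ⊗ y) ⊗ (z ⊗ w) ↦ (x ⊗ z) ⊗ (y ⊗ w)`. -/
def CT.mid (k X Y Z W : Type*) [NormedField k] [NormedAddCommGroup X] [NormedSpace k X]
    [NormedAddCommGroup Y] [NormedSpace k Y] [NormedAddCommGroup Z] [NormedSpace k Z]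
    [NormedAddCommGroup W] [NormedSpace k W] :
    BMap k (CT k (CT k X Y) (CT k Z W)) (CT k (CT k X Z) (CT k Y W)) :=
  CT.midWith (CT.swap k Y Z)

@[simp] theorem CT.mid_tm (x : X) (y : Y) (z : Z) (w : W) :
    CT.mid k X Y Z W (tm k (tm k x y) (tm k z w)) = tm k (tm k x z) (tm k y w) := by
  simp [CT.mid, CT.midWith]

/-- Scalar multiplication `k ⊗̂ X → X`. -/
def CT.lid (k X : Type*) [NormedField k] [NormedAddCommGroup X] [NormedSpace k X]
    [CompleteSpace X] [IsUltrametricDist X] : BMap k (CT k k X) X :=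
  CT.lift (LinearMap.lsmul k X) ⟨1, zero_le_one, fun c x => by simp [norm_smul]⟩

@[simp] theorem CT.lid_tm [CompleteSpace X] [IsUltrametricDist X] (c : k) (x : X) :
    CT.lid k X (tm k c x) = c • x := by simp [CT.lid]

/-- Scalar multiplication `X ⊗̂ k → X`. -/
def CT.rid (k X : Type*) [NormedField k] [NormedAddCommGroup X] [NormedSpace k X]
    [CompleteSpace X] [IsUltrametricDist X] : BMap k (CT k X k) X :=
  (CT.lid k X).comp (CT.swap k X k)

@[simp] theorem CT.rid_tm [CompleteSpace X] [IsUltrametricDist X] (x : X) (c : k) :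
    CT.rid k X (tm k x c) = c • x := by simp [CT.rid]

end Struct

/-! ### Contracting coproducts of lines -/

section Cop

variable (k : Type*) [NormedField k] {ι ι' : Type*}

/-- The algebraic direct sum of the lines `k · e i`, where `e i` has norm `w i`. -/
def Lines (_w : ι → ℝ≥0) : Type _ := ι →₀ k

variable {k}
variable {w : ι → ℝ≥0} {w' : ι' → ℝ≥0}

instance : AddCommGroup (Lines k w) := inferInstanceAs (AddCommGroup (ι →₀ k))
instance : Module k (Lines k w) := inferInstanceAs (Module k (ι →₀ k))

/-- The coefficient of `e i`. -/
def Lines.coeff (a : Lines k w) (i : ι) : k := (show ι →₀ k from a) i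

/-- `‖∑ aᵢ eᵢ‖ = max ‖aᵢ‖ w i`, as a nonnegative real. -/
def Lines.nn (a : Lines k w) : ℝ≥0 :=
  (show ι →₀ k from a).support.sup fun i => ‖a.coeff i‖₊ * w i

theorem Lines.coeff_le (a : Lines k w) (i : ι) : ‖a.coeff i‖₊ * w i ≤ a.nn := by
  by_cases h : i ∈ (show ι →₀ k from a).support
  · exact Finset.le_sup (f := fun i => ‖a.coeff i‖₊ * w i) h
  · have : a.coeff i = 0 := Finsupp.notMem_support_iff.1 h
    simp [this]

theorem Lines.nn_le {a : Lines k w} {c : ℝ≥0} (h : ∀ i, ‖a.coeff i‖₊ * w i ≤ c) : a.nn ≤ c :=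
  Finset.sup_le fun i _ => h i

instance : Norm (Lines k w) := ⟨fun a => (a.nn : ℝ)⟩

theorem Lines.norm_smul_le' (c : k) (a : Lines k w) : ‖c • a‖ ≤ ‖c‖ * ‖a‖ := by
  change ((c • a).nn : ℝ) ≤ ‖c‖ * (a.nn : ℝ)
  rw [← coe_nnnorm, ← NNReal.coe_mul, NNReal.coe_le_coe]
  refine Lines.nn_le fun i => ?_
  change ‖c • a.coeff i‖₊ * w i ≤ _
  rw [nnnorm_smul, mul_assoc]
  gcongr
  exact a.coeff_le i

variable [IsUltrametricDist k]

theorem Lines.norm_add_le_max (a b : Lines k w) : ‖a + b‖ ≤ max ‖a‖ ‖b‖ := by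
  change ((a + b).nn : ℝ) ≤ max (a.nn : ℝ) (b.nn : ℝ)
  rw [← NNReal.coe_max, NNReal.coe_le_coe]
  refine Lines.nn_le fun i => ?_
  have h : ‖a.coeff i + b.coeff i‖₊ ≤ max ‖a.coeff i‖₊ ‖b.coeff i‖₊ :=
    IsUltrametricDist.norm_add_le_max _ _
  calc ‖(a + b).coeff i‖₊ * w i ≤ max ‖a.coeff i‖₊ ‖b.coeff i‖₊ * w i := by gcongr; exact h
    _ = max (‖a.coeff i‖₊ * w i) (‖b.coeff i‖₊ * w i) := by rw [max_mul]
    _ ≤ max a.nn b.nn := max_le_max (a.coeff_le i) (b.coeff_le i)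

instance : SeminormedAddCommGroup (Lines k w) :=
  AddGroupSeminorm.toSeminormedAddCommGroup
    { toFun := fun a => ‖a‖
      map_zero' := by
        refine le_antisymm ?_ (NNReal.coe_nonneg _)
        change ((Lines.nn (0 : Lines k w) : ℝ≥0) : ℝ) ≤ ((0 : ℝ≥0) : ℝ)
        rw [NNReal.coe_le_coe]
        exact Lines.nn_le fun i => by
          have : (0 : Lines k w).coeff i = 0 := rfl
          simp [this]
      add_le' := fun a b => (Lines.norm_add_le_max a b).trans
        (max_le_add_of_nonneg (NNReal.coe_nonneg _) (NNReal.coe_nonneg _))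
      neg' := by
        have h : ∀ a : Lines k w, ‖-a‖ ≤ ‖a‖ := fun a => by
          simpa using Lines.norm_smul_le' (-1 : k) a
        exact fun a => le_antisymm (h a) (by simpa using h (-a)) }

instance : NormedSpace k (Lines k w) where
  norm_smul_le := Lines.norm_smul_le'

instance : IsUltrametricDist (Lines k w) :=
  IsUltrametricDist.isUltrametricDist_of_forall_norm_add_le_max_norm Lines.norm_add_le_max

variable (k w) in
/-- The contracting coproduct `∐_{i}^{≤1} k · e i` of the lines `k · e i` with `‖e i‖ = w i`: the
Banach space of families `(aᵢ)` with `‖aᵢ‖ w i → 0` under the sup norm, realised as the completion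
of the direct sum of the lines. -/
abbrev Cop : Type _ := UniformSpace.Completion (Lines k w)

variable (k w) in
/-- The basis vectors. -/
def Cop.e (i : ι) : Cop k w :=
  UniformSpace.Completion.coe' (α := Lines k w) (Finsupp.single i (1 : k))

variable {Z : Type*} [NormedAddCommGroup Z] [NormedSpace k Z]

theorem Cop.hom_ext {f g : BMap k (Cop k w) Z} (h : ∀ i, f (Cop.e k w i) = g (Cop.e k w i)) :
    f = g := by
  ext z
  refine UniformSpace.Completion.induction_on z (isClosed_eq f.continuous g.continuous) fun a => ?_
  let c : Lines k w →ₗ[k] Cop k w :=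
    (UniformSpace.Completion.toComplₗᵢ (𝕜 := k) (E := Lines k w)).toLinearMap
  have key : ∀ φ ψ : (ι →₀ k) →ₗ[k] Z,
      (∀ i, φ (Finsupp.single i 1) = ψ (Finsupp.single i 1)) → φ = ψ :=
    fun φ ψ h => Finsupp.lhom_ext' fun i => LinearMap.ext_ring (h i)
  exact LinearMap.congr_fun (key (f.toLinearMap.comp c) (g.toLinearMap.comp c) h) a

theorem Lines.lift_bound {Z : Type*} [NormedAddCommGroup Z] [NormedSpace k Z] [IsUltrametricDist Z]
    (y : ι → Z) {C : ℝ} (hC0 : 0 ≤ C) (hC : ∀ i, ‖y i‖ ≤ C * w i)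
    (a : Lines k w) : ‖Finsupp.linearCombination k y (show ι →₀ k from a)‖ ≤ C * ‖a‖ := by
  rw [Finsupp.linearCombination_apply, Finsupp.sum]
  refine IsUltrametricDist.norm_sum_le_of_forall_le_of_nonneg
    (mul_nonneg hC0 (NNReal.coe_nonneg _)) fun i _ => ?_
  have h1 : ‖a.coeff i‖ * w i ≤ ‖a‖ := by
    have := a.coeff_le i
    rwa [← NNReal.coe_le_coe, NNReal.coe_mul, coe_nnnorm] at this
  calc ‖a.coeff i • y i‖ = ‖a.coeff i‖ * ‖y i‖ := norm_smul _ _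
    _ ≤ ‖a.coeff i‖ * (C * w i) := by gcongr; exact hC i
    _ = C * (‖a.coeff i‖ * w i) := by ring
    _ ≤ C * ‖a‖ := by gcongr

variable [CompleteSpace Z] [IsUltrametricDist Z]

/-- The universal property: a family with `‖y i‖ ≤ C w i` extends to a bounded map. -/
def Cop.lift (y : ι → Z) (hy : ∃ C : ℝ, 0 ≤ C ∧ ∀ i, ‖y i‖ ≤ C * w i) : BMap k (Cop k w) Z :=
  BMap.extend (X := Lines k w)
    { toLinearMap := (Finsupp.linearCombination k y : (ι →₀ k) →ₗ[k] Z)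
      bound' := by
        obtain ⟨C, hC0, hC⟩ := hy
        exact ⟨C, fun a => Lines.lift_bound y hC0 hC a⟩ }

@[simp] theorem Cop.lift_e (y : ι → Z) (hy) (i : ι) : Cop.lift y hy (Cop.e k w i) = y i := by
  refine (BMap.extend_coe (X := Lines k w) _ _).trans ?_
  change Finsupp.linearCombination k y (Finsupp.single i (1 : k)) = _
  simp

theorem Cop.lift_bound (y : ι → Z) (hy) {C : ℝ} (hC0 : 0 ≤ C) (hC : ∀ i, ‖y i‖ ≤ C * w i)
    (a : Cop k w) : ‖Cop.lift y hy a‖ ≤ C * ‖a‖ :=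
  BMap.extend_bound (X := Lines k w) _ (fun z => Lines.lift_bound y hC0 hC z) a

theorem Cop.norm_e_le (i : ι) : ‖Cop.e k w i‖ ≤ w i := by
  have : ‖Cop.e k w i‖ = (Lines.nn (w := w) (Finsupp.single i (1 : k)) : ℝ) :=
    UniformSpace.Completion.norm_coe (E := Lines k w) (Finsupp.single i (1 : k))
  rw [this, NNReal.coe_le_coe]
  refine Lines.nn_le fun j => ?_
  by_cases h : i = j
  · subst h
    have : Lines.coeff (w := w) (Finsupp.single i (1 : k)) i = 1 := Finsupp.single_eq_same
    simp [this]
  · have : Lines.coeff (w := w) (Finsupp.single i (1 : k)) j = 0 :=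
      Finsupp.single_eq_of_ne (Ne.symm h)
    simp [this]

/-- A family with `‖g i j‖ ≤ w i * w' j` extends to a bounded map on the tensor product. -/
def Cop.lift₂ (g : ι → ι' → Z) (hg : ∀ i j, ‖g i j‖ ≤ w i * w' j) :
    BMap k (CT k (Cop k w) (Cop k w')) Z :=
  have h1 : ∀ i, ∃ C : ℝ, 0 ≤ C ∧ ∀ j, ‖g i j‖ ≤ C * w' j :=
    fun i => ⟨w i, NNReal.coe_nonneg _, hg i⟩
  have h2 : ∀ b : Cop k w', ∃ C : ℝ, 0 ≤ C ∧ ∀ i, ‖Cop.lift (g i) (h1 i) b‖ ≤ C * w i :=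
    fun b => ⟨‖b‖, norm_nonneg _, fun i => by
      rw [mul_comm]; exact Cop.lift_bound _ _ (NNReal.coe_nonneg _) (hg i) b⟩
  CT.lift (LinearMap.mk₂ k (fun a b => Cop.lift (fun i => Cop.lift (g i) (h1 i) b) (h2 b) a)
    (fun a a' b => map_add _ _ _) (fun c a b => map_smul _ _ _)
    (fun a b b' => by
      let s : BMap k (Cop k w) Z :=
        { toLinearMap := (Cop.lift (k := k) (w := w) _ (h2 b)).toLinearMap + (Cop.lift (k := k) (w := w) _ (h2 b')).toLinearMap
          bound' := by
            obtain ⟨C, -, hC⟩ := (Cop.lift (k := k) (w := w) _ (h2 b)).bound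
            obtain ⟨D, -, hD⟩ := (Cop.lift (k := k) (w := w) _ (h2 b')).bound
            exact ⟨C + D, fun x => (norm_add_le _ _).trans
              (by rw [add_mul]; exact add_le_add (hC x) (hD x))⟩ }
      have hs : ∀ x, s x = Cop.lift (k := k) (w := w) _ (h2 b) x + Cop.lift (k := k) (w := w) _ (h2 b') x := fun _ => rfl
      have : Cop.lift (k := k) (w := w) _ (h2 (b + b')) = s := Cop.hom_ext fun i => by
        rw [hs, Cop.lift_e, Cop.lift_e, Cop.lift_e, map_add]
      exact (congrArg (fun f : BMap k (Cop k w) Z => f a) this).trans (hs a))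
    (fun c a b => by
      let s : BMap k (Cop k w) Z :=
        { toLinearMap := c • (Cop.lift (k := k) (w := w) _ (h2 b)).toLinearMap
          bound' := by
            obtain ⟨C, -, hC⟩ := (Cop.lift (k := k) (w := w) _ (h2 b)).bound
            exact ⟨‖c‖ * C, fun x => (norm_smul_le _ _).trans
              (by rw [mul_assoc]; exact mul_le_mul_of_nonneg_left (hC x) (norm_nonneg _))⟩ }
      have hs : ∀ x, s x = c • Cop.lift (k := k) (w := w) _ (h2 b) x := fun _ => rfl
      have : Cop.lift (k := k) (w := w) _ (h2 (c • b)) = s := Cop.hom_ext fun i => by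
        rw [hs, Cop.lift_e, Cop.lift_e, map_smul]
      exact (congrArg (fun f : BMap k (Cop k w) Z => f a) this).trans (hs a)))
    ⟨1, zero_le_one, fun a b => by
      rw [one_mul, mul_comm, LinearMap.mk₂_apply]
      exact Cop.lift_bound _ _ (norm_nonneg _) (fun i => by
        rw [mul_comm]; exact Cop.lift_bound _ _ (NNReal.coe_nonneg _) (hg i) b) a⟩

@[simp] theorem Cop.lift₂_e (g : ι → ι' → Z) (hg) (i : ι) (j : ι') :
    Cop.lift₂ g hg (tm k (Cop.e k w i) (Cop.e k w' j)) = g i j := by simp [Cop.lift₂]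

end Cop

/-! ### Braided Banach Hopf algebras, pairings, double bosonisation -/

/-- The structure maps of a Banach Hopf algebra (the axioms are in `IsHopf`). -/
structure HopfStr (k X : Type*) [NormedField k] [NormedAddCommGroup X] [NormedSpace k X] where
  one : X
  mul : BMap k (CT k X X) X
  counit : BMap k X k
  comul : BMap k X (CT k X X)
  antipode : BMap k X X

section Hopf

variable {k : Type*} [NormedField k] [IsUltrametricDist k] [CompleteSpace k]

/-- The axioms of a braided Banach Hopf algebra with braiding `c`.  For `c = τ` these are the
axioms of a Banach Hopf algebra. -/
structure IsHopf {X : Type*} [NormedAddCommGroup X] [NormedSpace k X] [CompleteSpace X]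
    [IsUltrametricDist X] (c : BMap k (CT k X X) (CT k X X)) (S : HopfStr k X) : Prop where
  mul_assoc : S.mul.comp (CT.map S.mul (BMap.id k X)) =
    (S.mul.comp (CT.map (BMap.id k X) S.mul)).comp (CT.assoc k X X X)
  one_mul : ∀ x, S.mul (tm k S.one x) = x
  mul_one : ∀ x, S.mul (tm k x S.one) = x
  coassoc : (CT.assoc k X X X).comp ((CT.map S.comul (BMap.id k X)).comp S.comul) =
    (CT.map (BMap.id k X) S.comul).comp S.comul
  counit_comul : ∀ x, CT.lid k X (CT.map S.counit (BMap.id k X) (S.comul x)) = x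
  comul_counit : ∀ x, CT.rid k X (CT.map (BMap.id k X) S.counit (S.comul x)) = x
  comul_mul : S.comul.comp S.mul =
    (CT.map S.mul S.mul).comp ((CT.midWith c).comp (CT.map S.comul S.comul))
  comul_one : S.comul S.one = tm k S.one S.one
  counit_mul : S.counit.comp S.mul = (CT.lid k k).comp (CT.map S.counit S.counit)
  counit_one : S.counit S.one = 1
  antipode_left : ∀ x, S.mul (CT.map S.antipode (BMap.id k X) (S.comul x)) = S.counit x • S.one
  antipode_right : ∀ x, S.mul (CT.map (BMap.id k X) S.antipode (S.comul x)) = S.counit x • S.one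

variable {H A X Y : Type*}
  [NormedAddCommGroup H] [NormedSpace k H] [NormedAddCommGroup A] [NormedSpace k A]
  [NormedAddCommGroup X] [NormedSpace k X] [NormedAddCommGroup Y] [NormedSpace k Y]

/-- The braiding of `A`-comodules induced by a pairing `ev : H ⊗̂ A → k` and `R : A → H`,
`x ⊗ y ↦ ⟨R x₍₋₁₎, y₍₋₁₎⟩ y₍₀₎ ⊗ x₍₀₎`. -/
def psi (ev : BMap k (CT k H A) k) (R : BMap k A H) (δX : BMap k X (CT k A X))
    (δY : BMap k Y (CT k A Y)) : BMap k (CT k X Y) (CT k Y X) :=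
  (CT.lid k (CT k Y X)).comp <|
    (CT.map (ev.comp (CT.map R (BMap.id k A))) (CT.swap k X Y)).comp <|
      (CT.mid k A X A Y).comp (CT.map δX δY)

/-- The action of `H` on an `A`-comodule induced by the pairing, `h ⊗ x ↦ ⟨h, x₍₋₁₎⟩ x₍₀₎`. -/
def act [CompleteSpace X] [IsUltrametricDist X] (ev : BMap k (CT k H A) k)
    (δ : BMap k X (CT k A X)) : BMap k (CT k H X) X :=
  (CT.lid k X).comp <| (CT.map ev (BMap.id k X)).comp <|
    (CT.assocInv k H A X).comp (CT.map (BMap.id k H) δ)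

/-- The same action as an action on the right, `x ⊗ h ↦ ⟨h, x₍₋₁₎⟩ x₍₀₎`. -/
def ract [CompleteSpace X] [IsUltrametricDist X] (ev : BMap k (CT k H A) k)
    (δ : BMap k X (CT k A X)) : BMap k (CT k X H) X := (act ev δ).comp (CT.swap k X H)

/-- The structure maps of a braided Hopf algebra in `A`-comodules with invertible antipode.
In the application `A` is commutative and cocommutative, so that left and right comodules (and
the induced right and left `H`-modules) are the same thing; we always write the coaction on the
left. -/
structure ComodHopfStr (k A X : Type*) [NormedField k] [NormedAddCommGroup A] [NormedSpace k A]
    [NormedAddCommGroup X] [NormedSpace k X] extends HopfStr k X where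
  coact : BMap k X (CT k A X)
  antipodeInv : BMap k X X

/-- The axioms of a braided Hopf algebra in the braided category of `A`-comodules. -/
structure IsComodHopf [CompleteSpace X] [IsUltrametricDist X]
    (hA : HopfStr k A) (ev : BMap k (CT k H A) k) (R : BMap k A H) (S : ComodHopfStr k A X) :
    Prop where
  hopf : IsHopf (psi ev R S.coact S.coact) S.toHopfStr
  coact_coassoc : (CT.assoc k A A X).comp ((CT.map hA.comul (BMap.id k X)).comp S.coact) =
    (CT.map (BMap.id k A) S.coact).comp S.coact
  coact_counit : ∀ x, CT.lid k X (CT.map hA.counit (BMap.id k X) (S.coact x)) = x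
  coact_one : S.coact S.one = tm k hA.one S.one
  coact_mul : S.coact.comp S.mul =
    (CT.map hA.mul S.mul).comp ((CT.mid k A X A X).comp (CT.map S.coact S.coact))
  coact_comul : (CT.map (BMap.id k A) S.comul).comp S.coact =
    (CT.map hA.mul (BMap.id k (CT k X X))).comp
      ((CT.mid k A X A X).comp ((CT.map S.coact S.coact).comp S.comul))
  coact_counit' : ∀ x, CT.map (BMap.id k A) S.counit (S.coact x) = tm k hA.one (S.counit x)
  coact_antipode : S.coact.comp S.antipode = (CT.map (BMap.id k A) S.antipode).comp S.coact
  antipode_inv : ∀ x, S.antipode (S.antipodeInv x) = x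
  inv_antipode : ∀ x, S.antipodeInv (S.antipode x) = x

/-- `p` is an `H`-equivariant duality pairing of (braided) Hopf algebras,
`⟨b b', c⟩ = ⟨b, c₁⟩⟨b', c₂⟩`, `⟨b, c c'⟩ = ⟨b₁, c⟩⟨b₂, c'⟩`, and so on. -/
structure IsDualityPairing [CompleteSpace X] [IsUltrametricDist X] [CompleteSpace Y]
    [IsUltrametricDist Y] (ev : BMap k (CT k H A) k) (B : ComodHopfStr k A X)
    (C : ComodHopfStr k A Y) (p : BMap k (CT k X Y) k) : Prop where
  mul_left : p.comp (CT.map B.mul (BMap.id k Y)) =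
    (CT.lid k k).comp ((CT.map p p).comp ((CT.mid k X X Y Y).comp
      (CT.map (BMap.id k (CT k X X)) C.comul)))
  mul_right : p.comp (CT.map (BMap.id k X) C.mul) =
    (CT.lid k k).comp ((CT.map p p).comp ((CT.mid k X X Y Y).comp
      (CT.map B.comul (BMap.id k (CT k Y Y)))))
  one_left : ∀ y, p (tm k B.one y) = C.counit y
  one_right : ∀ x, p (tm k x C.one) = B.counit x
  antipode : ∀ x y, p (tm k (B.antipode x) y) = p (tm k x (C.antipode y))
  equivariant : ∀ x h y,
    p (tm k (ract ev B.coact (tm k x h)) y) = p (tm k x (act ev C.coact (tm k h y)))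

end Hopf

/-- The data to which double bosonisation applies: a dual pair of Hopf algebras `H`, `A` with
`R, Rbar : A → H`, braided Hopf algebras `C` and `B` in `A`-comodules, and a pairing of `B` with
`C`. -/
structure DBData (k H A C B : Type*) [NormedField k] [NormedAddCommGroup H] [NormedSpace k H]
    [NormedAddCommGroup A] [NormedSpace k A] [NormedAddCommGroup C] [NormedSpace k C]
    [NormedAddCommGroup B] [NormedSpace k B] where
  hH : HopfStr k H
  hA : HopfStr k A
  ev : BMap k (CT k H A) k
  R : BMap k A H
  Rbar : BMap k A H
  hC : ComodHopfStr k A C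
  hB : ComodHopfStr k A B
  pair : BMap k (CT k B C) k

namespace DBData

variable {k H A C B : Type*} [NormedField k] [IsUltrametricDist k] [CompleteSpace k]
  [NormedAddCommGroup H] [NormedSpace k H] [CompleteSpace H] [IsUltrametricDist H]
  [NormedAddCommGroup A] [NormedSpace k A] [CompleteSpace A] [IsUltrametricDist A]
  [NormedAddCommGroup C] [NormedSpace k C] [CompleteSpace C] [IsUltrametricDist C]
  [NormedAddCommGroup B] [NormedSpace k B] [CompleteSpace B] [IsUltrametricDist B]

/-- The comultiplication `Ψ⁻¹ ∘ Δ` of `C̄`.  The inverse braiding is the braiding defined by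
`Rbar`. -/
def comulCbar (D : DBData k H A C B) : BMap k C (CT k C C) :=
  (psi D.ev D.Rbar D.hC.coact D.hC.coact).comp D.hC.comul

/-- The multiplication of `C̄ ⋊ H̄`, `(c ⊗ h)(c' ⊗ h') = c (h₁ ▷ c') ⊗ h₂ h'`. -/
def mulCH (D : DBData k H A C B) : BMap k (CT k (CT k C H) (CT k C H)) (CT k C H) :=
  (CT.map (D.hC.mul.comp ((CT.map (BMap.id k C) (act D.ev D.hC.coact)).comp (CT.assoc k C H C)))
    D.hH.mul).comp <|
  (CT.mid k (CT k C H) H C H).comp <|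
  (CT.map ((CT.assocInv k C H H).comp (CT.map (BMap.id k C) D.hH.comul))
    (BMap.id k (CT k C H)))

/-- `c ⊗ h ↦ Rbar(c₍₋₁₎) h ⊗ c₍₀₎`, the braiding of `C̄` with `H̄` (on which `H` acts by left
multiplication). -/
def psiCH (D : DBData k H A C B) : BMap k (CT k C H) (CT k H C) :=
  (CT.map (D.hH.mul.comp (CT.map D.Rbar (BMap.id k H))) (BMap.id k C)).comp <|
  (CT.assocInv k A H C).comp <|
  (CT.map (BMap.id k A) (CT.swap k C H)).comp <|
  (CT.assoc k A C H).comp (CT.map D.hC.coact (BMap.id k H))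

/-- The comultiplication of `C̄ ⋊ H̄`. -/
def comulCH (D : DBData k H A C B) : BMap k (CT k C H) (CT k (CT k C H) (CT k C H)) :=
  (CT.midWith D.psiCH).comp (CT.map D.comulCbar D.hH.comul)

/-- The multiplication of `H ⋉ B`, `(h ⊗ b)(h' ⊗ b') = h h'₁ ⊗ (b ◁ h'₂) b'`. -/
def mulHB (D : DBData k H A C B) : BMap k (CT k (CT k H B) (CT k H B)) (CT k H B) :=
  (CT.map D.hH.mul
    (D.hB.mul.comp ((CT.map (ract D.ev D.hB.coact) (BMap.id k B)).comp
      (CT.assocInv k B H B)))).comp <|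
  (CT.mid k H B H (CT k H B)).comp <|
  (CT.map (BMap.id k (CT k H B))
    ((CT.assoc k H H B).comp (CT.map D.hH.comul (BMap.id k B))))

/-- `h ⊗ b ↦ b₍₀₎ ⊗ h R(b₍₋₁₎)`, the braiding of `H` (on which `H` acts by right multiplication)
with `B`. -/
def psiHB (D : DBData k H A C B) : BMap k (CT k H B) (CT k B H) :=
  (CT.swap k H B).comp <|
  (CT.map (D.hH.mul.comp (CT.map (BMap.id k H) D.R)) (BMap.id k B)).comp <|
  (CT.assocInv k H A B).comp (CT.map (BMap.id k H) D.hB.coact)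

/-- The comultiplication of `H ⋉ B`. -/
def comulHB (D : DBData k H A C B) : BMap k (CT k H B) (CT k (CT k H B) (CT k H B)) :=
  (CT.midWith D.psiHB).comp (CT.map D.hH.comul D.hB.comul)

/-- `b ⊗ c ↦ ⟨b₍₀₎, c₍₀₎⟩ Q(b₍₋₁₎) ⊗ Q(c₍₋₁₎)`. -/
def pairH (D : DBData k H A C B) (Q : BMap k A H) : BMap k (CT k B C) (CT k H H) :=
  (CT.rid k (CT k H H)).comp <| (CT.map (CT.map Q Q) D.pair).comp <|
    (CT.mid k A B A C).comp (CT.map D.hB.coact D.hC.coact)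

/-- `b ⊗ c ↦ (b₁ ⊗ c₁) ⊗ ((b₂ ⊗ c₂) ⊗ (b₃ ⊗ c₃))` for the comultiplications of `B` and `C̄`. -/
def split (D : DBData k H A C B) :
    BMap k (CT k B C) (CT k (CT k B C) (CT k (CT k B C) (CT k B C))) :=
  (CT.map (BMap.id k (CT k B C)) (CT.mid k B B C C)).comp <|
  (CT.mid k B (CT k B B) C (CT k C C)).comp <|
  CT.map ((CT.map (BMap.id k B) D.hB.comul).comp D.hB.comul)
    ((CT.map (BMap.id k C) D.comulCbar).comp D.comulCbar)

/-- `(h ⊗ h') ⊗ ((b ⊗ c) ⊗ (g ⊗ g')) ↦ (h' ▷ c) ⊗ h g' ⊗ (b ◁ g)`. -/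
def join (D : DBData k H A C B) :
    BMap k (CT k (CT k H H) (CT k (CT k B C) (CT k H H))) (CT k (CT k C H) B) :=
  (CT.map ((CT.map (act D.ev D.hC.coact) D.hH.mul).comp
      ((CT.mid k H H C H).comp (CT.map (CT.swap k H H) (BMap.id k (CT k C H)))))
    (BMap.id k B)).comp <|
  (CT.assocInv k (CT k H H) (CT k C H) B).comp <|
  CT.map (BMap.id k (CT k H H)) <|
    (CT.swap k B (CT k C H)).comp <|
    (CT.map (ract D.ev D.hB.coact) (BMap.id k (CT k C H))).comp (CT.mid k B C H H)

/-- The cross relation of the double bosonisation,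
`b · c = ⟨b₁, c₁⟩ ⟨b₃, S̄ c₃⟩ (R(c₁) ▷ c₂) · R(b₁) Rbar(c₃) · (b₂ ◁ Rbar(b₃))`,
where `R(x)` stands for `R` of the coaction component of `x`, the comultiplications are those of
`B` and `C̄`, and `S̄ = S_C⁻¹` is the antipode of `C̄`. -/
def cross (D : DBData k H A C B) : BMap k (CT k B C) (CT k (CT k C H) B) :=
  D.join.comp <|
  (CT.map (D.pairH D.R) (CT.map (BMap.id k (CT k B C))
    ((D.pairH D.Rbar).comp (CT.map (BMap.id k B) D.hC.antipodeInv)))).comp D.split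

/-- `C̄ ⋊ H̄ → C ⊗̂ H ⊗̂ B`. -/
def inCH (D : DBData k H A C B) : BMap k (CT k C H) (CT k (CT k C H) B) := CT.inl D.hB.one

/-- `H ⋉ B → C ⊗̂ H ⊗̂ B`. -/
def inHB (D : DBData k H A C B) : BMap k (CT k H B) (CT k (CT k C H) B) :=
  (CT.assocInv k C H B).comp (CT.inr D.hC.one)

/-- `C → C ⊗̂ H ⊗̂ B`. -/
def inC (D : DBData k H A C B) : BMap k C (CT k (CT k C H) B) := D.inCH.comp (CT.inl D.hH.one)

/-- `H → C ⊗̂ H ⊗̂ B`. -/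
def inH (D : DBData k H A C B) : BMap k H (CT k (CT k C H) B) := D.inCH.comp (CT.inr D.hC.one)

/-- `B → C ⊗̂ H ⊗̂ B`. -/
def inB (D : DBData k H A C B) : BMap k B (CT k (CT k C H) B) := D.inHB.comp (CT.inr D.hH.one)

/-- `U` is the Hopf algebra structure of the double bosonisation `U(C, H, B)` on
`C ⊗̂ H ⊗̂ B`. -/
structure IsDoubleBosonisation (D : DBData k H A C B) (U : HopfStr k (CT k (CT k C H) B)) :
    Prop where
  hopf : IsHopf (CT.swap k (CT k (CT k C H) B) (CT k (CT k C H) B)) U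
  one : U.one = tm k (tm k D.hC.one D.hH.one) D.hB.one
  /-- `C̄ ⋊ H̄ → C ⊗̂ H ⊗̂ B` is a morphism of Hopf algebras. -/
  mul_inCH : U.mul.comp (CT.map D.inCH D.inCH) = D.inCH.comp D.mulCH
  comul_inCH : U.comul.comp D.inCH = (CT.map D.inCH D.inCH).comp D.comulCH
  counit_inCH : U.counit.comp D.inCH = (CT.lid k k).comp (CT.map D.hC.counit D.hH.counit)
  /-- `H ⋉ B → C ⊗̂ H ⊗̂ B` is a morphism of Hopf algebras. -/
  mul_inHB : U.mul.comp (CT.map D.inHB D.inHB) = D.inHB.comp D.mulHB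
  comul_inHB : U.comul.comp D.inHB = (CT.map D.inHB D.inHB).comp D.comulHB
  counit_inHB : U.counit.comp D.inHB = (CT.lid k k).comp (CT.map D.hH.counit D.hB.counit)
  /-- `c ⊗ h ⊗ b` is the product of `c ⊗ h ∈ C̄ ⋊ H̄` and `b ∈ B`. -/
  mul_inCH_inB : ∀ x b, U.mul (tm k (D.inCH x) (D.inB b)) = tm k x b
  /-- The cross relation. -/
  mul_inB_inC : U.mul.comp (CT.map D.inB D.inC) = D.cross

end DBData

/-! ### The root datum and the Cartan part -/

/-- A root datum: the weight lattice is `Φ`, the simple roots `α i` are a basis of the root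
lattice, `d i = (α i, α i) / 2`, and `coroot i` is the simple coroot `2 (α i, ·) / (α i, α i)`. -/
structure RootDatum (I Φ : Type*) [AddCommGroup Φ] where
  α : I → Φ
  indep : LinearIndependent ℤ α
  form : Φ →ₗ[ℤ] Φ →ₗ[ℤ] ℚ
  form_symm : ∀ x y, form x y = form y x
  d : I → ℕ
  d_pos : ∀ i, 0 < d i
  form_self : ∀ i, form (α i) (α i) = 2 * d i
  form_nonpos : ∀ i j, i ≠ j → form (α i) (α j) ≤ 0
  coroot : I → Module.Dual ℤ Φ
  coroot_eq : ∀ i x, (coroot i x : ℚ) = 2 * form (α i) x / form (α i) (α i)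

namespace RootDatum

variable {I Φ : Type*} [AddCommGroup Φ] (D : RootDatum I Φ)

/-- `∑ nᵢ αᵢ`. -/
def toRoot : (I →₀ ℤ) →ₗ[ℤ] Φ := Finsupp.linearCombination ℤ D.α

/-- `∑ nᵢ dᵢ λᵢ`, the index of `∏ tᵢ ^ nᵢ`, where `λᵢ` are the simple coroots and
`tᵢ = K (dᵢ λᵢ)`. -/
def tK : (I →₀ ℤ) →ₗ[ℤ] Module.Dual ℤ Φ :=
  Finsupp.linearCombination ℤ fun i => (D.d i : ℤ) • D.coroot i

/-- The integer `(∑ nᵢ αᵢ, ∑ mᵢ αᵢ)`. -/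
def ip (n m : I →₀ ℤ) : ℤ := D.tK n (D.toRoot m)

theorem ip_eq (n m : I →₀ ℤ) : (D.ip n m : ℚ) = D.form (D.toRoot n) (D.toRoot m) := by
  unfold ip
  generalize D.toRoot m = x
  induction n using Finsupp.induction_linear with
  | zero => simp
  | add a b ha hb => simp only [map_add, LinearMap.add_apply, Int.cast_add, ha, hb]
  | single i c =>
    have h2 : (D.d i : ℚ) ≠ 0 := by exact_mod_cast (D.d_pos i).ne'
    simp only [tK, toRoot, Finsupp.linearCombination_single, LinearMap.smul_apply, map_smul,
      smul_eq_mul, Int.cast_mul, Int.cast_natCast, D.coroot_eq, D.form_self, zsmul_eq_mul]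
    field_simp

/-- The weight of a word in the simple roots. -/
def wt (_D : RootDatum I Φ) : List I → (I →₀ ℤ)
  | [] => 0
  | i :: w => Finsupp.single i 1 + wt _D w

theorem wt_append (u v : List I) : D.wt (u ++ v) = D.wt u + D.wt v := by
  induction u with
  | nil => simp [wt]
  | cons i u ih => simp [wt, ih, add_assoc]

end RootDatum

/-- An element of norm one which is not a root of unity. -/
structure QNumber (k : Type*) [NormedField k] where
  val : k
  norm_val : ‖val‖ = 1
  not_root : ∀ n : ℕ, 0 < n → val ^ n ≠ 1

theorem QNumber.norm_zpow {k : Type*} [NormedField k] (q : QNumber k) (n : ℤ) :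
    ‖q.val ^ n‖ = 1 := by rw [_root_.norm_zpow, q.norm_val, one_zpow]

section

variable (k : Type*) [NormedField k] [IsUltrametricDist k] [CompleteSpace k]

/-- The Banach group algebra of an (additive) group, with `‖e g‖ = 1`. -/
abbrev GA (G : Type*) : Type _ := Cop k (fun _ : G => (1 : ℝ≥0))

/-- The Banach space on words in `I` with `‖e w‖ = r ^ length w`, which underlies `T_r(V)`. -/
abbrev TA (I : Type*) (r : ℝ≥0) : Type _ := Cop k (fun w : List I => r ^ w.length)

variable {k}

/-- The Hopf algebra structure of the Banach group algebra. -/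
def GA.hopf (G : Type*) [AddCommGroup G] : HopfStr k (GA k G) where
  one := Cop.e k _ 0
  mul := Cop.lift₂ (fun g h => Cop.e k _ (g + h)) fun g h => by
    rw [NNReal.coe_one, one_mul]; exact Cop.norm_e_le _
  counit := Cop.lift (fun _ => 1) ⟨1, zero_le_one, fun _ => by simp⟩
  comul := Cop.lift (fun g => tm k (Cop.e k _ g) (Cop.e k _ g)) ⟨1, zero_le_one, fun g =>
    (norm_tm_le _ _).trans (mul_le_mul (Cop.norm_e_le _) (Cop.norm_e_le _) (norm_nonneg _)
      zero_le_one)⟩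
  antipode := Cop.lift (fun g => Cop.e k _ (-g)) ⟨1, zero_le_one, fun g => by
    rw [one_mul]; exact Cop.norm_e_le _⟩

variable {I Φ : Type*} [AddCommGroup Φ] (D : RootDatum I Φ) (q : QNumber k)

/-- The duality pairing `K_λ ⊗ tⁿ ↦ q ^ λ(∑ nᵢ αᵢ)` between `H = GA k Φ*` and
`H' = GA k ℤ^I`. -/
def evHA : BMap k (CT k (GA k (Module.Dual ℤ Φ)) (GA k (I →₀ ℤ))) k :=
  Cop.lift₂ (fun l n => q.val ^ (l (D.toRoot n))) fun l n => by
    rw [q.norm_zpow]; simp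

/-- The map `H' → H`, `tⁿ ↦ tⁿ`. -/
def RH : BMap k (GA k (I →₀ ℤ)) (GA k (Module.Dual ℤ Φ)) :=
  Cop.lift (fun n => Cop.e k _ (D.tK n)) ⟨1, zero_le_one, fun _ => by
    rw [one_mul]; exact Cop.norm_e_le _⟩

/-- The map `H' → H`, `tⁿ ↦ t⁻ⁿ`. -/
def RbarH : BMap k (GA k (I →₀ ℤ)) (GA k (Module.Dual ℤ Φ)) :=
  Cop.lift (fun n => Cop.e k _ (-D.tK n)) ⟨1, zero_le_one, fun _ => by
    rw [one_mul]; exact Cop.norm_e_le _⟩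

/-! ### The braided tensor algebra `T_r(V)` -/

/-- The concatenation product. -/
def TA.mul (I : Type*) (r : ℝ≥0) : BMap k (CT k (TA k I r) (TA k I r)) (TA k I r) :=
  Cop.lift₂ (fun u v => Cop.e k _ (u ++ v)) fun u v => by
    refine (Cop.norm_e_le _).trans (le_of_eq ?_)
    push_cast [List.length_append]
    exact pow_add _ _ _

/-- The coaction of `H'`, for which `v i` has coaction `t i ⊗ v i`. -/
def TA.coact (r : ℝ≥0) : BMap k (TA k I r) (CT k (GA k (I →₀ ℤ)) (TA k I r)) :=
  Cop.lift (fun w => tm k (Cop.e k _ (D.wt w)) (Cop.e k _ w)) ⟨1, zero_le_one, fun _ =>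
    (norm_tm_le _ _).trans (mul_le_mul (Cop.norm_e_le _) (Cop.norm_e_le _) (norm_nonneg _)
      zero_le_one)⟩

/-- Left multiplication by `v i`. -/
def TA.consL (r : ℝ≥0) (i : I) : BMap k (TA k I r) (TA k I r) :=
  Cop.lift (fun w => Cop.e k _ (i :: w)) ⟨r, r.2, fun w => by
    refine (Cop.norm_e_le _).trans (le_of_eq ?_)
    push_cast [List.length_cons]
    exact pow_succ' _ _⟩

/-- The braiding past `v i`, `w ↦ q ^ (αᵢ, |w|) w`. -/
def TA.scal (r : ℝ≥0) (i : I) : BMap k (TA k I r) (TA k I r) :=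
  Cop.lift (fun w => q.val ^ (D.ip (Finsupp.single i 1) (D.wt w)) • Cop.e k _ w)
    ⟨1, zero_le_one, fun w => by
      rw [norm_smul, q.norm_zpow]
      exact mul_le_mul_of_nonneg_left (Cop.norm_e_le _) zero_le_one⟩

/-- The comultiplication of `T_r(V)` on words: `Δ(1) = 1 ⊗ 1` and
`Δ(vᵢ w) = (vᵢ ⊗ 1 + 1 ⊗ vᵢ) Δ(w)`, the product being that of the braided tensor square for the
braiding `vᵢ ⊗ vⱼ ↦ q ^ (αᵢ, αⱼ) vⱼ ⊗ vᵢ`. -/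
def TA.comulWord (r : ℝ≥0) : List I → CT k (TA k I r) (TA k I r)
  | [] => tm k (Cop.e k _ []) (Cop.e k _ [])
  | i :: w => CT.map (TA.consL r i) (BMap.id k _) (TA.comulWord r w) +
      CT.map (TA.scal D q r i) (TA.consL r i) (TA.comulWord r w)

theorem TA.consL_bound (r : ℝ≥0) (i : I) (x : TA k I r) : ‖TA.consL r i x‖ ≤ r * ‖x‖ :=
  Cop.lift_bound _ _ r.2 (fun w => by
    refine (Cop.norm_e_le _).trans (le_of_eq ?_)
    push_cast [List.length_cons]
    exact pow_succ' _ _) x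

theorem TA.scal_bound (r : ℝ≥0) (i : I) (x : TA k I r) : ‖TA.scal D q r i x‖ ≤ 1 * ‖x‖ :=
  Cop.lift_bound _ _ zero_le_one (fun w => by
    rw [norm_smul, q.norm_zpow]
    exact mul_le_mul_of_nonneg_left (Cop.norm_e_le _) zero_le_one) x

theorem TA.comulWord_bound (r : ℝ≥0) (w : List I) :
    ‖TA.comulWord D q r w‖ ≤ (r : ℝ) ^ w.length := by
  induction w with
  | nil =>
    refine (norm_tm_le _ _).trans ?_
    have h : ‖Cop.e k (fun w : List I => r ^ w.length) []‖ ≤ 1 := by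
      simpa using Cop.norm_e_le (k := k) (w := fun w : List I => r ^ w.length) []
    simpa using mul_le_mul h h (norm_nonneg _) zero_le_one
  | cons i w ih =>
    rw [TA.comulWord, List.length_cons, pow_succ']
    refine (IsUltrametricDist.norm_add_le_max _ _).trans (max_le ?_ ?_)
    · refine (CT.map_bound (C := r) (D := 1) _ _ r.2 zero_le_one (TA.consL_bound r i)
        (fun x => by simp) _).trans ?_
      rw [mul_one]
      exact mul_le_mul_of_nonneg_left ih r.2
    · refine (CT.map_bound (C := 1) (D := r) _ _ zero_le_one r.2 (TA.scal_bound D q r i)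
        (TA.consL_bound r i) _).trans ?_
      rw [one_mul]
      exact mul_le_mul_of_nonneg_left ih r.2

/-- The comultiplication of `T_r(V)`. -/
def TA.comul (r : ℝ≥0) : BMap k (TA k I r) (CT k (TA k I r) (TA k I r)) :=
  Cop.lift (TA.comulWord D q r) ⟨1, zero_le_one, fun w => by
    rw [one_mul, NNReal.coe_pow]; exact TA.comulWord_bound D q r w⟩

open scoped Classical in
/-- The projection to the words of length `n`. -/
def TA.pr (I : Type*) (r : ℝ≥0) (n : ℕ) : BMap k (TA k I r) (TA k I r) :=
  Cop.lift (fun w => if w.length = n then Cop.e k _ w else 0) ⟨1, zero_le_one, fun w => by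
    rw [one_mul]
    split_ifs
    · exact Cop.norm_e_le _
    · simp⟩

/-! ### The analytic Nichols algebra -/

/-- The homogeneous ideals of `T_r(V)`, concentrated in degrees at least two, which are also
coideals. -/
structure IsNicholsIdeal (r : ℝ≥0) (J : Submodule k (TA k I r)) : Prop where
  left : ∀ x, ∀ y ∈ J, TA.mul I r (tm k x y) ∈ J
  right : ∀ x ∈ J, ∀ y, TA.mul I r (tm k x y) ∈ J
  homogeneous : ∀ x ∈ J, ∀ n, TA.pr I r n x ∈ J
  pr_zero : ∀ x ∈ J, TA.pr I r 0 x = 0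
  pr_one : ∀ x ∈ J, TA.pr I r 1 x = 0
  coideal : ∀ x ∈ J, TA.comul D q r x ∈
    (Submodule.span k {z | ∃ a b, (a ∈ J ∨ b ∈ J) ∧ tm k a b = z}).topologicalClosure

/-- The closure of the sum of all homogeneous ideals of `T_r(V)` which are also coideals and are
concentrated in degrees at least two. -/
def nicholsIdeal (r : ℝ≥0) : Submodule k (TA k I r) :=
  (sSup {J | IsNicholsIdeal D q r J}).topologicalClosure

instance (r : ℝ≥0) : IsClosed (nicholsIdeal D q r : Set (TA k I r)) :=
  Submodule.isClosed_topologicalClosure _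

/-- The underlying Banach space of the analytic Nichols algebra `f_r`. -/
abbrev Nichols (r : ℝ≥0) : Type _ := TA k I r ⧸ nicholsIdeal D q r

instance (r : ℝ≥0) : IsUltrametricDist (Nichols D q r) := by
  refine IsUltrametricDist.isUltrametricDist_of_forall_norm_add_le_max_norm fun x y => ?_
  refine le_of_forall_pos_le_add fun e he => ?_
  obtain ⟨a, rfl, ha⟩ := Submodule.Quotient.norm_mk_lt x he
  obtain ⟨b, rfl, hb⟩ := Submodule.Quotient.norm_mk_lt y he
  rw [← Submodule.Quotient.mk_add, ← max_add_add_right]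
  exact (Submodule.Quotient.norm_mk_le _ _).trans
    ((IsUltrametricDist.norm_add_le_max a b).trans (max_le_max ha.le hb.le))

/-- The quotient map `T_r(V) → f_r`. -/
def Nichols.π (r : ℝ≥0) : BMap k (TA k I r) (Nichols D q r) where
  toLinearMap := (nicholsIdeal D q r).mkQ
  bound' := ⟨1, fun x => by rw [one_mul]; exact Submodule.Quotient.norm_mk_le _ x⟩

/-- The generator `v i` of `f_r`. -/
def Nichols.v (r : ℝ≥0) (i : I) : Nichols D q r := Nichols.π D q r (Cop.e k _ [i])

/-- `S` is the structure of braided Hopf algebra in `H'`-comodules on `f_r` inherited from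
`T_r(V)`. -/
structure IsNichols (r : ℝ≥0) (S : ComodHopfStr k (GA k (I →₀ ℤ)) (Nichols D q r)) : Prop where
  comodHopf : IsComodHopf (GA.hopf (I →₀ ℤ)) (evHA D q) (RH D) S
  one : S.one = Nichols.π D q r (Cop.e k _ [])
  mul : S.mul.comp (CT.map (Nichols.π D q r) (Nichols.π D q r)) =
    (Nichols.π D q r).comp (TA.mul I r)
  comul : S.comul.comp (Nichols.π D q r) =
    (CT.map (Nichols.π D q r) (Nichols.π D q r)).comp (TA.comul D q r)
  coact : S.coact.comp (Nichols.π D q r) =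
    (CT.map (BMap.id k _) (Nichols.π D q r)).comp (TA.coact D r)

/-! ### The analytic quantum group -/

variable (k) in
/-- `qᵢ - qᵢ⁻¹`, where `qᵢ = q ^ dᵢ`. -/
def qDiff (i : I) : k := q.val ^ D.d i - (q.val ^ D.d i)⁻¹

variable (k) in
/-- The Cartan part, the Banach group algebra of `Φ*`. -/
abbrev Cartan (Φ : Type*) [AddCommGroup Φ] : Type _ := GA k (Module.Dual ℤ Φ)

/-- The Banach space `f_r ⊗̂ H ⊗̂ f_s`. -/
abbrev UqSpace (r s : ℝ≥0) : Type _ :=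
  CT k (CT k (Nichols D q r) (Cartan k Φ)) (Nichols D q s)

variable {r s : ℝ≥0} in
/-- The data entering the double bosonisation: the weakly quasi-triangular dual pair `H`, `H'`, and
structures `C` on `f_r` and `B` on `f_s` with a pairing. -/
def dbData (C : ComodHopfStr k (GA k (I →₀ ℤ)) (Nichols D q r))
    (B : ComodHopfStr k (GA k (I →₀ ℤ)) (Nichols D q s))
    (pair : BMap k (CT k (Nichols D q s) (Nichols D q r)) k) :
    DBData k (Cartan k Φ) (GA k (I →₀ ℤ)) (Nichols D q r) (Nichols D q s) where
  hH := GA.hopf (Module.Dual ℤ Φ)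
  hA := GA.hopf (I →₀ ℤ)
  ev := evHA D q
  R := RH D
  Rbar := RbarH D
  hC := C
  hB := B
  pair := pair

open scoped Classical in
/-- The analytic quantum group `U(f_r, H, f_s)`, together with the data from which it is formed:
the analytic Nichols algebras `C = f_r` and `B = f_s` as braided Hopf algebras, and their pairing
extending `⟨vᵢ, vⱼ⟩ = δᵢⱼ / (qᵢ - qᵢ⁻¹)`. -/
@[ext] structure AnalyticQuantumGroup (r s : ℝ≥0) where
  C : ComodHopfStr k (GA k (I →₀ ℤ)) (Nichols D q r)
  B : ComodHopfStr k (GA k (I →₀ ℤ)) (Nichols D q s)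
  pair : BMap k (CT k (Nichols D q s) (Nichols D q r)) k
  U : HopfStr k (UqSpace D q r s)
  isNichols_C : IsNichols D q r C
  isNichols_B : IsNichols D q s B
  isPairing : IsDualityPairing (evHA D q) B C pair
  pair_v : ∀ i j, pair (tm k (Nichols.v D q s i) (Nichols.v D q r j)) =
    if i = j then (qDiff k D q i)⁻¹ else 0
  isDB : (dbData D q C B pair).IsDoubleBosonisation U

namespace AnalyticQuantumGroup

variable {D q} {r s : ℝ≥0} (Q : AnalyticQuantumGroup D q r s)

/-- The data entering the double bosonisation. -/
abbrev data : DBData k (Cartan k Φ) (GA k (I →₀ ℤ)) (Nichols D q r) (Nichols D q s) :=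
  dbData D q Q.C Q.B Q.pair

/-- The element `F i = v i ⊗ 1 ⊗ 1`. -/
def F (i : I) : UqSpace D q r s := Q.data.inC (Nichols.v D q r i)

/-- The element `E i = 1 ⊗ 1 ⊗ v i`. -/
def E (i : I) : UqSpace D q r s := Q.data.inB (Nichols.v D q s i)

/-- The element `K_λ = 1 ⊗ K_λ ⊗ 1`. -/
def K (l : Module.Dual ℤ Φ) : UqSpace D q r s := Q.data.inH (Cop.e k _ l)

end AnalyticQuantumGroup

end

/-! ### The quantum enveloping algebra -/

section

variable {k : Type*} [NormedField k] {I Φ : Type*} [AddCommGroup Φ]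
  (D : RootDatum I Φ) (q : QNumber k)

open scoped Classical in
/-- The skew derivation `∂ᵢ` of the free algebra on words, `∂ᵢ(θⱼ) = δᵢⱼ` and
`∂ᵢ(x y) = ∂ᵢ(x) y + q ^ (αᵢ, |x|) x ∂ᵢ(y)`. -/
def skewWord (i : I) : List I → (List I →₀ k)
  | [] => 0
  | j :: w => (if i = j then Finsupp.single w 1 else 0) +
      q.val ^ (D.ip (Finsupp.single i 1) (Finsupp.single j 1)) •
        Finsupp.lmapDomain k k (List.cons j) (skewWord i w)

/-- The skew derivation as a linear map. -/
def skew (i : I) : (List I →₀ k) →ₗ[k] (List I →₀ k) :=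
  Finsupp.linearCombination k (skewWord D q i)

/-- Lusztig's bilinear form on the free algebra, `(1, 1) = 1`, `(1, θⱼ y) = 0` and
`(θᵢ x, y) = (qᵢ - qᵢ⁻¹)⁻¹ (x, ∂ᵢ y)`; the first argument is a word. -/
def lform : List I → ((List I →₀ k) →ₗ[k] k)
  | [] => Finsupp.lapply []
  | i :: u => (qDiff k D q i)⁻¹ • (lform u).comp (skew D q i)

/-- The elements of the radical of Lusztig's form. -/
def InRadical (y : List I →₀ k) : Prop := ∀ u, lform D q u y = 0

/-- The generators of `U_q(g)`. -/
inductive UqGen (_D : RootDatum I Φ) : Type _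
  | E (i : I) : UqGen _D
  | F (i : I) : UqGen _D
  | K (l : Module.Dual ℤ Φ) : UqGen _D

/-- The value of an element of the free algebra on words at a family `x` of elements. -/
def wordEval {A : Type*} [Ring A] [Algebra k A] (x : I → A) (y : List I →₀ k) : A :=
  Finsupp.linearCombination k (fun w : List I => (w.map x).prod) y

/-- A generator as an element of the free algebra. -/
def gen (g : UqGen D) : FreeAlgebra k (UqGen D) := FreeAlgebra.ι k g

/-- The defining relations of `U_q(g)`, in Lusztig's form: the quantum Serre relations appear as
the radical of Lusztig's form. -/
inductive UqRel : FreeAlgebra k (UqGen D) → FreeAlgebra k (UqGen D) → Prop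
  | K_zero : UqRel (gen D (.K 0)) 1
  | K_add (l m : Module.Dual ℤ Φ) : UqRel (gen D (.K l) * gen D (.K m)) (gen D (.K (l + m)))
  | K_E (l : Module.Dual ℤ Φ) (i : I) : UqRel (gen D (.K l) * gen D (.E i))
      (q.val ^ l (D.α i) • (gen D (.E i) * gen D (.K l)))
  | K_F (l : Module.Dual ℤ Φ) (i : I) : UqRel (gen D (.K l) * gen D (.F i))
      (q.val ^ (-l (D.α i)) • (gen D (.F i) * gen D (.K l)))
  | E_F (i : I) : UqRel (gen D (.E i) * gen D (.F i) - gen D (.F i) * gen D (.E i))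
      ((qDiff k D q i)⁻¹ • (gen D (.K ((D.d i : ℤ) • D.coroot i)) -
        gen D (.K (-((D.d i : ℤ) • D.coroot i)))))
  | E_F_ne (i j : I) (h : i ≠ j) : UqRel (gen D (.E i) * gen D (.F j)) (gen D (.F j) * gen D (.E i))
  | serre_E (y : List I →₀ k) (h : InRadical D q y) : UqRel (wordEval (fun i => gen D (.E i)) y) 0
  | serre_F (y : List I →₀ k) (h : InRadical D q y) : UqRel (wordEval (fun i => gen D (.F i)) y) 0

/-- The quantum enveloping algebra `U_q(g)` over `k`. -/
def Uq : Type _ := RingQuot (UqRel D q)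

instance : Ring (Uq D q) := inferInstanceAs (Ring (RingQuot (UqRel D q)))
instance : Algebra k (Uq D q) := inferInstanceAs (Algebra k (RingQuot (UqRel D q)))

/-- The image of a generator in `U_q(g)`. -/
def Uq.gen (g : UqGen D) : Uq D q := RingQuot.mkAlgHom k (UqRel D q) (QAn.gen D g)

/-- The generator `E i`. -/
def Uq.E (i : I) : Uq D q := Uq.gen D q (.E i)
/-- The generator `F i`. -/
def Uq.F (i : I) : Uq D q := Uq.gen D q (.F i)
/-- The generator `K_λ`. -/
def Uq.K (l : Module.Dual ℤ Φ) : Uq D q := Uq.gen D q (.K l)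
/-- `t i = K (d i • coroot i)`. -/
def Uq.t (i : I) : Uq D q := Uq.K D q ((D.d i : ℤ) • D.coroot i)
/-- `(t i)⁻¹`. -/
def Uq.tInv (i : I) : Uq D q := Uq.K D q (-((D.d i : ℤ) • D.coroot i))

/-- `Δ`, `ε`, `S` are the usual Hopf algebra structure maps of `U_q(g)`. -/
structure IsUsualHopf (Δ : Uq D q →ₐ[k] Uq D q ⊗[k] Uq D q) (ε : Uq D q →ₐ[k] k)
    (S : Uq D q →ₗ[k] Uq D q) : Prop where
  comul_E : ∀ i, Δ (Uq.E D q i) = Uq.E D q i ⊗ₜ 1 + Uq.t D q i ⊗ₜ Uq.E D q i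
  comul_F : ∀ i, Δ (Uq.F D q i) = Uq.F D q i ⊗ₜ Uq.tInv D q i + 1 ⊗ₜ Uq.F D q i
  comul_K : ∀ l, Δ (Uq.K D q l) = Uq.K D q l ⊗ₜ Uq.K D q l
  counit_E : ∀ i, ε (Uq.E D q i) = 0
  counit_F : ∀ i, ε (Uq.F D q i) = 0
  counit_K : ∀ l, ε (Uq.K D q l) = 1
  antipode_E : ∀ i, S (Uq.E D q i) = -(Uq.tInv D q i * Uq.E D q i)
  antipode_F : ∀ i, S (Uq.F D q i) = -(Uq.F D q i * Uq.t D q i)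
  antipode_K : ∀ l, S (Uq.K D q l) = Uq.K D q (-l)
  antipode_mul : ∀ x y, S (x * y) = S y * S x
  antipode_one : S 1 = 1
  coassoc : ∀ x, TensorProduct.assoc k _ _ _ (TensorProduct.map Δ.toLinearMap .id (Δ x)) =
    TensorProduct.map .id Δ.toLinearMap (Δ x)
  counit_comul : ∀ x, TensorProduct.lid k _ (TensorProduct.map ε.toLinearMap .id (Δ x)) = x
  comul_counit : ∀ x, TensorProduct.rid k _ (TensorProduct.map .id ε.toLinearMap (Δ x)) = x
  antipode_left : ∀ x, LinearMap.mul' k _ (TensorProduct.map S .id (Δ x)) = algebraMap k _ (ε x)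
  antipode_right : ∀ x, LinearMap.mul' k _ (TensorProduct.map .id S (Δ x)) = algebraMap k _ (ε x)

end

section

variable {k : Type*} [NormedField k] [IsUltrametricDist k] [CompleteSpace k]
  {I Φ : Type*} [AddCommGroup Φ] {D : RootDatum I Φ} {q : QNumber k} {r s : ℝ≥0}

/-- `ι` exhibits `U_q(g)`, with the structure maps `Δ`, `ε`, `S`, as a dense sub-Hopf algebra of
the analytic quantum group. -/
structure IsDenseSubHopf (Q : AnalyticQuantumGroup D q r s)
    (Δ : Uq D q →ₐ[k] Uq D q ⊗[k] Uq D q) (ε : Uq D q →ₐ[k] k) (S : Uq D q →ₗ[k] Uq D q)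
    (ι : Uq D q →ₗ[k] UqSpace D q r s) : Prop where
  injective : Function.Injective ι
  dense : DenseRange ι
  map_K : ∀ l, ι (Uq.K D q l) = Q.K (-l)
  map_E : ∀ i, ι (Uq.E D q i) = Q.U.mul (tm k (Q.E i) (Q.K (-((D.d i : ℤ) • D.coroot i))))
  map_F : ∀ i, ι (Uq.F D q i) = -Q.U.mul (tm k (Q.K ((D.d i : ℤ) • D.coroot i)) (Q.F i))
  map_one : ι 1 = Q.U.one
  map_mul : ∀ x y, ι (x * y) = Q.U.mul (tm k (ι x) (ι y))
  map_comul : ∀ x, Q.U.comul (ι x) = CT.ofAlg (TensorProduct.map ι ι (Δ x))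
  map_counit : ∀ x, Q.U.counit (ι x) = ε x
  map_antipode : ∀ x, Q.U.antipode (ι x) = ι (S x)

end

end QAn

end

open scoped TensorProduct NNReal

noncomputable section

namespace QAn

/-! ### Bounded maps and dense subspaces -/

section General

variable {k : Type*} [NormedField k]

/-! The algebra takes place on dense subspaces of finite linear combinations, and analysis enters
only through norm estimates and density.

On the free algebra, left multiplication by a generator is adjoint, up to the factor 1/(q_i -
q_i⁻¹), to a skew derivation for Lusztig's form. It follows that product and braided coproduct are
adjoint (`form_mul_left`, `form_mul_right`), that the form is symmetric (`form_symm`) and that the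
antipode is self-adjoint (`form_S`). Hence the radical is stable under all structure maps and is a
Hopf ideal (`comul_mem_radical`, `S_mem_radical`). Since the form pairs a word only with its
rearrangements (`perm_of_form_ne_zero`), the radical can be cut off along permutation-stable sets of
words and treated one weight at a time (`radical_weight`).

The condition |q_i - q_i⁻¹| r s ≥ 1 makes the form bounded on T_s ⊗ T_r (`norm_lform_le`). Its
orthogonal in T_r is the largest Nichols ideal (`nicholsIdeal_eq`), and cutting off shows that this
orthogonal is the closure of the algebraic radical (`nicholsIdeal_eq_closure`). So f_r is a
completion of words modulo the radical: a bounded map on T_r descends to f_r as soon as it kills the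
radical, which provides all structure maps and the pairing.

For U_q(g), put e_i = E_i t_i⁻¹, f_i = -t_i F_i and κ_λ = K_{-λ}. These satisfy relations of the
same type (`Uq.isTriple`), because rescaling by quasi-commuting elements preserves the relations in
the radical (`weval_radical_of_twist`). The algebra acts on the vector space `TriMod`, the algebraic
version of f ⊗ k[Φ*] ⊗ f, by explicit operators (`TriMod.isTriple`). Acting on the vacuum vector
inverts c ⊗ K_λ ⊗ b ↦ f_c κ_λ e_b, which gives the triangular decomposition (`Uq.tri_coord`,
`Uq.coord_tri`). Computing e_b on f_c times the vacuum gives precisely the cross relation of the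
double bosonisation (`weval_opE_pt`).

Existence: `TriMod` maps to C ⊗̂ H ⊗̂ B injectively, since the form and the coefficients of H
separate its points, and with dense image. The multiplication, comultiplication, counit and antipode
written down on C ⊗̂ H ⊗̂ B are composites of bounded maps which restrict to those of U_q(g)
(`DBEmbedding.mul_emb`, `DBEmbedding.comul_emb`, `DBEmbedding.antipode_emb`). The Hopf axioms
therefore follow by continuity from those of U_q(g), and density and injectivity of the embedding
come with the construction.

Uniqueness: counits and antipodes are determined by the remaining structure, the pairing by its
values on generators (`IsDualityPairing.eq`), the product by the triangular shape together with the
cross relation (`IsHopf.mul_eq_of_triangular`), and the coproduct by multiplicativity. -/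

@[simp] theorem BMap.coe_toLinearMap {X Y : Type*} [SeminormedAddCommGroup X] [NormedSpace k X]
    [SeminormedAddCommGroup Y] [NormedSpace k Y] (f : BMap k X Y) (x : X) :
    f.toLinearMap x = f x := rfl

theorem BMap.ext_dense {X Y : Type*} {X₀ : Type*} [SeminormedAddCommGroup X] [NormedSpace k X]
    [NormedAddCommGroup Y] [NormedSpace k Y] {j : X₀ → X} (hj : DenseRange j)
    {f g : BMap k X Y} (h : ∀ a, f (j a) = g (j a)) : f = g :=
  DFunLike.coe_injective (hj.equalizer f.continuous g.continuous (funext h))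

section
variable {X Y Z W X' Y' : Type*}
  [NormedAddCommGroup X] [NormedSpace k X] [NormedAddCommGroup Y] [NormedSpace k Y]
  [NormedAddCommGroup Z] [NormedSpace k Z] [NormedAddCommGroup W] [NormedSpace k W]
  [NormedAddCommGroup X'] [NormedSpace k X'] [NormedAddCommGroup Y'] [NormedSpace k Y']

theorem CT.denseRange_ofAlg : DenseRange (CT.ofAlg : X ⊗[k] Y →ₗ[k] CT k X Y) :=
  UniformSpace.Completion.denseRange_coe (α := NAT k X Y)

variable {X₀ Y₀ Z₀ : Type*} [AddCommGroup X₀] [Module k X₀] [AddCommGroup Y₀] [Module k Y₀]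
  [AddCommGroup Z₀] [Module k Z₀]

/-- The map from the algebraic tensor product of two vector spaces over `X` and `Y` to the
completed tensor product. -/
def CT.alg (j : X₀ →ₗ[k] X) (j' : Y₀ →ₗ[k] Y) : X₀ ⊗[k] Y₀ →ₗ[k] CT k X Y :=
  CT.ofAlg ∘ₗ TensorProduct.map j j'

@[simp] theorem CT.alg_tmul (j : X₀ →ₗ[k] X) (j' : Y₀ →ₗ[k] Y) (a : X₀) (b : Y₀) :
    CT.alg j j' (a ⊗ₜ b) = tm k (j a) (j' b) := rfl

/-- The closure of the range is a closed subspace, so it can be enlarged by passing to the limit in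
one tensor factor at a time; it then contains all pure tensors, hence everything. -/
theorem CT.denseRange_alg {j : X₀ →ₗ[k] X} {j' : Y₀ →ₗ[k] Y} (hj : DenseRange j)
    (hj' : DenseRange j') : DenseRange (CT.alg j j') := by
  let S : Submodule k (CT k X Y) := (LinearMap.range (CT.alg j j')).topologicalClosure
  have hS : IsClosed (S : Set (CT k X Y)) := Submodule.isClosed_topologicalClosure _
  have h0 : ∀ a b, tm k (j a) (j' b) ∈ S := fun a b =>
    Submodule.le_topologicalClosure _ ⟨a ⊗ₜ b, rfl⟩
  have h1 : ∀ x b, tm k x (j' b) ∈ S := fun x b =>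
    hj.induction_on (p := fun x => tm k x (j' b) ∈ S) x
      (hS.preimage (CT.inl (k := k) (X := X) (j' b)).continuous) fun a => h0 a b
  have h2 : ∀ x y, tm k x y ∈ S := fun x y =>
    hj'.induction_on (p := fun y => tm k x y ∈ S) y
      (hS.preimage (CT.inr (k := k) (Y := Y) x).continuous) fun b => h1 x b
  have h3 : ∀ z : X ⊗[k] Y, CT.ofAlg z ∈ S := fun z => by
    induction z using TensorProduct.induction_on with
    | zero => simp
    | tmul x y => exact h2 x y
    | add a b ha hb => rw [map_add]; exact S.add_mem ha hb
  intro z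
  exact CT.denseRange_ofAlg.induction_on (p := fun z => z ∈ S) z hS h3

theorem CT.hom_ext_dense {j : X₀ →ₗ[k] X} {j' : Y₀ →ₗ[k] Y} (hj : DenseRange j)
    (hj' : DenseRange j') {f g : BMap k (CT k X Y) Z}
    (h : ∀ a b, f (tm k (j a) (j' b)) = g (tm k (j a) (j' b))) : f = g := by
  refine BMap.ext_dense (CT.denseRange_alg hj hj') fun z => ?_
  induction z using TensorProduct.induction_on with
  | zero => simp
  | tmul a b => exact h a b
  | add a b ha hb => simp only [map_add, ha, hb]

theorem tm_zero_left (y : Y) : tm k (0 : X) y = 0 := by simp [tm]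
theorem tm_zero_right (x : X) : tm k x (0 : Y) = 0 := by simp [tm]

/-- A bounded map out of a threefold tensor product, compared with a linear map on a dense
subspace. -/
theorem CT.comp_alg {j : X₀ →ₗ[k] X} {j' : Y₀ →ₗ[k] Y} (f : BMap k (CT k X Y) Z)
    (g : X₀ ⊗[k] Y₀ →ₗ[k] Z) (h : ∀ a b, f (tm k (j a) (j' b)) = g (a ⊗ₜ b)) (z : X₀ ⊗[k] Y₀) :
    f (CT.alg j j' z) = g z := by
  induction z using TensorProduct.induction_on with
  | zero => simp
  | tmul a b => exact h a b
  | add a b ha hb => simp only [map_add, ha, hb]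

/-- Two maps which agree on a dense set in the second and a dense subset of pure tensors. -/
theorem CT.map_alg {j : X₀ →ₗ[k] X} {j' : Y₀ →ₗ[k] Y} {X₁ Y₁ : Type*} [AddCommGroup X₁]
    [Module k X₁] [AddCommGroup Y₁] [Module k Y₁] {i : X₁ →ₗ[k] X'} {i' : Y₁ →ₗ[k] Y'}
    {f : BMap k X X'} {g : BMap k Y Y'} {f₀ : X₀ →ₗ[k] X₁} {g₀ : Y₀ →ₗ[k] Y₁}
    (hf : ∀ a, f (j a) = i (f₀ a)) (hg : ∀ a, g (j' a) = i' (g₀ a)) (z : X₀ ⊗[k] Y₀) :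
    CT.map f g (CT.alg j j' z) = CT.alg i i' (TensorProduct.map f₀ g₀ z) := by
  refine CT.comp_alg (CT.map f g) (CT.alg i i' ∘ₗ TensorProduct.map f₀ g₀) (fun a b => ?_) z
  simp [hf, hg]

theorem CT.assoc_alg {j : X₀ →ₗ[k] X} {j' : Y₀ →ₗ[k] Y} {j'' : Z₀ →ₗ[k] Z}
    (z : (X₀ ⊗[k] Y₀) ⊗[k] Z₀) :
    CT.assoc k X Y Z (CT.alg (CT.alg j j') j'' z) =
      CT.alg j (CT.alg j' j'') (TensorProduct.assoc k X₀ Y₀ Z₀ z) := by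
  induction z using TensorProduct.induction_on with
  | zero => simp
  | add a b ha hb => simp only [map_add, ha, hb]
  | tmul w c =>
    induction w using TensorProduct.induction_on with
    | zero => simp
    | add a b ha hb =>
      rw [TensorProduct.add_tmul, map_add, map_add, ha, hb, map_add, map_add]
    | tmul a b => simp

end

/-! ### Contracting coproducts of lines: finite sums and coefficient functionals. -/

section
variable [IsUltrametricDist k] {ι : Type*} {w : ι → ℝ≥0}

variable (k w) in
/-- The finite linear combinations of the basis vectors. -/
def Cop.ofFinsupp : (ι →₀ k) →ₗ[k] Cop k w where
  toFun a := UniformSpace.Completion.coe' (α := Lines k w) a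
  map_add' a b := UniformSpace.Completion.coe_add (α := Lines k w) a b
  map_smul' c a := UniformSpace.Completion.coe_smul (X := Lines k w) c a

@[simp] theorem Cop.ofFinsupp_single_one (i : ι) :
    Cop.ofFinsupp k w (Finsupp.single i 1) = Cop.e k w i := rfl

theorem Cop.denseRange_ofFinsupp : DenseRange (Cop.ofFinsupp k w) :=
  UniformSpace.Completion.denseRange_coe (α := Lines k w)

variable [CompleteSpace k]

open scoped Classical in
/-- The coefficient of `e i`, where `e i` has positive norm. -/
def Cop.coeff (hw : ∀ i, 0 < w i) (i : ι) : BMap k (Cop k w) k :=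
  Cop.lift (fun j => if j = i then 1 else 0) ⟨(w i)⁻¹, by positivity, fun j => by
    split_ifs with h
    · subst h
      rw [norm_one, inv_mul_cancel₀]
      exact_mod_cast (hw j).ne'
    · rw [norm_zero]; positivity⟩

theorem Cop.coeff_ofFinsupp (hw : ∀ i, 0 < w i) (i : ι) (a : ι →₀ k) :
    Cop.coeff hw i (Cop.ofFinsupp k w a) = a i := by
  classical
  have : (Cop.coeff hw i).toLinearMap ∘ₗ Cop.ofFinsupp k w = Finsupp.lapply i :=
    Finsupp.lhom_ext' fun j => LinearMap.ext_ring (by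
      simp [Cop.coeff, Finsupp.single_apply])
  exact LinearMap.congr_fun this a

theorem Cop.coeff_e (hw : ∀ i, 0 < w i) [DecidableEq ι] (i j : ι) :
    Cop.coeff hw i (Cop.e k w j) = if j = i then 1 else 0 := by
  rw [← Cop.ofFinsupp_single_one, Cop.coeff_ofFinsupp, Finsupp.single_apply]

theorem Cop.norm_ofFinsupp_le {a : ι →₀ k} {c : ℝ} (hc : 0 ≤ c) (h : ∀ i, ‖a i‖ * w i ≤ c) :
    ‖Cop.ofFinsupp k w a‖ ≤ c := by
  have h1 : ‖Cop.ofFinsupp k w a‖ = (Lines.nn (w := w) a : ℝ) :=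
    UniformSpace.Completion.norm_coe (E := Lines k w) a
  rw [h1]
  lift c to ℝ≥0 using hc
  rw [NNReal.coe_le_coe]
  exact Lines.nn_le fun i => by
    rw [← NNReal.coe_le_coe]; exact h i

theorem Cop.coeff_bound (hw : ∀ i, 0 < w i) (i : ι) (x : Cop k w) :
    ‖Cop.coeff hw i x‖ * w i ≤ ‖x‖ := by
  have h0 : (0 : ℝ) < w i := hw i
  have : ‖Cop.coeff hw i x‖ ≤ (w i : ℝ)⁻¹ * ‖x‖ := by
    refine Cop.lift_bound _ _ (by positivity) (fun j => ?_) x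
    split_ifs with h
    · subst h
      rw [norm_one, inv_mul_cancel₀ h0.ne']
    · rw [norm_zero]; positivity
  rwa [inv_mul_eq_div, le_div_iff₀ h0] at this

/-- A finite combination close to x has small coefficients, because taking weighted coefficients is
contractive and those of x vanish. Its norm is the maximum of these, so it is small itself, and so
is x. -/
theorem Cop.eq_zero_of_coeff (hw : ∀ i, 0 < w i) (x : Cop k w)
    (hx : ∀ i, Cop.coeff hw i x = 0) : x = 0 := by
  rw [← norm_le_zero_iff]
  refine le_of_forall_pos_le_add fun e he => ?_
  obtain ⟨a, ha⟩ := Cop.denseRange_ofFinsupp.exists_dist_lt x (half_pos he)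
  rw [dist_eq_norm] at ha
  have h1 : ‖Cop.ofFinsupp k w a‖ ≤ e / 2 := by
    refine Cop.norm_ofFinsupp_le (half_pos he).le fun i => ?_
    have h2 := Cop.coeff_bound hw i (x - Cop.ofFinsupp k w a)
    rw [map_sub, hx, Cop.coeff_ofFinsupp, zero_sub, norm_neg] at h2
    exact h2.trans ha.le
  have h3 : ‖x‖ ≤ ‖x - Cop.ofFinsupp k w a‖ + ‖Cop.ofFinsupp k w a‖ := by
    simpa using norm_add_le (x - Cop.ofFinsupp k w a) (Cop.ofFinsupp k w a)
  linarith

end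

/-! ### Separating families of functionals -/

/-- Contract the second factor with ψ_b: the resulting vector of V is killed by every φ_a, so it is
zero. In a basis of V this says that every coefficient of z, an element of V', is killed by every
ψ_b. The lemma serves both for coproducts of the radical and for injectivity into completed tensor
products. -/
theorem eq_zero_of_separating {k V V' A B : Type*} [Field k] [AddCommGroup V]
    [Module k V] [AddCommGroup V'] [Module k V'] {φ : A → V →ₗ[k] k} {ψ : B → V' →ₗ[k] k}
    (hφ : ∀ v, (∀ a, φ a v = 0) → v = 0) (hψ : ∀ v, (∀ b, ψ b v = 0) → v = 0)
    (z : V ⊗[k] V')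
    (hz : ∀ a b, TensorProduct.lid k k (TensorProduct.map (φ a) (ψ b) z) = 0) : z = 0 := by
  classical
  let bs := Module.Free.chooseBasis k V
  let E := TensorProduct.equivFinsuppOfBasisLeft (N := V') bs
  have key : ∀ b, ∀ z : V ⊗[k] V', ∀ i, bs.repr (TensorProduct.rid k V
      (TensorProduct.map LinearMap.id (ψ b) z)) i = ψ b (E z i) := by
    intro b z i
    induction z using TensorProduct.induction_on with
    | zero => simp
    | tmul x y => simp [E, mul_comm]
    | add x y hx hy => simp only [map_add, Finsupp.add_apply, hx, hy]
  have h1 : ∀ a b (z : V ⊗[k] V'), φ a (TensorProduct.rid k V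
      (TensorProduct.map LinearMap.id (ψ b) z)) =
      TensorProduct.lid k k (TensorProduct.map (φ a) (ψ b) z) := by
    intro a b z
    induction z using TensorProduct.induction_on with
    | zero => simp
    | tmul x y => simp [mul_comm]
    | add x y hx hy => simp only [map_add, hx, hy]
  apply E.injective
  rw [map_zero]
  ext i
  refine hψ _ fun b => ?_
  have h2 : TensorProduct.rid k V (TensorProduct.map LinearMap.id (ψ b) z) = 0 :=
    hφ _ fun a => by rw [h1, hz]
  rw [← key b z i, h2]
  simp

end General

/-! ### Hopf algebra structures given on a dense subspace -/

section HopfDense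

variable {k : Type*} [NormedField k] [IsUltrametricDist k] [CompleteSpace k]
variable {X : Type*} [NormedAddCommGroup X] [NormedSpace k X] [CompleteSpace X]
  [IsUltrametricDist X]

/-- Each axiom is an equality of bounded maps, so it suffices to have it on a dense subspace on
which the structure maps come from algebraic ones. The map `bm` is the product of the braided tensor
square, so the braiding enters only through `h_bm`. -/
theorem IsHopf.of_dense {X₀ : Type*} [AddCommGroup X₀] [Module k X₀]
    {c : BMap k (CT k X X) (CT k X X)} {S : HopfStr k X} (j : X₀ →ₗ[k] X) (hj : DenseRange j)
    (one₀ : X₀) (mul₀ : X₀ →ₗ[k] X₀ →ₗ[k] X₀) (ε₀ : X₀ →ₗ[k] k) (Δ₀ : X₀ →ₗ[k] X₀ ⊗[k] X₀)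
    (S₀ : X₀ →ₗ[k] X₀) (bm : X₀ ⊗[k] X₀ →ₗ[k] X₀ ⊗[k] X₀ →ₗ[k] X₀ ⊗[k] X₀)
    (h_one : j one₀ = S.one) (h_mul : ∀ a b, S.mul (tm k (j a) (j b)) = j (mul₀ a b))
    (h_counit : ∀ a, S.counit (j a) = ε₀ a) (h_comul : ∀ a, S.comul (j a) = CT.alg j j (Δ₀ a))
    (h_antipode : ∀ a, S.antipode (j a) = j (S₀ a))
    (h_bm : ∀ a b c' d, CT.map S.mul S.mul (CT.midWith c
      (tm k (tm k (j a) (j b)) (tm k (j c') (j d)))) = CT.alg j j (bm (a ⊗ₜ b) (c' ⊗ₜ d)))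
    (mul_assoc₀ : ∀ a b d, mul₀ (mul₀ a b) d = mul₀ a (mul₀ b d))
    (one_mul₀ : ∀ a, mul₀ one₀ a = a) (mul_one₀ : ∀ a, mul₀ a one₀ = a)
    (coassoc₀ : ∀ a, TensorProduct.assoc k _ _ _ (TensorProduct.map Δ₀ .id (Δ₀ a)) =
      TensorProduct.map .id Δ₀ (Δ₀ a))
    (counit_comul₀ : ∀ a, TensorProduct.lid k _ (TensorProduct.map ε₀ .id (Δ₀ a)) = a)
    (comul_counit₀ : ∀ a, TensorProduct.rid k _ (TensorProduct.map .id ε₀ (Δ₀ a)) = a)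
    (comul_mul₀ : ∀ a b, Δ₀ (mul₀ a b) = bm (Δ₀ a) (Δ₀ b))
    (comul_one₀ : Δ₀ one₀ = one₀ ⊗ₜ one₀)
    (counit_mul₀ : ∀ a b, ε₀ (mul₀ a b) = ε₀ a * ε₀ b) (counit_one₀ : ε₀ one₀ = 1)
    (antipode_left₀ : ∀ a, TensorProduct.lift mul₀ (TensorProduct.map S₀ .id (Δ₀ a)) =
      ε₀ a • one₀)
    (antipode_right₀ : ∀ a, TensorProduct.lift mul₀ (TensorProduct.map .id S₀ (Δ₀ a)) =
      ε₀ a • one₀) : IsHopf c S where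
  mul_assoc := by
    refine CT.hom_ext_dense (j := CT.alg j j) (CT.denseRange_alg hj hj) hj fun z d => ?_
    induction z using TensorProduct.induction_on with
    | zero => simp [tm_zero_left]
    | add a b ha hb => rw [map_add, tm_add_left, map_add, map_add, ha, hb]
    | tmul a b => simp [h_mul, mul_assoc₀]
  one_mul x := hj.induction_on (p := fun x => S.mul (tm k S.one x) = x) x
    (isClosed_eq (S.mul.comp (CT.inr S.one)).continuous continuous_id) fun a => by
      rw [← h_one, h_mul, one_mul₀]
  mul_one x := hj.induction_on (p := fun x => S.mul (tm k x S.one) = x) x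
    (isClosed_eq (S.mul.comp (CT.inl S.one)).continuous continuous_id) fun a => by
      rw [← h_one, h_mul, mul_one₀]
  coassoc := by
    refine BMap.ext_dense hj fun a => ?_
    simp only [BMap.comp_apply, h_comul]
    rw [CT.map_alg (i := CT.alg j j) (i' := j) (f₀ := Δ₀) (g₀ := .id) h_comul (fun _ => rfl),
      CT.map_alg (i := j) (i' := CT.alg j j) (f₀ := .id) (g₀ := Δ₀) (fun _ => rfl) h_comul,
      CT.assoc_alg, coassoc₀]
  counit_comul x := hj.induction_on
    (p := fun x => CT.lid k X (CT.map S.counit (BMap.id k X) (S.comul x)) = x) x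
    (isClosed_eq ((CT.lid k X).comp ((CT.map S.counit (BMap.id k X)).comp S.comul)).continuous
      continuous_id) fun a => by
      rw [h_comul]
      have := CT.comp_alg (j := j) (j' := j) ((CT.lid k X).comp (CT.map S.counit (BMap.id k X)))
        (j ∘ₗ (TensorProduct.lid k X₀).toLinearMap ∘ₗ TensorProduct.map ε₀ .id)
        (fun a b => by simp [h_counit]) (Δ₀ a)
      simp only [BMap.comp_apply, LinearMap.comp_apply, LinearEquiv.coe_coe] at this
      rw [this, counit_comul₀]
  comul_counit x := hj.induction_on
    (p := fun x => CT.rid k X (CT.map (BMap.id k X) S.counit (S.comul x)) = x) x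
    (isClosed_eq ((CT.rid k X).comp ((CT.map (BMap.id k X) S.counit).comp S.comul)).continuous
      continuous_id) fun a => by
      rw [h_comul]
      have := CT.comp_alg (j := j) (j' := j) ((CT.rid k X).comp (CT.map (BMap.id k X) S.counit))
        (j ∘ₗ (TensorProduct.rid k X₀).toLinearMap ∘ₗ TensorProduct.map .id ε₀)
        (fun a b => by simp [h_counit]) (Δ₀ a)
      simp only [BMap.comp_apply, LinearMap.comp_apply, LinearEquiv.coe_coe] at this
      rw [this, comul_counit₀]
  comul_mul := by
    refine CT.hom_ext_dense hj hj fun a b => ?_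
    simp only [BMap.comp_apply, CT.map_tm, h_mul, h_comul, comul_mul₀]
    generalize Δ₀ a = y
    generalize Δ₀ b = z
    induction y using TensorProduct.induction_on with
    | zero => simp [tm_zero_left]
    | add y y' hy hy' => simp only [map_add, LinearMap.add_apply, tm_add_left, hy, hy']
    | tmul a b =>
      induction z using TensorProduct.induction_on with
      | zero => simp [tm_zero_right]
      | add y y' hy hy' => simp only [map_add, tm_add_right, hy, hy']
      | tmul c d => rw [CT.alg_tmul, CT.alg_tmul, h_bm]
  comul_one := by rw [← h_one, h_comul, comul_one₀, CT.alg_tmul]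
  counit_mul := by
    refine CT.hom_ext_dense hj hj fun a b => ?_
    simp [h_mul, h_counit, counit_mul₀]
  counit_one := by rw [← h_one, h_counit, counit_one₀]
  antipode_left x := by
    let g : BMap k X X := (CT.rid k X).comp ((CT.inr S.one).comp S.counit)
    have hg : ∀ x, g x = S.counit x • S.one := fun x => by simp [g]
    rw [← hg]
    refine hj.induction_on (p := fun x => S.mul (CT.map S.antipode (BMap.id k X) (S.comul x)) =
      g x) x (isClosed_eq (S.mul.comp ((CT.map S.antipode (BMap.id k X)).comp S.comul)).continuous
        g.continuous) fun a => ?_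
    have := CT.comp_alg (j := j) (j' := j) (S.mul.comp (CT.map S.antipode (BMap.id k X)))
        (j ∘ₗ TensorProduct.lift mul₀ ∘ₗ TensorProduct.map S₀ .id)
        (fun a b => by simp [h_antipode, h_mul]) (Δ₀ a)
    simp only [BMap.comp_apply, LinearMap.comp_apply] at this
    rw [h_comul, this, antipode_left₀, hg, map_smul, h_counit, h_one]
  antipode_right x := by
    let g : BMap k X X := (CT.rid k X).comp ((CT.inr S.one).comp S.counit)
    have hg : ∀ x, g x = S.counit x • S.one := fun x => by simp [g]
    rw [← hg]
    refine hj.induction_on (p := fun x => S.mul (CT.map (BMap.id k X) S.antipode (S.comul x)) =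
      g x) x (isClosed_eq (S.mul.comp ((CT.map (BMap.id k X) S.antipode).comp S.comul)).continuous
        g.continuous) fun a => ?_
    have := CT.comp_alg (j := j) (j' := j) (S.mul.comp (CT.map (BMap.id k X) S.antipode))
        (j ∘ₗ TensorProduct.lift mul₀ ∘ₗ TensorProduct.map .id S₀)
        (fun a b => by simp [h_antipode, h_mul]) (Δ₀ a)
    simp only [BMap.comp_apply, LinearMap.comp_apply] at this
    rw [h_comul, this, antipode_right₀, hg, map_smul, h_counit, h_one]

theorem CT.map_comp_apply {X Y X' Y' X'' Y'' : Type*}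
    [NormedAddCommGroup X] [NormedSpace k X] [NormedAddCommGroup Y] [NormedSpace k Y]
    [NormedAddCommGroup X'] [NormedSpace k X'] [NormedAddCommGroup Y'] [NormedSpace k Y']
    [NormedAddCommGroup X''] [NormedSpace k X''] [NormedAddCommGroup Y''] [NormedSpace k Y'']
    (f : BMap k X X') (g : BMap k Y Y') (f' : BMap k X' X'') (g' : BMap k Y' Y'')
    (z : CT k X Y) : CT.map f' g' (CT.map f g z) = CT.map (f'.comp f) (g'.comp g) z :=
  CT.induction_eq (f := (CT.map f' g').comp (CT.map f g)) (fun x y => by simp) z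

theorem CT.hom_ext₃ {X Y Z W : Type*}
    [NormedAddCommGroup X] [NormedSpace k X] [NormedAddCommGroup Y] [NormedSpace k Y]
    [NormedAddCommGroup Z] [NormedSpace k Z] [NormedAddCommGroup W] [NormedSpace k W]
    {f g : BMap k (CT k (CT k X Y) Z) W}
    (h : ∀ x y z, f (tm k (tm k x y) z) = g (tm k (tm k x y) z)) : f = g := by
  refine CT.hom_ext fun w z => ?_
  exact CT.induction_eq (f := f.comp (CT.inl z)) (g := g.comp (CT.inl z)) (fun x y => h x y z) w

theorem CT.assoc_map {X Y Z X' Y' Z' : Type*}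
    [NormedAddCommGroup X] [NormedSpace k X] [NormedAddCommGroup Y] [NormedSpace k Y]
    [NormedAddCommGroup X'] [NormedSpace k X'] [NormedAddCommGroup Y'] [NormedSpace k Y']
    [NormedAddCommGroup Z] [NormedSpace k Z] [NormedAddCommGroup Z'] [NormedSpace k Z']
    (f : BMap k X X') (g : BMap k Y Y') (h : BMap k Z Z') (w : CT k (CT k X Y) Z) :
    CT.assoc k X' Y' Z' (CT.map (CT.map f g) h w) =
      CT.map f (CT.map g h) (CT.assoc k X Y Z w) :=
  DFunLike.congr_fun (CT.hom_ext₃ (f := (CT.assoc k X' Y' Z').comp (CT.map (CT.map f g) h))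
    (g := (CT.map f (CT.map g h)).comp (CT.assoc k X Y Z)) fun x y z => by simp) w

/-- The counit is determined by the comultiplication. -/
theorem IsHopf.counit_eq {c c' : BMap k (CT k X X) (CT k X X)} {S S' : HopfStr k X}
    (h : IsHopf c S) (h' : IsHopf c' S') (hΔ : S'.comul = S.comul) : S'.counit = S.counit := by
  ext x
  -- Both sides are (ε ⊗ ε')(z); for z = Δ(x) each side collapses by one of the two counit axioms.
  have h1 : ∀ z, S.counit (CT.rid k X (CT.map (BMap.id k X) S'.counit z)) =
      S'.counit (CT.lid k X (CT.map S.counit (BMap.id k X) z)) := fun z =>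
    CT.induction_eq (f := S.counit.comp ((CT.rid k X).comp (CT.map (BMap.id k X) S'.counit)))
      (g := S'.counit.comp ((CT.lid k X).comp (CT.map S.counit (BMap.id k X))))
      (fun x y => by simp [mul_comm]) z
  have h2 := h1 (S.comul x)
  rw [h.counit_comul, ← hΔ, h'.comul_counit] at h2
  exact h2.symm

/-- The antipode is determined by the bialgebra structure. -/
theorem IsHopf.antipode_eq {c c' : BMap k (CT k X X) (CT k X X)} {S S' : HopfStr k X}
    (h : IsHopf c S) (h' : IsHopf c' S') (h1 : S'.one = S.one) (hm : S'.mul = S.mul)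
    (hΔ : S'.comul = S.comul) : S'.antipode = S.antipode := by
  have hε := h.counit_eq h' hΔ
  ext x
  let I := BMap.id k X
  have idl : ∀ f : BMap k X X, I.comp f = f := fun f => rfl
  let e : BMap k X X := (CT.rid k X).comp ((CT.inr S.one).comp S.counit)
  have he : ∀ x, e x = S.counit x • S.one := fun x => by simp [e]
  have hl : S.mul.comp ((CT.map S.antipode I).comp S.comul) = e :=
    BMap.ext fun x => by rw [he, ← h.antipode_left x]; rfl
  have hr : S.mul.comp ((CT.map I S'.antipode).comp S.comul) = e :=
    BMap.ext fun x => by rw [he, ← hε, ← h1, ← h'.antipode_right x, hm, hΔ]; rfl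
  have a1 : S.mul (CT.map S.antipode e (S.comul x)) = S.antipode x := by
    have : ∀ z, S.mul (CT.map S.antipode e z) =
        S.antipode (CT.rid k X (CT.map I S.counit z)) := fun z =>
      CT.induction_eq (f := S.mul.comp (CT.map S.antipode e))
        (g := S.antipode.comp ((CT.rid k X).comp (CT.map I S.counit)))
        (fun x y => by simp [he, tm_smul_right, h.mul_one, I]) z
    rw [this, h.comul_counit]
  have a2 : S.mul (CT.map e S'.antipode (S.comul x)) = S'.antipode x := by
    have : ∀ z, S.mul (CT.map e S'.antipode z) =
        S'.antipode (CT.lid k X (CT.map S.counit I z)) := fun z =>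
      CT.induction_eq (f := S.mul.comp (CT.map e S'.antipode))
        (g := S'.antipode.comp ((CT.lid k X).comp (CT.map S.counit I)))
        (fun x y => by simp [he, tm_smul_left, h.one_mul, I]) z
    rw [this, h.counit_comul]
  -- On the iterated coproduct, the two sides are the two bracketings of the convolution product S *
  -- id * S'; they reduce to S' and to S.
  have a3 : ∀ z, S.mul (CT.map (S.mul.comp (CT.map S.antipode I)) S'.antipode z) =
      S.mul (CT.map S.antipode (S.mul.comp (CT.map I S'.antipode)) (CT.assoc k X X X z)) := by
    intro z
    have h2 : CT.map (S.mul.comp (CT.map S.antipode I)) S'.antipode z =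
        CT.map S.mul I (CT.map (CT.map S.antipode I) S'.antipode z) := by
      rw [CT.map_comp_apply, idl]
    have h3 : ∀ w, CT.assoc k X X X (CT.map (CT.map S.antipode I) S'.antipode w) =
        CT.map S.antipode (CT.map I S'.antipode) (CT.assoc k X X X w) := CT.assoc_map _ _ _
    have h4 : ∀ w, S.mul (CT.map S.mul I w) = S.mul (CT.map I S.mul (CT.assoc k X X X w)) :=
      fun w => DFunLike.congr_fun h.mul_assoc w
    rw [h2, h4, h3, CT.map_comp_apply, idl]
  have a4 := a3 (CT.map S.comul I (S.comul x))
  have a5 : CT.assoc k X X X (CT.map S.comul I (S.comul x)) = CT.map I S.comul (S.comul x) :=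
    DFunLike.congr_fun h.coassoc x
  rw [a5, CT.map_comp_apply, CT.map_comp_apply] at a4
  have e1 : (S.mul.comp (CT.map S.antipode I)).comp S.comul = e := hl
  have e2 : (S.mul.comp (CT.map I S'.antipode)).comp S.comul = e := hr
  rw [e1, e2] at a4
  have e3 : S'.antipode.comp I = S'.antipode := rfl
  have e4 : S.antipode.comp I = S.antipode := rfl
  rw [e3, e4, a1, a2] at a4
  exact a4

end HopfDense

/-! ### The free algebra on words -/

namespace RootDatum

variable {I Φ : Type*} [AddCommGroup Φ] (D : RootDatum I Φ)

/-- The index of `tᵢ`. -/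
def ti (i : I) : Module.Dual ℤ Φ := D.tK (Finsupp.single i 1)

theorem ti_eq (i : I) : D.ti i = (D.d i : ℤ) • D.coroot i := by simp [ti, tK]

/-- The weight of a word, in `Φ`. -/
def rt (w : List I) : Φ := D.toRoot (D.wt w)

@[simp] theorem rt_nil : D.rt [] = 0 := by simp [rt, wt]
@[simp] theorem rt_cons (i : I) (w : List I) : D.rt (i :: w) = D.α i + D.rt w := by
  simp [rt, wt, toRoot]
@[simp] theorem rt_append (u w : List I) : D.rt (u ++ w) = D.rt u + D.rt w := by
  simp [rt, wt_append]
theorem toRoot_single (i : I) : D.toRoot (Finsupp.single i 1) = D.α i := by simp [toRoot]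

theorem ip_comm (n m : I →₀ ℤ) : D.ip n m = D.ip m n := by
  have : (D.ip n m : ℚ) = D.ip m n := by rw [ip_eq, ip_eq, form_symm]
  exact_mod_cast this

theorem ti_comm (i j : I) : D.ti i (D.α j) = D.ti j (D.α i) := by
  rw [← D.toRoot_single i, ← D.toRoot_single j]; exact D.ip_comm _ _

theorem ti_rt (i : I) (w : List I) : D.ti i (D.rt w) = D.tK (D.wt w) (D.α i) := by
  rw [← D.toRoot_single i]; exact D.ip_comm _ _

theorem tK_wt_nil : D.tK (D.wt []) = 0 := by simp [wt]
theorem tK_wt_cons (i : I) (w : List I) : D.tK (D.wt (i :: w)) = D.ti i + D.tK (D.wt w) := by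
  simp [wt, ti]

theorem tK_rt_comm (u w : List I) : D.tK (D.wt u) (D.rt w) = D.tK (D.wt w) (D.rt u) :=
  D.ip_comm _ _

theorem wt_perm {u w : List I} (h : u.Perm w) : D.wt u = D.wt w := by
  induction h with
  | nil => rfl
  | cons i _ ih => simp [wt, ih]
  | swap i j w => simp only [wt]; abel
  | trans _ _ h1 h2 => exact h1.trans h2

end RootDatum

section Words

variable {k : Type*} [NormedField k] {I Φ : Type*} [AddCommGroup Φ]
  (D : RootDatum I Φ) (q : QNumber k)

theorem QNumber.val_ne_zero : q.val ≠ 0 := fun h => by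
  have := q.norm_val; rw [h, norm_zero] at this; exact zero_ne_one this

theorem QNumber.mul_zpow (a b : ℤ) : q.val ^ a * q.val ^ b = q.val ^ (a + b) :=
  (zpow_add₀ q.val_ne_zero a b).symm

/-- Equality of q_i and its inverse would make q a root of unity of order dividing 2 d_i. This
allows the factors 1/(q_i - q_i⁻¹) to be cancelled in adjunction formulas. -/
theorem qDiff_ne_zero (i : I) : qDiff k D q i ≠ 0 := fun h => by
  rw [qDiff, sub_eq_zero] at h
  have h0 : q.val ^ D.d i ≠ 0 := pow_ne_zero _ q.val_ne_zero
  have h1 : q.val ^ (D.d i + D.d i) = 1 := by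
    rw [pow_add]
    nth_rewrite 1 [h]
    exact inv_mul_cancel₀ h0
  exact q.not_root _ (by have := D.d_pos i; omega) h1

variable (k I) in
/-- The free algebra, as the space of linear combinations of words. -/
abbrev Words : Type _ := List I →₀ k

variable (k) in
/-- A word as an element of the free algebra. -/
def bw (w : List I) : Words k I := Finsupp.single w 1

theorem Words.hom_ext {Z : Type*} [AddCommMonoid Z] [Module k Z] {f g : Words k I →ₗ[k] Z}
    (h : ∀ w, f (bw k w) = g (bw k w)) : f = g :=
  Finsupp.lhom_ext' fun w => LinearMap.ext_ring (h w)

theorem Words.hom_ext₂ {Z : Type*} [AddCommMonoid Z] [Module k Z]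
    {f g : Words k I →ₗ[k] Words k I →ₗ[k] Z}
    (h : ∀ u w, f (bw k u) (bw k w) = g (bw k u) (bw k w)) : f = g :=
  Words.hom_ext fun u => Words.hom_ext (h u)

variable (k) in
/-- Left multiplication by a generator. -/
def cons (i : I) : Words k I →ₗ[k] Words k I := Finsupp.lmapDomain k k (List.cons i)

variable (k) in
/-- Right multiplication by a generator. -/
def snoc (i : I) : Words k I →ₗ[k] Words k I := Finsupp.lmapDomain k k (fun w => w ++ [i])

theorem cons_bw (i : I) (w : List I) : cons k i (bw k w) = bw k (i :: w) := by
  simp [cons, bw]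
theorem snoc_bw (i : I) (w : List I) : snoc k i (bw k w) = bw k (w ++ [i]) := by
  simp [snoc, bw]

theorem snoc_cons (i j : I) (y : Words k I) : snoc k i (cons k j y) = cons k j (snoc k i y) := by
  have : snoc k i ∘ₗ cons k j = cons k j ∘ₗ snoc k i :=
    Words.hom_ext fun w => by simp [cons_bw, snoc_bw]
  exact LinearMap.congr_fun this y

/-- Induction for identities between linear maps on words. -/
theorem Words.induction {Z : Type*} [AddCommMonoid Z] [Module k Z] {f g : Words k I →ₗ[k] Z}
    (h0 : f (bw k []) = g (bw k []))
    (h1 : ∀ j y, (∃ w, y = bw k w) → f y = g y → f (cons k j y) = g (cons k j y))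
    (y : Words k I) : f y = g y := by
  have : f = g := Words.hom_ext fun w => by
    induction w with
    | nil => exact h0
    | cons j w ih => rw [← cons_bw]; exact h1 j _ ⟨w, rfl⟩ ih
  rw [this]

/-- The operator which multiplies words by `q ^ l(weight)`. -/
def tw (l : Module.Dual ℤ Φ) : Words k I →ₗ[k] Words k I :=
  Finsupp.linearCombination k fun w => q.val ^ l (D.rt w) • bw k w

theorem tw_bw (l : Module.Dual ℤ Φ) (w : List I) :
    tw D q l (bw k w) = q.val ^ l (D.rt w) • bw k w := by simp [tw, bw]

theorem tw_nil (l : Module.Dual ℤ Φ) : tw D q l (bw k []) = bw k [] := by simp [tw_bw]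

theorem tw_cons (l : Module.Dual ℤ Φ) (i : I) (y : Words k I) :
    tw D q l (cons k i y) = q.val ^ l (D.α i) • cons k i (tw D q l y) := by
  have : tw D q l ∘ₗ cons k i = q.val ^ l (D.α i) • cons k i ∘ₗ tw D q l :=
    Words.hom_ext fun w => by
      simp [cons_bw, tw_bw, smul_smul, q.mul_zpow]
  exact LinearMap.congr_fun this y

theorem tw_snoc (l : Module.Dual ℤ Φ) (i : I) (y : Words k I) :
    tw D q l (snoc k i y) = q.val ^ l (D.α i) • snoc k i (tw D q l y) := by
  have : tw D q l ∘ₗ snoc k i = q.val ^ l (D.α i) • snoc k i ∘ₗ tw D q l :=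
    Words.hom_ext fun w => by
      simp [snoc_bw, tw_bw, smul_smul, q.mul_zpow, add_comm]
  exact LinearMap.congr_fun this y

theorem tw_tw (l m : Module.Dual ℤ Φ) (y : Words k I) :
    tw D q l (tw D q m y) = tw D q (l + m) y := by
  have : tw D q l ∘ₗ tw D q m = tw D q (l + m) :=
    Words.hom_ext fun w => by simp [tw_bw, smul_smul, q.mul_zpow, add_comm]
  exact LinearMap.congr_fun this y

theorem tw_zero (y : Words k I) : tw D q 0 y = y := by
  have : tw D q 0 = LinearMap.id := Words.hom_ext fun w => by simp [tw_bw]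
  exact LinearMap.congr_fun this y

open scoped Classical in
theorem skew_cons (i j : I) (y : Words k I) : skew D q i (cons k j y) =
    (if i = j then y else 0) + q.val ^ D.ti i (D.α j) • cons k j (skew D q i y) := by
  have : skew D q i ∘ₗ cons k j = (if i = j then LinearMap.id else 0) +
      q.val ^ D.ti i (D.α j) • cons k j ∘ₗ skew D q i :=
    Words.hom_ext fun w => by
      simp only [LinearMap.comp_apply, cons_bw, LinearMap.add_apply, LinearMap.smul_apply]
      simp only [skew, bw, Finsupp.linearCombination_single, one_smul, skewWord, RootDatum.ip,
        RootDatum.toRoot_single]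
      split_ifs <;> rfl
  refine (LinearMap.congr_fun this y).trans ?_
  split_ifs <;> rfl

theorem skew_nil (i : I) : skew D q i (bw k []) = 0 := by simp [skew, bw, skewWord]

open scoped Classical in
/-- The skew derivation from the right, on words. -/
def rskewWord (i : I) : List I → Words k I
  | [] => 0
  | j :: w => (if i = j then tw D q (D.ti i) (bw k w) else 0) + cons k j (rskewWord i w)

/-- The skew derivation from the right, `Dᵢ(x y) = q ^ (αᵢ, |y|) Dᵢ(x) y + x Dᵢ(y)`. -/
def rskew (i : I) : Words k I →ₗ[k] Words k I := Finsupp.linearCombination k (rskewWord D q i)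

theorem rskew_nil (i : I) : rskew D q i (bw k []) = 0 := by simp [rskew, bw, rskewWord]

open scoped Classical in
theorem rskew_cons (i j : I) (y : Words k I) : rskew D q i (cons k j y) =
    (if i = j then tw D q (D.ti i) y else 0) + cons k j (rskew D q i y) := by
  have : rskew D q i ∘ₗ cons k j = (if i = j then tw D q (D.ti i) else 0) +
      cons k j ∘ₗ rskew D q i :=
    Words.hom_ext fun w => by
      simp only [LinearMap.comp_apply, cons_bw, LinearMap.add_apply]
      simp only [rskew, bw, Finsupp.linearCombination_single, one_smul, rskewWord]
      split_ifs <;> rfl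
  refine (LinearMap.congr_fun this y).trans ?_
  split_ifs <;> rfl

theorem skew_tw (l : Module.Dual ℤ Φ) (i : I) (y : Words k I) :
    skew D q i (tw D q l y) = q.val ^ l (D.α i) • tw D q l (skew D q i y) := by
  refine Words.induction (f := skew D q i ∘ₗ tw D q l)
    (g := q.val ^ l (D.α i) • tw D q l ∘ₗ skew D q i) (by simp [tw_nil, skew_nil])
    (fun j y _ ih => ?_) y
  simp only [LinearMap.comp_apply, LinearMap.smul_apply] at ih ⊢
  rw [tw_cons, map_smul, skew_cons, skew_cons, map_add, map_smul, tw_cons, ih, map_smul]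
  by_cases h : i = j
  · subst h
    simp only [if_true, smul_add, smul_smul]
  · simp only [if_neg h, map_zero, zero_add, smul_smul]
    congr 1; ring

theorem rskew_tw (l : Module.Dual ℤ Φ) (i : I) (y : Words k I) :
    rskew D q i (tw D q l y) = q.val ^ l (D.α i) • tw D q l (rskew D q i y) := by
  refine Words.induction (f := rskew D q i ∘ₗ tw D q l)
    (g := q.val ^ l (D.α i) • tw D q l ∘ₗ rskew D q i) (by simp [tw_nil, rskew_nil])
    (fun j y _ ih => ?_) y
  simp only [LinearMap.comp_apply, LinearMap.smul_apply] at ih ⊢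
  rw [tw_cons, map_smul, rskew_cons, rskew_cons, map_add, tw_cons, ih, map_smul]
  by_cases h : i = j
  · subst h
    simp only [if_true, smul_add, smul_smul, tw_tw]
    congr 2; rw [add_comm]
  · simp only [if_neg h, map_zero, zero_add, smul_smul]
    congr 1; ring

/-- The two derivations remove letters from opposite ends, and the scalars which they pick up from
each other's letter agree because (α_i, α_j) is symmetric. -/
theorem skew_rskew (i j : I) (y : Words k I) :
    skew D q i (rskew D q j y) = rskew D q j (skew D q i y) := by
  refine Words.induction (f := skew D q i ∘ₗ rskew D q j) (g := rskew D q j ∘ₗ skew D q i)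
    (by simp [skew_nil, rskew_nil]) (fun m y _ ih => ?_) y
  simp only [LinearMap.comp_apply] at ih ⊢
  rw [rskew_cons, skew_cons, map_add, map_add, skew_cons, map_smul, rskew_cons, ih]
  by_cases h : j = m
  · subst h
    by_cases h' : i = j
    · subst h'
      simp only [if_true, skew_tw, smul_add]
      abel
    · simp only [if_true, if_neg h', skew_tw, map_zero, zero_add, smul_add, D.ti_comm i j]
  · by_cases h' : i = m
    · subst h'
      simp only [if_true, if_neg h, map_zero, zero_add]
    · simp only [if_neg h, if_neg h', map_zero, zero_add]

theorem skew_snoc (i j : I) [Decidable (i = j)] (y : Words k I) : skew D q i (snoc k j y) =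
    snoc k j (skew D q i y) + (if i = j then tw D q (D.ti i) y else 0) := by
  have := Words.induction (f := skew D q i ∘ₗ snoc k j)
    (g := snoc k j ∘ₗ skew D q i + (if i = j then tw D q (D.ti i) else 0)) ?_
    (fun m y _ ih => ?_) y
  · refine this.trans ?_
    split_ifs <;> rfl
  · simp only [LinearMap.comp_apply, LinearMap.add_apply, skew_nil, map_zero, zero_add]
    rw [snoc_bw, List.nil_append, ← cons_bw, skew_cons, skew_nil, map_zero, smul_zero, add_zero]
    split_ifs <;> simp [tw_nil]
  · simp only [LinearMap.comp_apply, LinearMap.add_apply] at ih ⊢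
    rw [snoc_cons, skew_cons, skew_cons, ih, map_add (cons k m), map_add (snoc k j), map_smul,
      snoc_cons, smul_add,
      ← add_assoc]
    congr 1
    · congr 1
      split_ifs <;> simp
    · split_ifs
      · rw [tw_cons]
      · simp

/-- The concatenation product. -/
def Words.mul : Words k I →ₗ[k] Words k I →ₗ[k] Words k I :=
  Finsupp.linearCombination k fun u => Finsupp.lmapDomain k k (u ++ ·)

theorem Words.mul_bw (u w : List I) : Words.mul (bw k u) (bw k w) = bw k (u ++ w) := by
  simp [Words.mul, bw]

theorem Words.nil_mul (y : Words k I) : Words.mul (bw k []) y = y := by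
  have : Words.mul (bw k ([] : List I)) = LinearMap.id := Words.hom_ext fun w => by
    simp [Words.mul_bw]
  rw [this]; rfl

theorem Words.mul_nil (y : Words k I) : Words.mul y (bw k []) = y := by
  have : (Words.mul (I := I)).flip (bw k []) = LinearMap.id := Words.hom_ext fun w => by
    simp [Words.mul_bw]
  exact LinearMap.congr_fun this y

theorem Words.cons_mul (i : I) (x y : Words k I) :
    Words.mul (cons k i x) y = cons k i (Words.mul x y) := by
  have : (Words.mul (I := I)).comp (cons k i) = (Words.mul).compr₂ (cons k i) :=
    Words.hom_ext₂ fun u w => by simp [Words.mul_bw, cons_bw]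
  exact LinearMap.congr_fun₂ this x y

theorem Words.mul_assoc (x y z : Words k I) :
    Words.mul (Words.mul x y) z = Words.mul x (Words.mul y z) := by
  refine Words.induction (f := Words.mul.flip z ∘ₗ Words.mul.flip y)
    (g := Words.mul.flip (Words.mul y z)) (by simp [Words.nil_mul]) (fun j x _ ih => ?_) x
  simp only [LinearMap.comp_apply, LinearMap.flip_apply] at ih ⊢
  rw [Words.cons_mul, Words.cons_mul, ih, Words.cons_mul]

theorem Words.snoc_mul (i : I) (x y : Words k I) :
    Words.mul (snoc k i x) y = Words.mul x (cons k i y) := by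
  have : (Words.mul (I := I)).comp (snoc k i) = (Words.mul).compl₂ (cons k i) :=
    Words.hom_ext₂ fun u w => by simp [Words.mul_bw, cons_bw, snoc_bw]
  exact LinearMap.congr_fun₂ this x y

theorem Words.mul_snoc (i : I) (x y : Words k I) :
    Words.mul x (snoc k i y) = snoc k i (Words.mul x y) := by
  have : (Words.mul).compl₂ (snoc k i) = (Words.mul (I := I)).compr₂ (snoc k i) :=
    Words.hom_ext₂ fun u w => by simp [Words.mul_bw, snoc_bw]
  exact LinearMap.congr_fun₂ this x y

theorem tw_mul (l : Module.Dual ℤ Φ) (x y : Words k I) :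
    tw D q l (Words.mul x y) = Words.mul (tw D q l x) (tw D q l y) := by
  have : (Words.mul (I := I)).compr₂ (tw D q l) =
      (Words.mul.compl₂ (tw D q l)).comp (tw D q l) :=
    Words.hom_ext₂ fun u w => by simp [Words.mul_bw, tw_bw, smul_smul, q.mul_zpow]
  exact LinearMap.congr_fun₂ this x y

/-- The braided Leibniz rule: to reach the second factor, the derivation has to be braided past the
first. -/
theorem skew_mul (i : I) (x y : Words k I) : skew D q i (Words.mul x y) =
    Words.mul (skew D q i x) y + Words.mul (tw D q (D.ti i) x) (skew D q i y) := by
  refine Words.induction (f := skew D q i ∘ₗ Words.mul.flip y) (g := Words.mul.flip y ∘ₗ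
    skew D q i + Words.mul.flip (skew D q i y) ∘ₗ tw D q (D.ti i))
    (by simp [Words.nil_mul, tw_nil, skew_nil]) (fun j x _ ih => ?_) x
  simp only [LinearMap.comp_apply, LinearMap.add_apply, LinearMap.flip_apply] at ih ⊢
  rw [Words.cons_mul, skew_cons, ih, skew_cons, tw_cons, map_add Words.mul, map_smul, map_smul,
    LinearMap.add_apply, LinearMap.smul_apply, LinearMap.smul_apply, Words.cons_mul,
    Words.cons_mul, map_add, smul_add, ← add_assoc]
  congr 2
  split_ifs <;> simp

end Words

/-! ### Lusztig's form and the braided Hopf algebra of words -/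

section WordsHopf

variable {k : Type*} [NormedField k] {I Φ : Type*} [AddCommGroup Φ]
  (D : RootDatum I Φ) (q : QNumber k)

/-- The product of two functionals. -/
def tfun {V V' : Type*} [AddCommGroup V] [Module k V] [AddCommGroup V'] [Module k V']
    (f : V →ₗ[k] k) (g : V' →ₗ[k] k) : V ⊗[k] V' →ₗ[k] k :=
  (TensorProduct.lid k k).toLinearMap ∘ₗ TensorProduct.map f g

@[simp] theorem tfun_tmul {V V' : Type*} [AddCommGroup V] [Module k V] [AddCommGroup V']
    [Module k V'] (f : V →ₗ[k] k) (g : V' →ₗ[k] k) (a : V) (b : V') :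
    tfun f g (a ⊗ₜ b) = f a * g b := by simp [tfun]

/-- Lusztig's form as a bilinear form. -/
def form : Words k I →ₗ[k] Words k I →ₗ[k] k := Finsupp.linearCombination k (lform D q)

theorem form_bw (u : List I) (y : Words k I) : form D q (bw k u) y = lform D q u y := by
  simp [form, bw]

theorem form_nil_left (y : Words k I) : form D q (bw k []) y = y [] := by
  rw [form_bw]; rfl

theorem form_cons_left (i : I) (x y : Words k I) :
    form D q (cons k i x) y = (qDiff k D q i)⁻¹ * form D q x (skew D q i y) := by
  have : (form D q).comp (cons k i) =
      (qDiff k D q i)⁻¹ • (form D q).compl₂ (skew D q i) :=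
    Words.hom_ext fun w => LinearMap.ext fun y => by
      rw [LinearMap.comp_apply, cons_bw, LinearMap.smul_apply]
      simp [form, bw, lform]
  exact LinearMap.congr_fun₂ this x y

variable (k I) in
/-- The counit of the free algebra. -/
def Words.counit : Words k I →ₗ[k] k := Finsupp.lapply []

theorem Words.counit_nil : Words.counit k I (bw k []) = 1 := by simp [Words.counit, bw]
theorem Words.counit_cons (i : I) (y : Words k I) : Words.counit k I (cons k i y) = 0 := by
  have : Words.counit k I ∘ₗ cons k i = 0 := Words.hom_ext fun w => by
    rw [LinearMap.comp_apply, cons_bw]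
    simp [Words.counit, bw]
  exact LinearMap.congr_fun this y

theorem Words.counit_mul (x y : Words k I) :
    Words.counit k I (Words.mul x y) = Words.counit k I x * Words.counit k I y := by
  refine Words.induction (f := Words.counit k I ∘ₗ Words.mul.flip y)
    (g := Words.counit k I y • Words.counit k I)
    (by simp [Words.nil_mul, Words.counit_nil]) (fun j x _ ih => ?_) x |>.trans ?_
  · simp [Words.cons_mul, Words.counit_cons]
  · simp [mul_comm]

theorem form_nil_left' (y : Words k I) : form D q (bw k []) y = Words.counit k I y :=
  form_nil_left D q y

theorem form_nil_right (x : Words k I) : form D q x (bw k []) = Words.counit k I x := by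
  refine Words.induction (f := (form D q).flip (bw k [])) (g := Words.counit k I) ?_
    (fun j x _ ih => ?_) x
  · rw [LinearMap.flip_apply, form_nil_left']
  · rw [LinearMap.flip_apply, form_cons_left, skew_nil, map_zero, mul_zero, Words.counit_cons]

/-- In substance, the form pairs only elements of equal weight, so it does not matter which argument
is twisted. The induction uses only that a skew derivation lowers the weight by α_i. -/
theorem form_tw (l : Module.Dual ℤ Φ) (x y : Words k I) :
    form D q x (tw D q l y) = form D q (tw D q l x) y := by
  have key : ∀ w : List I, ∀ y : Words k I,
      form D q (bw k w) (tw D q l y) = form D q (tw D q l (bw k w)) y := by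
    intro w
    induction w with
    | nil =>
      intro y
      rw [tw_nil]
      refine Words.induction (f := form D q (bw k []) ∘ₗ tw D q l) (g := form D q (bw k []))
        (by simp [tw_nil]) (fun j y _ ih => ?_) y
      simp [tw_cons, form_nil_left', Words.counit_cons]
    | cons i w ih =>
      intro y
      rw [← cons_bw, form_cons_left, skew_tw, map_smul, ih, tw_cons, map_smul,
        LinearMap.smul_apply, form_cons_left, smul_eq_mul, smul_eq_mul]
      ring
  have : (form D q).compl₂ (tw D q l) = (form D q).comp (tw D q l) :=
    Words.hom_ext fun w => LinearMap.ext fun y => key w y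
  exact LinearMap.congr_fun₂ this x y

/-- Left multiplication by the primitive element `vᵢ` in the braided tensor square. -/
def Lop (i : I) : Words k I ⊗[k] Words k I →ₗ[k] Words k I ⊗[k] Words k I :=
  TensorProduct.map (cons k i) .id + TensorProduct.map (tw D q (D.ti i)) (cons k i)

theorem Lop_tmul (i : I) (a b : Words k I) :
    Lop D q i (a ⊗ₜ b) = cons k i a ⊗ₜ b + tw D q (D.ti i) a ⊗ₜ cons k i b := rfl

/-- The braided comultiplication on words. -/
def Words.comulWord : List I → Words k I ⊗[k] Words k I
  | [] => bw k [] ⊗ₜ bw k []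
  | i :: w => Lop D q i (Words.comulWord w)

/-- The braided comultiplication. -/
def Words.comul : Words k I →ₗ[k] Words k I ⊗[k] Words k I :=
  Finsupp.linearCombination k (Words.comulWord D q)

theorem Words.comul_nil : Words.comul D q (bw k []) = bw k [] ⊗ₜ bw k [] := by
  simp [Words.comul, bw, Words.comulWord]

theorem Words.comul_cons (i : I) (y : Words k I) :
    Words.comul D q (cons k i y) = Lop D q i (Words.comul D q y) := by
  have : Words.comul D q ∘ₗ cons k i = Lop D q i ∘ₗ Words.comul D q :=
    Words.hom_ext fun w => by
      rw [LinearMap.comp_apply, LinearMap.comp_apply, cons_bw]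
      simp [Words.comul, bw, Words.comulWord]
  exact LinearMap.congr_fun this y

theorem Words.comul_tw (l : Module.Dual ℤ Φ) (y : Words k I) : Words.comul D q (tw D q l y) =
    TensorProduct.map (tw D q l) (tw D q l) (Words.comul D q y) := by
  refine Words.induction (f := Words.comul D q ∘ₗ tw D q l)
    (g := TensorProduct.map (tw D q l) (tw D q l) ∘ₗ Words.comul D q)
    (by simp [tw_nil, Words.comul_nil]) (fun j y _ ih => ?_) y
  simp only [LinearMap.comp_apply] at ih ⊢
  rw [tw_cons, map_smul, Words.comul_cons, ih, Words.comul_cons]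
  have : q.val ^ l (D.α j) • Lop D q j ∘ₗ TensorProduct.map (tw D q l) (tw D q l) =
      TensorProduct.map (tw D q l) (tw D q l) ∘ₗ Lop D q j := TensorProduct.ext' fun a b => by
    simp only [LinearMap.smul_apply, LinearMap.comp_apply, TensorProduct.map_tmul, Lop_tmul,
      map_add, tw_cons, smul_add, TensorProduct.smul_tmul', TensorProduct.tmul_smul, tw_tw,
      add_comm]
  exact LinearMap.congr_fun this _

/-- Both sides extract v_i from the middle factor of the iterated coproduct, so a letter may be
removed at the right end of one tensor factor or at the left end of the next. The cross relation
rests on this exchange. -/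
theorem Words.rskew_comul (i : I) (y : Words k I) :
    TensorProduct.map (rskew D q i) .id (Words.comul D q y) =
      TensorProduct.map .id (skew D q i) (Words.comul D q y) := by
  refine Words.induction (f := TensorProduct.map (rskew D q i) .id ∘ₗ Words.comul D q)
    (g := TensorProduct.map .id (skew D q i) ∘ₗ Words.comul D q)
    (by simp [Words.comul_nil, skew_nil, rskew_nil]) (fun j y _ ih => ?_) y
  simp only [LinearMap.comp_apply] at ih ⊢
  rw [Words.comul_cons]
  -- This is left multiplication by v_j as seen after v_i has been removed. Both sides of the claim
  -- obey the same recursion with it, with the same extra term when i = j.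
  let L' : Words k I ⊗[k] Words k I →ₗ[k] Words k I ⊗[k] Words k I :=
    TensorProduct.map (cons k j) .id +
      q.val ^ D.ti i (D.α j) • TensorProduct.map (tw D q (D.ti j)) (cons k j)
  by_cases h : i = j
  · subst h
    have h1 : TensorProduct.map (rskew D q i) .id ∘ₗ Lop D q i =
        TensorProduct.map (tw D q (D.ti i)) .id + L' ∘ₗ TensorProduct.map (rskew D q i) .id :=
      TensorProduct.ext' fun a b => by
        simp [Lop_tmul, rskew_cons, rskew_tw, L', TensorProduct.add_tmul,
          TensorProduct.smul_tmul', add_assoc]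
    have h2 : TensorProduct.map .id (skew D q i) ∘ₗ Lop D q i =
        TensorProduct.map (tw D q (D.ti i)) .id + L' ∘ₗ TensorProduct.map .id (skew D q i) :=
      TensorProduct.ext' fun a b => by
        simp only [Lop_tmul, skew_cons, L', TensorProduct.tmul_add, LinearMap.comp_apply,
          map_add, TensorProduct.map_tmul, LinearMap.id_apply, if_true, LinearMap.add_apply,
          TensorProduct.tmul_smul, LinearMap.smul_apply]
        abel
    have e1 := LinearMap.congr_fun h1 (Words.comul D q y)
    have e2 := LinearMap.congr_fun h2 (Words.comul D q y)
    simp only [LinearMap.comp_apply, LinearMap.add_apply] at e1 e2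
    rw [e1, e2, ih]
  · have h1 : TensorProduct.map (rskew D q i) .id ∘ₗ Lop D q j =
        L' ∘ₗ TensorProduct.map (rskew D q i) .id :=
      TensorProduct.ext' fun a b => by
        simp [Lop_tmul, rskew_cons, rskew_tw, L', h, TensorProduct.smul_tmul', D.ti_comm i j]
    have h2 : TensorProduct.map .id (skew D q i) ∘ₗ Lop D q j =
        L' ∘ₗ TensorProduct.map .id (skew D q i) :=
      TensorProduct.ext' fun a b => by
        simp [Lop_tmul, skew_cons, L', h]
    have e1 := LinearMap.congr_fun h1 (Words.comul D q y)
    have e2 := LinearMap.congr_fun h2 (Words.comul D q y)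
    simp only [LinearMap.comp_apply] at e1 e2
    rw [e1, e2, ih]

/-- The derivation ∂_i extracts v_i from the leftmost factor of a coproduct, so coassociativity
carries it past the remaining splitting. -/
theorem Words.comul_skew (i : I) (y : Words k I) : Words.comul D q (skew D q i y) =
    TensorProduct.map (skew D q i) .id (Words.comul D q y) := by
  refine Words.induction (f := Words.comul D q ∘ₗ skew D q i)
    (g := TensorProduct.map (skew D q i) .id ∘ₗ Words.comul D q)
    (by simp [Words.comul_nil, skew_nil]) (fun j y _ ih => ?_) y
  simp only [LinearMap.comp_apply] at ih ⊢
  classical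
  rw [Words.comul_cons, skew_cons, map_add, map_smul, Words.comul_cons, ih]
  have h1 : TensorProduct.map (skew D q i) .id ∘ₗ Lop D q j = (if i = j then LinearMap.id else 0) +
      q.val ^ D.ti i (D.α j) • Lop D q j ∘ₗ TensorProduct.map (skew D q i) .id :=
    TensorProduct.ext' fun a b => by
      by_cases h : i = j
      · subst h
        simp [Lop_tmul, skew_cons, skew_tw, TensorProduct.add_tmul, TensorProduct.smul_tmul',
          add_assoc]
      · simp [Lop_tmul, skew_cons, skew_tw, h, TensorProduct.smul_tmul', D.ti_comm i j]
  have e1 := LinearMap.congr_fun h1 (Words.comul D q y)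
  simp only [LinearMap.comp_apply, LinearMap.add_apply, LinearMap.smul_apply] at e1
  rw [e1]
  split_ifs <;> simp

theorem Words.counit_comul (y : Words k I) :
    TensorProduct.lid k _ (TensorProduct.map (Words.counit k I) .id (Words.comul D q y)) = y := by
  refine Words.induction (f := (TensorProduct.lid k _).toLinearMap ∘ₗ
    TensorProduct.map (Words.counit k I) .id ∘ₗ Words.comul D q) (g := .id)
    (by simp [Words.comul_nil, Words.counit_nil]) (fun j y _ ih => ?_) y
  simp only [LinearMap.comp_apply, LinearMap.id_apply] at ih ⊢
  rw [Words.comul_cons]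
  have h1 : (TensorProduct.lid k _).toLinearMap ∘ₗ TensorProduct.map (Words.counit k I) .id ∘ₗ
      Lop D q j = cons k j ∘ₗ (TensorProduct.lid k _).toLinearMap ∘ₗ
        TensorProduct.map (Words.counit k I) .id := TensorProduct.ext' fun a b => by
    have : Words.counit k I (tw D q (D.ti j) a) = Words.counit k I a := by
      rw [← form_nil_left' D q, form_tw, tw_nil, form_nil_left']
    simp [Lop_tmul, Words.counit_cons, this]
  have e1 := LinearMap.congr_fun h1 (Words.comul D q y)
  simp only [LinearMap.comp_apply] at e1
  rw [e1, ih]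

theorem Words.comul_counit (y : Words k I) :
    TensorProduct.rid k _ (TensorProduct.map .id (Words.counit k I) (Words.comul D q y)) = y := by
  refine Words.induction (f := (TensorProduct.rid k _).toLinearMap ∘ₗ
    TensorProduct.map .id (Words.counit k I) ∘ₗ Words.comul D q) (g := .id)
    (by simp [Words.comul_nil, Words.counit_nil]) (fun j y _ ih => ?_) y
  simp only [LinearMap.comp_apply, LinearMap.id_apply] at ih ⊢
  rw [Words.comul_cons]
  have h1 : (TensorProduct.rid k _).toLinearMap ∘ₗ TensorProduct.map .id (Words.counit k I) ∘ₗ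
      Lop D q j = cons k j ∘ₗ (TensorProduct.rid k _).toLinearMap ∘ₗ
        TensorProduct.map .id (Words.counit k I) := TensorProduct.ext' fun a b => by
    simp [Lop_tmul, Words.counit_cons]
  have e1 := LinearMap.congr_fun h1 (Words.comul D q y)
  simp only [LinearMap.comp_apply] at e1
  rw [e1, ih]

/-- Either iterated coproduct turns left multiplication by a generator into the same operator `L3`
on the braided tensor cube, and both agree on the empty word. -/
theorem Words.coassoc (y : Words k I) :
    TensorProduct.assoc k _ _ _
      (TensorProduct.map (Words.comul D q) .id (Words.comul D q y)) =
    TensorProduct.map .id (Words.comul D q) (Words.comul D q y) := by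
  refine Words.induction (f := (TensorProduct.assoc k _ _ _).toLinearMap ∘ₗ
    TensorProduct.map (Words.comul D q) .id ∘ₗ Words.comul D q)
    (g := TensorProduct.map .id (Words.comul D q) ∘ₗ Words.comul D q)
    (by simp [Words.comul_nil]) (fun j y _ ih => ?_) y
  simp only [LinearMap.comp_apply] at ih ⊢
  rw [Words.comul_cons]
  let t := tw D q (D.ti j)
  let L3 : Words k I ⊗[k] (Words k I ⊗[k] Words k I) →ₗ[k]
      Words k I ⊗[k] (Words k I ⊗[k] Words k I) :=
    TensorProduct.map (cons k j) .id + TensorProduct.map t (Lop D q j)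
  have h1 : (TensorProduct.assoc k _ _ _).toLinearMap ∘ₗ
      TensorProduct.map (Words.comul D q) .id ∘ₗ Lop D q j =
      L3 ∘ₗ (TensorProduct.assoc k _ _ _).toLinearMap ∘ₗ
        TensorProduct.map (Words.comul D q) .id := TensorProduct.ext' fun a b => by
    simp only [LinearMap.comp_apply, Lop_tmul, map_add, TensorProduct.map_tmul, Words.comul_cons,
      Words.comul_tw]
    generalize Words.comul D q a = z
    induction z using TensorProduct.induction_on with
    | zero => simp
    | add x y hx hy =>
      simp only [map_add, TensorProduct.add_tmul] at hx hy ⊢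
      rw [add_add_add_comm, hx, hy]
    | tmul x y =>
      simp [Lop_tmul, L3, t, TensorProduct.add_tmul, TensorProduct.tmul_add, add_assoc]
  have h2 : TensorProduct.map .id (Words.comul D q) ∘ₗ Lop D q j =
      L3 ∘ₗ TensorProduct.map .id (Words.comul D q) := TensorProduct.ext' fun a b => by
    simp [Lop_tmul, L3, t, Words.comul_cons]
  have e1 := LinearMap.congr_fun h1 (Words.comul D q y)
  have e2 := LinearMap.congr_fun h2 (Words.comul D q y)
  simp only [LinearMap.comp_apply] at e1 e2
  rw [e1, ih, e2]

/-- Compatibility of the form with the product in the first argument. -/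
theorem form_mul_left (x x' y : Words k I) : form D q (Words.mul x x') y =
    tfun (form D q x) (form D q x') (Words.comul D q y) := by
  have key : ∀ w : List I, ∀ y, form D q (Words.mul (bw k w) x') y =
      tfun (form D q (bw k w)) (form D q x') (Words.comul D q y) := by
    intro w
    induction w with
    | nil =>
      intro y
      rw [Words.nil_mul]
      nth_rewrite 1 [← Words.counit_comul D q y]
      generalize Words.comul D q y = z
      induction z using TensorProduct.induction_on with
      | zero => simp
      | add x y hx hy => simp only [map_add, hx, hy]
      | tmul x y => simp [form_nil_left']
    | cons i w ih =>
      intro y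
      -- The derivation adjoint to v_i acts only on the left factor of the coproduct, which is where
      -- the letter i is to be paired.
      rw [← cons_bw, Words.cons_mul, form_cons_left, ih, Words.comul_skew]
      generalize Words.comul D q y = z
      induction z using TensorProduct.induction_on with
      | zero => simp
      | add x y hx hy => simp only [map_add, mul_add, hx, hy]
      | tmul x y => simp [form_cons_left, mul_assoc]
  have : (form D q).flip y ∘ₗ Words.mul.flip x' = Finsupp.linearCombination k
      (fun w => tfun (form D q (bw k w)) (form D q x') (Words.comul D q y)) :=
    Words.hom_ext fun w => by
      simp only [LinearMap.comp_apply, LinearMap.flip_apply, key]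
      simp [bw]
  have h2 : ∀ z, tfun (form D q x) (form D q x') z = Finsupp.linearCombination k
      (fun w => tfun (form D q (bw k w)) (form D q x') z) x := by
    intro z
    induction z using TensorProduct.induction_on with
    | zero => simp [Finsupp.linearCombination_apply]
    | add a b ha hb =>
      simp only [map_add, ha, hb]
      simp only [Finsupp.linearCombination_apply, Finsupp.sum, smul_add, Finset.sum_add_distrib]
    | tmul a b =>
      have h3 : form D q x' b • (form D q).flip a = Finsupp.linearCombination k
          (fun w => tfun (form D q (bw k w)) (form D q x') (a ⊗ₜ b)) :=
        Words.hom_ext fun w => by simp [bw, mul_comm]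
      rw [← h3]
      simp [mul_comm]
  rw [h2]
  exact LinearMap.congr_fun this x

/-- Compatibility of the form with the product in the second argument. -/
theorem form_mul_right (x y y' : Words k I) : form D q x (Words.mul y y') =
    tfun ((form D q).flip y) ((form D q).flip y') (Words.comul D q x) := by
  have key : ∀ w : List I, ∀ y y', form D q (bw k w) (Words.mul y y') =
      tfun ((form D q).flip y) ((form D q).flip y') (Words.comul D q (bw k w)) := by
    intro w
    induction w with
    | nil =>
      intro y y'
      simp [Words.comul_nil, form_nil_left', Words.counit_mul]
    | cons i w ih =>
      intro y y'
      -- The two terms of the Leibniz rule correspond to the two terms of `Lop`; the twist is moved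
      -- across by `form_tw`.
      rw [← cons_bw, form_cons_left, skew_mul, map_add, ih, ih, Words.comul_cons]
      generalize Words.comul D q (bw k w) = z
      induction z using TensorProduct.induction_on with
      | zero => simp
      | add x y hx hy =>
        simp only [map_add, mul_add] at hx hy ⊢
        rw [← hx, ← hy]; ring
      | tmul x y => simp [form_cons_left, Lop_tmul, form_tw]; ring
  have : (form D q).flip (Words.mul y y') =
      tfun ((form D q).flip y) ((form D q).flip y') ∘ₗ Words.comul D q :=
    Words.hom_ext fun w => by simp [key]
  exact LinearMap.congr_fun this x

/-- Only the part of degree one of x contributes to either side. This is the case of a single letter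
of the adjunction in the second argument. -/
theorem form_single_right (j : I) (x : Words k I) :
    form D q x (bw k [j]) = (qDiff k D q j)⁻¹ * form D q (bw k []) (skew D q j x) := by
  refine Words.induction (f := (form D q).flip (bw k [j]))
    (g := (qDiff k D q j)⁻¹ • form D q (bw k []) ∘ₗ skew D q j)
    ?_ (fun i x _ ih => ?_) x
  · rw [← cons_bw]
    simp [form_nil_left', Words.counit_cons, skew_nil]
  · rw [LinearMap.flip_apply, form_cons_left, ← cons_bw, skew_cons, skew_nil, map_zero, smul_zero,
      add_zero]
    simp only [LinearMap.smul_apply, LinearMap.comp_apply, skew_cons, map_add, map_smul,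
      form_nil_left', Words.counit_cons, smul_zero, add_zero]
    by_cases h : i = j
    · subst h
      simp [form_nil_right]
    · simp [h, Ne.symm h]

/-- Split off the letter by the product formula in the second argument; the pairing with a single
letter followed by the counit is exactly what ∂_j extracts from the coproduct. With the same rule in
the first argument this forces symmetry. -/
theorem form_cons_right (j : I) (x y : Words k I) :
    form D q x (cons k j y) = (qDiff k D q j)⁻¹ * form D q (skew D q j x) y := by
  have h1 : cons k j y = Words.mul (bw k [j]) y := by
    rw [← cons_bw, Words.cons_mul, Words.nil_mul]
  have h2 : skew D q j x = TensorProduct.lid k _ (TensorProduct.map (Words.counit k I) .id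
      (TensorProduct.map (skew D q j) .id (Words.comul D q x))) := by
    rw [← Words.comul_skew, Words.counit_comul]
  rw [h1, form_mul_right, h2]
  generalize Words.comul D q x = z
  induction z using TensorProduct.induction_on with
  | zero => simp
  | add x y hx hy => simp only [map_add, LinearMap.add_apply, mul_add, hx, hy]
  | tmul a b => simp [form_single_right, form_nil_left', mul_assoc]

theorem form_symm (x y : Words k I) : form D q x y = form D q y x := by
  have key : ∀ w : List I, ∀ x, form D q x (bw k w) = form D q (bw k w) x := by
    intro w
    induction w with
    | nil => intro x; rw [form_nil_right, form_nil_left']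
    | cons j w ih => intro x; rw [← cons_bw, form_cons_right, form_cons_left, ih]
  have : form D q x = (form D q).flip x := Words.hom_ext fun w => key w x
  exact LinearMap.congr_fun this y

end WordsHopf

section WordsAntipode

variable {k : Type*} [NormedField k] {I Φ : Type*} [AddCommGroup Φ]
  (D : RootDatum I Φ) (q : QNumber k)

/-! ### The antipode of the braided Hopf algebra of words -/

/-- The antipode (for `e = 1`) and its inverse (for `e = -1`) on words. -/
def Words.antipodeWord (e : ℤ) : List I → Words k I
  | [] => bw k []
  | j :: w => -(q.val ^ (e * D.ti j (D.rt w)) • snoc k j (Words.antipodeWord e w))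

/-- The antipode (for `e = 1`) and its inverse (for `e = -1`). -/
def Words.S (e : ℤ) : Words k I →ₗ[k] Words k I :=
  Finsupp.linearCombination k (Words.antipodeWord D q e)

theorem Words.S_nil (e : ℤ) : Words.S D q e (bw k []) = bw k [] := by
  simp [Words.S, bw, Words.antipodeWord]

theorem Words.S_cons (e : ℤ) (j : I) (y : Words k I) :
    Words.S D q e (cons k j y) = -snoc k j (Words.S D q e (tw D q (e • D.ti j) y)) := by
  have : Words.S D q e ∘ₗ cons k j = -(snoc k j ∘ₗ Words.S D q e ∘ₗ tw D q (e • D.ti j)) :=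
    Words.hom_ext fun w => by
      simp only [LinearMap.comp_apply, LinearMap.neg_apply, cons_bw, tw_bw, map_smul]
      simp [Words.S, bw, Words.antipodeWord]
  exact LinearMap.congr_fun this y

theorem Words.S_tw (e : ℤ) (l : Module.Dual ℤ Φ) (y : Words k I) :
    Words.S D q e (tw D q l y) = tw D q l (Words.S D q e y) := by
  have key : ∀ w : List I, Words.S D q e (tw D q l (bw k w)) =
      tw D q l (Words.S D q e (bw k w)) := by
    intro w
    induction w with
    | nil => rw [Words.S_nil, tw_nil, Words.S_nil]
    | cons j w ih =>
      rw [← cons_bw, tw_cons, map_smul, Words.S_cons, Words.S_cons, map_neg, tw_snoc]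
      simp only [tw_bw, map_smul] at ih ⊢
      rw [← ih]
      simp only [map_smul, smul_neg, smul_smul]
      congr 2; ring
  exact LinearMap.congr_fun (Words.hom_ext (f := Words.S D q e ∘ₗ tw D q l)
    (g := tw D q l ∘ₗ Words.S D q e) key) y

/-- The braided anti-multiplicativity of the antipode has the same shape at the right end of a word
as at the left, because the twists are symmetric. This is needed to compose two antipodes. -/
theorem Words.S_snoc (e : ℤ) (j : I) (y : Words k I) :
    Words.S D q e (snoc k j y) = -cons k j (Words.S D q e (tw D q (e • D.ti j) y)) := by
  refine Words.induction (f := Words.S D q e ∘ₗ snoc k j)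
    (g := -(cons k j ∘ₗ Words.S D q e ∘ₗ tw D q (e • D.ti j))) ?_ (fun m y _ ih => ?_) y
  · simp only [LinearMap.comp_apply, LinearMap.neg_apply, tw_nil, Words.S_nil, snoc_bw,
      List.nil_append]
    rw [← cons_bw, Words.S_cons, tw_nil, Words.S_nil, snoc_bw, cons_bw]; rfl
  · simp only [LinearMap.comp_apply, LinearMap.neg_apply] at ih ⊢
    rw [snoc_cons, Words.S_cons, Words.S_tw, ih, map_neg, tw_cons, Words.S_tw _ _ _ _ (cons k m y),
      Words.S_cons, map_neg, map_neg, tw_snoc]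
    simp only [Words.S_tw, tw_tw, map_neg, map_smul, snoc_cons, LinearMap.smul_apply,
      D.ti_comm m j, add_comm]

theorem Words.S_S (e f : ℤ) (h : e + f = 0) (y : Words k I) :
    Words.S D q e (Words.S D q f y) = y := by
  obtain rfl : f = -e := by omega
  refine Words.induction (f := Words.S D q e ∘ₗ Words.S D q (-e)) (g := .id) ?_
    (fun m y _ ih => ?_) y
  · simp [Words.S_nil]
  · simp only [LinearMap.comp_apply, LinearMap.id_apply] at ih ⊢
    rw [Words.S_cons, map_neg, Words.S_snoc, neg_neg, Words.S_tw, Words.S_tw, Words.S_tw, tw_tw,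
      ih, neg_smul, add_neg_cancel, tw_zero]

/-- The antipode reverses words, so it exchanges the left and the right derivation up to a sign and
a twist. -/
theorem skew_S (e : ℤ) (i : I) (y : Words k I) : skew D q i (Words.S D q e y) =
    -Words.S D q e (tw D q (e • D.ti i) (rskew D q i y)) := by
  classical
  refine Words.induction (f := skew D q i ∘ₗ Words.S D q e)
    (g := -(Words.S D q e ∘ₗ tw D q (e • D.ti i) ∘ₗ rskew D q i))
    (by simp [Words.S_nil, skew_nil, rskew_nil]) (fun j y _ ih => ?_) y
  simp only [LinearMap.comp_apply, LinearMap.neg_apply] at ih ⊢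
  rw [Words.S_cons, Words.S_tw, map_neg, skew_snoc, skew_tw, ih, rskew_cons, map_add, map_add,
    tw_cons, map_smul (Words.S D q e), Words.S_cons]
  by_cases h : i = j
  · subst h
    simp only [if_true, Words.S_tw, tw_tw, map_neg, map_smul, smul_neg]
    simp only [neg_add_rev, neg_neg, LinearMap.smul_apply, smul_eq_mul, add_comm]
  · simp only [if_neg h, map_zero, zero_add, Words.S_tw, tw_tw, map_neg, map_smul,
      smul_neg, neg_neg, LinearMap.smul_apply, D.ti_comm i j, add_comm]

/-- Right multiplication is adjoint to the right derivation: once the letters on the left have been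
removed by left derivations, which commute with the right one, only the empty word remains, where
the two derivations have the same counit. -/
theorem form_snoc_left (i : I) (x y : Words k I) :
    form D q (snoc k i x) y = (qDiff k D q i)⁻¹ * form D q x (rskew D q i y) := by
  have key : ∀ w : List I, ∀ y, form D q (snoc k i (bw k w)) y =
      (qDiff k D q i)⁻¹ * form D q (bw k w) (rskew D q i y) := by
    intro w
    induction w with
    | nil =>
      intro y
      rw [snoc_bw, List.nil_append, ← cons_bw, form_cons_left]
      congr 1
      refine Words.induction (f := form D q (bw k []) ∘ₗ skew D q i)
        (g := form D q (bw k []) ∘ₗ rskew D q i) (by simp [skew_nil, rskew_nil])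
        (fun j y _ ih => ?_) y
      simp only [LinearMap.comp_apply, skew_cons, rskew_cons, map_add, map_smul, form_nil_left',
        Words.counit_cons, smul_zero, add_zero]
      split_ifs
      · rw [← form_nil_left' D q, ← form_nil_left' D q, form_tw, tw_nil]
      · rfl
    | cons j w ih =>
      intro y
      rw [← cons_bw, snoc_cons, form_cons_left, ih, form_cons_left, skew_rskew]
      ring
  exact LinearMap.congr_fun (Words.hom_ext (f := (form D q).flip y ∘ₗ snoc k i)
    (g := (qDiff k D q i)⁻¹ • (form D q).flip (rskew D q i y)) fun w => by simp [key]) x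

/-- The antipode turns a left letter into a right one, and `skew_S` turns a left derivation into a
right one; these operations are adjoint with matching twists. Hence the radical is stable under the
antipode and its inverse, and the pairing is compatible with antipodes. -/
theorem form_S (e : ℤ) (x y : Words k I) :
    form D q (Words.S D q e x) y = form D q x (Words.S D q e y) := by
  have key : ∀ w : List I, ∀ y, form D q (Words.S D q e (bw k w)) y =
      form D q (bw k w) (Words.S D q e y) := by
    intro w
    induction w with
    | nil =>
      intro y
      rw [Words.S_nil]
      refine Words.induction (f := form D q (bw k []))
        (g := form D q (bw k []) ∘ₗ Words.S D q e) (by simp [Words.S_nil]) (fun j y _ ih => ?_) y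
      have : ∀ z, form D q (bw k []) (snoc k j z) = 0 := fun z => by
        rw [form_symm, form_snoc_left, rskew_nil, map_zero, mul_zero]
      simp [Words.S_cons, this, form_nil_left' _ _ (cons k j y), Words.counit_cons]
    | cons j w ih =>
      intro y
      rw [← cons_bw, Words.S_cons, map_neg, LinearMap.neg_apply, form_snoc_left, Words.S_tw,
        ← form_tw, ih, form_cons_left, skew_S, Words.S_tw, map_neg]
      ring
  exact LinearMap.congr_fun (Words.hom_ext (f := (form D q).flip y ∘ₗ Words.S D q e)
    (g := (form D q).flip (Words.S D q e y)) fun w => by simp [key]) x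

/-- Left multiplication by v_j produces two terms in the coproduct, and after applying S to the
first factor and multiplying, they cancel identically. -/
theorem Words.antipode_left (y : Words k I) : TensorProduct.lift Words.mul
    (TensorProduct.map (Words.S D q 1) .id (Words.comul D q y)) =
      Words.counit k I y • bw k [] := by
  refine Words.induction (f := TensorProduct.lift Words.mul ∘ₗ
    TensorProduct.map (Words.S D q 1) .id ∘ₗ Words.comul D q)
    (g := (Words.counit k I).smulRight (bw k []))
    (by simp [Words.comul_nil, Words.S_nil, Words.nil_mul, Words.counit_nil])
    (fun j y _ _ => ?_) y
  simp only [LinearMap.comp_apply, Words.comul_cons, LinearMap.smulRight_apply, Words.counit_cons,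
    zero_smul]
  have : TensorProduct.lift Words.mul ∘ₗ TensorProduct.map (Words.S D q 1) .id ∘ₗ Lop D q j =
      0 := TensorProduct.ext' fun a b => by
    simp [Lop_tmul, Words.S_cons, Words.snoc_mul]
  exact LinearMap.congr_fun this _

/-- Here left multiplication by v_j becomes v_j z - (twisted z) v_j applied to the value for y. By
induction that value is a multiple of the empty word, on which the difference vanishes. -/
theorem Words.antipode_right (y : Words k I) : TensorProduct.lift Words.mul
    (TensorProduct.map .id (Words.S D q 1) (Words.comul D q y)) =
      Words.counit k I y • bw k [] := by
  refine Words.induction (f := TensorProduct.lift Words.mul ∘ₗ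
    TensorProduct.map .id (Words.S D q 1) ∘ₗ Words.comul D q)
    (g := (Words.counit k I).smulRight (bw k []))
    (by simp [Words.comul_nil, Words.S_nil, Words.nil_mul, Words.counit_nil])
    (fun j y _ ih => ?_) y
  simp only [LinearMap.comp_apply, Words.comul_cons, LinearMap.smulRight_apply, Words.counit_cons,
    zero_smul] at ih ⊢
  have : TensorProduct.lift Words.mul ∘ₗ TensorProduct.map .id (Words.S D q 1) ∘ₗ Lop D q j =
      (cons k j - snoc k j ∘ₗ tw D q (D.ti j)) ∘ₗ TensorProduct.lift Words.mul ∘ₗ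
        TensorProduct.map .id (Words.S D q 1) := TensorProduct.ext' fun a b => by
    simp [Lop_tmul, Words.S_cons, Words.cons_mul, Words.mul_snoc, tw_mul, Words.S_tw,
      sub_eq_add_neg]
  have e1 := LinearMap.congr_fun this (Words.comul D q y)
  simp only [LinearMap.comp_apply] at e1
  rw [e1, ih]
  simp [tw_nil, cons_bw, snoc_bw]

/-! ### The braided tensor square -/

/-- The product of the braided tensor square. -/
def braidedMul : Words k I ⊗[k] Words k I →ₗ[k] Words k I ⊗[k] Words k I →ₗ[k]
    Words k I ⊗[k] Words k I :=
  TensorProduct.lift (Finsupp.linearCombination k (fun b =>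
    LinearMap.lcomp k _ (LinearMap.lTensor (Words k I) (Words.mul (bw k b))) ∘ₗ
      LinearMap.rTensorHom (Words k I) ∘ₗ
        LinearMap.lcomp k (Words k I) (tw D q (D.tK (D.wt b))) ∘ₗ Words.mul)).flip

theorem braidedMul_tmul (a : Words k I) (b : List I) (c : Words k I) (d : Words k I) :
    braidedMul D q (a ⊗ₜ bw k b) (c ⊗ₜ d) =
      Words.mul a (tw D q (D.tK (D.wt b)) c) ⊗ₜ Words.mul (bw k b) d := by
  simp [braidedMul, bw]

/-- An instance of associativity of the braided square: `Lop` is left multiplication by the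
primitive element v_i ⊗ 1 + 1 ⊗ v_i. It drives the induction which makes the coproduct
multiplicative. -/
theorem braidedMul_Lop (i : I) (s t : Words k I ⊗[k] Words k I) :
    braidedMul D q (Lop D q i s) t = Lop D q i (braidedMul D q s t) := by
  induction s using TensorProduct.induction_on with
  | zero => simp
  | add x y hx hy => simp only [map_add, LinearMap.add_apply, hx, hy]
  | tmul a b =>
    induction t using TensorProduct.induction_on with
    | zero => simp
    | add x y hx hy => simp only [map_add, hx, hy]
    | tmul c d =>
      have := Words.hom_ext (f := (braidedMul D q).flip (c ⊗ₜ d) ∘ₗ Lop D q i ∘ₗ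
        TensorProduct.mk k _ _ a) (g := Lop D q i ∘ₗ (braidedMul D q).flip (c ⊗ₜ d) ∘ₗ
        TensorProduct.mk k _ _ a) fun w => by
          simp only [LinearMap.comp_apply, TensorProduct.mk_apply, LinearMap.flip_apply, Lop_tmul,
            map_add, braidedMul_tmul, cons_bw]
          rw [Words.cons_mul, ← cons_bw, Words.cons_mul, tw_mul, tw_tw, D.tK_wt_cons]
      exact LinearMap.congr_fun this b

theorem Words.comul_mul (x y : Words k I) : Words.comul D q (Words.mul x y) =
    braidedMul D q (Words.comul D q x) (Words.comul D q y) := by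
  refine Words.induction (f := Words.comul D q ∘ₗ Words.mul.flip y)
    (g := (braidedMul D q).flip (Words.comul D q y) ∘ₗ Words.comul D q)
    ?_ (fun j x _ ih => ?_) x
  · simp only [LinearMap.comp_apply, LinearMap.flip_apply, Words.nil_mul, Words.comul_nil]
    generalize Words.comul D q y = z
    induction z using TensorProduct.induction_on with
    | zero => simp
    | add x y hx hy => rw [map_add, ← hx, ← hy]
    | tmul a b => rw [braidedMul_tmul, Words.nil_mul, Words.nil_mul, D.tK_wt_nil, tw_zero]
  · simp only [LinearMap.comp_apply, LinearMap.flip_apply] at ih ⊢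
    rw [Words.cons_mul, Words.comul_cons, ih, Words.comul_cons, braidedMul_Lop]

/-! ### The radical -/

/-- The radical of Lusztig's form. -/
def radical : Submodule k (Words k I) where
  carrier := {y | InRadical D q y}
  add_mem' hx hy u := by rw [map_add, hx u, hy u, add_zero]
  zero_mem' u := map_zero _
  smul_mem' c y hy u := by rw [map_smul, hy u, smul_zero]

theorem mem_radical {y : Words k I} : y ∈ radical D q ↔ ∀ x, form D q x y = 0 := by
  refine ⟨fun h x => ?_, fun h u => by rw [← form_bw]; exact h _⟩
  have : (form D q).flip y = 0 := Words.hom_ext fun w => by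
    rw [LinearMap.flip_apply, form_bw]; exact h w
  exact LinearMap.congr_fun this x

theorem skew_mem_radical {y : Words k I} (h : y ∈ radical D q) (i : I) :
    skew D q i y ∈ radical D q := (mem_radical D q).2 fun x => by
  have := (mem_radical D q).1 h (cons k i x)
  rw [form_cons_left] at this
  exact (mul_eq_zero.1 this).resolve_left (inv_ne_zero (qDiff_ne_zero D q i))

theorem rskew_mem_radical {y : Words k I} (h : y ∈ radical D q) (i : I) :
    rskew D q i y ∈ radical D q := (mem_radical D q).2 fun x => by
  have := (mem_radical D q).1 h (snoc k i x)
  rw [form_snoc_left] at this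
  exact (mul_eq_zero.1 this).resolve_left (inv_ne_zero (qDiff_ne_zero D q i))

theorem cons_mem_radical {y : Words k I} (h : y ∈ radical D q) (i : I) :
    cons k i y ∈ radical D q := (mem_radical D q).2 fun x => by
  rw [form_cons_right, (mem_radical D q).1 h, mul_zero]

theorem tw_mem_radical {y : Words k I} (h : y ∈ radical D q) (l : Module.Dual ℤ Φ) :
    tw D q l y ∈ radical D q := (mem_radical D q).2 fun x => by
  rw [form_tw, (mem_radical D q).1 h]

theorem S_mem_radical {y : Words k I} (h : y ∈ radical D q) (e : ℤ) :
    Words.S D q e y ∈ radical D q := (mem_radical D q).2 fun x => by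
  rw [← form_S, (mem_radical D q).1 h]

theorem mul_mem_radical {y : Words k I} (h : y ∈ radical D q) (x : Words k I) :
    Words.mul y x ∈ radical D q := (mem_radical D q).2 fun z => by
  rw [form_mul_right]
  have h0 : (form D q).flip y = 0 := LinearMap.ext fun x => (mem_radical D q).1 h x
  rw [h0]
  generalize Words.comul D q z = t
  induction t using TensorProduct.induction_on with
  | zero => simp
  | add x y hx hy => rw [map_add, hx, hy, add_zero]
  | tmul a b => simp

/-- The form descends to the quotient by the radical and separates its points. Evaluating the
coproduct of y on two such functionals gives (a b, y) = 0, so the coproduct vanishes in the tensor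
square of the quotient. -/
theorem comul_mem_radical {y : Words k I} (h : y ∈ radical D q) :
    TensorProduct.map (radical D q).mkQ (radical D q).mkQ (Words.comul D q y) = 0 := by
  let φ : Words k I → (Words k I ⧸ radical D q) →ₗ[k] k := fun x =>
    (radical D q).liftQ (form D q x) fun y hy => (mem_radical D q).1 hy x
  have hφ : ∀ v, (∀ x, φ x v = 0) → v = 0 := fun v hv => by
    obtain ⟨y, rfl⟩ := Submodule.mkQ_surjective _ v
    exact (Submodule.Quotient.mk_eq_zero _).2 ((mem_radical D q).2 fun x => hv x)
  refine eq_zero_of_separating hφ hφ _ fun a b => ?_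
  have h1 := (mem_radical D q).1 h (Words.mul a b)
  rw [form_mul_left] at h1
  rw [← h1]
  generalize Words.comul D q y = t
  induction t using TensorProduct.induction_on with
  | zero => simp
  | add x y hx hy => simp only [map_add, hx, hy]
  | tmul a b => simp [φ]; rfl

/-- A map out of the tensor square which kills the radical on either side kills the coproduct of
elements of the radical. -/
theorem comul_radical_eq_zero {Z : Type*} [AddCommGroup Z] [Module k Z]
    (f : Words k I →ₗ[k] Words k I →ₗ[k] Z) (h1 : ∀ y ∈ radical D q, ∀ x, f y x = 0)
    (h2 : ∀ y ∈ radical D q, ∀ x, f x y = 0) {y : Words k I} (h : y ∈ radical D q) :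
    TensorProduct.lift f (Words.comul D q y) = 0 := by
  let g : (Words k I ⧸ radical D q) →ₗ[k] (Words k I ⧸ radical D q) →ₗ[k] Z :=
    (radical D q).liftQ (LinearMap.flip ((radical D q).liftQ f.flip fun y hy =>
      LinearMap.ext fun x => h2 y hy x)) fun y hy => LinearMap.ext fun v => by
        obtain ⟨x, rfl⟩ := Submodule.mkQ_surjective _ v
        exact h1 y hy x
  have : ∀ t, TensorProduct.lift f t = TensorProduct.lift g
      (TensorProduct.map (radical D q).mkQ (radical D q).mkQ t) := fun t => by
    induction t using TensorProduct.induction_on with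
    | zero => simp
    | add x y hx hy => simp only [map_add, hx, hy]
    | tmul a b => rfl
  rw [this, comul_mem_radical D q h, map_zero]

theorem skewWord_mem_span (i : I) (w : List I) :
    skewWord D q i w ∈ Submodule.span k (bw k '' {w' | (i :: w').Perm w}) := by
  induction w with
  | nil => exact zero_mem _
  | cons j w ih =>
    rw [skewWord]
    refine add_mem ?_ (Submodule.smul_mem _ _ ?_)
    · split_ifs with h
      · subst h; exact Submodule.subset_span ⟨w, List.Perm.refl _, rfl⟩
      · exact zero_mem _
    · have := Submodule.mem_map_of_mem (f := cons k j) ih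
      rw [Submodule.map_span] at this
      refine Submodule.span_mono ?_ this
      rintro _ ⟨_, ⟨w', hw', rfl⟩, rfl⟩
      exact ⟨j :: w', (List.Perm.swap _ _ _).trans (hw'.cons j), (cons_bw j w').symm⟩

/-- Each letter of the first word is consumed by a derivation which deletes one equal letter of the
second, so a nonzero value needs the same letters with the same multiplicities. -/
theorem perm_of_form_ne_zero {u w : List I} (h : form D q (bw k u) (bw k w) ≠ 0) : u.Perm w := by
  induction u generalizing w with
  | nil =>
    rw [form_nil_left', Words.counit, bw, Finsupp.lapply_apply, Finsupp.single_apply] at h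
    have : w = [] := by by_contra h'; simp [h'] at h
    rw [this]
  | cons i u ih =>
    by_contra hp
    refine h ?_
    rw [← cons_bw, form_cons_left]
    have h1 : skew D q i (bw k w) = skewWord D q i w := by simp [skew, bw]
    have h2 : ∀ z ∈ Submodule.span k (bw k '' {w' | (i :: w').Perm w}),
        form D q (bw k u) z = 0 := fun z hz => by
      induction hz using Submodule.span_induction with
      | zero => simp
      | add x y _ _ hx hy => rw [map_add, hx, hy, add_zero]
      | smul c x _ hx => rw [map_smul, hx, smul_zero]
      | mem x hx =>
        obtain ⟨w', hw', rfl⟩ := hx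
        by_contra h3
        exact hp (((ih h3).cons i).trans hw')
    rw [h1, h2 _ (skewWord_mem_span D q i w), mul_zero]

/-- Truncation of an element of the radical to a set of words closed under permutations. -/
theorem sum_mem_radical {y : Words k I} (h : y ∈ radical D q) (P : List I → Prop)
    [DecidablePred P] (hP : ∀ u w : List I, u.Perm w → P u → P w) :
    ∑ w ∈ y.support.filter P, y w • bw k w ∈ radical D q := by
  intro u
  have hy := h u
  have h1 : y = ∑ w ∈ y.support, y w • bw k w := by
    conv_lhs => rw [← Finsupp.sum_single y]
    simp [Finsupp.sum, bw]
  rw [← form_bw] at hy ⊢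
  -- A word u pairs only with its permutations. If u lies in the set it sees all the relevant terms
  -- of y, and otherwise it sees none of the retained ones.
  by_cases hu : P u
  · rw [← hy]
    conv_rhs => rw [h1]
    rw [map_sum, map_sum, Finset.sum_filter]
    refine Finset.sum_congr rfl fun w _ => ?_
    split_ifs with hw
    · rfl
    · by_contra h2
      rw [map_smul] at h2
      exact hw (hP u w (perm_of_form_ne_zero D q fun h3 => h2 (by rw [h3, smul_zero])) hu)
  · rw [map_sum]
    refine Finset.sum_eq_zero fun w hw => ?_
    by_contra h2
    rw [map_smul] at h2
    exact hu (hP w u (perm_of_form_ne_zero D q fun h3 => h2 (by rw [h3, smul_zero])).symm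
      (Finset.mem_filter.1 hw).2)

/-- A map which on each weight space agrees with a map killing the radical kills the radical. -/
theorem radical_weight {Z : Type*} [AddCommGroup Z] [Module k Z]
    (ψ : (I →₀ ℤ) → Words k I →ₗ[k] Z) (hψ : ∀ n, ∀ y ∈ radical D q, ψ n y = 0)
    (φ : Words k I →ₗ[k] Z) (hφ : ∀ w, φ (bw k w) = ψ (D.wt w) (bw k w))
    {y : Words k I} (h : y ∈ radical D q) : φ y = 0 := by
  classical
  have h1 : y = ∑ w ∈ y.support, y w • bw k w := by
    conv_lhs => rw [← Finsupp.sum_single y]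
    simp [Finsupp.sum, bw]
  rw [h1, map_sum, ← Finset.sum_fiberwise_of_maps_to
    (t := y.support.image D.wt) (g := D.wt) fun w hw => Finset.mem_image_of_mem _ hw]
  refine Finset.sum_eq_zero fun n _ => ?_
  -- Permuted words have equal weight, so the part of y of weight n lies again in the radical.
  have h2 := hψ n _ (sum_mem_radical D q h (fun w => D.wt w = n)
    fun u w hp hu => by rw [← D.wt_perm hp, hu])
  rw [map_sum] at h2
  rw [← h2]
  refine Finset.sum_congr rfl fun w hw => ?_
  rw [map_smul, map_smul, hφ, (Finset.mem_filter.1 hw).2]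

end WordsAntipode

/-! ### The pairing of the Banach tensor algebras and the Nichols ideal -/

section Pairing

variable {k : Type*} [NormedField k] [IsUltrametricDist k]
  {I Φ : Type*} [AddCommGroup Φ] (D : RootDatum I Φ) (q : QNumber k)

instance {X Y : Type*} [SeminormedAddCommGroup X] [NormedSpace k X] [SeminormedAddCommGroup Y]
    [NormedSpace k Y] : Zero (BMap k X Y) := ⟨{ toLinearMap := 0, bound' := ⟨0, by simp⟩ }⟩

@[simp] theorem BMap.zero_apply {X Y : Type*} [SeminormedAddCommGroup X] [NormedSpace k X]
    [SeminormedAddCommGroup Y] [NormedSpace k Y] (x : X) : (0 : BMap k X Y) x = 0 := rfl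

/-- All coefficients are sums of powers of q, of norm one, and the norm is ultrametric. -/
theorem norm_skewWord_le (i : I) (w x : List I) : ‖skewWord D q i w x‖ ≤ 1 := by
  induction w generalizing x with
  | nil => simp [skewWord]
  | cons j w ih =>
    rw [skewWord, Finsupp.add_apply]
    refine (IsUltrametricDist.norm_add_le_max _ _).trans (max_le ?_ ?_)
    · split_ifs
      · classical
        rw [Finsupp.single_apply]
        split_ifs <;> simp
      · simp
    · rw [Finsupp.smul_apply, norm_smul, q.norm_zpow, one_mul, Finsupp.lmapDomain_apply]
      by_cases h : x ∈ Set.range (List.cons j)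
      · obtain ⟨x', rfl⟩ := h
        rw [Finsupp.mapDomain_apply (List.cons_injective)]
        exact ih x'
      · rw [Finsupp.mapDomain_of_notMem_range _ _ h]; simp

theorem norm_skew_le (i : I) (y : Words k I) {C : ℝ} (hC : 0 ≤ C) (hy : ∀ w, ‖y w‖ ≤ C)
    (x : List I) : ‖skew D q i y x‖ ≤ C := by
  rw [skew, Finsupp.linearCombination_apply, Finsupp.sum, Finsupp.finsetSum_apply]
  refine IsUltrametricDist.norm_sum_le_of_forall_le_of_nonneg hC fun w _ => ?_
  rw [Finsupp.smul_apply, norm_smul]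
  exact (mul_le_mul (hy w) (norm_skewWord_le D q i w x) (norm_nonneg _) hC).trans (mul_one C).le

/-- Skew derivations do not increase the sup norm of coefficients, and each letter contributes |q_i
- q_i⁻¹|⁻¹ ≤ r s. This is where the hypothesis on r and s makes the form continuous. -/
theorem norm_lform_le {r s : ℝ≥0} (hrs : ∀ i, 1 ≤ ‖qDiff k D q i‖ * r * s) (u : List I)
    (y : Words k I) {C : ℝ} (hC : 0 ≤ C) (hy : ∀ w, ‖y w‖ ≤ C) :
    ‖lform D q u y‖ ≤ (s * r) ^ u.length * C := by
  induction u generalizing y with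
  | nil => simpa [lform] using hy []
  | cons i u ih =>
    have h1 := ih (skew D q i y) (norm_skew_le D q i y hC hy)
    have h2 : 0 < ‖qDiff k D q i‖ := norm_pos_iff.2 (qDiff_ne_zero D q i)
    have h3 : ‖qDiff k D q i‖⁻¹ ≤ s * r := by
      rw [inv_le_iff_one_le_mul₀ h2]
      calc (1 : ℝ) ≤ _ := hrs i
        _ = _ := by ring
    rw [lform, LinearMap.smul_apply, norm_smul, norm_inv, List.length_cons, pow_succ',
      _root_.mul_assoc]
    exact mul_le_mul h3 h1 (norm_nonneg _) (by positivity)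

variable {D q} in
/-- The pairing of the Banach tensor algebras. -/
def pairT [CompleteSpace k] {r s : ℝ≥0} (hrs : ∀ i, 1 ≤ ‖qDiff k D q i‖ * r * s) :
    BMap k (CT k (TA k I s) (TA k I r)) k :=
  Cop.lift₂ (fun u w => form D q (bw k u) (bw k w)) fun u w => by
    by_cases h : form D q (bw k u) (bw k w) = 0
    · rw [h, norm_zero]; positivity
    -- Words which pair nontrivially have equal length, so the bound (s r)^n is s^n r^n, the product
    -- of the norms of the two words.
    · have hl := (perm_of_form_ne_zero D q h).length_eq
      rw [form_bw]
      refine (norm_lform_le D q hrs u (bw k w) zero_le_one fun x => ?_).trans (le_of_eq ?_)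
      · classical
        rw [bw, Finsupp.single_apply]
        split_ifs <;> simp
      · rw [mul_one, mul_pow, hl]; push_cast; rfl

variable (k I) in
/-- The free algebra as a dense subspace of the Banach tensor algebra. -/
def jT (r : ℝ≥0) : Words k I →ₗ[k] TA k I r := Cop.ofFinsupp k _

theorem jT_bw (r : ℝ≥0) (w : List I) : jT k I r (bw k w) = Cop.e k _ w := rfl

theorem jT_dense (r : ℝ≥0) : DenseRange (jT k I r) := Cop.denseRange_ofFinsupp

variable [CompleteSpace k]

theorem pairT_jT {r s : ℝ≥0} (hrs : ∀ i, 1 ≤ ‖qDiff k D q i‖ * r * s) (x y : Words k I) :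
    pairT hrs (tm k (jT k I s x) (jT k I r y)) = form D q x y := by
  have h1 : ∀ u, (pairT hrs).toLinearMap ∘ₗ (CT.inr (jT k I s (bw k u))).toLinearMap ∘ₗ
      jT k I r = form D q (bw k u) := fun u => Words.hom_ext fun w => by
    simp [jT_bw, pairT]
  have h2 : (pairT hrs).toLinearMap ∘ₗ (CT.inl (jT k I r y)).toLinearMap ∘ₗ
      jT k I s = (form D q).flip y := Words.hom_ext fun u => LinearMap.congr_fun (h1 u) y
  exact LinearMap.congr_fun h2 x

theorem TA.mul_jT (r : ℝ≥0) (x y : Words k I) :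
    TA.mul I r (tm k (jT k I r x) (jT k I r y)) = jT k I r (Words.mul x y) := by
  have h1 : ∀ u, (TA.mul I r).toLinearMap ∘ₗ (CT.inr (jT k I r (bw k u))).toLinearMap ∘ₗ
      jT k I r = jT k I r ∘ₗ Words.mul (bw k u) := fun u => Words.hom_ext fun w => by
    simp [jT_bw, TA.mul, Words.mul_bw]
  have h2 : (TA.mul I r).toLinearMap ∘ₗ (CT.inl (jT k I r y)).toLinearMap ∘ₗ
      jT k I r = jT k I r ∘ₗ Words.mul.flip y :=
    Words.hom_ext fun u => LinearMap.congr_fun (h1 u) y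
  exact LinearMap.congr_fun h2 x

theorem TA.consL_jT (r : ℝ≥0) (i : I) (y : Words k I) :
    TA.consL r i (jT k I r y) = jT k I r (cons k i y) :=
  LinearMap.congr_fun (Words.hom_ext (f := (TA.consL r i).toLinearMap ∘ₗ jT k I r)
    (g := jT k I r ∘ₗ cons k i) fun w => by simp [jT_bw, TA.consL, cons_bw]) y

theorem TA.scal_jT (r : ℝ≥0) (i : I) (y : Words k I) :
    TA.scal D q r i (jT k I r y) = jT k I r (tw D q (D.ti i) y) :=
  LinearMap.congr_fun (Words.hom_ext (f := (TA.scal D q r i).toLinearMap ∘ₗ jT k I r)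
    (g := jT k I r ∘ₗ tw D q (D.ti i)) fun w => by
      simp [jT_bw, TA.scal, tw_bw, RootDatum.ip, RootDatum.rt, RootDatum.ti]) y

theorem TA.comul_jT (r : ℝ≥0) (y : Words k I) :
    TA.comul D q r (jT k I r y) = CT.alg (jT k I r) (jT k I r) (Words.comul D q y) := by
  have key : ∀ w : List I, TA.comulWord D q r w =
      CT.alg (jT k I r) (jT k I r) (Words.comulWord D q w) := fun w => by
    induction w with
    | nil => rfl
    | cons i w ih =>
      rw [TA.comulWord, ih, Words.comulWord, Lop, LinearMap.add_apply, map_add]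
      have h1 := CT.map_alg (g := BMap.id k _) (g₀ := LinearMap.id) (j' := jT k I r)
        (i' := jT k I r) (TA.consL_jT r i) (fun _ => rfl) (Words.comulWord D q w)
      have h2 := CT.map_alg (TA.scal_jT D q r i) (TA.consL_jT r i) (Words.comulWord D q w)
      rw [h1, h2]
  exact LinearMap.congr_fun (Words.hom_ext (f := (TA.comul D q r).toLinearMap ∘ₗ jT k I r)
    (g := CT.alg (jT k I r) (jT k I r) ∘ₗ Words.comul D q) fun w => by
      have h : Words.comul D q (bw k w) = Words.comulWord D q w := by simp [Words.comul, bw]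
      change TA.comul D q r (Cop.e k _ w) = CT.alg _ _ (Words.comul D q (bw k w))
      rw [h, ← key, TA.comul, Cop.lift_e]) y

/-- The elements of the Banach tensor algebra orthogonal to all words. -/
def orth {r s : ℝ≥0} (hrs : ∀ i, 1 ≤ ‖qDiff k D q i‖ * r * s) : Submodule k (TA k I r) where
  carrier := {x | ∀ u, pairT hrs (tm k (Cop.e k _ u) x) = 0}
  add_mem' hx hy u := by rw [tm_add_right, map_add, hx u, hy u, add_zero]
  zero_mem' u := by rw [tm_zero_right, map_zero]
  smul_mem' c x hx u := by rw [tm_smul_right, map_smul, hx u, smul_zero]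

variable {r s : ℝ≥0}

theorem mem_orth (hrs : ∀ i, 1 ≤ ‖qDiff k D q i‖ * r * s) {x : TA k I r} :
    x ∈ orth D q hrs ↔ ∀ b, pairT hrs (tm k b x) = 0 := by
  refine ⟨fun h b => ?_, fun h u => h _⟩
  have : (pairT hrs).comp (CT.inl x) = 0 := Cop.hom_ext fun u => h u
  exact DFunLike.congr_fun this b

theorem jT_mem_orth (hrs : ∀ i, 1 ≤ ‖qDiff k D q i‖ * r * s) {y : Words k I} (h : y ∈ radical D q) : jT k I r y ∈ orth D q hrs :=
  fun u => by
    change pairT hrs (tm k (jT k I s (bw k u)) _) = 0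
    rw [pairT_jT]; exact (mem_radical D q).1 h _

theorem TA.pow_pos (hr : 0 < r) (w : List I) : 0 < r ^ w.length := by positivity

open scoped Classical in
/-- The projection to the words in a set. -/
def TA.proj (r : ℝ≥0) (P : Set (List I)) : BMap k (TA k I r) (TA k I r) :=
  Cop.lift (fun w => if w ∈ P then Cop.e k _ w else 0) ⟨1, zero_le_one, fun w => by
    rw [one_mul]
    split_ifs
    · exact Cop.norm_e_le _
    · simp⟩

theorem TA.proj_bound (P : Set (List I)) (x : TA k I r) : ‖TA.proj r P x‖ ≤ 1 * ‖x‖ :=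
  Cop.lift_bound _ _ zero_le_one (fun w => by
    rw [one_mul]
    split_ifs
    · exact Cop.norm_e_le _
    · simp) x

theorem TA.proj_jT (P : Set (List I)) (y : Words k I) (hy : ∀ w ∈ y.support, w ∈ P) :
    TA.proj r P (jT k I r y) = jT k I r y := by
  have h1 : y = ∑ w ∈ y.support, y w • bw k w := by
    conv_lhs => rw [← Finsupp.sum_single y]
    simp [Finsupp.sum, bw]
  rw [h1, map_sum, map_sum]
  refine Finset.sum_congr rfl fun w hw => ?_
  rw [map_smul, map_smul, jT_bw, TA.proj, Cop.lift_e, if_pos (hy w hw)]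

/-- The form vanishes between words which are not permutations of each other, so on a
permutation-stable set of words truncating x amounts to truncating the test word. -/
theorem pairT_proj (hrs : ∀ i, 1 ≤ ‖qDiff k D q i‖ * r * s) (P : Set (List I)) (hP : ∀ u w : List I, u.Perm w → u ∈ P → w ∈ P)
    (x : TA k I r) (u : List I) [Decidable (u ∈ P)] :
    pairT hrs (tm k (Cop.e k _ u) (TA.proj r P x)) =
      if u ∈ P then pairT hrs (tm k (Cop.e k _ u) x) else 0 := by
  have h0 : ∀ w, form D q (bw k u) (bw k w) ≠ 0 → (u ∈ P ↔ w ∈ P) := fun w h =>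
    ⟨hP u w (perm_of_form_ne_zero D q h), hP w u (perm_of_form_ne_zero D q h).symm⟩
  have h1 : ((pairT hrs).comp (CT.inr (Cop.e k _ u))).comp (TA.proj r P) =
      if u ∈ P then (pairT hrs).comp (CT.inr (Cop.e k _ u)) else 0 := Cop.hom_ext fun w => by
    have h2 := h0 w
    by_cases hu : u ∈ P <;> by_cases hw : w ∈ P
    · simp [hu, hw, TA.proj]
    · simp only [BMap.comp_apply, TA.proj, Cop.lift_e, if_neg hw, if_pos hu, map_zero,
        CT.inr_apply, pairT, Cop.lift₂_e]
      by_contra h3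
      exact hw ((h2 (Ne.symm h3)).1 hu)
    · simp only [BMap.comp_apply, TA.proj, Cop.lift_e, if_neg hu, if_pos hw, CT.inr_apply, pairT,
        Cop.lift₂_e, BMap.zero_apply]
      by_contra h3
      exact hu ((h2 h3).2 hw)
    · simp [hu, hw, TA.proj, tm_zero_right]
  refine (DFunLike.congr_fun h1 x).trans ?_
  split_ifs <;> rfl

theorem TA.coeff_proj (hr : 0 < r) (P : Set (List I)) (x : TA k I r) (u : List I) [Decidable (u ∈ P)] :
    Cop.coeff (TA.pow_pos hr) u (TA.proj r P x) =
      if u ∈ P then Cop.coeff (TA.pow_pos hr) u x else 0 := by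
  classical
  have h1 : (Cop.coeff (TA.pow_pos hr) u).comp (TA.proj r P) =
      if u ∈ P then Cop.coeff (k := k) (TA.pow_pos hr) u else 0 := Cop.hom_ext fun w => by
    simp only [BMap.comp_apply, TA.proj, Cop.lift_e]
    by_cases h : w = u
    · subst h; by_cases hw : w ∈ P <;> simp [hw]
    · by_cases hw : w ∈ P <;> by_cases hu : u ∈ P <;> simp [hw, hu, Cop.coeff_e, h]
  refine (DFunLike.congr_fun h1 x).trans ?_
  split_ifs <;> rfl

/-- Elements orthogonal to all words are limits of elements of the radical. -/
theorem mem_closure_of_mem_orth (hr : 0 < r)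
    (hrs : ∀ i, 1 ≤ ‖qDiff k D q i‖ * r * s) {x : TA k I r} (hx : x ∈ orth D q hrs) :
    x ∈ closure (jT k I r '' radical D q) := by
  classical
  rw [Metric.mem_closure_iff]
  intro e he
  obtain ⟨a, ha⟩ := (jT_dense (k := k) (I := I) r).exists_dist_lt x he
  -- Closing the support of the approximant a under permutations keeps it finite; the truncation of
  -- x to it is then a finite combination still orthogonal to all words, that is, an element of the
  -- radical.
  let S : Finset (List I) := a.support.biUnion fun w => w.permutations.toFinset
  have hS : ∀ w, w ∈ S ↔ ∃ v ∈ a.support, w.Perm v := fun w => by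
    simp only [S, Finset.mem_biUnion, List.mem_toFinset, List.mem_permutations]
  have hP : ∀ u w : List I, u.Perm w → u ∈ (S : Set (List I)) → w ∈ (S : Set (List I)) := by
    intro u w h hu
    obtain ⟨v, hv, h1⟩ := (hS u).1 hu
    exact (hS w).2 ⟨v, hv, h.symm.trans h1⟩
  let y : Words k I := ∑ w ∈ S, Cop.coeff (TA.pow_pos hr) w x • bw k w
  have hy : TA.proj r (S : Set (List I)) x = jT k I r y := by
    rw [← sub_eq_zero]
    refine Cop.eq_zero_of_coeff (TA.pow_pos hr) _ fun w => ?_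
    rw [map_sub, TA.coeff_proj hr, jT, Cop.coeff_ofFinsupp, Finsupp.finsetSum_apply]
    simp [bw, Finsupp.single_apply]
  refine ⟨_, ⟨y, ?_, rfl⟩, ?_⟩
  · refine (mem_radical D q).2 fun z => ?_
    have : (form D q).flip y = 0 := Words.hom_ext fun u => by
      rw [LinearMap.flip_apply, ← pairT_jT D q hrs, ← hy, jT_bw, pairT_proj D q hrs _ hP, hx u,
        ite_self, LinearMap.zero_apply]
    exact LinearMap.congr_fun this z
  · rw [← hy, dist_eq_norm]
    rw [dist_eq_norm] at ha
    -- The projection fixes a, so the error of truncating x is the error of truncating x - a, and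
    -- the projection is contractive.
    have h1 : x - TA.proj r (S : Set (List I)) x = (x - jT k I r a) +
        -(TA.proj r (S : Set (List I)) (x - jT k I r a)) := by
      rw [map_sub, TA.proj_jT _ a fun w hw => (hS w).2 ⟨w, hw, .refl _⟩]; abel
    rw [h1]
    refine (IsUltrametricDist.norm_add_le_max _ _).trans_lt (max_lt ha ?_)
    rw [norm_neg]
    exact ((TA.proj_bound _ _).trans (one_mul _).le).trans_lt ha

/-- If the values of `p` on products are given by a coproduct on dense subspaces, they are given by
it everywhere. -/
theorem pairing_mul_mem {X Y W W' : Type*} [NormedAddCommGroup X] [NormedSpace k X]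
    [NormedAddCommGroup Y] [NormedSpace k Y] [AddCommGroup W] [Module k W] [AddCommGroup W']
    [Module k W'] (p : BMap k (CT k X Y) k) (m : BMap k (CT k Y Y) Y) (j : W →ₗ[k] X)
    {j' : W' →ₗ[k] Y} (hj' : DenseRange j') (x : X) (t : W ⊗[k] W)
    (h : ∀ a b, p (tm k x (m (tm k (j' a) (j' b)))) =
      tfun (p.toLinearMap ∘ₗ (CT.inl (j' a)).toLinearMap ∘ₗ j)
        (p.toLinearMap ∘ₗ (CT.inl (j' b)).toLinearMap ∘ₗ j) t) (y y' : Y)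
    (hy : (∀ a, p (tm k a y) = 0) ∨ ∀ a, p (tm k a y') = 0) : p (tm k x (m (tm k y y'))) = 0 := by
  let G : W ⊗[k] W →ₗ[k] CT k X X := CT.alg j j
  have h1 : ∀ t a b, tfun (p.toLinearMap ∘ₗ (CT.inl a).toLinearMap ∘ₗ j)
        (p.toLinearMap ∘ₗ (CT.inl b).toLinearMap ∘ₗ j) t =
      CT.lid k k (CT.map p p (CT.mid k X X Y Y (tm k (G t) (tm k a b)))) := fun t a b => by
    induction t using TensorProduct.induction_on with
    | zero => simp [tm_zero_left]
    | add a b ha hb => simp only [map_add, tm_add_left, ha, hb]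
    | tmul a b => simp [G]
  have h2 : p.comp ((CT.inr x).comp m) = (CT.lid k k).comp ((CT.map p p).comp
      ((CT.mid k X X Y Y).comp (CT.inr (G t)))) := CT.hom_ext_dense hj' hj' fun a b => by
    simp only [BMap.comp_apply, CT.inr_apply, h, h1]
  have h3 : ∀ t, tfun (p.toLinearMap ∘ₗ (CT.inl y).toLinearMap ∘ₗ j)
        (p.toLinearMap ∘ₗ (CT.inl y').toLinearMap ∘ₗ j) t = 0 := fun t => by
    induction t using TensorProduct.induction_on with
    | zero => simp
    | add a b ha hb => rw [map_add, ha, hb, add_zero]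
    | tmul a b => rcases hy with hy | hy <;> simp [hy]
  exact (DFunLike.congr_fun h2 (tm k y y')).trans ((h1 t y y').symm.trans (h3 t))

theorem orth_mul (hrs : ∀ i, 1 ≤ ‖qDiff k D q i‖ * r * s) (x y : TA k I r)
    (hx : x ∈ orth D q hrs ∨ y ∈ orth D q hrs) : TA.mul I r (tm k x y) ∈ orth D q hrs := fun u => by
  refine pairing_mul_mem (pairT hrs) (TA.mul I r) (jT k I s) (jT_dense r) _
    (Words.comul D q (bw k u)) (fun a b => ?_) x y (by simpa only [mem_orth] using hx)
  rw [TA.mul_jT, ← jT_bw, pairT_jT, form_mul_right]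
  congr 2 <;> exact LinearMap.ext fun z => (pairT_jT D q hrs z _).symm

/-- The orthogonal is an ideal because products are adjoint to coproducts. It is homogeneous because
truncation by length is compatible with the form. It vanishes in degrees zero and one, where the
form is diagonal with nonzero entries. It is a coideal because this holds for the radical, which is
dense in it. -/
theorem orth_isNicholsIdeal (hr : 0 < r)
    (hrs : ∀ i, 1 ≤ ‖qDiff k D q i‖ * r * s) : IsNicholsIdeal D q r (orth D q hrs) where
  left x y hy := orth_mul D q hrs x y (.inr hy)
  right x hx y := orth_mul D q hrs x y (.inl hx)
  homogeneous x hx n u := by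
    classical
    have : TA.pr (k := k) I r n = TA.proj r {w | w.length = n} :=
      Cop.hom_ext fun w => by simp [TA.pr, TA.proj]
    rw [this, pairT_proj D q hrs _ fun u w h hu => by
      rw [Set.mem_ofPred_eq] at hu ⊢; rw [← h.length_eq, hu], hx u, ite_self]
  pr_zero x hx := by
    classical
    have : TA.pr (k := k) I r 0 = TA.proj r {w | w.length = 0} :=
      Cop.hom_ext fun w => by simp [TA.pr, TA.proj]
    refine Cop.eq_zero_of_coeff (TA.pow_pos hr) _ fun w => ?_
    rw [this, TA.coeff_proj hr]
    split_ifs with hw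
    · obtain rfl : w = [] := List.length_eq_zero_iff.1 hw
      rw [← hx []]
      refine DFunLike.congr_fun (f := Cop.coeff (TA.pow_pos hr) [])
        (g := (pairT hrs).comp (CT.inr (Cop.e k _ []))) (Cop.hom_ext fun u => ?_) x
      have h : form D q (bw k []) (bw k u) = if u = [] then 1 else 0 := by
        rw [form_nil_left, bw, Finsupp.single_apply]
      simp only [BMap.comp_apply, CT.inr_apply, pairT, Cop.lift₂_e, Cop.coeff_e, h]
    · rfl
  pr_one x hx := by
    classical
    have : TA.pr (k := k) I r 1 = TA.proj r {w | w.length = 1} :=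
      Cop.hom_ext fun w => by simp [TA.pr, TA.proj]
    refine Cop.eq_zero_of_coeff (TA.pow_pos hr) _ fun w => ?_
    rw [this, TA.coeff_proj hr]
    split_ifs with hw
    · obtain ⟨i, rfl⟩ : ∃ i, w = [i] := List.length_eq_one_iff.1 hw
      have h1 := hx [i]
      -- Pairing with v_i reads off the coefficient of v_i up to the nonzero factor 1/(q_i - q_i⁻¹).
      have h2 : (CT.lid k k).comp ((CT.inr (qDiff k D q i)⁻¹).comp (Cop.coeff (TA.pow_pos hr) [i]))
          = (pairT hrs).comp (CT.inr (Cop.e k _ [i])) := Cop.hom_ext fun u => by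
        simp only [BMap.comp_apply, CT.inr_apply, CT.lid_tm, Cop.coeff_e, pairT, Cop.lift₂_e,
          smul_eq_mul]
        by_cases hu : u = [i]
        · subst hu
          rw [if_pos rfl, ← cons_bw, form_cons_left, skew_cons]
          simp [skew_nil, form_nil_left', Words.counit_nil]
        · rw [if_neg hu, mul_zero]
          by_contra h3
          exact hu (List.perm_singleton.1 (perm_of_form_ne_zero D q (Ne.symm h3)).symm)
      have h3 := (DFunLike.congr_fun h2 x).trans h1
      simp only [BMap.comp_apply, CT.inr_apply, CT.lid_tm, smul_eq_mul] at h3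
      exact (mul_eq_zero.1 h3).resolve_left (inv_ne_zero (qDiff_ne_zero D q i))
    · rfl
  coideal x hx := by
    let K : Submodule k (CT k (TA k I r) (TA k I r)) :=
      Submodule.span k {z | ∃ a b, (a ∈ orth D q hrs ∨ b ∈ orth D q hrs) ∧ tm k a b = z}
    have hK : IsClosed ((fun x => TA.comul D q r x) ⁻¹' (K.topologicalClosure : Set _)) :=
      K.isClosed_topologicalClosure.preimage (TA.comul D q r).continuous
    -- The condition is closed, so it is enough to check it on images of elements of the algebraic
    -- radical.
    refine closure_minimal ?_ hK (mem_closure_of_mem_orth D q hr hrs hx)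
    rintro _ ⟨y, hy, rfl⟩
    rw [Set.mem_preimage, TA.comul_jT]
    refine K.le_topologicalClosure ?_
    let f : Words k I →ₗ[k] Words k I →ₗ[k] (CT k (TA k I r) (TA k I r) ⧸ K) :=
      (TensorProduct.mk k _ _).compr₂ (K.mkQ ∘ₗ CT.alg (jT k I r) (jT k I r))
    have h1 := comul_radical_eq_zero D q f (fun y hy x => (Submodule.Quotient.mk_eq_zero K).2
        (Submodule.subset_span ⟨_, _, Or.inl (jT_mem_orth D q hrs hy), rfl⟩))
      (fun y hy x => (Submodule.Quotient.mk_eq_zero K).2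
        (Submodule.subset_span ⟨_, _, Or.inr (jT_mem_orth D q hrs hy), rfl⟩)) hy
    have h2 : TensorProduct.lift f = K.mkQ ∘ₗ CT.alg (jT k I r) (jT k I r) :=
      TensorProduct.ext' fun a b => rfl
    rw [h2] at h1
    exact (Submodule.Quotient.mk_eq_zero K).1 h1

/-- Pairing with a word i u is pairing the coproduct with v_i ⊗ u. By the coideal property this only
meets tensors with one factor in J: a left factor is killed by v_i because J has no component of
degree one, and a right factor is killed by u by induction. The empty word is handled by the absence
of degree zero. -/
theorem IsNicholsIdeal.le_orth
    (hrs : ∀ i, 1 ≤ ‖qDiff k D q i‖ * r * s) {J : Submodule k (TA k I r)} (hJ : IsNicholsIdeal D q r J) :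
    J ≤ orth D q hrs := by
  classical
  have h0 : ∀ x ∈ J, pairT hrs (tm k (Cop.e k _ []) x) = 0 := fun x hx => by
    have h1 : (pairT hrs).comp (CT.inr (Cop.e k _ [])) =
        ((pairT hrs).comp (CT.inr (Cop.e k _ []))).comp (TA.pr I r 0) := Cop.hom_ext fun w => by
      by_cases hw : w = []
      · simp [hw, TA.pr]
      · have h1 : (bw k w) [] = 0 := by simp [bw, hw]
        simp [hw, TA.pr, pairT, form_nil_left, h1, tm_zero_right]
    refine (DFunLike.congr_fun h1 x).trans ?_
    rw [BMap.comp_apply, hJ.pr_zero x hx, map_zero]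
  have h1 : ∀ i, ∀ x ∈ J, pairT hrs (tm k (Cop.e k _ [i]) x) = 0 := fun i x hx => by
    have h1 : (pairT hrs).comp (CT.inr (Cop.e k _ [i])) =
        ((pairT hrs).comp (CT.inr (Cop.e k _ [i]))).comp (TA.pr I r 1) := Cop.hom_ext fun w => by
      by_cases hw : w.length = 1
      · simp [hw, TA.pr]
      · simp only [BMap.comp_apply, TA.pr, Cop.lift_e, if_neg hw, map_zero, CT.inr_apply, pairT,
          Cop.lift₂_e]
        by_contra h3
        exact hw (perm_of_form_ne_zero D q h3).length_eq.symm
    refine (DFunLike.congr_fun h1 x).trans ?_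
    rw [BMap.comp_apply, hJ.pr_one x hx, map_zero]
  intro x hx u
  induction u generalizing x with
  | nil => exact h0 x hx
  | cons i u ih =>
    let F : BMap k (CT k (TA k I r) (TA k I r)) k := (CT.lid k k).comp
      (CT.map ((pairT hrs).comp (CT.inr (Cop.e k _ [i])))
        ((pairT hrs).comp (CT.inr (Cop.e k _ u))))
    have h2 : (pairT hrs).comp (CT.inr (Cop.e k _ (i :: u))) = F.comp (TA.comul D q r) :=
      BMap.ext_dense (jT_dense r) fun y => by
        rw [BMap.comp_apply, BMap.comp_apply, CT.inr_apply, TA.comul_jT, ← jT_bw, pairT_jT]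
        have : bw k (i :: u) = Words.mul (bw k [i]) (bw k u) := by rw [Words.mul_bw]; rfl
        rw [this, form_mul_left]
        generalize Words.comul D q y = t
        induction t using TensorProduct.induction_on with
        | zero => simp
        | add a b ha hb => simp only [map_add, ha, hb]
        | tmul a b => simp [F, ← jT_bw, pairT_jT]
    refine (DFunLike.congr_fun h2 x).trans ?_
    have h3 : IsClosed (F ⁻¹' {0}) := isClosed_singleton.preimage F.continuous
    refine closure_minimal ?_ h3 (hJ.coideal x hx)
    intro z hz
    rw [Set.mem_preimage, Set.mem_singleton_iff]
    induction hz using Submodule.span_induction with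
    | zero => simp
    | add x y _ _ hx hy => rw [map_add, hx, hy, add_zero]
    | smul c x _ hx => rw [map_smul, hx, smul_zero]
    | mem z hz =>
      obtain ⟨a, b, hab, rfl⟩ := hz
      rcases hab with ha | hb
      · simp [F, h1 i a ha]
      · simp [F, ih hb]

/-- The orthogonal is itself a Nichols ideal and contains all others, and it is closed because the
pairing is continuous. Taking the closure of the sum of all of them therefore adds nothing. -/
theorem nicholsIdeal_eq (hr : 0 < r)
    (hrs : ∀ i, 1 ≤ ‖qDiff k D q i‖ * r * s) : nicholsIdeal D q r = orth D q hrs := by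
  refine le_antisymm ?_ ?_
  · refine Submodule.topologicalClosure_minimal _
      (sSup_le fun J hJ => IsNicholsIdeal.le_orth D q hrs hJ) ?_
    have : (orth D q hrs : Set (TA k I r)) =
        ⋂ u, ((pairT hrs).comp (CT.inr (Cop.e k _ u))) ⁻¹' {0} := by
      ext x; simp [orth]
    rw [this]
    exact isClosed_iInter fun u => isClosed_singleton.preimage (BMap.continuous _)
  · exact (le_sSup (a := orth D q hrs) (orth_isNicholsIdeal D q hr hrs)).trans
      (Submodule.le_topologicalClosure _)

end Pairing

/-! ### Structures modelled on the braided Hopf algebra of words -/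

section Model

variable {k : Type*} [NormedField k] [IsUltrametricDist k] [CompleteSpace k]
  {I Φ : Type*} [AddCommGroup Φ] (D : RootDatum I Φ) (q : QNumber k)
variable {H A X Y : Type*} [NormedAddCommGroup H] [NormedSpace k H]
  [NormedAddCommGroup A] [NormedSpace k A]
  [NormedAddCommGroup X] [NormedSpace k X] [CompleteSpace X] [IsUltrametricDist X]
  [NormedAddCommGroup Y] [NormedSpace k Y] [CompleteSpace Y] [IsUltrametricDist Y]

/-- `H` and `A` are completions of the group algebras of `Φ*` and `ℤ^(I)`, with their Hopf algebra
structures, their pairing and the two maps `A → H`. -/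
structure CartanModel (jH : (Module.Dual ℤ Φ →₀ k) →ₗ[k] H) (eA : (I →₀ ℤ) → A)
    (hH : HopfStr k H) (hA : HopfStr k A) (ev : BMap k (CT k H A) k) (R Rbar : BMap k A H) :
    Prop where
  dense : DenseRange jH
  H_one : hH.one = jH (.single 0 1)
  H_mul : ∀ l m, hH.mul (tm k (jH (.single l 1)) (jH (.single m 1))) = jH (.single (l + m) 1)
  H_counit : ∀ l, hH.counit (jH (.single l 1)) = 1
  H_comul : ∀ l, hH.comul (jH (.single l 1)) = tm k (jH (.single l 1)) (jH (.single l 1))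
  H_antipode : ∀ l, hH.antipode (jH (.single l 1)) = jH (.single (-l) 1)
  A_one : hA.one = eA 0
  A_mul : ∀ n m, hA.mul (tm k (eA n) (eA m)) = eA (n + m)
  A_counit : ∀ n, hA.counit (eA n) = 1
  A_comul : ∀ n, hA.comul (eA n) = tm k (eA n) (eA n)
  ev : ∀ l n, ev (tm k (jH (.single l 1)) (eA n)) = q.val ^ (l (D.toRoot n))
  R : ∀ n, R (eA n) = jH (.single (D.tK n) 1)
  Rbar : ∀ n, Rbar (eA n) = jH (.single (-D.tK n) 1)

/-- The structure maps of `S` extend those of the braided Hopf algebra of words. -/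
structure NicholsModel (eA : (I →₀ ℤ) → A) (j : Words k I →ₗ[k] X) (S : ComodHopfStr k A X) :
    Prop where
  dense : DenseRange j
  one : S.one = j (bw k [])
  mul : ∀ x y, S.mul (tm k (j x) (j y)) = j (Words.mul x y)
  counit : ∀ x, S.counit (j x) = Words.counit k I x
  comul : ∀ x, S.comul (j x) = CT.alg j j (Words.comul D q x)
  antipode : ∀ x, S.antipode (j x) = j (Words.S D q 1 x)
  antipodeInv : ∀ x, S.antipodeInv (j x) = j (Words.S D q (-1) x)
  coact : ∀ w, S.coact (j (bw k w)) = tm k (eA (D.wt w)) (j (bw k w))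

variable {D q} {jH : (Module.Dual ℤ Φ →₀ k) →ₗ[k] H} {eA : (I →₀ ℤ) → A} {hH : HopfStr k H}
  {hA : HopfStr k A} {ev : BMap k (CT k H A) k} {R Rbar : BMap k A H}
  {j : Words k I →ₗ[k] X} {S : ComodHopfStr k A X} {j' : Words k I →ₗ[k] Y}
  {S' : ComodHopfStr k A Y}

theorem CT.hom_ext_dense_left {k X Y Z W X₀ Y₀ Z₀ : Type*} [NormedField k]
    [NormedAddCommGroup X] [NormedSpace k X] [NormedAddCommGroup Y] [NormedSpace k Y]
    [NormedAddCommGroup Z] [NormedSpace k Z] [NormedAddCommGroup W] [NormedSpace k W]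
    [AddCommGroup X₀] [Module k X₀] [AddCommGroup Y₀] [Module k Y₀] [AddCommGroup Z₀]
    [Module k Z₀] {j : X₀ →ₗ[k] X} {j' : Y₀ →ₗ[k] Y} {j'' : Z₀ →ₗ[k] Z} (hj : DenseRange j)
    (hj' : DenseRange j') (hj'' : DenseRange j'') {f g : BMap k (CT k (CT k X Y) Z) W}
    (h : ∀ a b c, f (tm k (tm k (j a) (j' b)) (j'' c)) = g (tm k (tm k (j a) (j' b)) (j'' c))) :
    f = g :=
  CT.hom_ext_dense (j := CT.alg j j') (CT.denseRange_alg hj hj') hj'' fun z c => by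
    induction z using TensorProduct.induction_on with
    | zero => rw [map_zero, tm_zero_left, map_zero, map_zero]
    | add a b ha hb => rw [map_add, tm_add_left, map_add, map_add, ha, hb]
    | tmul a b => exact h a b c

theorem CT.hom_ext_dense_right {k X Y Z W X₀ Y₀ Z₀ : Type*} [NormedField k]
    [NormedAddCommGroup X] [NormedSpace k X] [NormedAddCommGroup Y] [NormedSpace k Y]
    [NormedAddCommGroup Z] [NormedSpace k Z] [NormedAddCommGroup W] [NormedSpace k W]
    [AddCommGroup X₀] [Module k X₀] [AddCommGroup Y₀] [Module k Y₀] [AddCommGroup Z₀]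
    [Module k Z₀] {j : X₀ →ₗ[k] X} {j' : Y₀ →ₗ[k] Y} {j'' : Z₀ →ₗ[k] Z} (hj : DenseRange j)
    (hj' : DenseRange j') (hj'' : DenseRange j'') {f g : BMap k (CT k X (CT k Y Z)) W}
    (h : ∀ a b c, f (tm k (j a) (tm k (j' b) (j'' c))) = g (tm k (j a) (tm k (j' b) (j'' c)))) :
    f = g :=
  CT.hom_ext_dense (j' := CT.alg j' j'') hj (CT.denseRange_alg hj' hj'') fun a z => by
    induction z using TensorProduct.induction_on with
    | zero => rw [map_zero, tm_zero_right, map_zero, map_zero]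
    | add b c hb hc => rw [map_add, tm_add_right, map_add, map_add, hb, hc]
    | tmul b c => exact h a b c

theorem act_model (hM : CartanModel D q jH eA hH hA ev R Rbar) (hS : NicholsModel D q eA j S)
    (l : Module.Dual ℤ Φ) (y : Words k I) :
    act ev S.coact (tm k (jH (.single l 1)) (j y)) = j (tw D q l y) := by
  have : (act ev S.coact).toLinearMap ∘ₗ (CT.inr (jH (.single l 1))).toLinearMap ∘ₗ j =
      j ∘ₗ tw D q l := Words.hom_ext fun w => by
    simp [act, hS.coact, hM.ev, tw_bw, RootDatum.rt]
  exact LinearMap.congr_fun this y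

theorem ract_model (hM : CartanModel D q jH eA hH hA ev R Rbar) (hS : NicholsModel D q eA j S)
    (l : Module.Dual ℤ Φ) (y : Words k I) :
    ract ev S.coact (tm k (j y) (jH (.single l 1))) = j (tw D q l y) := by
  rw [ract, BMap.comp_apply, CT.swap_tm, act_model hM hS]

theorem psi_model {Q : BMap k A H} {τ : (I →₀ ℤ) → Module.Dual ℤ Φ}
    (hM : CartanModel D q jH eA hH hA ev R Rbar) (hQ : ∀ n, Q (eA n) = jH (.single (τ n) 1))
    (hS : NicholsModel D q eA j S) (u : List I) (y : Words k I) :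
    psi ev Q S.coact S.coact (tm k (j (bw k u)) (j y)) =
      tm k (j (tw D q (τ (D.wt u)) y)) (j (bw k u)) := by
  have : (psi ev Q S.coact S.coact).toLinearMap ∘ₗ (CT.inr (j (bw k u))).toLinearMap ∘ₗ j =
      (CT.inl (j (bw k u))).toLinearMap ∘ₗ j ∘ₗ tw D q (τ (D.wt u)) := Words.hom_ext fun w => by
    simp [psi, hS.coact, hM.ev, hQ, tw_bw, RootDatum.rt]
  exact LinearMap.congr_fun this y

/-- By density the axioms reduce to those already known for words; it only remains to identify the
braiding given by coaction and pairing with the one hidden in `braidedMul`. -/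
theorem NicholsModel.isHopf (hM : CartanModel D q jH eA hH hA ev R Rbar)
    (hS : NicholsModel D q eA j S) : IsHopf (psi ev R S.coact S.coact) S.toHopfStr := by
  refine IsHopf.of_dense j hS.dense (bw k []) Words.mul (Words.counit k I) (Words.comul D q)
    (Words.S D q 1) (braidedMul D q) hS.one.symm hS.mul hS.counit hS.comul hS.antipode
    (fun a b c d => ?_) Words.mul_assoc Words.nil_mul Words.mul_nil (Words.coassoc D q)
    (Words.counit_comul D q) (Words.comul_counit D q) (Words.comul_mul D q)
    (Words.comul_nil D q) Words.counit_mul Words.counit_nil (Words.antipode_left D q)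
    (Words.antipode_right D q)
  let f : Words k I →ₗ[k] CT k X X := (CT.map S.mul S.mul).toLinearMap ∘ₗ
    (CT.midWith (psi ev R S.coact S.coact)).toLinearMap ∘ₗ
    (CT.inl (tm k (j c) (j d))).toLinearMap ∘ₗ (CT.inr (j a)).toLinearMap ∘ₗ j
  let g : Words k I →ₗ[k] CT k X X := CT.alg j j ∘ₗ
    (braidedMul D q).flip (c ⊗ₜ d) ∘ₗ TensorProduct.mk k _ _ a
  have : f = g := Words.hom_ext fun w => by
    simp [f, g, braidedMul_tmul, CT.midWith, psi_model hM hM.R hS, hS.mul]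
  exact LinearMap.congr_fun this b

theorem coact_counit_model (hS : NicholsModel D q eA j S) (x : Words k I) :
    CT.map (BMap.id k A) S.counit (S.coact (j x)) = tm k (eA 0) (Words.counit k I x) := by
  have : (CT.map (BMap.id k A) S.counit).toLinearMap ∘ₗ S.coact.toLinearMap ∘ₗ j =
      (CT.inr (eA 0)).toLinearMap ∘ₗ Words.counit k I := Words.hom_ext fun w => by
    cases w with
    | nil => simp [hS.coact, hS.counit, RootDatum.wt]
    | cons i w =>
      have : Words.counit k I (bw k (i :: w)) = 0 := by rw [← cons_bw, Words.counit_cons]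
      simp [hS.coact, hS.counit, this, tm_zero_right]
  exact LinearMap.congr_fun this x

theorem coact_weight (hS : NicholsModel D q eA j S) {n : I →₀ ℤ} {y : Words k I}
    (hy : y ∈ Submodule.span k (bw k '' {w | D.wt w = n})) :
    S.coact (j y) = tm k (eA n) (j y) := by
  induction hy using Submodule.span_induction with
  | zero => simp [tm_zero_right]
  | add x y _ _ hx hy => simp only [map_add, hx, hy, tm_add_right]
  | smul c x _ hx => simp only [map_smul, hx, tm_smul_right]
  | mem y h => obtain ⟨w, rfl, rfl⟩ := h; exact hS.coact w

variable (D q) in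
theorem S_bw_mem (e : ℤ) (w : List I) : Words.S D q e (bw k w) ∈
    Submodule.span k (bw k '' {w' : List I | D.wt w' = D.wt w}) := by
  induction w with
  | nil => rw [Words.S_nil]; exact Submodule.subset_span ⟨_, rfl, rfl⟩
  | cons i w ih =>
    rw [← cons_bw, Words.S_cons, tw_bw, map_smul, map_smul]
    refine Submodule.neg_mem _ (Submodule.smul_mem _ _ ?_)
    have h1 := Submodule.mem_map_of_mem (f := snoc k i) ih
    refine (Submodule.map_span_le _ _ _).2 ?_ h1
    rintro _ ⟨w', hw', rfl⟩
    rw [snoc_bw]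
    refine Submodule.subset_span ⟨_, ?_, rfl⟩
    have h2 : D.wt w' = D.wt w := hw'
    change D.wt (w' ++ [i]) = D.wt (i :: w)
    rw [D.wt_append, h2]
    simp [RootDatum.wt, add_comm]

/-- The span of the tensors of words of total weight `n`. -/
def weightTensors (k : Type*) [NormedField k] (D : RootDatum I Φ) (n : I →₀ ℤ) :
    Submodule k (Words k I ⊗[k] Words k I) :=
  Submodule.span k {z | ∃ u w, D.wt u + D.wt w = n ∧ bw k u ⊗ₜ bw k w = z}

variable (D q) in
theorem comul_bw_mem (w : List I) : Words.comul D q (bw k w) ∈ weightTensors k D (D.wt w) := by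
  induction w with
  | nil => rw [Words.comul_nil]; exact Submodule.subset_span ⟨[], [], by simp [RootDatum.wt], rfl⟩
  | cons i w ih =>
    rw [← cons_bw, Words.comul_cons]
    refine (Submodule.map_span_le (Lop D q i) _ _).2 ?_ (Submodule.mem_map_of_mem ih)
    rintro _ ⟨u, w', h, rfl⟩
    rw [Lop_tmul, tw_bw, ← TensorProduct.smul_tmul', cons_bw, cons_bw]
    refine add_mem (Submodule.subset_span ⟨i :: u, w', ?_, rfl⟩)
      (Submodule.smul_mem _ _ (Submodule.subset_span ⟨u, i :: w', ?_, rfl⟩))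
    · simp only [RootDatum.wt, ← h, add_assoc]
    · simp only [RootDatum.wt, ← h]; abel

theorem coact_weightTensors (hM : CartanModel D q jH eA hH hA ev R Rbar)
    (hS : NicholsModel D q eA j S) {n : I →₀ ℤ} {z : Words k I ⊗[k] Words k I}
    (hz : z ∈ weightTensors k D n) :
    CT.map hA.mul (BMap.id k (CT k X X)) (CT.mid k A X A X
      (CT.map S.coact S.coact (CT.alg j j z))) = tm k (eA n) (CT.alg j j z) := by
  induction hz using Submodule.span_induction with
  | zero => simp [tm_zero_right]
  | add x y _ _ hx hy => simp only [map_add, hx, hy, tm_add_right]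
  | smul c x _ hx => simp only [map_smul, hx, tm_smul_right]
  | mem y h => obtain ⟨u, w, rfl, rfl⟩ := h; simp [hS.coact, hM.A_mul]

theorem NicholsModel.isComodHopf (hM : CartanModel D q jH eA hH hA ev R Rbar)
    (hS : NicholsModel D q eA j S) : IsComodHopf hA ev R S where
  hopf := hS.isHopf hM
  coact_coassoc := BMap.ext_dense hS.dense fun x => by
    refine LinearMap.congr_fun (Words.hom_ext (f := ((CT.assoc k A A X).comp
      ((CT.map hA.comul (BMap.id k X)).comp S.coact)).toLinearMap ∘ₗ j)
      (g := ((CT.map (BMap.id k A) S.coact).comp S.coact).toLinearMap ∘ₗ j) fun w => ?_) x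
    simp [hS.coact, hM.A_comul]
  coact_counit x := by
    refine DFunLike.congr_fun (f := (CT.lid k X).comp ((CT.map hA.counit (BMap.id k X)).comp
      S.coact)) (g := BMap.id k X) (BMap.ext_dense hS.dense fun x => ?_) x
    refine LinearMap.congr_fun (Words.hom_ext (f := ((CT.lid k X).comp
      ((CT.map hA.counit (BMap.id k X)).comp S.coact)).toLinearMap ∘ₗ j) (g := j) fun w => ?_) x
    simp [hS.coact, hM.A_counit]
  coact_one := by rw [hS.one, hS.coact, hM.A_one]; rfl
  coact_mul := CT.hom_ext_dense hS.dense hS.dense fun x y => by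
    let f : Words k I →ₗ[k] Words k I →ₗ[k] CT k A X :=
      Words.mul.compr₂ (S.coact.toLinearMap ∘ₗ j)
    let T : CT k X X →ₗ[k] CT k A X := (CT.map hA.mul S.mul).toLinearMap ∘ₗ
      (CT.mid k A X A X).toLinearMap ∘ₗ (CT.map S.coact S.coact).toLinearMap
    let g : Words k I →ₗ[k] Words k I →ₗ[k] CT k A X :=
      (TensorProduct.mk k _ _).compr₂ (T ∘ₗ CT.alg j j)
    have : f = g := Words.hom_ext₂ fun u w => by
      simp [f, g, T, hS.coact, hM.A_mul, hS.mul, Words.mul_bw, D.wt_append]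
    have h := LinearMap.congr_fun₂ this x y
    simp only [f, g, T, LinearMap.compr₂_apply, LinearMap.comp_apply, TensorProduct.mk_apply,
      CT.alg_tmul, BMap.coe_toLinearMap] at h
    simp only [BMap.comp_apply, hS.mul, h]
  coact_comul := BMap.ext_dense hS.dense fun x => by
    refine LinearMap.congr_fun (Words.hom_ext (f := ((CT.map (BMap.id k A) S.comul).comp
      S.coact).toLinearMap ∘ₗ j) (g := ((CT.map hA.mul (BMap.id k (CT k X X))).comp
      ((CT.mid k A X A X).comp ((CT.map S.coact S.coact).comp S.comul))).toLinearMap ∘ₗ j)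
        fun w => ?_) x
    have := coact_weightTensors hM hS (comul_bw_mem D q w)
    simp only [LinearMap.comp_apply, BMap.coe_toLinearMap, BMap.comp_apply, hS.comul, this,
      hS.coact, CT.map_tm, BMap.id_apply]
  coact_counit' x := by
    refine DFunLike.congr_fun (f := (CT.map (BMap.id k A) S.counit).comp S.coact)
      (g := (CT.inr hA.one).comp S.counit) (BMap.ext_dense hS.dense fun x => ?_) x
    rw [BMap.comp_apply, coact_counit_model hS, BMap.comp_apply, hS.counit, hM.A_one]; rfl
  coact_antipode := BMap.ext_dense hS.dense fun x => by
    refine LinearMap.congr_fun (Words.hom_ext (f := (S.coact.comp S.antipode).toLinearMap ∘ₗ j)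
      (g := ((CT.map (BMap.id k A) S.antipode).comp S.coact).toLinearMap ∘ₗ j) fun w => ?_) x
    simp only [LinearMap.comp_apply, BMap.coe_toLinearMap, BMap.comp_apply, hS.antipode,
      hS.coact, CT.map_tm, BMap.id_apply]
    exact coact_weight hS (S_bw_mem D q 1 w)
  antipode_inv x := by
    refine DFunLike.congr_fun (f := S.antipode.comp S.antipodeInv) (g := BMap.id k X)
      (BMap.ext_dense hS.dense fun x => ?_) x
    simp [hS.antipodeInv, hS.antipode, Words.S_S D q 1 (-1) rfl]
  inv_antipode x := by
    refine DFunLike.congr_fun (f := S.antipodeInv.comp S.antipode) (g := BMap.id k X)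
      (BMap.ext_dense hS.dense fun x => ?_) x
    simp [hS.antipodeInv, hS.antipode, Words.S_S D q (-1) 1 rfl]

theorem pairing_comul_right {p : BMap k (CT k X Y) k} (hp : ∀ x y, p (tm k (j x) (j' y)) =
    form D q x y) (x x' : Words k I) (t : Words k I ⊗[k] Words k I) :
    CT.lid k k (CT.map p p (CT.mid k X X Y Y (tm k (tm k (j x) (j x')) (CT.alg j' j' t)))) =
      tfun (form D q x) (form D q x') t := by
  induction t using TensorProduct.induction_on with
  | zero => simp [tm_zero_right]
  | add a b ha hb => simp only [map_add, tm_add_right, ha, hb]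
  | tmul a b => simp [hp]

theorem pairing_comul_left {p : BMap k (CT k X Y) k} (hp : ∀ x y, p (tm k (j x) (j' y)) =
    form D q x y) (y y' : Words k I) (t : Words k I ⊗[k] Words k I) :
    CT.lid k k (CT.map p p (CT.mid k X X Y Y (tm k (CT.alg j j t) (tm k (j' y) (j' y'))))) =
      tfun ((form D q).flip y) ((form D q).flip y') t := by
  induction t using TensorProduct.induction_on with
  | zero => simp [tm_zero_left]
  | add a b ha hb => simp only [map_add, tm_add_left, ha, hb]
  | tmul a b => simp [hp]

/-- Group-like elements act by weight twists, for which the form is self-adjoint; the general case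
follows by continuity in the Cartan argument and then in the two others. -/
theorem pairing_equivariant (hM : CartanModel D q jH eA hH hA ev R Rbar)
    (hS : NicholsModel D q eA j S) (hS' : NicholsModel D q eA j' S') {p : BMap k (CT k X Y) k}
    (hp : ∀ x y, p (tm k (j x) (j' y)) = form D q x y) (x : X) (h : H) (y : Y) :
    p (tm k (ract ev S.coact (tm k x h)) y) = p (tm k x (act ev S'.coact (tm k h y))) := by
  have h1 : ∀ a b h, p (tm k (ract ev S.coact (tm k (j a) h)) (j' b)) =
      p (tm k (j a) (act ev S'.coact (tm k h (j' b)))) := fun a b h => by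
    refine DFunLike.congr_fun (f := (p.comp (CT.inl (j' b))).comp ((ract ev S.coact).comp
      (CT.inr (j a)))) (g := (p.comp (CT.inr (j a))).comp ((act ev S'.coact).comp
      (CT.inl (j' b)))) (BMap.ext_dense hM.dense fun h => ?_) h
    refine LinearMap.congr_fun (Finsupp.lhom_ext' fun l => LinearMap.ext_ring ?_ :
      ((p.comp (CT.inl (j' b))).comp ((ract ev S.coact).comp (CT.inr (j a)))).toLinearMap ∘ₗ jH =
      ((p.comp (CT.inr (j a))).comp ((act ev S'.coact).comp (CT.inl (j' b)))).toLinearMap ∘ₗ jH) h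
    change p (tm k (ract ev S.coact (tm k (j a) (jH (.single l 1)))) (j' b)) =
      p (tm k (j a) (act ev S'.coact (tm k (jH (.single l 1)) (j' b))))
    rw [ract_model hM hS, act_model hM hS', hp, hp, form_tw]
  have h2 : p.comp (CT.map ((ract ev S.coact).comp (CT.inl h)) (BMap.id k Y)) =
      p.comp (CT.map (BMap.id k X) ((act ev S'.coact).comp (CT.inr h))) :=
    CT.hom_ext_dense hS.dense hS'.dense fun a b => by
      simpa only [BMap.comp_apply, CT.map_tm, BMap.id_apply, CT.inl_apply, CT.inr_apply]
        using h1 a b h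
  simpa only [BMap.comp_apply, CT.map_tm, BMap.id_apply, CT.inl_apply, CT.inr_apply]
    using DFunLike.congr_fun h2 (tm k x y)

theorem pairing_antipode
    (hS : NicholsModel D q eA j S) (hS' : NicholsModel D q eA j' S') {p : BMap k (CT k X Y) k}
    (hp : ∀ x y, p (tm k (j x) (j' y)) = form D q x y) (x : X) (y : Y) :
    p (tm k (S.antipode x) y) = p (tm k x (S'.antipode y)) := by
  have h : p.comp (CT.map S.antipode (BMap.id k Y)) = p.comp (CT.map (BMap.id k X) S'.antipode) :=
    CT.hom_ext_dense hS.dense hS'.dense fun x y => by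
      simp [hS.antipode, hS'.antipode, hp, form_S]
  simpa using DFunLike.congr_fun h (tm k x y)

theorem pairing_mul_left
    (hS : NicholsModel D q eA j S) (hS' : NicholsModel D q eA j' S') {p : BMap k (CT k X Y) k}
    (hp : ∀ x y, p (tm k (j x) (j' y)) = form D q x y) :
    p.comp (CT.map S.mul (BMap.id k Y)) =
    (CT.lid k k).comp ((CT.map p p).comp ((CT.mid k X X Y Y).comp
      (CT.map (BMap.id k (CT k X X)) S'.comul))) :=
  CT.hom_ext_dense_left hS.dense hS.dense hS'.dense fun a b y => by
    simp only [BMap.comp_apply, CT.map_tm, BMap.id_apply, hS.mul, hS'.comul,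
      pairing_comul_right hp, hp, form_mul_left]

theorem pairing_mul_right
    (hS : NicholsModel D q eA j S) (hS' : NicholsModel D q eA j' S') {p : BMap k (CT k X Y) k}
    (hp : ∀ x y, p (tm k (j x) (j' y)) = form D q x y) :
    p.comp (CT.map (BMap.id k X) S'.mul) =
    (CT.lid k k).comp ((CT.map p p).comp ((CT.mid k X X Y Y).comp
      (CT.map S.comul (BMap.id k (CT k Y Y))))) :=
  CT.hom_ext_dense_right hS.dense hS'.dense hS'.dense fun x a b => by
    simp only [BMap.comp_apply, CT.map_tm, BMap.id_apply, hS'.mul, hS.comul,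
      pairing_comul_left hp, hp, form_mul_right]

theorem NicholsModel.isDualityPairing (hM : CartanModel D q jH eA hH hA ev R Rbar)
    (hS : NicholsModel D q eA j S) (hS' : NicholsModel D q eA j' S') {p : BMap k (CT k X Y) k}
    (hp : ∀ x y, p (tm k (j x) (j' y)) = form D q x y) : IsDualityPairing ev S S' p where
  mul_left := pairing_mul_left hS hS' hp
  mul_right := pairing_mul_right hS hS' hp
  one_left y := by
    refine DFunLike.congr_fun (f := p.comp (CT.inr S.one)) (g := S'.counit)
      (BMap.ext_dense hS'.dense fun y => ?_) y
    rw [BMap.comp_apply, CT.inr_apply, hS.one, hp, hS'.counit, form_nil_left']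
  one_right x := by
    refine DFunLike.congr_fun (f := p.comp (CT.inl S'.one)) (g := S.counit)
      (BMap.ext_dense hS.dense fun x => ?_) x
    rw [BMap.comp_apply, CT.inl_apply, hS'.one, hp, hS.counit, form_nil_right]
  antipode := pairing_antipode hS hS' hp
  equivariant := pairing_equivariant hM hS hS' hp

end Model

/-! ### The analytic Nichols algebras -/

section Quotient

variable {k : Type*} [NormedField k] {Y Y' Z : Type*} [NormedAddCommGroup Y] [NormedSpace k Y]
  [NormedAddCommGroup Y'] [NormedSpace k Y'] [NormedAddCommGroup Z] [NormedSpace k Z]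

/-- The quotient norm is the infimum of the norms of representatives, so an estimate valid for each
of them passes to the quotient with the same constant. -/
theorem norm_le_of_quotient {N : Submodule k Y} {C c : ℝ} (hC : 0 ≤ C) (x : Y ⧸ N)
    (h : ∀ y, Submodule.Quotient.mk y = x → c ≤ C * ‖y‖) : c ≤ C * ‖x‖ := by
  refine le_of_forall_pos_le_add fun e he => ?_
  have he' : 0 < e / (C + 1) := by positivity
  obtain ⟨m, hm, hm'⟩ := Submodule.Quotient.norm_mk_lt x he'
  refine (h m hm).trans ((mul_le_mul_of_nonneg_left hm'.le hC).trans ?_)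
  rw [mul_add]
  refine add_le_add le_rfl ?_
  rw [mul_div_assoc', div_le_iff₀ (by positivity)]
  nlinarith

/-- A bounded map which vanishes on a subspace descends to the quotient. -/
def BMap.liftQ (N : Submodule k Y) (f : BMap k Y Z) (h : ∀ x ∈ N, f x = 0) :
    BMap k (Y ⧸ N) Z where
  toLinearMap := N.liftQ f.toLinearMap h
  bound' := by
    obtain ⟨C, hC, hf⟩ := f.bound
    exact ⟨C, fun x => norm_le_of_quotient hC x fun y hy => by rw [← hy]; exact hf y⟩

/-- A bounded map on a tensor product which vanishes on subspaces of the factors descends to the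
quotients. -/
def BMap.liftQ₂ [CompleteSpace Z] [IsUltrametricDist Z] (N : Submodule k Y) (N' : Submodule k Y')
    [IsClosed (N : Set Y)] [IsClosed (N' : Set Y')]
    (f : BMap k (CT k Y Y') Z) (h : ∀ x ∈ N, ∀ y, f (tm k x y) = 0)
    (h' : ∀ x, ∀ y ∈ N', f (tm k x y) = 0) : BMap k (CT k (Y ⧸ N) (Y' ⧸ N')) Z :=
  CT.lift (N.liftQ
    { toFun := fun x => N'.liftQ (f.toLinearMap ∘ₗ (CT.inr x).toLinearMap) (h' x)
      map_add' := fun x x' => by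
        ext y
        change f (tm k (x + x') y) = f (tm k x y) + f (tm k x' y)
        rw [tm_add_left, map_add]
      map_smul' := fun c x => by
        ext y
        change f (tm k (c • x) y) = c • f (tm k x y)
        rw [tm_smul_left, map_smul] } fun x hx => by
        ext y
        exact h x hx y) (by
      obtain ⟨C, hC, hf⟩ := f.bound
      refine ⟨C, hC, fun x y => ?_⟩
      rw [← mul_assoc]
      refine norm_le_of_quotient (mul_nonneg hC (norm_nonneg _)) y fun y' hy => ?_
      rw [mul_assoc, mul_comm ‖x‖, ← mul_assoc]
      refine norm_le_of_quotient (mul_nonneg hC (norm_nonneg _)) x fun x' hx => ?_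
      rw [← hx, ← hy]
      refine (hf (tm k x' y')).trans ?_
      rw [mul_assoc, mul_comm ‖y'‖]
      exact mul_le_mul_of_nonneg_left (norm_tm_le _ _) hC)

theorem BMap.liftQ₂_tm [CompleteSpace Z] [IsUltrametricDist Z] (N : Submodule k Y)
    (N' : Submodule k Y') [IsClosed (N : Set Y)] [IsClosed (N' : Set Y')]
    (f : BMap k (CT k Y Y') Z) (h h') (x : Y) (y : Y') :
    BMap.liftQ₂ N N' f h h' (tm k (N.mkQ x) (N'.mkQ y)) = f (tm k x y) := by
  rw [BMap.liftQ₂, CT.lift_tm]; rfl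

theorem BMap.eq_zero_of_mem_closure {s : Set Y} (f : BMap k Y Z) (h : ∀ x ∈ s, f x = 0) {x : Y}
    (hx : x ∈ closure s) : f x = 0 :=
  closure_minimal (t := f ⁻¹' {0}) h (isClosed_singleton.preimage f.continuous) hx

variable {X : Type*} [NormedAddCommGroup X] [NormedSpace k X]

theorem CT.eq_of_comp_map {π : BMap k Y X} {π' : BMap k Y' Z} (hπ : Function.Surjective π)
    (hπ' : Function.Surjective π') {W : Type*} [NormedAddCommGroup W] [NormedSpace k W]
    {f g : BMap k (CT k X Z) W} (h : f.comp (CT.map π π') = g.comp (CT.map π π')) : f = g :=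
  CT.hom_ext fun x y => by
    obtain ⟨a, rfl⟩ := hπ x
    obtain ⟨b, rfl⟩ := hπ' y
    simpa using DFunLike.congr_fun h (tm k a b)

theorem BMap.eq_of_comp {π : BMap k Y X} (hπ : Function.Surjective π) {f g : BMap k X Z}
    (h : f.comp π = g.comp π) : f = g := by
  ext x
  obtain ⟨a, rfl⟩ := hπ x
  exact DFunLike.congr_fun h a

end Quotient

/-! ### Structure maps on quotients by the radical, and their uniqueness. -/

section NicholsStr

variable {k : Type*} [NormedField k] [IsUltrametricDist k] [CompleteSpace k]
  {I Φ : Type*} [AddCommGroup Φ] (D : RootDatum I Φ) (q : QNumber k)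

theorem mul_mem_radical' {y : Words k I} (h : y ∈ radical D q) (x : Words k I) :
    Words.mul x y ∈ radical D q := by
  have : (radical D q).mkQ ∘ₗ Words.mul.flip y = 0 := Words.hom_ext fun w => by
    refine (Submodule.Quotient.mk_eq_zero _).2 ?_
    induction w with
    | nil => rw [LinearMap.flip_apply, Words.nil_mul]; exact h
    | cons i w ih =>
      rw [LinearMap.flip_apply, ← cons_bw, Words.cons_mul]
      exact cons_mem_radical D q ih i
  exact (Submodule.Quotient.mk_eq_zero _).1 (LinearMap.congr_fun this x)

variable {X A : Type*} [NormedAddCommGroup X] [NormedSpace k X] [NormedAddCommGroup A]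
  [NormedSpace k A]

theorem alg_comul_radical {j : Words k I →ₗ[k] X} (hj : ∀ y ∈ radical D q, j y = 0)
    {y : Words k I} (hy : y ∈ radical D q) : CT.alg j j (Words.comul D q y) = 0 := by
  let f : Words k I →ₗ[k] Words k I →ₗ[k] CT k X X := (TensorProduct.mk k _ _).compr₂ (CT.alg j j)
  have h2 : TensorProduct.lift f = CT.alg j j := TensorProduct.ext' fun a b => rfl
  rw [← h2]
  exact comul_radical_eq_zero D q f (fun y hy x => by simp [f, hj y hy, tm_zero_left])
    (fun y hy x => by simp [f, hj y hy, tm_zero_right]) hy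

/-- On words of a fixed weight n the coaction is y ↦ tⁿ ⊗ y, which kills the radical, and the
radical is compatible with weights. -/
theorem coact_radical {j : Words k I →ₗ[k] X} (hj : ∀ y ∈ radical D q, j y = 0)
    {eA : (I →₀ ℤ) → A} {δ : Words k I →ₗ[k] CT k A X}
    (hδ : ∀ w, δ (bw k w) = tm k (eA (D.wt w)) (j (bw k w))) {y : Words k I}
    (hy : y ∈ radical D q) : δ y = 0 :=
  radical_weight D q (fun n => (CT.inr (eA n)).toLinearMap ∘ₗ j)
    (fun n y hy => by simp [hj y hy, tm_zero_right]) δ hδ hy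

theorem CT.map_alg_id {W W' V V' X X' : Type*} [AddCommGroup W] [Module k W] [AddCommGroup W']
    [Module k W'] [NormedAddCommGroup V] [NormedSpace k V] [NormedAddCommGroup V']
    [NormedSpace k V'] [NormedAddCommGroup X] [NormedSpace k X] [NormedAddCommGroup X']
    [NormedSpace k X'] {f : BMap k V X} {g : BMap k V' X'} {i : W →ₗ[k] V} {i' : W' →ₗ[k] V'}
    {j : W →ₗ[k] X} {j' : W' →ₗ[k] X'} (hf : ∀ x, f (i x) = j x) (hg : ∀ x, g (i' x) = j' x)
    (z : W ⊗[k] W') : CT.map f g (CT.alg i i' z) = CT.alg j j' z :=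
  (CT.map_alg (f₀ := .id) (g₀ := .id) hf hg z).trans (by rw [TensorProduct.map_id]; rfl)

variable {D q} in
theorem NicholsModel.of_quotient [CompleteSpace X] [IsUltrametricDist X] {T : Type*}
    [NormedAddCommGroup T] [NormedSpace k T] {π : BMap k T X} (hπ : Function.Surjective π)
    {jT : Words k I →ₗ[k] T} (hjT : DenseRange jT) {eA : (I →₀ ℤ) → A} {mT : BMap k (CT k T T) T}
    {ΔT : BMap k T (CT k T T)} {δT : BMap k T (CT k A T)}
    (hm : ∀ x y, mT (tm k (jT x) (jT y)) = jT (Words.mul x y))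
    (hΔ : ∀ x, ΔT (jT x) = CT.alg jT jT (Words.comul D q x))
    (hδ : ∀ w, δT (jT (bw k w)) = tm k (eA (D.wt w)) (jT (bw k w)))
    {S : ComodHopfStr k A X} (one : S.one = π (jT (bw k [])))
    (mul : S.mul.comp (CT.map π π) = π.comp mT)
    (comul : S.comul.comp π = (CT.map π π).comp ΔT)
    (coact : S.coact.comp π = (CT.map (BMap.id k _) π).comp δT)
    (counit : ∀ x, S.counit (π (jT x)) = Words.counit k I x)
    (antipode : ∀ x, S.antipode (π (jT x)) = π (jT (Words.S D q 1 x)))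
    (antipodeInv : ∀ x, S.antipodeInv (π (jT x)) = π (jT (Words.S D q (-1) x))) :
    NicholsModel D q eA (π.toLinearMap ∘ₗ jT) S where
  dense := hπ.denseRange.comp hjT π.continuous
  one := one
  mul x y := by
    have := DFunLike.congr_fun mul (tm k (jT x) (jT y))
    rw [BMap.comp_apply, BMap.comp_apply, CT.map_tm, hm] at this
    exact this
  counit := counit
  comul x := by
    have := DFunLike.congr_fun comul (jT x)
    rw [BMap.comp_apply, BMap.comp_apply, hΔ] at this
    exact this.trans (CT.map_alg_id (fun _ => rfl) (fun _ => rfl) _)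
  antipode := antipode
  antipodeInv := antipodeInv
  coact w := by
    have := DFunLike.congr_fun coact (jT (bw k w))
    rw [BMap.comp_apply, BMap.comp_apply, hδ, CT.map_tm] at this
    exact this

/-- Counit and antipode are determined by the bialgebra structure, and the inverse antipode, being a
two-sided inverse, is determined by the antipode. -/
theorem ComodHopfStr.eq_of_isComodHopf [CompleteSpace X] [IsUltrametricDist X] {H : Type*}
    [NormedAddCommGroup H] [NormedSpace k H] {hA : HopfStr k A} {ev : BMap k (CT k H A) k}
    {R : BMap k A H} {S S' : ComodHopfStr k A X} (h : IsComodHopf hA ev R S)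
    (h' : IsComodHopf hA ev R S') (one : S'.one = S.one) (mul : S'.mul = S.mul)
    (comul : S'.comul = S.comul) (coact : S'.coact = S.coact) : S' = S := by
  have h1 := h.hopf.counit_eq h'.hopf comul
  have h2 := h.hopf.antipode_eq h'.hopf one mul comul
  have h3 : S'.antipodeInv = S.antipodeInv := BMap.ext fun x => by
    rw [← h.inv_antipode (S'.antipodeInv x), ← h2, h'.antipode_inv]
  obtain ⟨⟨_, _, _, _, _⟩, _, _⟩ := S
  obtain ⟨⟨_, _, _, _, _⟩, _, _⟩ := S'
  simp only at one mul comul coact h1 h2 h3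
  subst one mul comul coact h1 h2 h3
  rfl

end NicholsStr

/-! ### The Nichols algebras as completions of words modulo the radical, and their pairing. -/

section Concrete

variable {k : Type*} [NormedField k] [IsUltrametricDist k] [CompleteSpace k]
  {I Φ : Type*} [AddCommGroup Φ] (D : RootDatum I Φ) (q : QNumber k)

theorem cartanModel : CartanModel D q (Cop.ofFinsupp k _) (Cop.e k _)
    (GA.hopf (Module.Dual ℤ Φ)) (GA.hopf (I →₀ ℤ)) (evHA D q) (RH D) (RbarH D) where
  dense := Cop.denseRange_ofFinsupp
  H_one := rfl
  H_mul l m := by simp only [Cop.ofFinsupp_single_one, GA.hopf, Cop.lift₂_e]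
  H_counit l := by simp only [Cop.ofFinsupp_single_one, GA.hopf, Cop.lift_e]
  H_comul l := by simp only [Cop.ofFinsupp_single_one, GA.hopf, Cop.lift_e]
  H_antipode l := by simp only [Cop.ofFinsupp_single_one, GA.hopf, Cop.lift_e]
  A_one := rfl
  A_mul n m := by simp only [GA.hopf, Cop.lift₂_e]
  A_counit n := by simp only [GA.hopf, Cop.lift_e]
  A_comul n := by simp only [GA.hopf, Cop.lift_e]
  ev l n := by simp only [Cop.ofFinsupp_single_one, evHA, Cop.lift₂_e]
  R n := by simp only [Cop.ofFinsupp_single_one, RH, Cop.lift_e]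
  Rbar n := by simp only [Cop.ofFinsupp_single_one, RbarH, Cop.lift_e]

variable {D q} {r s : ℝ≥0}

/-- The right-hand side does not involve the other radius: for both algebras the Nichols ideal is
the closure of the same algebraic radical. This is the only description of the ideal used
afterwards. -/
theorem nicholsIdeal_eq_closure (hr : 0 < r) (hrs : ∀ i, 1 ≤ ‖qDiff k D q i‖ * r * s) :
    (nicholsIdeal D q r : Set (TA k I r)) = closure (jT k I r '' radical D q) := by
  refine Set.Subset.antisymm ?_ ?_
  · rw [nicholsIdeal_eq D q hr hrs]
    exact fun x hx => mem_closure_of_mem_orth D q hr hrs hx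
  · refine closure_minimal ?_ (Submodule.isClosed_topologicalClosure _)
    rintro _ ⟨y, hy, rfl⟩
    change _ ∈ nicholsIdeal D q r
    rw [nicholsIdeal_eq D q hr hrs]
    exact jT_mem_orth D q hrs hy

variable {Z : Type*} [NormedAddCommGroup Z] [NormedSpace k Z]
  (hN : (nicholsIdeal D q r : Set (TA k I r)) = closure (jT k I r '' radical D q))
  (hN' : (nicholsIdeal D q s : Set (TA k I s)) = closure (jT k I s '' radical D q))

/-- A bounded map on `T_r` which kills the radical descends to the Nichols algebra. -/
def Nichols.lift (f : BMap k (TA k I r) Z) (h : ∀ y ∈ radical D q, f (jT k I r y) = 0) :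
    BMap k (Nichols D q r) Z :=
  BMap.liftQ _ f fun x hx => f.eq_zero_of_mem_closure
    (by rintro _ ⟨y, hy, rfl⟩; exact h y hy) (hN ▸ hx : x ∈ closure (jT k I r '' radical D q))

/-- A bounded map on `T_r ⊗̂ T_s` which kills the radicals descends to the Nichols algebras. -/
def Nichols.lift₂ [CompleteSpace Z] [IsUltrametricDist Z] (f : BMap k (CT k (TA k I r) (TA k I s)) Z)
    (h : ∀ y ∈ radical D q, ∀ x, f (tm k (jT k I r y) (jT k I s x)) = 0)
    (h' : ∀ y ∈ radical D q, ∀ x, f (tm k (jT k I r x) (jT k I s y)) = 0) :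
    BMap k (CT k (Nichols D q r) (Nichols D q s)) Z :=
  BMap.liftQ₂ _ _ f
    (fun x hx y => (f.comp (CT.inl y)).eq_zero_of_mem_closure (by
      rintro _ ⟨z, hz, rfl⟩
      exact DFunLike.congr_fun (f := f.comp (CT.inr (jT k I r z))) (g := 0)
        (BMap.ext_dense (jT_dense s) fun x => h z hz x) y)
      (hN ▸ hx : x ∈ closure (jT k I r '' radical D q)))
    (fun x y hy => (f.comp (CT.inr x)).eq_zero_of_mem_closure (by
      rintro _ ⟨z, hz, rfl⟩
      exact DFunLike.congr_fun (f := f.comp (CT.inl (jT k I s z))) (g := 0)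
        (BMap.ext_dense (jT_dense r) fun x => h' z hz x) x)
      (hN' ▸ hy : y ∈ closure (jT k I s '' radical D q)))

theorem Nichols.lift₂_tm [CompleteSpace Z] [IsUltrametricDist Z]
    (f : BMap k (CT k (TA k I r) (TA k I s)) Z) (h h') (x : TA k I r) (y : TA k I s) :
    Nichols.lift₂ hN hN' f h h' (tm k (Nichols.π D q r x) (Nichols.π D q s y)) = f (tm k x y) := by
  unfold Nichols.lift₂
  exact BMap.liftQ₂_tm _ _ _ _ _ x y

variable (D q) in
theorem Nichols.π_surjective (r : ℝ≥0) : Function.Surjective (Nichols.π (k := k) D q r) :=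
  Submodule.mkQ_surjective _

variable (D q) in
/-- The dense image of the free algebra in the Nichols algebra. -/
def Nichols.j (r : ℝ≥0) : Words k I →ₗ[k] Nichols D q r :=
  (Nichols.π D q r).toLinearMap ∘ₗ jT k I r

theorem Nichols.j_radical
    (hN : (nicholsIdeal D q r : Set (TA k I r)) = closure (jT k I r '' radical D q)) : ∀ y ∈ radical D q, Nichols.j D q r y = 0 := fun y hy => by
  refine (Submodule.Quotient.mk_eq_zero _).2 ?_
  change _ ∈ (nicholsIdeal D q r : Set (TA k I r))
  rw [hN]
  exact subset_closure ⟨y, hy, rfl⟩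

/-- The antipode reverses a word and multiplies it by a sign and a power of q. Hence it preserves
the norm of basis vectors and extends to the Banach algebra. -/
theorem exists_antipodeWord (e : ℤ) (w : List I) :
    ∃ c : k, ‖c‖ = 1 ∧ Words.antipodeWord D q e w = c • bw k w.reverse := by
  induction w with
  | nil => exact ⟨1, norm_one, by simp [Words.antipodeWord]⟩
  | cons i w ih =>
    obtain ⟨c, hc, h⟩ := ih
    refine ⟨-(q.val ^ (e * D.ti i (D.rt w)) * c), by rw [norm_neg, norm_mul, q.norm_zpow, hc, one_mul], ?_⟩
    rw [Words.antipodeWord, h, map_smul, snoc_bw, smul_smul, neg_smul, List.reverse_cons]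

variable (D q) in
/-- The antipode (`e = 1`) of `T_r` and its inverse (`e = -1`). -/
def TA.S (r : ℝ≥0) (e : ℤ) : BMap k (TA k I r) (TA k I r) :=
  Cop.lift (fun w => jT k I r (Words.antipodeWord D q e w)) ⟨1, zero_le_one, fun w => by
    obtain ⟨c, hc, h⟩ := exists_antipodeWord (D := D) (q := q) e w
    rw [h, map_smul, norm_smul, hc, jT_bw]
    refine mul_le_mul_of_nonneg_left ((Cop.norm_e_le _).trans ?_) zero_le_one
    rw [List.length_reverse]⟩

theorem TA.S_jT (r : ℝ≥0) (e : ℤ) (x : Words k I) :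
    TA.S D q r e (jT k I r x) = jT k I r (Words.S D q e x) := by
  refine LinearMap.congr_fun (Words.hom_ext (f := (TA.S D q r e).toLinearMap ∘ₗ jT k I r)
    (g := jT k I r ∘ₗ Words.S D q e) fun w => ?_) x
  have h : Words.S D q e (bw k w) = Words.antipodeWord D q e w := by simp [Words.S, bw]
  change TA.S D q r e (Cop.e k _ w) = jT k I r (Words.S D q e (bw k w))
  rw [h, TA.S, Cop.lift_e]

open scoped Classical in
variable (k I) in
/-- The counit of `T_r`. -/
def TA.counit (r : ℝ≥0) : BMap k (TA k I r) k :=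
  Cop.lift (fun w => if w = [] then 1 else 0) ⟨1, zero_le_one, fun w => by
    split_ifs with h
    · simp [h]
    · rw [norm_zero]; positivity⟩

theorem TA.counit_jT (r : ℝ≥0) (x : Words k I) :
    TA.counit k I r (jT k I r x) = Words.counit k I x := by
  classical
  refine LinearMap.congr_fun (Words.hom_ext (f := (TA.counit k I r).toLinearMap ∘ₗ jT k I r)
    (g := Words.counit k I) fun w => ?_) x
  change TA.counit k I r (Cop.e k _ w) = Words.counit k I (bw k w)
  rw [TA.counit, Cop.lift_e, Words.counit, bw, Finsupp.lapply_apply, Finsupp.single_apply]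

theorem counit_radical {y : Words k I} (hy : y ∈ radical D q) : Words.counit k I y = 0 := by
  rw [← form_nil_left' D q]; exact (mem_radical D q).1 hy _

theorem TA.coact_jT (r : ℝ≥0) (w : List I) : TA.coact D r (jT k I r (bw k w)) =
    tm k (Cop.e k _ (D.wt w)) (jT k I r (bw k w)) := Cop.lift_e _ _ w

/-- The multiplication of the Nichols algebra. -/
def Nichols.mul : BMap k (CT k (Nichols D q r) (Nichols D q r)) (Nichols D q r) :=
  Nichols.lift₂ hN hN ((Nichols.π D q r).comp (TA.mul I r))
    (fun y hy x => by
      rw [BMap.comp_apply, TA.mul_jT]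
      exact Nichols.j_radical hN _ (mul_mem_radical D q hy x))
    (fun y hy x => by
      rw [BMap.comp_apply, TA.mul_jT]
      exact Nichols.j_radical hN _ (mul_mem_radical' D q hy x))

theorem Nichols.mul_π (x y : TA k I r) : Nichols.mul hN (tm k (Nichols.π D q r x)
    (Nichols.π D q r y)) = Nichols.π D q r (TA.mul I r (tm k x y)) := by
  rw [Nichols.mul, Nichols.lift₂_tm]; rfl

/-- The structure of braided Hopf algebra of the Nichols algebra. -/
def Nichols.str : ComodHopfStr k (GA k (I →₀ ℤ)) (Nichols D q r) where
  one := Nichols.j D q r (bw k [])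
  mul := Nichols.mul hN
  counit := Nichols.lift hN (TA.counit k I r) fun y hy => by
    rw [TA.counit_jT, counit_radical hy]
  comul := Nichols.lift hN ((CT.map (Nichols.π D q r) (Nichols.π D q r)).comp (TA.comul D q r))
    fun y hy => by
      rw [BMap.comp_apply, TA.comul_jT]
      exact (CT.map_alg_id (fun _ => rfl) (fun _ => rfl) _).trans
        (alg_comul_radical D q (Nichols.j_radical hN) hy)
  antipode := Nichols.lift hN ((Nichols.π D q r).comp (TA.S D q r 1)) fun y hy => by
    rw [BMap.comp_apply, TA.S_jT]
    exact Nichols.j_radical hN _ (S_mem_radical D q hy 1)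
  antipodeInv := Nichols.lift hN ((Nichols.π D q r).comp (TA.S D q r (-1))) fun y hy => by
    rw [BMap.comp_apply, TA.S_jT]
    exact Nichols.j_radical hN _ (S_mem_radical D q hy (-1))
  coact := Nichols.lift hN ((CT.map (BMap.id k _) (Nichols.π D q r)).comp (TA.coact D r))
    fun y hy => by
      refine coact_radical D q (Nichols.j_radical hN) (eA := Cop.e k _) (δ := ((CT.map (BMap.id k _)
        (Nichols.π D q r)).comp (TA.coact D r)).toLinearMap ∘ₗ jT k I r) (fun w => ?_) hy
      rw [LinearMap.comp_apply, BMap.coe_toLinearMap, BMap.comp_apply, TA.coact_jT, CT.map_tm]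
      rfl

theorem Nichols.isNichols_mul :
    (Nichols.str hN).mul.comp (CT.map (Nichols.π D q r) (Nichols.π D q r)) =
      (Nichols.π D q r).comp (TA.mul I r) := CT.hom_ext fun x y => by
  rw [BMap.comp_apply, CT.map_tm]
  exact Nichols.mul_π hN x y

theorem Nichols.str_model : NicholsModel D q (Cop.e k _) (Nichols.j D q r) (Nichols.str hN) :=
  NicholsModel.of_quotient (Nichols.π_surjective D q r) (jT_dense r) (TA.mul_jT r)
    (TA.comul_jT D q r) (TA.coact_jT r) rfl
    (Nichols.isNichols_mul hN) rfl rfl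
    (TA.counit_jT r) (fun x => congrArg (Nichols.π D q r) (TA.S_jT r 1 x))
    (fun x => congrArg (Nichols.π D q r) (TA.S_jT r (-1) x))

theorem Nichols.isNichols : IsNichols D q r (Nichols.str hN) where
  comodHopf := (Nichols.str_model hN).isComodHopf (cartanModel D q)
  one := rfl
  mul := Nichols.isNichols_mul hN
  comul := rfl
  coact := rfl

/-- Surjectivity of T_r → f_r determines unit, product, coproduct and coaction, and these determine
the rest. -/
theorem IsNichols.eq {S S' : ComodHopfStr k (GA k (I →₀ ℤ)) (Nichols D q r)}
    (h : IsNichols D q r S) (h' : IsNichols D q r S') : S' = S :=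
  ComodHopfStr.eq_of_isComodHopf h.comodHopf h'.comodHopf (h'.one.trans h.one.symm)
    (CT.eq_of_comp_map (Nichols.π_surjective D q r) (Nichols.π_surjective D q r)
      (h'.mul.trans h.mul.symm))
    (BMap.eq_of_comp (Nichols.π_surjective D q r) (h'.comul.trans h.comul.symm))
    (BMap.eq_of_comp (Nichols.π_surjective D q r) (h'.coact.trans h.coact.symm))

/-- The pairing of the Nichols algebras. -/
def Nichols.pair (hrs : ∀ i, 1 ≤ ‖qDiff k D q i‖ * r * s) :
    BMap k (CT k (Nichols D q s) (Nichols D q r)) k :=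
  Nichols.lift₂ hN' hN (pairT hrs)
    (fun y hy x => by rw [pairT_jT, form_symm, (mem_radical D q).1 hy])
    (fun y hy x => by rw [pairT_jT, (mem_radical D q).1 hy])

theorem Nichols.pair_j (hrs : ∀ i, 1 ≤ ‖qDiff k D q i‖ * r * s) (x y : Words k I) :
    Nichols.pair hN hN' hrs (tm k (Nichols.j D q s x) (Nichols.j D q r y)) = form D q x y := by
  refine Eq.trans ?_ (pairT_jT D q hrs x y)
  change Nichols.pair hN hN' hrs (tm k (Nichols.π D q s _) (Nichols.π D q r _)) = _
  rw [Nichols.pair, Nichols.lift₂_tm]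

end Concrete

/-! ### Uniqueness of the pairing and of the double bosonisation -/

section Uniqueness

variable {k : Type*} [NormedField k] [IsUltrametricDist k] [CompleteSpace k]
  {I Φ : Type*} [AddCommGroup Φ] {D : RootDatum I Φ} {q : QNumber k}
variable {H A C B : Type*} [NormedAddCommGroup H] [NormedSpace k H] [CompleteSpace H]
  [IsUltrametricDist H] [NormedAddCommGroup A] [NormedSpace k A] [CompleteSpace A]
  [IsUltrametricDist A] [NormedAddCommGroup C] [NormedSpace k C] [CompleteSpace C]
  [IsUltrametricDist C] [NormedAddCommGroup B] [NormedSpace k B] [CompleteSpace B]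
  [IsUltrametricDist B]

theorem lid_map_mid_left {X Y : Type*} [NormedAddCommGroup X] [NormedSpace k X]
    [NormedAddCommGroup Y] [NormedSpace k Y] (p : BMap k (CT k X Y) k) (a b : X) (z : CT k Y Y) :
    CT.lid k k (CT.map p p (CT.mid k X X Y Y (tm k (tm k a b) z))) =
      CT.lid k k (CT.map (p.comp (CT.inr a)) (p.comp (CT.inr b)) z) :=
  CT.induction_eq (f := (CT.lid k k).comp ((CT.map p p).comp ((CT.mid k X X Y Y).comp
    (CT.inr (tm k a b))))) (g := (CT.lid k k).comp
      (CT.map (p.comp (CT.inr a)) (p.comp (CT.inr b)))) (fun x y => by simp) z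

section Pairing

variable {eA : (I →₀ ℤ) → A} {ev : BMap k (CT k H A) k}
  {j : Words k I →ₗ[k] B} {S : ComodHopfStr k A B} {j' : Words k I →ₗ[k] C}
  {S' : ComodHopfStr k A C} {p p' : BMap k (CT k B C) k}

/-- Since v_i is primitive, pairing it with v_a y gives one term for each factor, and the term with
the counit of v_a vanishes. -/
theorem IsDualityPairing.gen_cons (hS : NicholsModel D q eA j S) (hS' : NicholsModel D q eA j' S')
    (hp : IsDualityPairing ev S S' p) (i a : I) (y : Words k I) :
    p (tm k (j (bw k [i])) (j' (cons k a y))) =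
      p (tm k (j (bw k [i])) (j' (bw k [a]))) * Words.counit k I y := by
  have h1 : Words.mul (bw k [a]) y = cons k a y := by
    rw [← cons_bw, Words.cons_mul, Words.nil_mul]
  have h2 : Words.comul D q (bw k [i]) = bw k [i] ⊗ₜ bw k [] + bw k [] ⊗ₜ bw k [i] := by
    rw [← cons_bw, Words.comul_cons, Words.comul_nil, Lop_tmul, tw_nil]
  have h3 := DFunLike.congr_fun hp.mul_right (tm k (j (bw k [i])) (tm k (j' (bw k [a])) (j' y)))
  have h4 : ∀ y, p (tm k (j (bw k [])) (j' y)) = Words.counit k I y := fun y => by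
    rw [← hS.one, hp.one_left, hS'.counit]
  have h5 : Words.counit k I (bw k [a]) = 0 := by rw [← cons_bw, Words.counit_cons]
  simp only [BMap.comp_apply, CT.map_tm, BMap.id_apply, hS'.mul, h1, hS.comul, h2, map_add,
    CT.alg_tmul, tm_add_left, CT.mid_tm, CT.lid_tm, h4, h5, smul_eq_mul, zero_mul, add_zero] at h3
  exact h3

/-- The product formula in the second argument reduces pairings of a generator to pairings of two
generators, and the product formula in the first argument then reaches all words. Density finishes
the argument. -/
theorem IsDualityPairing.eq (hS : NicholsModel D q eA j S) (hS' : NicholsModel D q eA j' S')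
    (hp : IsDualityPairing ev S S' p) (hp' : IsDualityPairing ev S S' p')
    (h : ∀ i a, p' (tm k (j (bw k [i])) (j' (bw k [a]))) =
      p (tm k (j (bw k [i])) (j' (bw k [a])))) : p' = p := by
  have h1 : ∀ i, p'.comp (CT.inr (j (bw k [i]))) = p.comp (CT.inr (j (bw k [i]))) := fun i =>
    BMap.ext_dense hS'.dense fun y => by
      refine Words.induction (f := p'.toLinearMap ∘ₗ (CT.inr (j (bw k [i]))).toLinearMap ∘ₗ j')
        (g := p.toLinearMap ∘ₗ (CT.inr (j (bw k [i]))).toLinearMap ∘ₗ j') ?_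
        (fun a y _ _ => ?_) y
      · change p' (tm k _ (j' (bw k []))) = p (tm k _ (j' (bw k [])))
        rw [← hS'.one, hp.one_right, hp'.one_right]
      · change p' (tm k _ (j' (cons k a y))) = p (tm k _ (j' (cons k a y)))
        rw [hp.gen_cons hS hS', hp'.gen_cons hS hS', h]
  have h2 : ∀ w : List I, p'.comp (CT.inr (j (bw k w))) = p.comp (CT.inr (j (bw k w))) := fun w => by
    induction w with
    | nil =>
      refine BMap.ext fun y => ?_
      rw [BMap.comp_apply, BMap.comp_apply, CT.inr_apply, ← hS.one, hp.one_left, hp'.one_left]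
    | cons i w ih =>
      have h3 : S.mul (tm k (j (bw k [i])) (j (bw k w))) = j (bw k (i :: w)) := by
        rw [hS.mul, Words.mul_bw]; rfl
      have h4 : ∀ {p}, IsDualityPairing ev S S' p → ∀ y, p (tm k (j (bw k (i :: w))) y) =
          CT.lid k k (CT.map (p.comp (CT.inr (j (bw k [i])))) (p.comp (CT.inr (j (bw k w))))
            (S'.comul y)) := fun {p} hp y => by
        have := DFunLike.congr_fun hp.mul_left (tm k (tm k (j (bw k [i])) (j (bw k w))) y)
        simp only [BMap.comp_apply, CT.map_tm, BMap.id_apply, h3] at this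
        rw [this, lid_map_mid_left]
      exact BMap.ext fun y => by
        rw [BMap.comp_apply, BMap.comp_apply, CT.inr_apply, h4 hp, h4 hp', h1, ih]
  refine CT.hom_ext_dense hS.dense hS'.dense fun x y => ?_
  exact LinearMap.congr_fun (Words.hom_ext (f := p'.toLinearMap ∘ₗ
    (CT.inl (j' y)).toLinearMap ∘ₗ j) (g := p.toLinearMap ∘ₗ (CT.inl (j' y)).toLinearMap ∘ₗ j)
    fun w => DFunLike.congr_fun (h2 w) (j' y)) x

end Pairing

variable {jH : (Module.Dual ℤ Φ →₀ k) →ₗ[k] H} {eA : (I →₀ ℤ) → A}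
  {jC : Words k I →ₗ[k] C} {jB : Words k I →ₗ[k] B}

variable (D q) in
/-- The data of the double bosonisation, modelled on words. -/
structure DBModel (jH : (Module.Dual ℤ Φ →₀ k) →ₗ[k] H) (eA : (I →₀ ℤ) → A)
    (jC : Words k I →ₗ[k] C) (jB : Words k I →ₗ[k] B) (E : DBData k H A C B) : Prop where
  cartan : CartanModel D q jH eA E.hH E.hA E.ev E.R E.Rbar
  C : NicholsModel D q eA jC E.hC
  B : NicholsModel D q eA jB E.hB
  pair : ∀ x y, E.pair (tm k (jB x) (jC y)) = form D q x y

variable {E : DBData k H A C B}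

theorem mulCH_model (hE : DBModel D q jH eA jC jB E) (x y : Words k I) (l m : Module.Dual ℤ Φ) :
    E.mulCH (tm k (tm k (jC x) (jH (.single l 1))) (tm k (jC y) (jH (.single m 1)))) =
      tm k (jC (Words.mul x (tw D q l y))) (jH (.single (l + m) 1)) := by
  simp only [DBData.mulCH, BMap.comp_apply, CT.map_tm, BMap.id_apply, hE.cartan.H_comul,
    CT.assocInv_tm, CT.mid_tm, CT.assoc_tm, act_model hE.cartan hE.C, hE.C.mul, hE.cartan.H_mul]

theorem mulHB_model (hE : DBModel D q jH eA jC jB E) (x y : Words k I) (l m : Module.Dual ℤ Φ) :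
    E.mulHB (tm k (tm k (jH (.single l 1)) (jB x)) (tm k (jH (.single m 1)) (jB y))) =
      tm k (jH (.single (l + m) 1)) (jB (Words.mul (tw D q m x) y)) := by
  simp only [DBData.mulHB, BMap.comp_apply, CT.map_tm, BMap.id_apply, hE.cartan.H_comul,
    CT.assocInv_tm, CT.mid_tm, CT.assoc_tm, ract_model hE.cartan hE.B, hE.B.mul, hE.cartan.H_mul]

theorem inHB_tm (E : DBData k H A C B) (h : H) (b : B) :
    E.inHB (tm k h b) = tm k (tm k E.hC.one h) b := by
  simp [DBData.inHB]

theorem inCH_tm (E : DBData k H A C B) (x : CT k C H) : E.inCH x = tm k x E.hB.one := rfl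

theorem inH_eq (E : DBData k H A C B) (h : H) : E.inHB (tm k h E.hB.one) = E.inH h := inHB_tm E h _

variable {U U' : HopfStr k (CT k (CT k C H) B)}

/-- For group-like h this is the product of c ⊗ 1 and 1 ⊗ h in the smash product, where no twist
arises. It shows that C and H generate the left half of the triangular decomposition. -/
theorem mul_inC_inH (hE : DBModel D q jH eA jC jB E)
    (hU : U.mul.comp (CT.map E.inCH E.inCH) = E.inCH.comp E.mulCH) (c : C) (h : H) :
    U.mul (tm k (E.inC c) (E.inH h)) = E.inCH (tm k c h) := by
  have h0 : U.mul.comp (CT.map E.inC E.inH) = E.inCH := by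
    refine CT.hom_ext_dense hE.C.dense hE.cartan.dense fun x h => ?_
    refine LinearMap.congr_fun (Finsupp.lhom_ext' fun l => LinearMap.ext_ring ?_ :
      (U.mul.comp (CT.map E.inC E.inH)).toLinearMap ∘ₗ (CT.inr (jC x)).toLinearMap ∘ₗ jH =
      E.inCH.toLinearMap ∘ₗ (CT.inr (jC x)).toLinearMap ∘ₗ jH) h
    have h1 := DFunLike.congr_fun hU (tm k (tm k (jC x) (jH (.single 0 1)))
      (tm k (jC (bw k [])) (jH (.single l 1))))
    rw [BMap.comp_apply, BMap.comp_apply, CT.map_tm, mulCH_model hE, tw_zero, Words.mul_nil,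
      zero_add, ← hE.cartan.H_one, ← hE.C.one] at h1
    change U.mul (CT.map E.inC E.inH (tm k (jC x) (jH (.single l 1)))) = _
    rw [CT.map_tm]
    exact h1
  simpa using DFunLike.congr_fun h0 (tm k c h)

theorem mul_inH_inB (hE : DBModel D q jH eA jC jB E)
    (hU : U.mul.comp (CT.map E.inHB E.inHB) = E.inHB.comp E.mulHB) (h : H) (b : B) :
    U.mul (tm k (E.inH h) (E.inB b)) = E.inHB (tm k h b) := by
  have h0 : U.mul.comp (CT.map E.inH E.inB) = E.inHB := by
    refine CT.hom_ext_dense hE.cartan.dense hE.B.dense fun h x => ?_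
    refine LinearMap.congr_fun (Finsupp.lhom_ext' fun l => LinearMap.ext_ring ?_ :
      (U.mul.comp (CT.map E.inH E.inB)).toLinearMap ∘ₗ (CT.inl (jB x)).toLinearMap ∘ₗ jH =
      E.inHB.toLinearMap ∘ₗ (CT.inl (jB x)).toLinearMap ∘ₗ jH) h
    have h1 := DFunLike.congr_fun hU (tm k (tm k (jH (.single l 1)) (jB (bw k [])))
      (tm k (jH (.single 0 1)) (jB x)))
    rw [BMap.comp_apply, BMap.comp_apply, CT.map_tm, mulHB_model hE, tw_zero, Words.nil_mul,
      add_zero, ← hE.cartan.H_one, ← hE.B.one, inH_eq] at h1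
    change U.mul (CT.map E.inH E.inB (tm k (jH (.single l 1)) (jB x))) = _
    rw [CT.map_tm]
    exact h1
  simpa using DFunLike.congr_fun h0 (tm k h b)

theorem IsHopf.mul_mul {X : Type*} [NormedAddCommGroup X] [NormedSpace k X] [CompleteSpace X]
    [IsUltrametricDist X] {c : BMap k (CT k X X) (CT k X X)} {S : HopfStr k X} (h : IsHopf c S)
    (x y z : X) : S.mul (tm k (S.mul (tm k x y)) z) = S.mul (tm k x (S.mul (tm k y z))) := by
  simpa using DFunLike.congr_fun h.mul_assoc (tm k (tm k x y) z)

/-- Two associative products agree if they agree on enough pairs of elements of subspaces which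
generate the algebra in the manner of a triangular decomposition. -/
theorem IsHopf.mul_eq_of_triangular {X V W : Type*} [NormedAddCommGroup X] [NormedSpace k X]
    [CompleteSpace X] [IsUltrametricDist X] [NormedAddCommGroup V] [NormedSpace k V]
    [NormedAddCommGroup W] [NormedSpace k W] {c c' : BMap k (CT k X X) (CT k X X)}
    {U U' : HopfStr k X} (h : IsHopf c U) (h' : IsHopf c' U') {i : BMap k V X} {i' : BMap k W X}
    {iC : BMap k C X} {iH : BMap k H X} {iB : BMap k B X} (hiC : ∀ c, ∃ x, iC c = i x)
    (hiH : ∀ y, ∃ x, iH y = i x) (hiH' : ∀ y, ∃ x, iH y = i' x) (hiB : ∀ b, ∃ x, iB b = i' x)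
    (eV : ∀ x y, ∃ z, U.mul (tm k (i x) (i y)) = i z)
    (eW : ∀ x y, ∃ z, U.mul (tm k (i' x) (i' y)) = i' z)
    (dX : ∀ f g : BMap k X X,
      (∀ x b, f (U.mul (tm k (i x) (iB b))) = g (U.mul (tm k (i x) (iB b)))) → ∀ z, f z = g z)
    (dV : ∀ f g : BMap k X X, (∀ x y, f (U.mul (tm k (iC x) (iH y))) =
      g (U.mul (tm k (iC x) (iH y)))) → ∀ z, f (i z) = g (i z))
    (dW : ∀ f g : BMap k X X, (∀ x y, f (U.mul (tm k (iH x) (iB y))) =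
      g (U.mul (tm k (iH x) (iB y)))) → ∀ z, f (i' z) = g (i' z))
    (pV : ∀ x y, U'.mul (tm k (i x) (i y)) = U.mul (tm k (i x) (i y)))
    (pW : ∀ x y, U'.mul (tm k (i' x) (i' y)) = U.mul (tm k (i' x) (i' y)))
    (pVB : ∀ x y, U'.mul (tm k (i x) (iB y)) = U.mul (tm k (i x) (iB y)))
    (pBC : ∀ x y, U'.mul (tm k (iB x) (iC y)) = U.mul (tm k (iB x) (iC y))) : U'.mul = U.mul := by
  let P (a b : X) : Prop := U'.mul (tm k a b) = U.mul (tm k a b)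
  -- Associativity of both products transfers agreement from (a, b), (ab, c) and (b, c) to (a, bc).
  -- The next statement is the mirror image; all later steps alternate these two with density.
  have asr : ∀ {a b c}, P a b → P (U.mul (tm k a b)) c → P b c → P a (U.mul (tm k b c)) :=
    fun {a b c} h1 h2 h3 => by
      change U'.mul _ = U.mul _
      rw [← h3, ← h'.mul_mul, h1, h2, h.mul_mul, h3]
  have asl : ∀ {a b c}, P b c → P a (U.mul (tm k b c)) → P a b → P (U.mul (tm k a b)) c :=
    fun {a b c} h1 h2 h3 => by
      change U'.mul _ = U.mul _
      rw [← h3, h'.mul_mul, h1, h2, ← h.mul_mul, h3]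
  -- The left half times the right half: factor an element of the right half as H times B, and
  -- absorb the H part into the left half.
  have s2 : ∀ x y, P (i x) (i' y) := fun x y => by
    refine dW (U'.mul.comp (CT.inr (i x))) (U.mul.comp (CT.inr (i x))) (fun y b => ?_) y
    obtain ⟨y', e1⟩ := hiH y
    obtain ⟨y'', e2⟩ := hiH' y
    obtain ⟨b', e3⟩ := hiB b
    obtain ⟨z, e4⟩ := eV x y'
    exact asr (by rw [e1]; exact pV _ _) (by rw [e1, e4]; exact pVB _ _)
      (by rw [e2, e3]; exact pW _ _)
  have s3 : ∀ z y, P z (i' y) := fun z y => by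
    refine dX (U'.mul.comp (CT.inl (i' y))) (U.mul.comp (CT.inl (i' y))) (fun x b => ?_) z
    obtain ⟨b', e3⟩ := hiB b
    obtain ⟨z, e4⟩ := eW b' y
    exact asl (by rw [e3]; exact pW _ _) (by rw [e3, e4]; exact s2 _ _) (pVB _ _)
  -- Only here is the agreement of the cross relations needed: B is moved past C, and the remaining
  -- factor in H is covered by `s3`.
  have s4 : ∀ b x, P (iB b) (i x) := fun b x => by
    refine dV (U'.mul.comp (CT.inr (iB b))) (U.mul.comp (CT.inr (iB b))) (fun c y => ?_) x
    obtain ⟨y', e1⟩ := hiH y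
    obtain ⟨y'', e2⟩ := hiH' y
    obtain ⟨c', e3⟩ := hiC c
    exact asr (pBC _ _) (by rw [e2]; exact s3 _ _) (by rw [e1, e3]; exact pV _ _)
  have s3' : ∀ z b, P z (iB b) := fun z b => by
    obtain ⟨b', e3⟩ := hiB b
    rw [e3]; exact s3 _ _
  have s5 : ∀ b z, P (iB b) z := fun b z =>
    dX (U'.mul.comp (CT.inr (iB b))) (U.mul.comp (CT.inr (iB b)))
      (fun _ _ => asr (s4 _ _) (s3' _ _) (pVB _ _)) z
  have s6 : ∀ x z, P (i x) z := fun x z =>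
    dX (U'.mul.comp (CT.inr (i x))) (U.mul.comp (CT.inr (i x)))
      (fun _ _ => asr (pV _ _) (s3' _ _) (pVB _ _)) z
  refine CT.hom_ext fun z z' => dX (U'.mul.comp (CT.inl z')) (U.mul.comp (CT.inl z'))
    (fun x b => asl (s5 _ _) (s6 _ _) (pVB _ _)) z

/-- Both products agree within each half, on the left half times B, and on B times C by the common
cross relation; triangularity propagates this to all pairs. -/
theorem IsDoubleBosonisation.mul_eq (hE : DBModel D q jH eA jC jB E)
    (h : E.IsDoubleBosonisation U) (h' : E.IsDoubleBosonisation U') : U'.mul = U.mul := by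
  refine h.hopf.mul_eq_of_triangular h'.hopf (i := E.inCH) (i' := E.inHB) (iC := E.inC)
    (iH := E.inH) (iB := E.inB) (fun c => ⟨_, rfl⟩) (fun y => ⟨_, rfl⟩)
    (fun y => ⟨_, (inH_eq E y).symm⟩) (fun b => ⟨_, rfl⟩) (fun x y => ⟨E.mulCH (tm k x y), ?_⟩)
    (fun x y => ⟨E.mulHB (tm k x y), ?_⟩) (fun f g hfg z => ?_) (fun f g hfg z => ?_)
    (fun f g hfg z => ?_) (fun x y => ?_) (fun x y => ?_) (fun x b => ?_) (fun b c => ?_)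
  · simpa only [BMap.comp_apply, CT.map_tm] using DFunLike.congr_fun h.mul_inCH (tm k x y)
  · simpa only [BMap.comp_apply, CT.map_tm] using DFunLike.congr_fun h.mul_inHB (tm k x y)
  · refine CT.induction_eq (fun x b => ?_) z
    rw [← h.mul_inCH_inB]; exact hfg x b
  · refine CT.induction_eq (f := f.comp E.inCH) (g := g.comp E.inCH) (fun x y => ?_) z
    rw [BMap.comp_apply, BMap.comp_apply, ← mul_inC_inH hE h.mul_inCH]; exact hfg x y
  · refine CT.induction_eq (f := f.comp E.inHB) (g := g.comp E.inHB) (fun x y => ?_) z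
    rw [BMap.comp_apply, BMap.comp_apply, ← mul_inH_inB hE h.mul_inHB]; exact hfg x y
  · simpa only [BMap.comp_apply, CT.map_tm] using
      DFunLike.congr_fun (h'.mul_inCH.trans h.mul_inCH.symm) (tm k x y)
  · simpa only [BMap.comp_apply, CT.map_tm] using
      DFunLike.congr_fun (h'.mul_inHB.trans h.mul_inHB.symm) (tm k x y)
  · exact (h'.mul_inCH_inB x b).trans (h.mul_inCH_inB x b).symm
  · simpa only [BMap.comp_apply, CT.map_tm] using
      DFunLike.congr_fun (h'.mul_inB_inC.trans h.mul_inB_inC.symm) (tm k b c)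

/-- With the product known, the coproduct is determined because x ⊗ b is a product of elements whose
coproducts are prescribed; counit and antipode follow formally. -/
theorem IsDoubleBosonisation.eq (hE : DBModel D q jH eA jC jB E)
    (h : E.IsDoubleBosonisation U) (h' : E.IsDoubleBosonisation U') : U' = U := by
  have h1 : U'.one = U.one := h'.one.trans h.one.symm
  have h2 := IsDoubleBosonisation.mul_eq hE h h'
  have h3 : U'.comul = U.comul := CT.hom_ext fun x b => by
    have e : ∀ b, U'.comul (E.inB b) = U.comul (E.inB b) := fun b =>
      DFunLike.congr_fun (h'.comul_inHB.trans h.comul_inHB.symm) (tm k E.hH.one b)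
    have e' : ∀ x, U'.comul (E.inCH x) = U.comul (E.inCH x) := fun x =>
      DFunLike.congr_fun (h'.comul_inCH.trans h.comul_inCH.symm) x
    have f := DFunLike.congr_fun h.hopf.comul_mul (tm k (E.inCH x) (E.inB b))
    have f' := DFunLike.congr_fun h'.hopf.comul_mul (tm k (E.inCH x) (E.inB b))
    simp only [BMap.comp_apply, CT.map_tm, h.mul_inCH_inB, e, e', h2] at f f'
    rw [f, f']
  have h4 := h.hopf.counit_eq h'.hopf h3
  have h5 := h.hopf.antipode_eq h'.hopf h1 h2 h3
  obtain ⟨_, _, _, _, _⟩ := U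
  obtain ⟨_, _, _, _, _⟩ := U'
  simp only at h1 h2 h3 h4 h5
  subst h1 h2 h3 h4 h5
  rfl

end Uniqueness

/-! ### Triangular triples in an algebra -/

namespace RootDatum

variable {I Φ : Type*} [AddCommGroup Φ] (D : RootDatum I Φ)

/-- The sum of the `(αᵢ, αⱼ)` over the pairs of letters of a word of weight `n`. -/
def quad (n : I →₀ ℤ) : ℤ :=
  (D.ip n n - Finsupp.linearCombination ℤ
    (fun i => D.ip (Finsupp.single i 1) (Finsupp.single i 1)) n) / 2

theorem quad_zero : D.quad 0 = 0 := by simp [quad, ip]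

/-- Adding one letter changes the numerator by twice an integer, so the integer division by two
causes no loss. This makes `quad` a function of the weight alone which accumulates the scalars from
reordering the letters of a word. -/
theorem quad_single_add (i : I) (n : I →₀ ℤ) :
    D.quad (Finsupp.single i 1 + n) = D.quad n + D.ip (Finsupp.single i 1) n := by
  have h : D.ip (Finsupp.single i 1 + n) (Finsupp.single i 1 + n) =
      D.ip (Finsupp.single i 1) (Finsupp.single i 1) + 2 * D.ip (Finsupp.single i 1) n +
        D.ip n n := by
    have := D.ip_comm (Finsupp.single i 1) n
    simp only [ip, map_add, LinearMap.add_apply] at this ⊢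
    omega
  rw [quad, quad, h, map_add, Finsupp.linearCombination_single, one_smul]
  omega

end RootDatum

section Triple

variable {k : Type*} [NormedField k] {I Φ : Type*} [AddCommGroup Φ]
  (D : RootDatum I Φ) (q : QNumber k) {A : Type*} [Ring A] [Algebra k A]

/-- The algebra map from the free algebra given by a family of elements. -/
def weval (x : I → A) : Words k I →ₗ[k] A :=
  Finsupp.linearCombination k (fun w : List I => (w.map x).prod)

theorem wordEval_eq (x : I → A) (y : Words k I) : wordEval x y = weval x y := rfl

theorem weval_bw (x : I → A) (w : List I) : weval x (bw k w) = (w.map x).prod := by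
  simp [weval, bw]

@[simp] theorem weval_nil (x : I → A) : weval x (bw k []) = 1 := by simp [weval_bw]

theorem weval_cons (x : I → A) (i : I) (y : Words k I) :
    weval x (cons k i y) = x i * weval x y := by
  have : weval x ∘ₗ cons k i = LinearMap.mulLeft k (x i) ∘ₗ weval x :=
    Words.hom_ext fun w => by simp [cons_bw, weval_bw]
  exact LinearMap.congr_fun this y

theorem weval_snoc (x : I → A) (i : I) (y : Words k I) :
    weval x (snoc k i y) = weval x y * x i := by
  have : weval x ∘ₗ snoc k i = LinearMap.mulRight k (x i) ∘ₗ weval x :=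
    Words.hom_ext fun w => by simp [snoc_bw, weval_bw]
  exact LinearMap.congr_fun this y

theorem weval_mul (x : I → A) (y z : Words k I) :
    weval x (Words.mul y z) = weval x y * weval x z := by
  have : (Words.mul (k := k) (I := I)).compr₂ (weval x) =
      ((LinearMap.mul k A).comp (weval x)).compl₂ (weval x) :=
    Words.hom_ext₂ fun u w => by simp [Words.mul_bw, weval_bw]
  exact LinearMap.congr_fun₂ this y z

theorem map_weval {A' : Type*} [Ring A'] [Algebra k A'] (g : A →ₐ[k] A') (x : I → A)
    (y : Words k I) : g (weval x y) = weval (fun i => g (x i)) y := by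
  have : g.toLinearMap ∘ₗ weval x = weval (fun i => g (x i)) :=
    Words.hom_ext fun w => by simp [weval_bw, map_list_prod, Function.comp_def]
  exact LinearMap.congr_fun this y

/-- Rescaling a family of elements, and multiplying it by quasi-commuting elements, preserves the
relations in the radical. -/
theorem weval_radical_of_twist {x x' : I → A} (hx : ∀ y ∈ radical D q, weval x y = 0)
    (κ : (I →₀ ℤ) → A) (h0 : κ 0 = 1) (χ : I → k) (hχ : ∀ i, χ i ≠ 0) (ε : ℤ)
    (h : ∀ i w, x' i * (weval x (bw k w) * κ (D.wt w)) =
      (χ i * q.val ^ (ε * D.ti i (D.rt w))) • (weval x (bw k (i :: w)) * κ (D.wt (i :: w))))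
    {y : Words k I} (hy : y ∈ radical D q) : weval x' y = 0 := by
  -- The total scalar collected on a word of weight n. It depends on the weight only, so the
  -- relations can be compared weight by weight.
  let g : (I →₀ ℤ) → k := fun n => (n.prod fun i m => χ i ^ m) * q.val ^ (ε * D.quad n)
  have hg : ∀ i n, g (Finsupp.single i 1 + n) =
      χ i * q.val ^ (ε * D.ip (Finsupp.single i 1) n) * g n := by
    intro i n
    have h1 : ((Finsupp.single i 1 + n).prod fun i m => χ i ^ m) =
        χ i * n.prod fun i m => χ i ^ m := by
      rw [Finsupp.prod_add_index' (by simp) (fun i a b => zpow_add₀ (hχ i) a b),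
        Finsupp.prod_single_index (by simp), zpow_one]
    simp only [g, h1, D.quad_single_add, mul_add, ← q.mul_zpow]
    ring
  refine radical_weight D q (fun n => g n • LinearMap.mulRight k (κ n) ∘ₗ weval x)
    (fun n y hy => by simp [hx y hy]) (weval x') (fun w => ?_) hy
  induction w with
  | nil => simp [RootDatum.wt, h0, g, D.quad_zero]
  | cons i w ih =>
    rw [← cons_bw, weval_cons, ih, LinearMap.smul_apply, mul_smul_comm]
    simp only [LinearMap.comp_apply, LinearMap.mulRight_apply, LinearMap.smul_apply]
    rw [h, smul_smul, cons_bw]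
    congr 1
    rw [show D.wt (i :: w) = Finsupp.single i 1 + D.wt w from rfl, hg]
    rw [show D.ti i (D.rt w) = D.ip (Finsupp.single i 1) (D.wt w) from rfl]
    ring

open scoped Classical in
/-- Elements which satisfy the relations of the quantum group, except for those in the radical. -/
structure IsPreTriple (e f : I → A) (κ : Module.Dual ℤ Φ → A) : Prop where
  κ_zero : κ 0 = 1
  κ_add : ∀ l m, κ (l + m) = κ l * κ m
  e_κ : ∀ i l, e i * κ l = q.val ^ l (D.α i) • (κ l * e i)
  κ_f : ∀ i l, κ l * f i = q.val ^ l (D.α i) • (f i * κ l)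
  e_f : ∀ i j, e i * f j = f j * e i +
    if i = j then (qDiff k D q j)⁻¹ • (κ (D.ti j) - κ (-D.ti j)) else 0

/-- Elements which satisfy the relations of the quantum group. -/
structure IsTriple (e f : I → A) (κ : Module.Dual ℤ Φ → A) : Prop extends
    IsPreTriple D q e f κ where
  serre_e : ∀ y ∈ radical D q, weval e y = 0
  serre_f : ∀ y ∈ radical D q, weval f y = 0

namespace IsPreTriple

variable {D q} {e f : I → A} {κ : Module.Dual ℤ Φ → A}

theorem κ_comm (h : IsPreTriple D q e f κ) (l m : Module.Dual ℤ Φ) : κ l * κ m = κ m * κ l := by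
  rw [← h.κ_add, add_comm, h.κ_add]

theorem κ_e (h : IsPreTriple D q e f κ)
    (i : I) (l : Module.Dual ℤ Φ) : κ l * e i = q.val ^ (-l (D.α i)) • (e i * κ l) := by
  rw [h.e_κ, smul_smul, q.mul_zpow, neg_add_cancel, zpow_zero, one_smul]

theorem f_κ (h : IsPreTriple D q e f κ)
    (i : I) (l : Module.Dual ℤ Φ) : f i * κ l = q.val ^ (-l (D.α i)) • (κ l * f i) := by
  rw [h.κ_f, smul_smul, q.mul_zpow, neg_add_cancel, zpow_zero, one_smul]

theorem weval_e_κ (h : IsPreTriple D q e f κ) (l : Module.Dual ℤ Φ) (y : Words k I) :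
    weval e y * κ l = κ l * weval e (tw D q l y) := by
  refine Words.induction (f := LinearMap.mulRight k (κ l) ∘ₗ weval e)
    (g := LinearMap.mulLeft k (κ l) ∘ₗ weval e ∘ₗ tw D q l) (by simp [tw_nil])
    (fun j y _ ih => ?_) y
  simp only [LinearMap.comp_apply, LinearMap.mulRight_apply, LinearMap.mulLeft_apply] at ih ⊢
  rw [weval_cons, mul_assoc, ih, ← mul_assoc, h.e_κ, tw_cons, map_smul, weval_cons, mul_smul_comm,
    smul_mul_assoc, mul_assoc]

theorem κ_weval_f (h : IsPreTriple D q e f κ) (l : Module.Dual ℤ Φ) (y : Words k I) :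
    κ l * weval f y = weval f (tw D q l y) * κ l := by
  refine Words.induction (f := LinearMap.mulLeft k (κ l) ∘ₗ weval f)
    (g := LinearMap.mulRight k (κ l) ∘ₗ weval f ∘ₗ tw D q l) (by simp [tw_nil])
    (fun j y _ ih => ?_) y
  simp only [LinearMap.comp_apply, LinearMap.mulRight_apply, LinearMap.mulLeft_apply] at ih ⊢
  rw [weval_cons, ← mul_assoc, h.κ_f, smul_mul_assoc, mul_assoc, ih, tw_cons, map_smul, weval_cons,
    smul_mul_assoc, mul_assoc]

theorem κ_neg_mul (h : IsPreTriple D q e f κ) (l : Module.Dual ℤ Φ) : κ (-l) * κ l = 1 := by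
  rw [← h.κ_add, neg_add_cancel, h.κ_zero]

/-- The commutator with e_i replaces one letter f_i by (κ(t_i) - κ(-t_i))/(q_i - q_i⁻¹). Moving
κ(t_i) to the right end and κ(-t_i) to the left end produces the scalars of the right and left
derivation, respectively. -/
theorem e_weval_f (h : IsPreTriple D q e f κ)
    (i : I) (y : Words k I) : e i * weval f y = weval f y * e i +
    (qDiff k D q i)⁻¹ • (weval f (rskew D q i y) * κ (D.ti i) -
      κ (-D.ti i) * weval f (skew D q i y)) := by
  refine Words.induction (f := LinearMap.mulLeft k (e i) ∘ₗ weval f)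
    (g := LinearMap.mulRight k (e i) ∘ₗ weval f + (qDiff k D q i)⁻¹ •
      (LinearMap.mulRight k (κ (D.ti i)) ∘ₗ weval f ∘ₗ rskew D q i -
        LinearMap.mulLeft k (κ (-D.ti i)) ∘ₗ weval f ∘ₗ skew D q i)) (by simp [skew_nil, rskew_nil])
    (fun j y _ ih => ?_) y
  simp only [LinearMap.comp_apply, LinearMap.mulRight_apply, LinearMap.mulLeft_apply,
    LinearMap.add_apply, LinearMap.smul_apply, LinearMap.sub_apply] at ih ⊢
  rw [weval_cons, ← mul_assoc, h.e_f, add_mul, mul_assoc (f j), ih, rskew_cons, skew_cons,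
    map_add, map_add, map_smul, weval_cons, weval_cons, mul_add (f j), mul_smul_comm, mul_sub,
    mul_assoc (f j) (weval f y), mul_add (κ _), add_mul (weval f _), mul_smul_comm,
    ← mul_assoc (κ _) (f j), h.κ_f, smul_mul_assoc, smul_smul, q.mul_zpow, LinearMap.neg_apply,
    add_neg_cancel, zpow_zero, one_smul]
  by_cases hij : i = j
  · subst hij
    simp only [if_true, smul_mul_assoc, sub_mul, h.κ_weval_f (D.ti i) y, mul_assoc]
    rw [add_assoc, ← smul_add]
    congr 2
    abel
  · simp [if_neg hij, mul_assoc]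

theorem weval_e_f (h : IsPreTriple D q e f κ)
    (j : I) (y : Words k I) : weval e y * f j = f j * weval e y +
    (qDiff k D q j)⁻¹ • (κ (D.ti j) * weval e (skew D q j y) -
      weval e (rskew D q j y) * κ (-D.ti j)) := by
  refine Words.induction (f := LinearMap.mulRight k (f j) ∘ₗ weval e)
    (g := LinearMap.mulLeft k (f j) ∘ₗ weval e + (qDiff k D q j)⁻¹ •
      (LinearMap.mulLeft k (κ (D.ti j)) ∘ₗ weval e ∘ₗ skew D q j -
        LinearMap.mulRight k (κ (-D.ti j)) ∘ₗ weval e ∘ₗ rskew D q j))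
    (by simp [skew_nil, rskew_nil]) (fun i y _ ih => ?_) y
  simp only [LinearMap.comp_apply, LinearMap.mulRight_apply, LinearMap.mulLeft_apply,
    LinearMap.add_apply, LinearMap.smul_apply, LinearMap.sub_apply] at ih ⊢
  rw [weval_cons, mul_assoc, ih, rskew_cons, skew_cons, map_add, map_add, map_smul, weval_cons,
    weval_cons, mul_add (e i), ← mul_assoc (e i), h.e_f, mul_smul_comm, mul_sub,
    ← mul_assoc (e i) (κ _), h.e_κ, smul_mul_assoc, mul_add (κ _), mul_smul_comm,
    mul_assoc (κ _) (e i), D.ti_comm, add_mul (weval e _), add_mul (f j * _), mul_assoc (f j),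
    mul_assoc (e i)]
  by_cases hij : i = j
  · subst hij
    simp only [if_true, smul_mul_assoc, sub_mul, h.weval_e_κ (-D.ti i), tw_tw, neg_add_cancel,
      tw_zero]
    rw [add_assoc, ← smul_add]
    congr 2
    abel
  · simp [if_neg hij, if_neg (Ne.symm hij)]

end IsPreTriple

end Triple

/-! ### The universal property of the quantum enveloping algebra -/

section UqLift

variable {k : Type*} [NormedField k] {I Φ : Type*} [AddCommGroup Φ]
  {D : RootDatum I Φ} {q : QNumber k} {A : Type*} [Ring A] [Algebra k A]

namespace IsTriple

variable {e f : I → A} {κ : Module.Dual ℤ Φ → A}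

/-- Collecting the factors κ at the right end of a word produces scalars which depend only on its
weight, so each weight component of a relation is merely rescaled. -/
theorem serre_e_twist (h : IsTriple D q e f κ) : ∀ y ∈ radical D q,
    weval (fun i => e i * κ (-D.ti i)) y = 0 := fun _ hy => by
  refine weval_radical_of_twist D q h.serre_e (fun n => κ (-D.tK n)) (by simp [h.κ_zero])
    (fun _ => 1) (fun _ => one_ne_zero) 1 (fun i w => ?_) hy
  simp only [one_mul]
  rw [← cons_bw, weval_cons, mul_assoc, ← mul_assoc (κ _), ← map_neg, D.tK_wt_cons, neg_add,
    h.κ_add]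
  have : κ (-D.ti i) * weval e (bw k w) = q.val ^ D.ti i (D.rt w) •
      (weval e (bw k w) * κ (-D.ti i)) := by
    rw [h.weval_e_κ, tw_bw, map_smul, mul_smul_comm, smul_smul, q.mul_zpow, LinearMap.neg_apply,
      add_neg_cancel, zpow_zero, one_smul]
  rw [map_neg, this, smul_mul_assoc, mul_smul_comm, mul_assoc, mul_assoc]

theorem serre_f_twist (h : IsTriple D q e f κ) : ∀ y ∈ radical D q,
    weval (fun i => -(κ (D.ti i) * f i)) y = 0 := fun _ hy => by
  refine weval_radical_of_twist D q h.serre_f (fun n => κ (D.tK n)) (by simp [h.κ_zero])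
    (fun i => -q.val ^ D.ti i (D.α i)) (fun i => neg_ne_zero.2 (zpow_ne_zero _ q.val_ne_zero)) 1
    (fun i w => ?_) hy
  rw [← cons_bw, weval_cons, D.tK_wt_cons, h.κ_add, neg_mul, h.κ_f, smul_mul_assoc, mul_assoc,
    ← mul_assoc (κ _), h.κ_weval_f, tw_bw, map_smul, smul_mul_assoc, smul_mul_assoc,
    mul_smul_comm, smul_smul, one_mul, neg_mul, neg_smul, mul_assoc, mul_assoc]

/-- The defining relations of U_q(g) are those of a triple rewritten through E_i = e_i κ(-t_i), F_i
= -κ(t_i) f_i, K_λ = κ(-λ). The sign in F_i compensates the replacement of λ by -λ. -/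
theorem lift_rel (h : IsTriple D q e f κ) {G : UqGen D → A}
    (hE : ∀ i, G (.E i) = e i * κ (-D.ti i)) (hF : ∀ i, G (.F i) = -(κ (D.ti i) * f i))
    (hK : ∀ l, G (.K l) = κ (-l)) ⦃x y : FreeAlgebra k (UqGen D)⦄ (hxy : UqRel D q x y) :
    FreeAlgebra.lift k G x = FreeAlgebra.lift k G y := by
  -- Both products acquire the same scalar and the same Cartan factor, so the twisted commutator is
  -- a multiple of the untwisted one; scalar and factor are trivial for i = j.
  have hEF : ∀ i j, (e i * κ (-D.ti i)) * (-(κ (D.ti j) * f j)) -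
      (-(κ (D.ti j) * f j)) * (e i * κ (-D.ti i)) =
        -(q.val ^ (D.ti j (D.α j) - D.ti i (D.α j)) • ((e i * f j - f j * e i) *
          κ (D.ti j - D.ti i))) := fun i j => by
    have h1 : (e i * κ (-D.ti i)) * (κ (D.ti j) * f j) =
        q.val ^ (D.ti j (D.α j) - D.ti i (D.α j)) • (e i * f j * κ (D.ti j - D.ti i)) := by
      rw [mul_assoc, ← mul_assoc (κ _), ← h.κ_add, neg_add_eq_sub, h.κ_f, mul_smul_comm,
        LinearMap.sub_apply, mul_assoc]
    have h2 : (κ (D.ti j) * f j) * (e i * κ (-D.ti i)) =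
        q.val ^ (D.ti j (D.α j) - D.ti i (D.α j)) • (f j * e i * κ (D.ti j - D.ti i)) := by
      rw [h.κ_f, smul_mul_assoc, mul_assoc, ← mul_assoc (κ _), h.κ_e, smul_mul_assoc,
        mul_smul_comm, smul_smul, q.mul_zpow, mul_assoc (e i), ← h.κ_add, ← sub_eq_add_neg,
        D.ti_comm j i, ← sub_eq_add_neg, mul_assoc]
    rw [mul_neg, neg_mul, h1, h2, sub_mul, smul_sub]
    abel
  cases hxy with
  | K_zero => simp [gen, hK, h.κ_zero]
  | K_add l m => simp [gen, hK, ← h.κ_add, add_comm]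
  | K_E l i =>
    simp only [gen, map_mul, map_smul, FreeAlgebra.lift_ι_apply, hE, hK]
    rw [← mul_assoc, h.κ_e, LinearMap.neg_apply, neg_neg, smul_mul_assoc, mul_assoc, h.κ_comm,
      mul_assoc]
  | K_F l i =>
    simp only [gen, map_mul, map_smul, FreeAlgebra.lift_ι_apply, hF, hK]
    rw [mul_neg, ← mul_assoc, h.κ_comm, mul_assoc, h.κ_f, mul_smul_comm, neg_mul, smul_neg,
      mul_assoc, LinearMap.neg_apply]
  | E_F i =>
    simp only [gen, map_mul, map_sub, map_smul, FreeAlgebra.lift_ι_apply, hE, hF, hK, hEF,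
      ← D.ti_eq]
    rw [h.e_f, if_pos rfl, sub_self, sub_self, zpow_zero, one_smul, h.κ_zero, mul_one,
      add_sub_cancel_left, neg_neg, ← smul_neg, neg_sub]
  | E_F_ne i j hij =>
    simp only [gen, map_mul, FreeAlgebra.lift_ι_apply, hE, hF]
    rw [← sub_eq_zero, hEF, h.e_f, if_neg hij]
    simp
  | serre_E y hy =>
    rw [wordEval_eq, map_weval, map_zero]
    simp only [gen, FreeAlgebra.lift_ι_apply, hE]
    exact h.serre_e_twist y hy
  | serre_F y hy =>
    rw [wordEval_eq, map_weval, map_zero]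
    simp only [gen, FreeAlgebra.lift_ι_apply, hF]
    exact h.serre_f_twist y hy

/-- The images of the generators of `U_q(g)`. -/
def genImage (e f : I → A) (κ : Module.Dual ℤ Φ → A) : UqGen D → A
  | .E i => e i * κ (-D.ti i)
  | .F i => -(κ (D.ti i) * f i)
  | .K l => κ (-l)

/-- The algebra map defined by a triple. -/
def lift (h : IsTriple D q e f κ) : Uq D q →ₐ[k] A :=
  RingQuot.liftAlgHom k ⟨FreeAlgebra.lift k (genImage e f κ), fun _ _ hxy =>
    h.lift_rel (fun _ => rfl) (fun _ => rfl) (fun _ => rfl) hxy⟩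

theorem lift_gen (h : IsTriple D q e f κ) (g : UqGen D) :
    h.lift (Uq.gen D q g) = genImage e f κ g := by
  refine (RingQuot.liftAlgHom_mkAlgHom_apply k _ _ _).trans ?_
  simp [gen]

end IsTriple

variable (D q)

/-- The element `Eᵢ tᵢ⁻¹` of `U_q(g)`. -/
def Uq.e (i : I) : Uq D q := Uq.E D q i * Uq.tInv D q i
/-- The element `-tᵢ Fᵢ` of `U_q(g)`. -/
def Uq.f (i : I) : Uq D q := -(Uq.t D q i * Uq.F D q i)
/-- The element `K_{-λ}` of `U_q(g)`. -/
def Uq.κ (l : Module.Dual ℤ Φ) : Uq D q := Uq.K D q (-l)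

theorem Uq.rel {x y : FreeAlgebra k (UqGen D)} (h : UqRel D q x y) :
    RingQuot.mkAlgHom k (UqRel D q) x = RingQuot.mkAlgHom k (UqRel D q) y :=
  RingQuot.mkAlgHom_rel k h

theorem Uq.K_zero : Uq.K D q 0 = 1 := (Uq.rel D q .K_zero).trans (map_one _)

theorem Uq.K_add (l m : Module.Dual ℤ Φ) : Uq.K D q l * Uq.K D q m = Uq.K D q (l + m) :=
  (map_mul _ _ _).symm.trans (Uq.rel D q (.K_add l m))

theorem Uq.K_E (l : Module.Dual ℤ Φ) (i : I) :
    Uq.K D q l * Uq.E D q i = q.val ^ l (D.α i) • (Uq.E D q i * Uq.K D q l) := by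
  have := Uq.rel D q (.K_E l i)
  rw [map_smul, map_mul, map_mul] at this
  exact this

theorem Uq.K_F (l : Module.Dual ℤ Φ) (i : I) :
    Uq.K D q l * Uq.F D q i = q.val ^ (-l (D.α i)) • (Uq.F D q i * Uq.K D q l) := by
  have := Uq.rel D q (.K_F l i)
  rw [map_smul, map_mul, map_mul] at this
  exact this

open scoped Classical in
theorem Uq.E_F (i j : I) : Uq.E D q i * Uq.F D q j - Uq.F D q j * Uq.E D q i =
    if i = j then (qDiff k D q j)⁻¹ • (Uq.K D q (D.ti j) - Uq.K D q (-D.ti j)) else 0 := by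
  split_ifs with h
  · subst h
    have := Uq.rel D q (.E_F i)
    rw [map_smul, map_sub, map_sub, map_mul, map_mul, ← D.ti_eq] at this
    exact this
  · have := Uq.rel D q (.E_F_ne i j h)
    rw [map_mul, map_mul] at this
    rw [sub_eq_zero]
    exact this

theorem Uq.serre_E {y : Words k I} (hy : y ∈ radical D q) : weval (Uq.E D q) y = 0 := by
  have := Uq.rel D q (.serre_E y hy)
  rwa [map_zero, wordEval_eq, map_weval] at this

theorem Uq.serre_F {y : Words k I} (hy : y ∈ radical D q) : weval (Uq.F D q) y = 0 := by
  have := Uq.rel D q (.serre_F y hy)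
  rwa [map_zero, wordEval_eq, map_weval] at this

theorem Uq.weval_E_K (l : Module.Dual ℤ Φ) (w : List I) : Uq.K D q l * weval (Uq.E D q) (bw k w) =
    q.val ^ l (D.rt w) • (weval (Uq.E D q) (bw k w) * Uq.K D q l) := by
  induction w with
  | nil => simp
  | cons i w ih =>
    rw [← cons_bw, weval_cons, ← mul_assoc, Uq.K_E, smul_mul_assoc, mul_assoc, ih, mul_smul_comm,
      smul_smul, q.mul_zpow, mul_assoc, D.rt_cons, map_add]

theorem Uq.weval_F_K (l : Module.Dual ℤ Φ) (w : List I) : Uq.K D q l * weval (Uq.F D q) (bw k w) =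
    q.val ^ (-l (D.rt w)) • (weval (Uq.F D q) (bw k w) * Uq.K D q l) := by
  induction w with
  | nil => simp
  | cons i w ih =>
    rw [← cons_bw, weval_cons, ← mul_assoc, Uq.K_F, smul_mul_assoc, mul_assoc, ih, mul_smul_comm,
      smul_smul, q.mul_zpow, mul_assoc, D.rt_cons, map_add, neg_add]

theorem Uq.t_eq (i : I) : Uq.t D q i = Uq.K D q (D.ti i) := by rw [Uq.t, D.ti_eq]
theorem Uq.tInv_eq (i : I) : Uq.tInv D q i = Uq.K D q (-D.ti i) := by rw [Uq.tInv, D.ti_eq]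

/-- The change of generators adapted to the double bosonisation: e_i and f_i quasi-commute with the
torus as before, their commutator has the form required by the cross relation, and the relations in
the radical survive because the inserted Cartan elements only rescale weight components. -/
theorem Uq.isTriple : IsTriple D q (Uq.e D q) (Uq.f D q) (Uq.κ D q) where
  κ_zero := by rw [Uq.κ, neg_zero, Uq.K_zero]
  κ_add l m := by rw [Uq.κ, Uq.κ, Uq.κ, Uq.K_add, neg_add]
  e_κ i l := by
    rw [Uq.κ, Uq.e, Uq.tInv_eq, ← mul_assoc, Uq.K_E, smul_mul_assoc, smul_smul, q.mul_zpow,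
      LinearMap.neg_apply, add_neg_cancel, zpow_zero, one_smul, mul_assoc, mul_assoc, Uq.K_add,
      Uq.K_add, add_comm]
  κ_f i l := by
    rw [Uq.κ, Uq.f, Uq.t_eq, mul_neg, neg_mul, smul_neg, ← mul_assoc, Uq.K_add, add_comm,
      ← Uq.K_add, mul_assoc, mul_assoc, Uq.K_F, mul_smul_comm, LinearMap.neg_apply, neg_neg]
  e_f i j := by
    have h := Uq.E_F D q i j
    have h1 : Uq.e D q i * Uq.f D q j = -(q.val ^ (D.ti i (D.α j) - D.ti j (D.α j)) •
        (Uq.E D q i * Uq.F D q j * Uq.K D q (D.ti j - D.ti i))) := by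
      rw [Uq.e, Uq.f, Uq.tInv_eq, Uq.t_eq, mul_neg, mul_assoc, ← mul_assoc (Uq.K D q _), Uq.K_add,
        Uq.K_F, mul_smul_comm, neg_add_eq_sub, ← mul_assoc, LinearMap.sub_apply, neg_sub]
    have h2 : Uq.f D q j * Uq.e D q i = -(q.val ^ (D.ti i (D.α j) - D.ti j (D.α j)) •
        (Uq.F D q j * Uq.E D q i * Uq.K D q (D.ti j - D.ti i))) := by
      rw [Uq.e, Uq.f, Uq.tInv_eq, Uq.t_eq, neg_mul, Uq.K_F, smul_mul_assoc, mul_assoc,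
        ← mul_assoc (Uq.K D q _), Uq.K_E, smul_mul_assoc, mul_smul_comm, smul_smul, q.mul_zpow,
        mul_assoc (Uq.E D q i), Uq.K_add, ← sub_eq_add_neg, D.ti_comm j i, neg_add_eq_sub,
        mul_assoc]
    rw [h1, h2, ← sub_eq_iff_eq_add', sub_neg_eq_add, neg_add_eq_sub, ← smul_sub, ← sub_mul,
      ← neg_sub (Uq.E D q i * _), h]
    by_cases hij : i = j
    · subst hij
      simp [Uq.K_zero, Uq.κ]
      rw [← smul_neg, neg_sub]
    · simp [hij]
  serre_e y hy := by
    refine weval_radical_of_twist D q (fun y hy => Uq.serre_E D q hy)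
      (fun n => Uq.K D q (-D.tK n)) (by simp [Uq.K_zero]) (fun _ => 1) (fun _ => one_ne_zero) (-1)
      (fun i w => ?_) hy
    simp only [one_mul, neg_mul]
    rw [Uq.e, Uq.tInv_eq, ← cons_bw, weval_cons, mul_assoc, ← mul_assoc (Uq.K D q _),
      Uq.weval_E_K, D.tK_wt_cons, smul_mul_assoc, mul_smul_comm, mul_assoc (weval _ _), Uq.K_add,
      neg_add, LinearMap.neg_apply, mul_assoc]
  serre_f y hy := by
    refine weval_radical_of_twist D q (fun y hy => Uq.serre_F D q hy)
      (fun n => Uq.K D q (D.tK n)) (by simp [Uq.K_zero]) (fun i => -q.val ^ (-D.ti i (D.α i)))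
      (fun i => neg_ne_zero.2 (zpow_ne_zero _ q.val_ne_zero)) (-1)
      (fun i w => ?_) hy
    simp only [neg_mul, one_mul]
    rw [Uq.f, Uq.t_eq, ← cons_bw, weval_cons, neg_mul, Uq.K_F, smul_mul_assoc, mul_assoc,
      ← mul_assoc (Uq.K D q _), Uq.weval_F_K, D.tK_wt_cons, smul_mul_assoc, mul_smul_comm,
      smul_smul, mul_assoc (weval _ _), Uq.K_add, neg_smul, mul_assoc]

theorem Uq.K_eq (l : Module.Dual ℤ Φ) : Uq.K D q l = Uq.κ D q (-l) := by rw [Uq.κ, neg_neg]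

theorem Uq.E_eq (i : I) : Uq.E D q i = Uq.e D q i * Uq.κ D q (-D.ti i) := by
  rw [Uq.e, Uq.tInv_eq, Uq.κ, mul_assoc, Uq.K_add, neg_neg, neg_add_cancel, Uq.K_zero, mul_one]

theorem Uq.F_eq (i : I) : Uq.F D q i = -(Uq.κ D q (D.ti i) * Uq.f D q i) := by
  rw [Uq.f, Uq.t_eq, Uq.κ, mul_neg, ← mul_assoc, Uq.K_add, neg_add_cancel, Uq.K_zero, one_mul,
    neg_neg]

variable {D q}

theorem IsTriple.lift_κ {e f : I → A} {κ : Module.Dual ℤ Φ → A} (h : IsTriple D q e f κ)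
    (l : Module.Dual ℤ Φ) : h.lift (Uq.κ D q l) = κ l := by
  rw [Uq.κ, Uq.K, h.lift_gen, genImage, neg_neg]

theorem IsTriple.lift_e {e f : I → A} {κ : Module.Dual ℤ Φ → A} (h : IsTriple D q e f κ)
    (i : I) : h.lift (Uq.e D q i) = e i := by
  rw [Uq.e, map_mul, Uq.E, h.lift_gen, Uq.tInv_eq, Uq.K, h.lift_gen, genImage, genImage, mul_assoc,
    neg_neg, h.κ_neg_mul, mul_one]

theorem IsTriple.lift_f {e f : I → A} {κ : Module.Dual ℤ Φ → A} (h : IsTriple D q e f κ)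
    (i : I) : h.lift (Uq.f D q i) = f i := by
  rw [Uq.f, map_neg, map_mul, Uq.F, h.lift_gen, Uq.t_eq, Uq.K, h.lift_gen, genImage, genImage,
    mul_neg, neg_neg, ← mul_assoc, h.κ_neg_mul, one_mul]

/-- Induction on the generators. -/
theorem Uq.induction {P : Uq D q → Prop} (he : ∀ i, P (Uq.e D q i)) (hf : ∀ i, P (Uq.f D q i))
    (hκ : ∀ l, P (Uq.κ D q l)) (h_mul : ∀ x y, P x → P y → P (x * y))
    (h_add : ∀ x y, P x → P y → P (x + y)) (h_alg : ∀ c : k, P (algebraMap k _ c)) (x : Uq D q) :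
    P x := by
  obtain ⟨x, rfl⟩ := RingQuot.mkAlgHom_surjective k (UqRel D q) x
  change P (RingQuot.mkAlgHom k (UqRel D q) x)
  induction x using FreeAlgebra.induction with
  | grade0 c => rw [AlgHom.commutes]; exact h_alg c
  | grade1 g =>
    change P (Uq.gen D q g)
    cases g with
    | E i =>
      have := h_mul _ _ (he i) (hκ (-D.ti i))
      rwa [← Uq.E_eq] at this
    | F i =>
      have := h_mul _ _ (h_alg (-1)) (h_mul _ _ (hκ (D.ti i)) (hf i))
      rw [map_neg, map_one, neg_one_mul, ← Uq.F_eq] at this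
      exact this
    | K l =>
      have := hκ (-l)
      rwa [← Uq.K_eq] at this
  | mul x y hx hy => rw [map_mul]; exact h_mul _ _ hx hy
  | add x y hx hy => rw [map_add]; exact h_add _ _ hx hy

theorem Uq.algHom_ext {g g' : Uq D q →ₐ[k] A} (he : ∀ i, g (Uq.e D q i) = g' (Uq.e D q i))
    (hf : ∀ i, g (Uq.f D q i) = g' (Uq.f D q i)) (hκ : ∀ l, g (Uq.κ D q l) = g' (Uq.κ D q l)) :
    g = g' :=
  AlgHom.ext <| Uq.induction he hf hκ (fun x y hx hy => by rw [map_mul, map_mul, hx, hy])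
    (fun x y hx hy => by rw [map_add, map_add, hx, hy])
    (fun c => by rw [AlgHom.commutes, AlgHom.commutes])

end UqLift

/-! ### The usual Hopf algebra structure of `U_q(g)` -/

section UsualHopf

variable {k : Type*} [NormedField k] {I Φ : Type*} [AddCommGroup Φ]
  (D : RootDatum I Φ) (q : QNumber k)

open Uq

/-- The map `u ⊗ v ↦ e_u ⊗ κ_{|u|} e_v`, for words `u` and `v`. -/
def Uq.comulE : Words k I →ₗ[k] Words k I →ₗ[k] Uq D q ⊗[k] Uq D q :=
  Finsupp.linearCombination k fun u => TensorProduct.mk k _ _ (weval (e D q) (bw k u)) ∘ₗ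
    LinearMap.mulLeft k (κ D q (D.tK (D.wt u))) ∘ₗ weval (e D q)

theorem Uq.comulE_bw (u : List I) (y : Words k I) : comulE D q (bw k u) y =
    weval (e D q) (bw k u) ⊗ₜ (κ D q (D.tK (D.wt u)) * weval (e D q) y) := by
  simp [comulE, bw]

/-- The map `u ⊗ v ↦ κ_{-|u|} f_v ⊗ f_u`, for words `u` and `v`. -/
def Uq.comulF : Words k I →ₗ[k] Words k I →ₗ[k] Uq D q ⊗[k] Uq D q :=
  Finsupp.linearCombination k fun u =>
    (TensorProduct.mk k _ _).flip (weval (f D q) (bw k u)) ∘ₗ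
    LinearMap.mulLeft k (κ D q (-D.tK (D.wt u))) ∘ₗ weval (f D q)

theorem Uq.comulF_bw (u : List I) (y : Words k I) : comulF D q (bw k u) y =
    (κ D q (-D.tK (D.wt u)) * weval (f D q) y) ⊗ₜ weval (f D q) (bw k u) := by
  simp [comulF, bw]

/-- The map respects the radical in each argument: in the first after fixing the weight, since the
Cartan factor depends on the weight, and in the second directly. The coproduct of an element of the
radical is therefore sent to zero. -/
theorem Uq.comulE_radical {y : Words k I} (hy : y ∈ radical D q) :
    TensorProduct.lift (comulE D q) (Words.comul D q y) = 0 := by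
  refine comul_radical_eq_zero D q (comulE D q) (fun y hy x => ?_) (fun y hy x => ?_) hy
  · refine radical_weight D q (fun n => (TensorProduct.mk k _ _).flip
      (κ D q (D.tK n) * weval (e D q) x) ∘ₗ weval (e D q)) (fun n y hy => ?_)
      ((comulE D q).flip x) (fun w => ?_) hy
    · simp [(isTriple D q).serre_e y hy]
    · simp [comulE_bw]
  · have : (comulE D q).flip y = 0 := Words.hom_ext fun w => by
      simp [comulE_bw, (isTriple D q).serre_e y hy]
    exact LinearMap.congr_fun this x

theorem Uq.comulF_radical {y : Words k I} (hy : y ∈ radical D q) :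
    TensorProduct.lift (comulF D q) (Words.comul D q y) = 0 := by
  refine comul_radical_eq_zero D q (comulF D q) (fun y hy x => ?_) (fun y hy x => ?_) hy
  · refine radical_weight D q (fun n => TensorProduct.mk k _ _
      (κ D q (-D.tK n) * weval (f D q) x) ∘ₗ weval (f D q)) (fun n y hy => ?_)
      ((comulF D q).flip x) (fun w => ?_) hy
    · simp [(isTriple D q).serre_f y hy]
    · simp [comulF_bw]
  · have : (comulF D q).flip y = 0 := Words.hom_ext fun w => by
      simp [comulF_bw, (isTriple D q).serre_f y hy]
    exact LinearMap.congr_fun this x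

/-- Inserting κ of the weight of the first factor bosonises the braided coproduct: multiplication by
Δ(e_j) then corresponds to the operator `Lop`, because the scalar from commuting e_j with κ is that
of the braiding. -/
theorem Uq.weval_comul_e (y : Words k I) :
    weval (fun i => e D q i ⊗ₜ[k] κ D q (D.ti i) + 1 ⊗ₜ e D q i) y =
      TensorProduct.lift (comulE D q) (Words.comul D q y) := by
  have h := (isTriple D q)
  refine Words.induction (g := TensorProduct.lift (comulE D q) ∘ₗ Words.comul D q) ?_
    (fun j y _ ih => ?_) y
  · simp [Words.comul_nil, comulE_bw, RootDatum.wt, h.κ_zero, Algebra.TensorProduct.one_def]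
  · rw [LinearMap.comp_apply] at ih ⊢
    rw [weval_cons, ih, Words.comul_cons]
    generalize Words.comul D q y = z
    have : LinearMap.mulLeft k (e D q j ⊗ₜ[k] κ D q (D.ti j) + 1 ⊗ₜ e D q j) ∘ₗ
        TensorProduct.lift (comulE D q) = TensorProduct.lift (comulE D q) ∘ₗ Lop D q j := by
        refine TensorProduct.ext (Words.hom_ext₂ fun u v => ?_)
        simp only [TensorProduct.mk_apply, LinearMap.comp_apply, LinearMap.compr₂ₛₗ_apply,
          TensorProduct.lift.tmul, Lop_tmul, map_add, LinearMap.mulLeft_apply, comulE_bw, cons_bw,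
          tw_bw, map_smul, LinearMap.smul_apply, add_mul, Algebra.TensorProduct.tmul_mul_tmul,
          one_mul]
        rw [← mul_assoc, ← h.κ_add, ← D.tK_wt_cons, ← weval_cons, cons_bw, ← mul_assoc, h.e_κ,
          smul_mul_assoc, mul_assoc, ← weval_cons, cons_bw, TensorProduct.tmul_smul, D.ti_rt]
    exact LinearMap.congr_fun this z

/-- The same bosonisation for the opposite half: the two tensor factors are exchanged and the Cartan
element is inverted, reflecting the inverse braiding in the comultiplication of C̄. -/
theorem Uq.weval_comul_f (y : Words k I) :
    weval (fun i => f D q i ⊗ₜ[k] 1 + κ D q (-D.ti i) ⊗ₜ f D q i) y =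
      TensorProduct.lift (comulF D q) (Words.comul D q y) := by
  have h := (isTriple D q)
  refine Words.induction (g := TensorProduct.lift (comulF D q) ∘ₗ Words.comul D q) ?_
    (fun j y _ ih => ?_) y
  · simp [Words.comul_nil, comulF_bw, RootDatum.wt, h.κ_zero, Algebra.TensorProduct.one_def]
  · rw [LinearMap.comp_apply] at ih ⊢
    rw [weval_cons, ih, Words.comul_cons]
    generalize Words.comul D q y = z
    have : LinearMap.mulLeft k (f D q j ⊗ₜ[k] 1 + κ D q (-D.ti j) ⊗ₜ f D q j) ∘ₗ
        TensorProduct.lift (comulF D q) = TensorProduct.lift (comulF D q) ∘ₗ Lop D q j := by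
        refine TensorProduct.ext (Words.hom_ext₂ fun u v => ?_)
        simp only [TensorProduct.mk_apply, LinearMap.comp_apply, LinearMap.compr₂ₛₗ_apply,
          TensorProduct.lift.tmul, Lop_tmul, map_add, LinearMap.mulLeft_apply, comulF_bw, cons_bw,
          tw_bw, map_smul, LinearMap.smul_apply, add_mul, Algebra.TensorProduct.tmul_mul_tmul,
          one_mul]
        rw [← mul_assoc, h.f_κ, smul_mul_assoc, mul_assoc, ← weval_cons, cons_bw, ← mul_assoc,
          ← h.κ_add, ← weval_cons, cons_bw, D.tK_wt_cons, neg_add, TensorProduct.smul_tmul',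
          LinearMap.neg_apply, neg_neg, D.ti_rt, add_comm]
    exact LinearMap.congr_fun this z

/-- By the universal property this yields the comultiplication as an algebra map; the relations in
the radical hold because the bosonised coproduct kills the radical. -/
theorem Uq.isTriple_comul : IsTriple D q
    (fun i => e D q i ⊗ₜ[k] κ D q (D.ti i) + 1 ⊗ₜ e D q i)
    (fun i => f D q i ⊗ₜ[k] 1 + κ D q (-D.ti i) ⊗ₜ f D q i)
    (fun l => κ D q l ⊗ₜ[k] κ D q l) := by
  have h := (isTriple D q)
  refine ⟨⟨?_, fun l m => ?_, fun i l => ?_, fun i l => ?_, fun i j => ?_⟩, fun y hy => ?_,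
    fun y hy => ?_⟩
  · rw [h.κ_zero]; rfl
  · rw [Algebra.TensorProduct.tmul_mul_tmul, ← h.κ_add]
  · simp only [add_mul, mul_add, Algebra.TensorProduct.tmul_mul_tmul, h.e_κ, h.κ_comm (D.ti i) l,
      one_mul, mul_one, smul_add, TensorProduct.tmul_smul, TensorProduct.smul_tmul']
  · simp only [add_mul, mul_add, Algebra.TensorProduct.tmul_mul_tmul, h.κ_f, h.κ_comm (-D.ti i) l,
      one_mul, mul_one, smul_add, TensorProduct.tmul_smul, TensorProduct.smul_tmul']
  · simp only [add_mul, mul_add, Algebra.TensorProduct.tmul_mul_tmul, one_mul, mul_one]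
    -- The mixed terms commute because the scalars from the two tensor factors are inverse to each
    -- other, by symmetry of (α_i, α_j).
    have h1 : (e D q i * κ D q (-D.ti j)) ⊗ₜ[k] (κ D q (D.ti i) * f D q j) =
        (κ D q (-D.ti j) * e D q i) ⊗ₜ[k] (f D q j * κ D q (D.ti i)) := by
      rw [h.e_κ, h.κ_f, ← TensorProduct.smul_tmul', TensorProduct.tmul_smul, smul_smul,
        q.mul_zpow, D.ti_comm i j, LinearMap.neg_apply, neg_add_cancel, zpow_zero, one_smul]
    rw [h1, h.e_f]
    by_cases hij : i = j
    · subst hij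
      simp only [if_true, TensorProduct.add_tmul, TensorProduct.tmul_add, smul_sub,
        TensorProduct.sub_tmul, TensorProduct.tmul_sub, TensorProduct.tmul_smul,
        TensorProduct.smul_tmul', ]
      abel
    · simp only [if_neg hij, add_zero]
      abel
  · rw [weval_comul_e, comulE_radical D q hy]
  · rw [weval_comul_f, comulF_radical D q hy]

/-- The comultiplication of `U_q(g)`. -/
def Uq.comul : Uq D q →ₐ[k] Uq D q ⊗[k] Uq D q := (isTriple_comul D q).lift

theorem Uq.comul_weval_e (y : Words k I) : comul D q (weval (e D q) y) =
    TensorProduct.lift (comulE D q) (Words.comul D q y) := by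
  rw [← weval_comul_e, map_weval]
  simp only [comul, IsTriple.lift_e]

theorem Uq.comul_weval_f (y : Words k I) : comul D q (weval (f D q) y) =
    TensorProduct.lift (comulF D q) (Words.comul D q y) := by
  rw [← weval_comul_f, map_weval]
  simp only [comul, IsTriple.lift_f]

theorem weval_zero (y : Words k I) : weval (fun _ : I => (0 : k)) y = Words.counit k I y :=
  Words.induction (f := weval (fun _ : I => (0 : k))) (g := Words.counit k I)
    (by simp [Words.counit_nil])
    (fun j y _ _ => by rw [weval_cons, zero_mul, Words.counit_cons]) y

theorem Uq.isTriple_counit :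
    IsTriple D q (fun _ : I => (0 : k)) (fun _ => 0) (fun _ => (1 : k)) where
  κ_zero := rfl
  κ_add _ _ := by simp
  e_κ _ _ := by simp
  κ_f _ _ := by simp
  e_f _ _ := by simp
  serre_e y hy := by rw [weval_zero, ← form_nil_left' D q, (mem_radical D q).1 hy]
  serre_f y hy := by rw [weval_zero, ← form_nil_left' D q, (mem_radical D q).1 hy]

/-- The counit of `U_q(g)`. -/
def Uq.counit : Uq D q →ₐ[k] k := (isTriple_counit D q).lift

open MulOpposite in
-- The antipode of a bosonisation is the braided antipode followed by a Cartan element of the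
-- opposite weight. For the f half, the inverse braided antipode takes its place.
theorem Uq.weval_antipode_e (w : List I) :
    weval (fun i => op (-(e D q i * κ D q (-D.ti i)))) (bw k w) =
      op (weval (e D q) (Words.S D q 1 (bw k w)) * κ D q (-D.tK (D.wt w))) := by
  have h := (isTriple D q)
  induction w with
  | nil => simp [Words.S_nil, RootDatum.wt, h.κ_zero]
  | cons i w ih =>
    rw [← cons_bw, weval_cons, ih, ← op_mul, Words.S_cons, map_neg, weval_snoc, D.tK_wt_cons,
      tw_bw, map_smul, map_smul, one_smul, mul_neg, mul_assoc, ← mul_assoc (κ D q _), h.κ_e,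
      smul_mul_assoc, mul_smul_comm, mul_assoc (e D q i), ← h.κ_add, neg_mul, smul_mul_assoc,
      smul_mul_assoc, mul_assoc, LinearMap.neg_apply, neg_neg, ← D.ti_rt, neg_add, add_comm]

open MulOpposite in
theorem Uq.weval_antipode_f (w : List I) :
    weval (fun i => op (-(κ D q (D.ti i) * f D q i))) (bw k w) =
      op (κ D q (D.tK (D.wt w)) * weval (f D q) (Words.S D q (-1) (bw k w))) := by
  have h := (isTriple D q)
  induction w with
  | nil => simp [Words.S_nil, RootDatum.wt, h.κ_zero]
  | cons i w ih =>
    have h1 := h.κ_weval_f (D.ti i) (Words.S D q (-1) (tw D q (-D.ti i) (bw k w)))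
    rw [← Words.S_tw, tw_tw, add_neg_cancel, tw_zero] at h1
    rw [← cons_bw, weval_cons, ih, ← op_mul, Words.S_cons, map_neg, weval_snoc, D.tK_wt_cons,
      mul_neg, mul_assoc, ← mul_assoc (weval _ _), ← h1, neg_one_smul, add_comm (D.ti i), h.κ_add,
      mul_neg, mul_assoc, mul_assoc]

open MulOpposite in
-- Working in the opposite algebra turns the anti-homomorphism into one supplied by the universal
-- property. The relations in the radical hold since the radical is stable under the braided
-- antipode and its inverse.
theorem Uq.isTriple_antipode : IsTriple D q
    (fun i => op (-(e D q i * κ D q (-D.ti i))))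
    (fun i => op (-(κ D q (D.ti i) * f D q i)))
    (fun l => op (κ D q (-l))) := by
  have h := (isTriple D q)
  refine ⟨⟨?_, fun l m => ?_, fun i l => ?_, fun i l => ?_, fun i j => ?_⟩, fun y hy => ?_,
    fun y hy => ?_⟩
  · rw [neg_zero, h.κ_zero]; rfl
  · rw [← op_mul, ← h.κ_add, neg_add_rev]
  · rw [← op_mul, ← op_mul, ← op_smul, mul_neg, ← mul_assoc, h.κ_e, neg_mul, mul_assoc,
      h.κ_comm (-D.ti i), smul_mul_assoc, mul_assoc, LinearMap.neg_apply, neg_neg, smul_neg]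
  · rw [← op_mul, ← op_mul, ← op_smul, neg_mul, mul_assoc, h.f_κ, mul_neg, mul_smul_comm,
      ← mul_assoc, h.κ_comm (D.ti i), mul_assoc, LinearMap.neg_apply, neg_neg, smul_neg]
  · have h1 : (κ D q (D.ti j) * f D q j) * (e D q i * κ D q (-D.ti i)) =
        κ D q (D.ti j) * (f D q j * e D q i) * κ D q (-D.ti i) := by simp only [mul_assoc]
    have h2 : (e D q i * κ D q (-D.ti i)) * (κ D q (D.ti j) * f D q j) =
        κ D q (D.ti j) * (e D q i * f D q j) * κ D q (-D.ti i) := by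
      rw [mul_assoc, ← mul_assoc (κ D q _), h.κ_comm, mul_assoc, h.κ_f, mul_smul_comm,
        mul_smul_comm, ← mul_assoc, h.e_κ, smul_mul_assoc, smul_smul, q.mul_zpow, ← mul_assoc,
        D.ti_comm j i, LinearMap.neg_apply, neg_add_cancel, zpow_zero, one_smul, mul_assoc (κ D q _)]
    rw [← op_mul, ← op_mul, neg_mul_neg, neg_mul_neg, h1, h2, h.e_f]
    by_cases hij : i = j
    · subst hij
      rw [if_pos rfl, if_pos rfl, ← op_sub, ← op_smul, ← op_add]
      congr 1
      simp only [mul_add, add_mul, mul_smul_comm, smul_mul_assoc, mul_sub, sub_mul, ← h.κ_add,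
        neg_neg]
      simp only [add_neg_cancel_right, add_neg_cancel, zero_add]
      rw [add_assoc, ← smul_add, sub_add_sub_cancel, sub_self, smul_zero, add_zero]
    · simp [if_neg hij]
  · refine radical_weight D q (fun n => (opLinearEquiv k).toLinearMap ∘ₗ
      LinearMap.mulRight k (κ D q (-D.tK n)) ∘ₗ weval (e D q) ∘ₗ Words.S D q 1)
      (fun n y hy => ?_) _ (fun w => weval_antipode_e D q w) hy
    simp [h.serre_e _ (S_mem_radical D q hy 1)]
  · refine radical_weight D q (fun n => (opLinearEquiv k).toLinearMap ∘ₗ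
      LinearMap.mulLeft k (κ D q (D.tK n)) ∘ₗ weval (f D q) ∘ₗ Words.S D q (-1))
      (fun n y hy => ?_) _ (fun w => weval_antipode_f D q w) hy
    simp [h.serre_f _ (S_mem_radical D q hy (-1))]

/-- The antipode of `U_q(g)`. -/
def Uq.antipode : Uq D q →ₗ[k] Uq D q :=
  (MulOpposite.opLinearEquiv k).symm.toLinearMap ∘ₗ (isTriple_antipode D q).lift.toLinearMap

theorem Uq.antipode_eq (x : Uq D q) :
    antipode D q x = ((isTriple_antipode D q).lift x).unop := rfl

theorem Uq.antipode_mul (x y : Uq D q) :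
    antipode D q (x * y) = antipode D q y * antipode D q x := by
  simp [antipode_eq]

theorem Uq.antipode_one : antipode D q 1 = 1 := by simp [antipode_eq]

theorem Uq.antipode_e (i : I) : antipode D q (e D q i) = -(e D q i * κ D q (-D.ti i)) := by
  rw [antipode_eq, IsTriple.lift_e, MulOpposite.unop_op]

theorem Uq.antipode_f (i : I) : antipode D q (f D q i) = -(κ D q (D.ti i) * f D q i) := by
  rw [antipode_eq, IsTriple.lift_f, MulOpposite.unop_op]

theorem Uq.antipode_κ (l : Module.Dual ℤ Φ) : antipode D q (κ D q l) = κ D q (-l) := by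
  rw [antipode_eq, IsTriple.lift_κ, MulOpposite.unop_op]

theorem Uq.antipode_weval_e (w : List I) : antipode D q (weval (e D q) (bw k w)) =
    weval (e D q) (Words.S D q 1 (bw k w)) * κ D q (-D.tK (D.wt w)) := by
  rw [antipode_eq, map_weval]
  simp only [IsTriple.lift_e]
  rw [weval_antipode_e, MulOpposite.unop_op]

theorem Uq.antipode_weval_f (w : List I) : antipode D q (weval (f D q) (bw k w)) =
    κ D q (D.tK (D.wt w)) * weval (f D q) (Words.S D q (-1) (bw k w)) := by
  rw [antipode_eq, map_weval]
  simp only [IsTriple.lift_f]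
  rw [weval_antipode_f, MulOpposite.unop_op]

theorem Uq.comul_e (i : I) :
    comul D q (e D q i) = e D q i ⊗ₜ[k] κ D q (D.ti i) + 1 ⊗ₜ e D q i := IsTriple.lift_e _ _
theorem Uq.comul_f (i : I) :
    comul D q (f D q i) = f D q i ⊗ₜ[k] 1 + κ D q (-D.ti i) ⊗ₜ f D q i := IsTriple.lift_f _ _
theorem Uq.comul_κ (l : Module.Dual ℤ Φ) :
    comul D q (κ D q l) = κ D q l ⊗ₜ[k] κ D q l := IsTriple.lift_κ _ _
theorem Uq.counit_e (i : I) : counit D q (e D q i) = 0 := IsTriple.lift_e _ _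
theorem Uq.counit_f (i : I) : counit D q (f D q i) = 0 := IsTriple.lift_f _ _
theorem Uq.counit_κ (l : Module.Dual ℤ Φ) : counit D q (κ D q l) = 1 := IsTriple.lift_κ _ _

theorem Uq.antipode_left (x : Uq D q) : LinearMap.mul' k _
    (TensorProduct.map (antipode D q) .id (comul D q x)) = algebraMap k _ (counit D q x) := by
  have h := (isTriple D q)
  let μ : Uq D q ⊗[k] Uq D q →ₗ[k] Uq D q :=
    LinearMap.mul' k _ ∘ₗ TensorProduct.map (antipode D q) .id
  have hμ : ∀ a b, μ (a ⊗ₜ b) = antipode D q a * b := fun a b => by simp [μ]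
  -- The antipode identity is strengthened by an arbitrary factor t on the right; in this form it is
  -- stable under products of x and can be checked on generators.
  have key : ∀ x : Uq D q, ∀ t, μ (comul D q x * t) = counit D q x • μ t := by
    have gen : ∀ x : Uq D q, (∀ a b, μ (comul D q x * a ⊗ₜ b) = counit D q x • μ (a ⊗ₜ b)) →
        ∀ t, μ (comul D q x * t) = counit D q x • μ t := fun x hx t => by
      have : μ ∘ₗ LinearMap.mulLeft k (comul D q x) = counit D q x • μ :=
        TensorProduct.ext' fun a b => hx a b
      exact LinearMap.congr_fun this t
    refine Uq.induction (fun i => gen _ fun a b => ?_) (fun i => gen _ fun a b => ?_)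
      (fun l => gen _ fun a b => ?_) (fun x y hx hy t => ?_) (fun x y hx hy t => ?_) (fun c t => ?_)
    · rw [comul_e, add_mul, Algebra.TensorProduct.tmul_mul_tmul,
        Algebra.TensorProduct.tmul_mul_tmul, map_add, hμ, hμ, one_mul, antipode_mul, antipode_e,
        counit_e, zero_smul, mul_neg, neg_mul, mul_assoc, mul_assoc, ← mul_assoc (κ D q _),
        h.κ_neg_mul, one_mul, neg_add_cancel]
    · rw [comul_f, add_mul, Algebra.TensorProduct.tmul_mul_tmul,
        Algebra.TensorProduct.tmul_mul_tmul, map_add, hμ, hμ, one_mul, antipode_mul, antipode_mul,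
        antipode_f, antipode_κ, counit_f, zero_smul, mul_neg, neg_mul, mul_assoc, mul_assoc,
        neg_neg, mul_assoc, neg_add_cancel]
    · rw [comul_κ, Algebra.TensorProduct.tmul_mul_tmul, hμ, hμ, antipode_mul, antipode_κ, counit_κ,
        one_smul, mul_assoc, ← mul_assoc (κ D q _), h.κ_neg_mul, one_mul]
    · rw [map_mul (comul D q), mul_assoc, hx, hy, map_mul, smul_smul]
    · rw [map_add, add_mul, map_add, hx, hy, map_add, add_smul]
    · rw [AlgHom.commutes, AlgHom.commutes, ← Algebra.smul_def, map_smul]; rfl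
  have := key x (1 ⊗ₜ 1)
  rw [← Algebra.TensorProduct.one_def, mul_one, Algebra.TensorProduct.one_def, hμ, antipode_one,
    mul_one] at this
  rw [Algebra.algebraMap_eq_smul_one]
  exact this

theorem Uq.antipode_right (x : Uq D q) : LinearMap.mul' k _
    (TensorProduct.map .id (antipode D q) (comul D q x)) = algebraMap k _ (counit D q x) := by
  have h := (isTriple D q)
  let μ : Uq D q ⊗[k] Uq D q →ₗ[k] Uq D q :=
    LinearMap.mul' k _ ∘ₗ TensorProduct.map .id (antipode D q)
  have hμ : ∀ a b, μ (a ⊗ₜ b) = a * antipode D q b := fun a b => by simp [μ]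
  -- The mirror image of the previous strengthening: here the factor t has to stand on the left.
  have key : ∀ x : Uq D q, ∀ t, μ (t * comul D q x) = counit D q x • μ t := by
    have gen : ∀ x : Uq D q, (∀ a b, μ (a ⊗ₜ b * comul D q x) = counit D q x • μ (a ⊗ₜ b)) →
        ∀ t, μ (t * comul D q x) = counit D q x • μ t := fun x hx t => by
      have : μ ∘ₗ LinearMap.mulRight k (comul D q x) = counit D q x • μ :=
        TensorProduct.ext' fun a b => hx a b
      exact LinearMap.congr_fun this t
    refine Uq.induction (fun i => gen _ fun a b => ?_) (fun i => gen _ fun a b => ?_)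
      (fun l => gen _ fun a b => ?_) (fun x y hx hy t => ?_) (fun x y hx hy t => ?_) (fun c t => ?_)
    · rw [comul_e, mul_add, Algebra.TensorProduct.tmul_mul_tmul,
        Algebra.TensorProduct.tmul_mul_tmul, map_add, hμ, hμ, mul_one, antipode_mul, antipode_mul,
        antipode_κ, antipode_e, counit_e, zero_smul, neg_mul, mul_neg, mul_assoc, mul_assoc,
        add_neg_cancel]
    · rw [comul_f, mul_add, Algebra.TensorProduct.tmul_mul_tmul,
        Algebra.TensorProduct.tmul_mul_tmul, map_add, hμ, hμ, mul_one, antipode_mul, antipode_f,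
        counit_f, zero_smul, neg_mul, mul_neg, mul_assoc, mul_assoc,
        mul_assoc (κ D q (D.ti i)), ← mul_assoc (κ D q _) (κ D q _), h.κ_neg_mul, one_mul,
        add_neg_cancel]
    · rw [comul_κ, Algebra.TensorProduct.tmul_mul_tmul, hμ, hμ, antipode_mul, antipode_κ, counit_κ,
        one_smul, mul_assoc, ← mul_assoc (κ D q _), h.κ_comm l, h.κ_neg_mul, one_mul]
    · rw [map_mul (comul D q), ← mul_assoc, hy, hx, map_mul, smul_smul, mul_comm]
    · rw [map_add, mul_add, map_add, hx, hy, map_add, add_smul]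
    · rw [AlgHom.commutes, AlgHom.commutes, ← Algebra.commutes, ← Algebra.smul_def, map_smul]; rfl
  have := key x (1 ⊗ₜ 1)
  rw [← Algebra.TensorProduct.one_def, one_mul, Algebra.TensorProduct.one_def, hμ, antipode_one,
    mul_one] at this
  rw [Algebra.algebraMap_eq_smul_one]
  exact this

theorem Uq.coassoc (x : Uq D q) : TensorProduct.assoc k _ _ _
    (TensorProduct.map (comul D q).toLinearMap .id (comul D q x)) =
    TensorProduct.map .id (comul D q).toLinearMap (comul D q x) := by
  have : ((Algebra.TensorProduct.assoc k k k (Uq D q) (Uq D q) (Uq D q)).toAlgHom.comp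
      (Algebra.TensorProduct.map (comul D q) (AlgHom.id k _))).comp (comul D q) =
      (Algebra.TensorProduct.map (AlgHom.id k _) (comul D q)).comp (comul D q) := by
    refine Uq.algHom_ext (fun i => ?_) (fun i => ?_) (fun l => ?_)
    · simp [comul_e, comul_κ, TensorProduct.add_tmul, TensorProduct.tmul_add,
        Algebra.TensorProduct.one_def, add_assoc]
    · simp [comul_f, comul_κ, TensorProduct.add_tmul, TensorProduct.tmul_add,
        Algebra.TensorProduct.one_def, add_assoc]
    · simp [comul_κ]
  exact DFunLike.congr_fun this x

theorem Uq.counit_comul (x : Uq D q) : TensorProduct.lid k _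
    (TensorProduct.map (counit D q).toLinearMap .id (comul D q x)) = x := by
  have : ((Algebra.TensorProduct.lid k (Uq D q)).toAlgHom.comp
      (Algebra.TensorProduct.map (counit D q) (AlgHom.id k _))).comp (comul D q) =
      AlgHom.id k _ := by
    refine Uq.algHom_ext (fun i => ?_) (fun i => ?_) (fun l => ?_)
    · simp [comul_e, counit_e]
    · simp [comul_f, counit_f, counit_κ]
    · simp [comul_κ, counit_κ]
  exact DFunLike.congr_fun this x

theorem Uq.comul_counit (x : Uq D q) : TensorProduct.rid k _
    (TensorProduct.map .id (counit D q).toLinearMap (comul D q x)) = x := by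
  have : ((Algebra.TensorProduct.rid k k (Uq D q)).toAlgHom.comp
      (Algebra.TensorProduct.map (AlgHom.id k _) (counit D q))).comp (comul D q) =
      AlgHom.id k _ := by
    refine Uq.algHom_ext (fun i => ?_) (fun i => ?_) (fun l => ?_)
    · simp [comul_e, counit_e, counit_κ]
    · simp [comul_f, counit_f]
    · simp [comul_κ, counit_κ]
  exact DFunLike.congr_fun this x

/-- `U_q(g)` is a Hopf algebra. -/
theorem Uq.isUsualHopf : IsUsualHopf D q (comul D q) (counit D q) (antipode D q) where
  comul_E i := by
    have h := (isTriple D q)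
    rw [E_eq, map_mul, comul_e, comul_κ, add_mul, Algebra.TensorProduct.tmul_mul_tmul,
      Algebra.TensorProduct.tmul_mul_tmul, h.κ_comm (D.ti i), h.κ_neg_mul, one_mul, t_eq, K_eq]
  comul_F i := by
    have h := (isTriple D q)
    rw [F_eq, map_neg, map_mul, comul_f, comul_κ, mul_add, Algebra.TensorProduct.tmul_mul_tmul,
      Algebra.TensorProduct.tmul_mul_tmul, h.κ_comm (D.ti i) (-_), h.κ_neg_mul, mul_one, tInv_eq,
      K_eq, neg_neg, neg_add, TensorProduct.neg_tmul, TensorProduct.tmul_neg]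
  comul_K l := by rw [K_eq, comul_κ]
  counit_E i := by rw [E_eq, map_mul, counit_e, zero_mul]
  counit_F i := by rw [F_eq, map_neg, map_mul, counit_f, mul_zero, neg_zero]
  counit_K l := by rw [K_eq, counit_κ]
  antipode_E i := by
    rw [E_eq, antipode_mul, antipode_e, antipode_κ, neg_neg, mul_neg, tInv_eq, K_eq, neg_neg]
  antipode_F i := by
    rw [F_eq, map_neg, antipode_mul, antipode_f, antipode_κ, neg_mul, t_eq, K_eq, neg_mul]
  antipode_K l := by rw [K_eq, antipode_κ, K_eq]
  antipode_mul := antipode_mul D q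
  antipode_one := antipode_one D q
  coassoc := coassoc D q
  counit_comul := counit_comul D q
  comul_counit := comul_counit D q
  antipode_left := antipode_left D q
  antipode_right := antipode_right D q

end UsualHopf

/-! ### The triangular decomposition of `U_q(g)` -/

section TriMod

variable {k : Type*} [NormedField k] {I Φ : Type*} [AddCommGroup Φ]
  (D : RootDatum I Φ) (q : QNumber k)

/-- The space which is to be identified with `U_q(g)` by the triangular decomposition. -/
def TriMod : Type _ := ((Words k I ⧸ radical D q) ⊗[k] (Module.Dual ℤ Φ →₀ k)) ⊗[k]
  (Words k I ⧸ radical D q)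

instance : AddCommGroup (TriMod D q) := inferInstanceAs (AddCommGroup
  (((Words k I ⧸ radical D q) ⊗[k] (Module.Dual ℤ Φ →₀ k)) ⊗[k] (Words k I ⧸ radical D q)))
instance : Module k (TriMod D q) := inferInstanceAs (Module k
  (((Words k I ⧸ radical D q) ⊗[k] (Module.Dual ℤ Φ →₀ k)) ⊗[k] (Words k I ⧸ radical D q)))

/-- The underlying tensor product. -/
def TriMod.equiv : ((Words k I ⧸ radical D q) ⊗[k] (Module.Dual ℤ Φ →₀ k)) ⊗[k]
    (Words k I ⧸ radical D q) ≃ₗ[k] TriMod D q where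
  toFun x := x
  map_add' _ _ := rfl
  map_smul' _ _ := rfl
  invFun x := x
  left_inv _ := rfl
  right_inv _ := rfl

/-- The pure tensors. -/
def TriMod.pt (l : Module.Dual ℤ Φ) : Words k I →ₗ[k] Words k I →ₗ[k] TriMod D q :=
  LinearMap.mk₂ k (fun c b => TriMod.equiv D q
      (((radical D q).mkQ c ⊗ₜ Finsupp.single l 1) ⊗ₜ (radical D q).mkQ b))
    (fun c c' b => by simp only [map_add, TensorProduct.add_tmul])
    (fun a c b => by rw [← map_smul, map_smul, TensorProduct.smul_tmul', TensorProduct.smul_tmul'])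
    (fun c b b' => by simp only [map_add, TensorProduct.tmul_add])
    (fun a c b => by rw [← map_smul, map_smul, TensorProduct.tmul_smul])

theorem TriMod.pt_apply (l : Module.Dual ℤ Φ) (c b : Words k I) : TriMod.pt D q l c b =
    TriMod.equiv D q (((radical D q).mkQ c ⊗ₜ Finsupp.single l 1) ⊗ₜ (radical D q).mkQ b) := rfl

variable {D q} {Z : Type*} [AddCommGroup Z] [Module k Z]

theorem TriMod.hom_ext {g g' : TriMod D q →ₗ[k] Z}
    (h : ∀ l c b, g (TriMod.pt D q l c b) = g' (TriMod.pt D q l c b)) : g = g' := by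
  suffices h' : g ∘ₗ (TriMod.equiv D q).toLinearMap = g' ∘ₗ (TriMod.equiv D q).toLinearMap from
    LinearMap.ext fun x => LinearMap.congr_fun h' x
  refine TensorProduct.ext_threefold fun c m b => ?_
  obtain ⟨c, rfl⟩ := (radical D q).mkQ_surjective c
  obtain ⟨b, rfl⟩ := (radical D q).mkQ_surjective b
  let e : (Module.Dual ℤ Φ →₀ k) →ₗ[k] TriMod D q := (TriMod.equiv D q).toLinearMap ∘ₗ
    (TensorProduct.mk k _ _).flip ((radical D q).mkQ b) ∘ₗ
      TensorProduct.mk k _ _ ((radical D q).mkQ c)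
  have : g ∘ₗ e = g' ∘ₗ e := Finsupp.lhom_ext' fun l => LinearMap.ext_ring (h l c b)
  exact LinearMap.congr_fun this m

theorem TriMod.hom_ext_bw {g g' : TriMod D q →ₗ[k] Z}
    (h : ∀ l c b, g (TriMod.pt D q l (bw k c) (bw k b)) = g' (TriMod.pt D q l (bw k c) (bw k b))) :
    g = g' := TriMod.hom_ext fun l c b => by
  have : (TriMod.pt D q l).compr₂ g = (TriMod.pt D q l).compr₂ g' :=
    Words.hom_ext₂ fun c b => h l c b
  exact LinearMap.congr_fun₂ this c b

/-- The universal property of the triangular decomposition. -/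
def TriMod.lift (φ : Module.Dual ℤ Φ → Words k I →ₗ[k] Words k I →ₗ[k] Z)
    (h1 : ∀ l, ∀ y ∈ radical D q, ∀ x, φ l y x = 0)
    (h2 : ∀ l, ∀ y ∈ radical D q, ∀ x, φ l x y = 0) : TriMod D q →ₗ[k] Z :=
  (TensorProduct.lift <| TensorProduct.lift <| LinearMap.flip <|
    Finsupp.linearCombination k fun l =>
      (radical D q).liftQ (LinearMap.flip ((radical D q).liftQ (φ l).flip fun y hy =>
        LinearMap.ext fun x => h2 l y hy x)) fun y hy => LinearMap.ext fun x => by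
          obtain ⟨x, rfl⟩ := (radical D q).mkQ_surjective x
          exact h1 l y hy x) ∘ₗ (TriMod.equiv D q).symm.toLinearMap

theorem TriMod.lift_pt (φ : Module.Dual ℤ Φ → Words k I →ₗ[k] Words k I →ₗ[k] Z) (h1) (h2)
    (l : Module.Dual ℤ Φ) (c b : Words k I) :
    TriMod.lift (D := D) (q := q) φ h1 h2 (TriMod.pt D q l c b) = φ l c b := by
  simp only [TriMod.lift, TriMod.pt_apply, LinearMap.comp_apply, LinearEquiv.coe_coe,
    LinearEquiv.symm_apply_apply, TensorProduct.lift.tmul, LinearMap.flip_apply, Finsupp.linearCombination_single, one_smul]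
  rfl

theorem TriMod.pt_left {y : Words k I} (hy : y ∈ radical D q) (l : Module.Dual ℤ Φ)
    (x : Words k I) : TriMod.pt D q l y x = 0 := by
  have h : (radical D q).mkQ y = 0 := (Submodule.Quotient.mk_eq_zero (radical D q)).2 hy
  rw [TriMod.pt_apply, h, TensorProduct.zero_tmul, TensorProduct.zero_tmul, map_zero]

theorem TriMod.pt_right {y : Words k I} (hy : y ∈ radical D q) (l : Module.Dual ℤ Φ)
    (x : Words k I) : TriMod.pt D q l x y = 0 := by
  have h : (radical D q).mkQ y = 0 := (Submodule.Quotient.mk_eq_zero (radical D q)).2 hy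
  rw [TriMod.pt_apply, h, TensorProduct.tmul_zero, map_zero]

variable (D q)

/-- The action of `Fᵢ`. -/
def TriMod.opF (i : I) : TriMod D q →ₗ[k] TriMod D q :=
  TriMod.lift (fun l => (TriMod.pt D q l) ∘ₗ cons k i)
    (fun l _ hy x => TriMod.pt_left (cons_mem_radical D q hy i) l x)
    (fun l _ hy _ => TriMod.pt_right hy l _)

theorem TriMod.opF_pt (i : I) (l : Module.Dual ℤ Φ) (c b : Words k I) :
    TriMod.opF D q i (TriMod.pt D q l c b) = TriMod.pt D q l (cons k i c) b :=
  TriMod.lift_pt _ _ _ l c b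

/-- The action of `K_λ`. -/
def TriMod.opK (m : Module.Dual ℤ Φ) : TriMod D q →ₗ[k] TriMod D q :=
  TriMod.lift (fun l => (TriMod.pt D q (m + l)) ∘ₗ tw D q m)
    (fun _ _ hy x => TriMod.pt_left (tw_mem_radical D q hy m) _ x)
    (fun _ _ hy _ => TriMod.pt_right hy _ _)

theorem TriMod.opK_pt (m l : Module.Dual ℤ Φ) (c b : Words k I) :
    TriMod.opK D q m (TriMod.pt D q l c b) = TriMod.pt D q (m + l) (tw D q m c) b :=
  TriMod.lift_pt _ _ _ l c b

/-- The action of `Eᵢ`. -/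
def TriMod.opE (i : I) : TriMod D q →ₗ[k] TriMod D q :=
  TriMod.lift (fun l => q.val ^ l (D.α i) • (TriMod.pt D q l).compl₂ (cons k i) +
      (qDiff k D q i)⁻¹ • (TriMod.pt D q (D.ti i + l) ∘ₗ rskew D q i -
        TriMod.pt D q (-D.ti i + l) ∘ₗ tw D q (-D.ti i) ∘ₗ skew D q i))
    (fun l y hy x => by
      simp [TriMod.pt_left hy, TriMod.pt_left (rskew_mem_radical D q hy i),
        TriMod.pt_left (tw_mem_radical D q (skew_mem_radical D q hy i) _)])
    (fun l y hy x => by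
      simp [TriMod.pt_right hy, TriMod.pt_right (cons_mem_radical D q hy i)])

theorem TriMod.opE_pt (i : I) (l : Module.Dual ℤ Φ) (c b : Words k I) :
    TriMod.opE D q i (TriMod.pt D q l c b) =
      q.val ^ l (D.α i) • TriMod.pt D q l c (cons k i b) +
        (qDiff k D q i)⁻¹ • (TriMod.pt D q (D.ti i + l) (rskew D q i c) b -
          TriMod.pt D q (-D.ti i + l) (tw D q (-D.ti i) (skew D q i c)) b) :=
  TriMod.lift_pt _ _ _ l c b

/-- The operators imitate left multiplication on f_c κ_λ e_b brought back to triangular order. The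
commutator of E_i with F_j then reduces to the rules for the two skew derivations on v_j c. -/
theorem TriMod.isPreTriple :
    IsPreTriple D q (TriMod.opE D q) (TriMod.opF D q) (TriMod.opK D q) where
  κ_zero := TriMod.hom_ext fun l c b => by
    rw [TriMod.opK_pt, zero_add, tw_zero]; rfl
  κ_add l m := TriMod.hom_ext fun n c b => by
    rw [Module.End.mul_apply, TriMod.opK_pt, TriMod.opK_pt, TriMod.opK_pt, tw_tw, add_assoc]
  e_κ i l := TriMod.hom_ext fun m c b => by
    simp only [Module.End.mul_apply, LinearMap.smul_apply, TriMod.opK_pt, TriMod.opE_pt, map_add,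
      map_smul, map_sub, skew_tw, rskew_tw, LinearMap.add_apply, LinearMap.smul_apply, tw_tw,
      smul_add, smul_sub, smul_smul, q.mul_zpow]
    rw [mul_comm _ (q.val ^ l _), add_left_comm (D.ti i), add_left_comm (-D.ti i),
      add_comm (-D.ti i) l]
  κ_f i l := TriMod.hom_ext fun m c b => by
    simp only [Module.End.mul_apply, LinearMap.smul_apply, TriMod.opK_pt, TriMod.opF_pt, tw_cons,
      map_smul]
  e_f i j := TriMod.hom_ext fun m c b => by
    rw [Module.End.mul_apply, LinearMap.add_apply, Module.End.mul_apply, TriMod.opF_pt,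
      TriMod.opE_pt, TriMod.opE_pt, map_add, map_smul, map_smul, map_sub, TriMod.opF_pt,
      TriMod.opF_pt, TriMod.opF_pt, rskew_cons, skew_cons, map_add, map_add, map_add, map_smul,
      tw_cons, smul_smul, q.mul_zpow, LinearMap.neg_apply, add_neg_cancel, zpow_zero, one_smul,
      LinearMap.add_apply, LinearMap.add_apply, add_assoc]
    congr 1
    by_cases hij : i = j
    · subst hij
      simp only [if_true, LinearMap.smul_apply, LinearMap.sub_apply, TriMod.opK_pt]
      rw [← smul_add]
      congr 1
      abel
    · simp [if_neg hij]

theorem TriMod.weval_opF (y : Words k I) (l : Module.Dual ℤ Φ) (c b : Words k I) :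
    weval (TriMod.opF D q) y (TriMod.pt D q l c b) = TriMod.pt D q l (Words.mul y c) b := by
  refine Words.induction (f := LinearMap.applyₗ (TriMod.pt D q l c b) ∘ₗ weval (TriMod.opF D q))
    (g := (TriMod.pt D q l).flip b ∘ₗ Words.mul.flip c) ?_ (fun j y _ ih => ?_) y
  · simp [Words.nil_mul]
  · simp only [LinearMap.comp_apply, LinearMap.applyₗ_apply_apply, LinearMap.flip_apply] at ih ⊢
    rw [weval_cons, Module.End.mul_apply, ih, TriMod.opF_pt, Words.cons_mul]

/-- On vectors with empty c the derivation terms of E_i vanish, so the operators simply multiply the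
last factor, up to the twist from passing the Cartan factor. -/
theorem TriMod.weval_opE (y : Words k I) (l : Module.Dual ℤ Φ) (b : Words k I) :
    weval (TriMod.opE D q) y (TriMod.pt D q l (bw k []) b) =
      TriMod.pt D q l (bw k []) (Words.mul (tw D q l y) b) := by
  refine Words.induction (f := LinearMap.applyₗ (TriMod.pt D q l (bw k []) b) ∘ₗ
    weval (TriMod.opE D q)) (g := (TriMod.pt D q l (bw k [])) ∘ₗ Words.mul.flip b ∘ₗ tw D q l) ?_
    (fun j y _ ih => ?_) y
  · simp [Words.nil_mul, tw_nil]
  · simp only [LinearMap.comp_apply, LinearMap.applyₗ_apply_apply, LinearMap.flip_apply] at ih ⊢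
    rw [weval_cons, Module.End.mul_apply, ih, TriMod.opE_pt, tw_cons, map_smul,
      LinearMap.smul_apply, Words.cons_mul, rskew_nil, skew_nil]
    simp

/-- Induction on the length of c. Commuting a relation past F_j produces the same relation together
with its two skew derivatives, all in the radical, applied to shorter vectors. For empty c the
operator is left multiplication by an element of the radical in the last factor. -/
theorem TriMod.serre_opE {y : Words k I} (hy : y ∈ radical D q) :
    weval (TriMod.opE D q) y = 0 := by
  have h := TriMod.isPreTriple D q
  refine TriMod.hom_ext_bw fun l c b => ?_
  induction c generalizing y with
  | nil =>
    rw [TriMod.weval_opE, TriMod.pt_right (mul_mem_radical D q (tw_mem_radical D q hy l) _),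
      LinearMap.zero_apply]
  | cons j c ih =>
    have h1 : ∀ y ∈ radical D q, weval (TriMod.opE D q) y (TriMod.pt D q l (bw k c) (bw k b)) = 0 :=
      fun y hy => ih hy
    rw [← cons_bw, ← TriMod.opF_pt, ← Module.End.mul_apply, h.weval_e_f, h.weval_e_κ]
    simp only [LinearMap.add_apply, LinearMap.smul_apply, LinearMap.sub_apply,
      Module.End.mul_apply, h1 _ hy, h1 _ (skew_mem_radical D q hy j),
      h1 _ (tw_mem_radical D q (rskew_mem_radical D q hy j) _), map_zero, sub_zero, smul_zero,
      add_zero, LinearMap.zero_apply]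

theorem TriMod.isTriple : IsTriple D q (TriMod.opE D q) (TriMod.opF D q) (TriMod.opK D q) where
  toIsPreTriple := TriMod.isPreTriple D q
  serre_e _ hy := TriMod.serre_opE D q hy
  serre_f y hy := TriMod.hom_ext fun l c b => by
    rw [TriMod.weval_opF, TriMod.pt_left (mul_mem_radical D q hy c), LinearMap.zero_apply]

/-- The representation of `U_q(g)`. -/
def TriMod.rep : Uq D q →ₐ[k] Module.End k (TriMod D q) := (TriMod.isTriple D q).lift

/-- The map `c ⊗ K_λ ⊗ b ↦ f_c κ_λ e_b`. -/
def Uq.tri : TriMod D q →ₗ[k] Uq D q :=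
  TriMod.lift (fun l => ((LinearMap.mul k (Uq D q)).compl₂ (weval (Uq.e D q))) ∘ₗ
      LinearMap.mulRight k (Uq.κ D q l) ∘ₗ weval (Uq.f D q))
    (fun _ y hy _ => by simp [(Uq.isTriple D q).serre_f y hy])
    (fun _ y hy _ => by simp [(Uq.isTriple D q).serre_e y hy])

theorem Uq.tri_pt (l : Module.Dual ℤ Φ) (c b : Words k I) : Uq.tri D q (TriMod.pt D q l c b) =
    weval (Uq.f D q) c * Uq.κ D q l * weval (Uq.e D q) b :=
  (TriMod.lift_pt _ _ _ l c b).trans rfl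

theorem Uq.tri_opE (i : I) (m : TriMod D q) :
    Uq.tri D q (TriMod.opE D q i m) = Uq.e D q i * Uq.tri D q m := by
  have h := Uq.isTriple D q
  have : Uq.tri D q ∘ₗ TriMod.opE D q i = LinearMap.mulLeft k (Uq.e D q i) ∘ₗ Uq.tri D q :=
    TriMod.hom_ext fun l c b => by
      simp only [LinearMap.comp_apply, LinearMap.mulLeft_apply, TriMod.opE_pt, map_add, map_smul,
        map_sub, Uq.tri_pt, weval_cons]
      rw [← mul_assoc (Uq.e D q i), ← mul_assoc (Uq.e D q i), h.e_weval_f, h.κ_weval_f, add_mul, smul_mul_assoc,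
        mul_assoc (weval _ c) (Uq.e D q i), h.e_κ, sub_mul, mul_assoc _ (Uq.κ D q _) (Uq.κ D q l),
        mul_assoc _ (Uq.κ D q _) (Uq.κ D q l), ← h.κ_add, ← h.κ_add, add_mul, mul_smul_comm,
        smul_mul_assoc, smul_mul_assoc, sub_mul]
      simp only [mul_assoc]
  exact LinearMap.congr_fun this m

theorem Uq.tri_opF (i : I) (m : TriMod D q) :
    Uq.tri D q (TriMod.opF D q i m) = Uq.f D q i * Uq.tri D q m := by
  have : Uq.tri D q ∘ₗ TriMod.opF D q i = LinearMap.mulLeft k (Uq.f D q i) ∘ₗ Uq.tri D q :=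
    TriMod.hom_ext fun l c b => by
      simp only [LinearMap.comp_apply, LinearMap.mulLeft_apply, TriMod.opF_pt, Uq.tri_pt,
        weval_cons, mul_assoc]
  exact LinearMap.congr_fun this m

theorem Uq.tri_opK (l : Module.Dual ℤ Φ) (m : TriMod D q) :
    Uq.tri D q (TriMod.opK D q l m) = Uq.κ D q l * Uq.tri D q m := by
  have h := Uq.isTriple D q
  have : Uq.tri D q ∘ₗ TriMod.opK D q l = LinearMap.mulLeft k (Uq.κ D q l) ∘ₗ Uq.tri D q :=
    TriMod.hom_ext fun m c b => by
      simp only [LinearMap.comp_apply, LinearMap.mulLeft_apply, TriMod.opK_pt, Uq.tri_pt,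
        ← mul_assoc, h.κ_weval_f, h.κ_add]
  exact LinearMap.congr_fun this m

/-- The operators were designed so that multiplying out is equivariant for left multiplication; it
suffices to check generators. Applied to the vacuum vector this gives surjectivity of the triangular
decomposition. -/
theorem Uq.tri_rep (x : Uq D q) (m : TriMod D q) :
    Uq.tri D q (TriMod.rep D q x m) = x * Uq.tri D q m := by
  induction x using Uq.induction generalizing m with
  | he i => rw [TriMod.rep, IsTriple.lift_e, Uq.tri_opE]
  | hf i => rw [TriMod.rep, IsTriple.lift_f, Uq.tri_opF]
  | hκ l => rw [TriMod.rep, IsTriple.lift_κ, Uq.tri_opK]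
  | h_mul x y hx hy => rw [map_mul, Module.End.mul_apply, hx, hy, mul_assoc]
  | h_add x y hx hy => rw [map_add, LinearMap.add_apply, map_add, hx, hy, add_mul]
  | h_alg c => rw [AlgHom.commutes, Module.algebraMap_end_apply, map_smul, Algebra.smul_def]

/-- The coordinates in the triangular decomposition. -/
def Uq.coord : Uq D q →ₗ[k] TriMod D q :=
  LinearMap.applyₗ (TriMod.pt D q 0 (bw k []) (bw k [])) ∘ₗ (TriMod.rep D q).toLinearMap

theorem Uq.tri_coord (x : Uq D q) : Uq.tri D q (Uq.coord D q x) = x := by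
  refine (Uq.tri_rep D q x _).trans ?_
  rw [Uq.tri_pt, weval_nil, weval_nil, (Uq.isTriple D q).κ_zero, mul_one, mul_one, mul_one]

/-- Acting on the vacuum, e_b creates the last factor, κ_λ the middle one and f_c the first, with no
correction terms. This is the injectivity half of the triangular decomposition. -/
theorem Uq.coord_tri (m : TriMod D q) : Uq.coord D q (Uq.tri D q m) = m := by
  have : Uq.coord D q ∘ₗ Uq.tri D q = .id := TriMod.hom_ext fun l c b => by
    change TriMod.rep D q (Uq.tri D q _) (TriMod.pt D q 0 (bw k []) (bw k [])) = _
    rw [Uq.tri_pt, map_mul, map_mul, map_weval, map_weval]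
    simp only [TriMod.rep, IsTriple.lift_e, IsTriple.lift_f, IsTriple.lift_κ]
    rw [Module.End.mul_apply, TriMod.weval_opE, tw_zero, Words.mul_nil, Module.End.mul_apply,
      TriMod.opK_pt, tw_nil, TriMod.weval_opF, Words.mul_nil, add_zero]
    rfl
  exact LinearMap.congr_fun this m

end TriMod

/-! ### The cross relation in `U_q(g)` -/

section Cross

variable {k : Type*} [NormedField k] {I Φ : Type*} [AddCommGroup Φ]
  (D : RootDatum I Φ) (q : QNumber k) {Z : Type*} [AddCommGroup Z] [Module k Z]

theorem Words.hom_ext₃ {f g : Words k I ⊗[k] (Words k I ⊗[k] Words k I) →ₗ[k] Z}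
    (h : ∀ u v w, f (bw k u ⊗ₜ (bw k v ⊗ₜ bw k w)) = g (bw k u ⊗ₜ (bw k v ⊗ₜ bw k w))) : f = g :=
  TensorProduct.ext <| Words.hom_ext fun u => TensorProduct.ext <| Words.hom_ext₂ fun v w => h u v w

/-- The map `c₁ ⊗ (c₂ ⊗ c₃) ↦ φ(c₁) χ(c₃) Ψ(c₂)`. -/
def xi (φ : Words k I →ₗ[k] k) (Ψ : Words k I →ₗ[k] Z) (χ : Words k I →ₗ[k] k) :
    Words k I ⊗[k] (Words k I ⊗[k] Words k I) →ₗ[k] Z :=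
  (TensorProduct.lid k Z).toLinearMap ∘ₗ TensorProduct.map φ
    ((TensorProduct.rid k Z).toLinearMap ∘ₗ TensorProduct.map Ψ χ)

theorem xi_tmul (φ : Words k I →ₗ[k] k) (Ψ : Words k I →ₗ[k] Z) (χ : Words k I →ₗ[k] k)
    (a b c : Words k I) : xi φ Ψ χ (a ⊗ₜ (b ⊗ₜ c)) = (φ a * χ c) • Ψ b := by
  simp [xi, smul_smul, mul_comm]

/-- The iterated comultiplication. -/
def Words.comul₃ : Words k I →ₗ[k] Words k I ⊗[k] (Words k I ⊗[k] Words k I) :=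
  TensorProduct.map .id (Words.comul D q) ∘ₗ Words.comul D q

/-- A letter at the boundary of the second and third factor may be removed from either side; the
next lemma treats the boundary of the first and second factor. -/
theorem Words.comul₃_rskew_mid (i : I) (y : Words k I) :
    TensorProduct.map .id (TensorProduct.map (rskew D q i) .id) (Words.comul₃ D q y) =
      TensorProduct.map .id (TensorProduct.map .id (skew D q i)) (Words.comul₃ D q y) := by
  rw [Words.comul₃, LinearMap.comp_apply, TensorProduct.map_map, TensorProduct.map_map]
  congr 2
  exact LinearMap.ext (Words.rskew_comul D q i)

theorem Words.comul₃_rskew_left (i : I) (y : Words k I) :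
    TensorProduct.map (rskew D q i) .id (Words.comul₃ D q y) =
      TensorProduct.map .id (TensorProduct.map (skew D q i) .id) (Words.comul₃ D q y) := by
  have h := congrArg (TensorProduct.map .id (Words.comul D q)) (Words.rskew_comul D q i y)
  rw [TensorProduct.map_map, TensorProduct.map_map, LinearMap.id_comp, LinearMap.id_comp,
    LinearMap.comp_id] at h
  rw [Words.comul₃, LinearMap.comp_apply, TensorProduct.map_map, TensorProduct.map_map,
    LinearMap.id_comp, LinearMap.comp_id, LinearMap.id_comp, h]
  congr 2
  exact LinearMap.ext (Words.comul_skew D q i)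

/-- Left multiplication by a generator on the braided tensor cube. -/
def Lop₃ (i : I) : Words k I ⊗[k] (Words k I ⊗[k] Words k I) →ₗ[k]
    Words k I ⊗[k] (Words k I ⊗[k] Words k I) :=
  TensorProduct.map (cons k i) .id + TensorProduct.map (tw D q (D.ti i)) (Lop D q i)

theorem Words.comul₃_cons (i : I) (y : Words k I) :
    Words.comul₃ D q (cons k i y) = Lop₃ D q i (Words.comul₃ D q y) := by
  rw [Words.comul₃, LinearMap.comp_apply, LinearMap.comp_apply, Words.comul_cons]
  generalize Words.comul D q y = t
  have : TensorProduct.map .id (Words.comul D q) ∘ₗ Lop D q i =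
      Lop₃ D q i ∘ₗ TensorProduct.map .id (Words.comul D q) :=
    TensorProduct.ext' fun a b => by
      simp [Lop_tmul, Lop₃, Words.comul_cons]
  exact LinearMap.congr_fun this t

/-- Trades a right derivation of the middle component for a left derivation of the last one, which
is the adjoint of lengthening the word paired with that component. -/
theorem xi_rskew_mid (φ : Words k I →ₗ[k] k) (Ψ : Words k I →ₗ[k] Z) (χ : Words k I →ₗ[k] k)
    (i : I) (y : Words k I) : xi φ Ψ (χ ∘ₗ skew D q i) (Words.comul₃ D q y) =
      xi φ (Ψ ∘ₗ rskew D q i) χ (Words.comul₃ D q y) := by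
  have h := congrArg (xi φ Ψ χ) (Words.comul₃_rskew_mid D q i y)
  have h1 : xi φ Ψ χ ∘ₗ TensorProduct.map .id (TensorProduct.map (rskew D q i) .id) =
      xi φ (Ψ ∘ₗ rskew D q i) χ := Words.hom_ext₃ fun u v w => by simp [xi_tmul]
  have h2 : xi φ Ψ χ ∘ₗ TensorProduct.map .id (TensorProduct.map .id (skew D q i)) =
      xi φ Ψ (χ ∘ₗ skew D q i) := Words.hom_ext₃ fun u v w => by simp [xi_tmul]
  rw [← h1, ← h2, LinearMap.comp_apply, LinearMap.comp_apply, h]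

theorem xi_rskew_left (φ : Words k I →ₗ[k] k) (Ψ : Words k I →ₗ[k] Z) (χ : Words k I →ₗ[k] k)
    (i : I) (y : Words k I) : xi (φ ∘ₗ rskew D q i) Ψ χ (Words.comul₃ D q y) =
      xi φ (Ψ ∘ₗ skew D q i) χ (Words.comul₃ D q y) := by
  have h := congrArg (xi φ Ψ χ) (Words.comul₃_rskew_left D q i y)
  have h1 : xi φ Ψ χ ∘ₗ TensorProduct.map (rskew D q i) .id =
      xi (φ ∘ₗ rskew D q i) Ψ χ := Words.hom_ext₃ fun u v w => by simp [xi_tmul]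
  have h2 : xi φ Ψ χ ∘ₗ TensorProduct.map .id (TensorProduct.map (skew D q i) .id) =
      xi φ (Ψ ∘ₗ skew D q i) χ := Words.hom_ext₃ fun u v w => by simp [xi_tmul]
  rw [← h1, ← h2, LinearMap.comp_apply, LinearMap.comp_apply, h]

/-- The contribution of `b₁ ⊗ b₂ ⊗ b₃` to the cross relation. -/
def crossTerm (b₁ b₂ b₃ : List I) :
    Words k I ⊗[k] (Words k I ⊗[k] Words k I) →ₗ[k] TriMod D q :=
  q.val ^ (-D.tK (D.wt b₃) (D.rt b₁ + D.rt b₂)) •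
    xi (form D q (bw k b₃) ∘ₗ Words.S D q (-1))
      ((TriMod.pt D q (D.tK (D.wt b₁) - D.tK (D.wt b₃))).flip (bw k b₂) ∘ₗ
        tw D q (-D.tK (D.wt b₃))) (form D q (bw k b₁))

/-- The cross relation, on the iterated coproducts. -/
def crossMap : Words k I ⊗[k] (Words k I ⊗[k] Words k I) →ₗ[k]
    Words k I ⊗[k] (Words k I ⊗[k] Words k I) →ₗ[k] TriMod D q :=
  TensorProduct.lift <| Finsupp.linearCombination k fun b₁ => TensorProduct.lift <|
    Finsupp.linearCombination k fun b₂ => Finsupp.linearCombination k fun b₃ =>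
      crossTerm D q b₁ b₂ b₃

theorem crossMap_bw (b₁ b₂ b₃ : List I) :
    crossMap D q (bw k b₁ ⊗ₜ (bw k b₂ ⊗ₜ bw k b₃)) = crossTerm D q b₁ b₂ b₃ := by
  simp [crossMap, bw]

/-- Lengthening the word paired through the inverse antipode amounts to a right derivation of the
argument, since the antipode exchanges the two sides. -/
theorem form_S_cons (i : I) (b : List I) :
    form D q (bw k (i :: b)) ∘ₗ Words.S D q (-1) =
      (-((qDiff k D q i)⁻¹ * q.val ^ (-D.ti i (D.rt b)))) •
        ((form D q (bw k b) ∘ₗ Words.S D q (-1)) ∘ₗ rskew D q i) := LinearMap.ext fun y => by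
  simp only [LinearMap.comp_apply, LinearMap.smul_apply]
  rw [← cons_bw, form_cons_left, skew_S, Words.S_tw, map_neg, form_tw, tw_bw, map_smul,
    LinearMap.smul_apply, neg_one_smul, LinearMap.neg_apply, smul_eq_mul, smul_eq_mul]
  ring

/-- The operator E_i gives three terms: a new letter in b₂, a right derivation and a left derivation
of the middle part of y. The last two are passed to the neighbouring factors, where they lengthen b₁
and b₃. These are the three terms of left multiplication by v_i on the braided cube, and the scalars
agree. -/
theorem opE_crossTerm (i : I) (b₁ b₂ b₃ : List I) (y : Words k I) :
    TriMod.opE D q i (crossTerm D q b₁ b₂ b₃ (Words.comul₃ D q y)) =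
      crossMap D q (Lop₃ D q i (bw k b₁ ⊗ₜ (bw k b₂ ⊗ₜ bw k b₃))) (Words.comul₃ D q y) := by
  have h0 : ∀ (φ Ψ χ), TriMod.opE D q i (xi φ Ψ χ (Words.comul₃ D q y)) =
      xi φ (TriMod.opE D q i ∘ₗ Ψ) χ (Words.comul₃ D q y) := fun φ Ψ χ => by
    have : TriMod.opE D q i ∘ₗ xi φ Ψ χ = xi φ (TriMod.opE D q i ∘ₗ Ψ) χ :=
      Words.hom_ext₃ fun u v w => by simp [xi_tmul]
    exact LinearMap.congr_fun this _
  have hadd : ∀ (φ χ) (Ψ Ψ' : Words k I →ₗ[k] TriMod D q),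
      xi φ (Ψ + Ψ') χ = xi φ Ψ χ + xi φ Ψ' χ := fun φ χ Ψ Ψ' =>
    Words.hom_ext₃ fun u v w => by simp [xi_tmul]
  have hsmul : ∀ (φ χ) (Ψ : Words k I →ₗ[k] TriMod D q) (a : k),
      xi φ (a • Ψ) χ = a • xi φ Ψ χ := fun φ χ Ψ a =>
    Words.hom_ext₃ fun u v w => by
      rw [LinearMap.smul_apply, xi_tmul, xi_tmul, LinearMap.smul_apply, smul_comm]
  have hsmul_left : ∀ (φ χ) (Ψ : Words k I →ₗ[k] TriMod D q) (a : k),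
      xi (a • φ) Ψ χ = a • xi φ Ψ χ := fun φ χ Ψ a =>
    Words.hom_ext₃ fun u v w => by
      rw [LinearMap.smul_apply, xi_tmul, xi_tmul, LinearMap.smul_apply, smul_smul, smul_eq_mul,
        mul_assoc]
  have hsmul_right : ∀ (φ χ) (Ψ : Words k I →ₗ[k] TriMod D q) (a : k),
      xi φ Ψ (a • χ) = a • xi φ Ψ χ := fun φ χ Ψ a =>
    Words.hom_ext₃ fun u v w => by
      rw [LinearMap.smul_apply, xi_tmul, xi_tmul, LinearMap.smul_apply, smul_smul, smul_eq_mul,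
        mul_left_comm]
  have hform : form D q (bw k (i :: b₁)) =
      (qDiff k D q i)⁻¹ • (form D q (bw k b₁) ∘ₗ skew D q i) := LinearMap.ext fun y => by
    rw [← cons_bw, form_cons_left]; rfl
  set t₁ := D.tK (D.wt b₁) with ht₁
  set t₃ := D.tK (D.wt b₃) with ht₃
  -- The Cartan weights are regrouped so that the right-derivation term shows t₁ increased by t_i,
  -- and the left-derivation term t₃ increased by t_i, as for the lengthened words.
  have hΨ : TriMod.opE D q i ∘ₗ ((TriMod.pt D q (t₁ - t₃)).flip (bw k b₂) ∘ₗ tw D q (-t₃)) =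
      q.val ^ (t₁ - t₃) (D.α i) • ((TriMod.pt D q (t₁ - t₃)).flip (bw k (i :: b₂)) ∘ₗ
        tw D q (-t₃)) +
      (((qDiff k D q i)⁻¹ * q.val ^ (-t₃ (D.α i))) •
        (((TriMod.pt D q (D.ti i + t₁ - t₃)).flip (bw k b₂) ∘ₗ tw D q (-t₃)) ∘ₗ rskew D q i) +
      (-((qDiff k D q i)⁻¹ * q.val ^ (-t₃ (D.α i)))) •
        (((TriMod.pt D q (t₁ - (D.ti i + t₃))).flip (bw k b₂) ∘ₗ tw D q (-(D.ti i + t₃))) ∘ₗ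
          skew D q i)) := LinearMap.ext fun c => by
    simp only [LinearMap.comp_apply, LinearMap.flip_apply, LinearMap.add_apply,
      LinearMap.smul_apply, TriMod.opE_pt, cons_bw, rskew_tw, skew_tw, map_smul, tw_tw,
      LinearMap.neg_apply, neg_smul]
    rw [smul_sub, smul_smul, smul_smul, sub_eq_add_neg (_ • _), ← add_sub_assoc,
      show -D.ti i + (t₁ - t₃) = t₁ - (D.ti i + t₃) by abel, neg_add]
  have e1 : (Lop₃ D q i (bw k b₁ ⊗ₜ (bw k b₂ ⊗ₜ bw k b₃))) =
      bw k (i :: b₁) ⊗ₜ (bw k b₂ ⊗ₜ bw k b₃) + q.val ^ D.ti i (D.rt b₁) •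
        (bw k b₁ ⊗ₜ (bw k (i :: b₂) ⊗ₜ bw k b₃) + q.val ^ D.ti i (D.rt b₂) •
          bw k b₁ ⊗ₜ (bw k b₂ ⊗ₜ bw k (i :: b₃))) := by
    simp only [Lop₃, LinearMap.add_apply, TensorProduct.map_tmul, Lop_tmul, cons_bw, tw_bw,
      LinearMap.id_apply, ← TensorProduct.smul_tmul', TensorProduct.tmul_add,
      TensorProduct.tmul_smul, smul_add]
    rw [smul_comm (q.val ^ D.ti i (D.rt b₁))]
  have t3 : t₃ (D.α i) = D.ti i (D.rt b₃) := (D.ti_rt i b₃).symm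
  have t1 : t₁ (D.α i) = D.ti i (D.rt b₁) := (D.ti_rt i b₁).symm
  rw [e1, map_add, map_smul, map_add, map_smul, crossMap_bw, crossMap_bw, crossMap_bw]
  simp only [LinearMap.add_apply, LinearMap.smul_apply, crossTerm, map_smul, h0, ← ht₁, ← ht₃, hΨ,
    hadd, hsmul, D.tK_wt_cons, form_S_cons, hform, hsmul_left, hsmul_right, xi_rskew_mid,
    xi_rskew_left, smul_add, smul_smul, D.rt_cons]
  rw [add_left_comm]
  congr 1
  · congr 1
    rw [mul_left_comm, q.mul_zpow, mul_comm]
    congr 2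
    simp only [map_add]
    ring
  · congr 1
    · congr 1
      rw [q.mul_zpow, q.mul_zpow]
      congr 1
      simp only [map_add, LinearMap.sub_apply, t1, t3]
      ring
    · congr 1
      rw [mul_neg, mul_neg, mul_neg, mul_neg, mul_left_comm, q.mul_zpow,
        mul_left_comm _ (qDiff k D q i)⁻¹, mul_left_comm _ (qDiff k D q i)⁻¹,
        mul_left_comm _ (qDiff k D q i)⁻¹, q.mul_zpow, q.mul_zpow, q.mul_zpow]
      congr 3
      simp only [map_add, t3]
      ring

/-- Both sides are built up one letter of b at a time by the same operators, by `opE_crossTerm`. The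
right-hand side is the cross relation with the components of c in reversed order, because it uses
the coproduct of C rather than that of C̄. -/
theorem weval_opE_pt (b c : Words k I) :
    weval (TriMod.opE D q) b (TriMod.pt D q 0 c (bw k [])) =
      crossMap D q (Words.comul₃ D q b) (Words.comul₃ D q c) := by
  refine Words.induction (f := LinearMap.applyₗ (TriMod.pt D q 0 c (bw k [])) ∘ₗ
    weval (TriMod.opE D q)) (g := (crossMap D q).flip (Words.comul₃ D q c) ∘ₗ Words.comul₃ D q)
    ?_ (fun j y _ ih => ?_) b
  -- For empty b both pairings become counits, and the counit axioms collapse the iterated coproduct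
  -- of c to c.
  · have h1 : Words.comul₃ D q (bw k []) = bw k [] ⊗ₜ (bw k [] ⊗ₜ bw k []) := by
      simp [Words.comul₃, Words.comul_nil]
    have h2 : form D q (bw k []) = Words.counit k I := LinearMap.ext fun y => form_nil_left' D q y
    have h3 : Words.counit k I ∘ₗ Words.S D q (-1) = Words.counit k I := LinearMap.ext fun y => by
      rw [LinearMap.comp_apply, ← form_nil_left' D q, ← form_S, Words.S_nil, form_nil_left']
    have h4 : ∀ x : Words k I, tw D q 0 x = x := tw_zero D q
    simp only [LinearMap.comp_apply, LinearMap.applyₗ_apply_apply, LinearMap.flip_apply, weval_nil,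
      Module.End.one_apply, h1, crossMap_bw, crossTerm, h2, D.tK_wt_nil, h3]
    simp only [LinearMap.zero_apply, neg_zero, zpow_zero, one_smul, sub_zero]
    have h5 : xi (Words.counit k I) ((TriMod.pt D q 0).flip (bw k []) ∘ₗ tw D q 0)
        (Words.counit k I) = (TriMod.pt D q 0).flip (bw k []) ∘ₗ
          (TensorProduct.lid k _).toLinearMap ∘ₗ TensorProduct.map (Words.counit k I)
            ((TensorProduct.rid k _).toLinearMap ∘ₗ TensorProduct.map .id (Words.counit k I)) :=
      Words.hom_ext₃ fun u v w => by simp [xi_tmul, h4, smul_smul, mul_comm]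
    have h6 : ((TensorProduct.rid k _).toLinearMap ∘ₗ
        TensorProduct.map .id (Words.counit k I)) ∘ₗ Words.comul D q = .id :=
      LinearMap.ext fun y => Words.comul_counit D q y
    rw [h5, Words.comul₃, LinearMap.comp_apply, LinearMap.comp_apply, LinearMap.comp_apply,
      TensorProduct.map_map, h6,
      LinearMap.comp_id, LinearEquiv.coe_coe, Words.counit_comul]
    rfl
  · simp only [LinearMap.comp_apply, LinearMap.applyₗ_apply_apply, LinearMap.flip_apply] at ih ⊢
    rw [weval_cons, Module.End.mul_apply, ih, Words.comul₃_cons]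
    generalize Words.comul₃ D q y = t
    have : TriMod.opE D q j ∘ₗ (crossMap D q).flip (Words.comul₃ D q c) =
        (crossMap D q).flip (Words.comul₃ D q c) ∘ₗ Lop₃ D q j :=
      Words.hom_ext₃ fun u v w => by
        simp only [LinearMap.comp_apply, LinearMap.flip_apply, crossMap_bw, opE_crossTerm]
    exact LinearMap.congr_fun this t

/-- The cross relation in `U_q(g)`. -/
theorem Uq.coord_e_mul_f (b c : Words k I) :
    Uq.coord D q (weval (Uq.e D q) b * weval (Uq.f D q) c) =
      crossMap D q (Words.comul₃ D q b) (Words.comul₃ D q c) := by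
  rw [← weval_opE_pt, Uq.coord, LinearMap.comp_apply, AlgHom.toLinearMap_apply, map_mul,
    map_weval, map_weval]
  simp only [TriMod.rep, IsTriple.lift_e, IsTriple.lift_f]
  rw [LinearMap.applyₗ_apply_apply, Module.End.mul_apply, TriMod.weval_opF, Words.mul_nil]

end Cross

/-! ### The embedding of `U_q(g)` and the product of the double bosonisation -/

section TriEmb

variable {k : Type*} [NormedField k] [IsUltrametricDist k] [CompleteSpace k]
  {I Φ : Type*} [AddCommGroup Φ] {D : RootDatum I Φ} {q : QNumber k}
variable {H A C B : Type*} [NormedAddCommGroup H] [NormedSpace k H] [CompleteSpace H]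
  [IsUltrametricDist H] [NormedAddCommGroup A] [NormedSpace k A] [CompleteSpace A]
  [IsUltrametricDist A] [NormedAddCommGroup C] [NormedSpace k C] [CompleteSpace C]
  [IsUltrametricDist C] [NormedAddCommGroup B] [NormedSpace k B] [CompleteSpace B]
  [IsUltrametricDist B]
variable {jH : (Module.Dual ℤ Φ →₀ k) →ₗ[k] H} {eA : (I →₀ ℤ) → A}
  {jC : Words k I →ₗ[k] C} {jB : Words k I →ₗ[k] B} {E : DBData k H A C B}

variable (D q) in
/-- The data of the double bosonisation, modelled on words modulo the radical. -/
structure DBEmbedding (jH : (Module.Dual ℤ Φ →₀ k) →ₗ[k] H) (eA : (I →₀ ℤ) → A)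
    (jC : Words k I →ₗ[k] C) (jB : Words k I →ₗ[k] B) (E : DBData k H A C B) : Prop
    extends DBModel D q jH eA jC jB E where
  C_radical : ∀ y ∈ radical D q, jC y = 0
  B_radical : ∀ y ∈ radical D q, jB y = 0
  coeff : ∀ l, ∃ φ : BMap k H k, ∀ a, φ (jH a) = a l

/-- The map from the triangular decomposition to the completed tensor product. -/
def DBEmbedding.tri (hE : DBEmbedding D q jH eA jC jB E) :
    TriMod D q →ₗ[k] CT k (CT k C H) B :=
  CT.alg (CT.alg ((radical D q).liftQ jC fun y hy => hE.C_radical y hy) jH)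
    ((radical D q).liftQ jB fun y hy => hE.B_radical y hy) ∘ₗ (TriMod.equiv D q).symm.toLinearMap

theorem DBEmbedding.tri_pt (hE : DBEmbedding D q jH eA jC jB E) (l : Module.Dual ℤ Φ)
    (c b : Words k I) :
    hE.tri (TriMod.pt D q l c b) = tm k (tm k (jC c) (jH (.single l 1))) (jB b) := rfl

theorem DenseRange.liftQ {X : Type*} [NormedAddCommGroup X] [NormedSpace k X]
    {j : Words k I →ₗ[k] X} (hj : DenseRange j) {N : Submodule k (Words k I)}
    (h : N ≤ LinearMap.ker j) : DenseRange (N.liftQ j h) :=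
  Dense.mono (by rintro _ ⟨x, rfl⟩; exact ⟨N.mkQ x, rfl⟩) hj

theorem DBEmbedding.denseRange_tri (hE : DBEmbedding D q jH eA jC jB E) : DenseRange hE.tri := by
  have hC : DenseRange ((radical D q).liftQ jC fun y hy => hE.C_radical y hy) :=
    DenseRange.liftQ hE.C.dense _
  have hB : DenseRange ((radical D q).liftQ jB fun y hy => hE.B_radical y hy) :=
    DenseRange.liftQ hE.B.dense _
  refine Dense.mono ?_ (CT.denseRange_alg (CT.denseRange_alg hC hE.cartan.dense) hB)
  rintro _ ⟨x, rfl⟩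
  exact ⟨TriMod.equiv D q x, rfl⟩

variable (D q) in
theorem radical_separating (v : Words k I ⧸ radical D q) (hv : ∀ x, (radical D q).liftQ (form D q x)
    (fun _ hy => (mem_radical D q).1 hy x) v = 0) : v = 0 := by
  obtain ⟨y, rfl⟩ := Submodule.mkQ_surjective _ v
  exact (Submodule.Quotient.mk_eq_zero _).2 ((mem_radical D q).2 fun x => hv x)

/-- Pairing with words separates points modulo the radical, and coefficients separate finite
combinations of group-likes. All these functionals are bounded, so their products extend to the
completed tensor product and still detect elements of the algebraic one. -/
theorem DBEmbedding.injective_tri (hE : DBEmbedding D q jH eA jC jB E) :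
    Function.Injective hE.tri := by
  refine (injective_iff_map_eq_zero _).2 fun z hz => ?_
  choose φ hφ using hE.coeff
  let f : Words k I → (Words k I ⧸ radical D q) →ₗ[k] k := fun x =>
    (radical D q).liftQ (form D q x) fun y hy => (mem_radical D q).1 hy x
  have h1 : ∀ v : (Words k I ⧸ radical D q) ⊗[k] (Module.Dual ℤ Φ →₀ k),
      (∀ p : Words k I × Module.Dual ℤ Φ, TensorProduct.lid k k
        (TensorProduct.map (f p.1) (Finsupp.lapply p.2) v) = 0) → v = 0 := fun v hv =>
    eq_zero_of_separating (φ := f) (ψ := fun l => Finsupp.lapply l) (radical_separating D q)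
      (fun v hv => Finsupp.ext hv) v fun a l => hv (a, l)
  refine eq_zero_of_separating (φ := fun p : Words k I × Module.Dual ℤ Φ =>
    (TensorProduct.lid k k).toLinearMap ∘ₗ TensorProduct.map (f p.1) (Finsupp.lapply p.2))
    (ψ := f) h1 (radical_separating D q) (z : _ ⊗[k] _) fun p x => ?_
  -- The bounded extensions of the algebraic functionals: pairing on C and B, and a coefficient on
  -- H.
  let F : BMap k (CT k C H) k := (CT.lid k k).comp
    (CT.map (E.pair.comp (CT.inr (jB p.1))) (φ p.2))
  let G : BMap k B k := E.pair.comp (CT.inl (jC x))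
  have hF : ∀ t, F (CT.alg ((radical D q).liftQ jC fun y hy => hE.C_radical y hy) jH t) =
      TensorProduct.lid k k (TensorProduct.map (f p.1) (Finsupp.lapply p.2) t) := by
    refine CT.comp_alg F ((TensorProduct.lid k k).toLinearMap ∘ₗ
      TensorProduct.map (f p.1) (Finsupp.lapply p.2)) fun a b => ?_
    obtain ⟨a, rfl⟩ := (radical D q).mkQ_surjective a
    have e1 : E.pair (tm k (jB p.1) (jC a)) = f p.1 ((radical D q).mkQ a) := hE.pair _ _
    change CT.lid k k (CT.map (E.pair.comp (CT.inr (jB p.1))) (φ p.2) (tm k (jC a) (jH b))) = _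
    rw [CT.map_tm, CT.lid_tm, BMap.comp_apply, CT.inr_apply, e1, hφ]
    rfl
  have hG : ∀ b, G ((radical D q).liftQ jB (fun y hy => hE.B_radical y hy) b) = f x b := fun b => by
    obtain ⟨b, rfl⟩ := (radical D q).mkQ_surjective b
    exact (hE.pair b x).trans (form_symm D q b x)
  have key := CT.comp_alg ((CT.lid k k).comp (CT.map F G)) ((TensorProduct.lid k k).toLinearMap ∘ₗ
    TensorProduct.map ((TensorProduct.lid k k).toLinearMap ∘ₗ TensorProduct.map (f p.1)
      (Finsupp.lapply p.2)) (f x)) (fun a b => by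
        rw [BMap.comp_apply, CT.map_tm, CT.lid_tm, hF, hG]; rfl)
    ((TriMod.equiv D q).symm z)
  have hz' : CT.alg (CT.alg ((radical D q).liftQ jC fun y hy => hE.C_radical y hy) jH)
    ((radical D q).liftQ jB fun y hy => hE.B_radical y hy) ((TriMod.equiv D q).symm z) = 0 := hz
  rw [hz', map_zero] at key
  exact key.symm

/-- The embedding of `U_q(g)`. -/
def DBEmbedding.emb (hE : DBEmbedding D q jH eA jC jB E) : Uq D q →ₗ[k] CT k (CT k C H) B :=
  hE.tri ∘ₗ Uq.coord D q

theorem DBEmbedding.emb_tri (hE : DBEmbedding D q jH eA jC jB E) (m : TriMod D q) :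
    hE.emb (Uq.tri D q m) = hE.tri m := by
  rw [emb, LinearMap.comp_apply, Uq.coord_tri]

theorem DBEmbedding.emb_pt (hE : DBEmbedding D q jH eA jC jB E) (l : Module.Dual ℤ Φ)
    (c b : Words k I) :
    hE.emb (weval (Uq.f D q) c * Uq.κ D q l * weval (Uq.e D q) b) =
      tm k (tm k (jC c) (jH (.single l 1))) (jB b) := by
  rw [← Uq.tri_pt, hE.emb_tri, hE.tri_pt]

theorem DBEmbedding.injective_emb (hE : DBEmbedding D q jH eA jC jB E) :
    Function.Injective hE.emb :=
  hE.injective_tri.comp (Function.LeftInverse.injective (Uq.tri_coord D q))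

theorem DBEmbedding.denseRange_emb (hE : DBEmbedding D q jH eA jC jB E) : DenseRange hE.emb :=
  Dense.mono (by rintro _ ⟨m, rfl⟩; exact ⟨_, hE.emb_tri m⟩) hE.denseRange_tri

/-- By the triangular decomposition the elements f_c κ_λ e_b span U_q(g). -/
theorem Uq.hom_ext_tri {Z : Type*} [AddCommGroup Z] [Module k Z] {g g' : Uq D q →ₗ[k] Z}
    (h : ∀ (l) (c b : Words k I), g (weval (Uq.f D q) c * Uq.κ D q l * weval (Uq.e D q) b) =
      g' (weval (Uq.f D q) c * Uq.κ D q l * weval (Uq.e D q) b)) : g = g' := by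
  have : g ∘ₗ Uq.tri D q = g' ∘ₗ Uq.tri D q := TriMod.hom_ext fun l c b => by
    simp only [LinearMap.comp_apply, Uq.tri_pt, h]
  refine LinearMap.ext fun x => ?_
  rw [← Uq.tri_coord D q x]
  exact LinearMap.congr_fun this _

/-- The left action of `C ⊗ H`. -/
def DBData.lact (E : DBData k H A C B) :
    BMap k (CT k (CT k C H) (CT k (CT k C H) B)) (CT k (CT k C H) B) :=
  (CT.map E.mulCH (BMap.id k B)).comp (CT.assocInv k (CT k C H) (CT k C H) B)

/-- The right action of `H ⊗ B`. -/
def DBData.ract (E : DBData k H A C B) :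
    BMap k (CT k (CT k (CT k C H) B) (CT k H B)) (CT k (CT k C H) B) :=
  (CT.assocInv k C H B).comp <| (CT.map (BMap.id k C) E.mulHB).comp <|
    (CT.assoc k C (CT k H B) (CT k H B)).comp (CT.map (CT.assoc k C H B) (BMap.id k (CT k H B)))

/-- Left multiplication by f_c κ_λ preserves the triangular order, so it needs only the product of
C̄ ⋊ H̄ and no cross relation. The right action of H ⋉ B is treated in the same way. -/
theorem DBEmbedding.lact_emb (hE : DBEmbedding D q jH eA jC jB E) (c : Words k I)
    (l : Module.Dual ℤ Φ) (y : Uq D q) :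
    E.lact (tm k (tm k (jC c) (jH (.single l 1))) (hE.emb y)) =
      hE.emb (weval (Uq.f D q) c * Uq.κ D q l * y) := by
  have h := Uq.isTriple D q
  refine LinearMap.congr_fun (Uq.hom_ext_tri (g := E.lact.toLinearMap ∘ₗ
    (CT.inr (tm k (jC c) (jH (.single l 1)))).toLinearMap ∘ₗ hE.emb)
    (g' := hE.emb ∘ₗ LinearMap.mulLeft k (weval (Uq.f D q) c * Uq.κ D q l)) fun m c' b => ?_) y
  change E.lact (tm k _ (hE.emb _)) = hE.emb (_ * _)
  have e : weval (Uq.f D q) c * Uq.κ D q l *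
      (weval (Uq.f D q) c' * Uq.κ D q m * weval (Uq.e D q) b) =
      weval (Uq.f D q) (Words.mul c (tw D q l c')) * Uq.κ D q (l + m) * weval (Uq.e D q) b := by
    rw [weval_mul, h.κ_add]
    simp only [← mul_assoc]
    rw [mul_assoc (weval (Uq.f D q) c) (Uq.κ D q l), h.κ_weval_f]
    simp only [← mul_assoc]
  rw [e, hE.emb_pt, hE.emb_pt, DBData.lact, BMap.comp_apply, CT.assocInv_tm, CT.map_tm,
    mulCH_model hE.toDBModel, BMap.id_apply]

theorem DBEmbedding.ract_emb (hE : DBEmbedding D q jH eA jC jB E) (y : Uq D q)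
    (l : Module.Dual ℤ Φ) (b : Words k I) :
    E.ract (tm k (hE.emb y) (tm k (jH (.single l 1)) (jB b))) =
      hE.emb (y * (Uq.κ D q l * weval (Uq.e D q) b)) := by
  have h := Uq.isTriple D q
  refine LinearMap.congr_fun (Uq.hom_ext_tri (g := E.ract.toLinearMap ∘ₗ
    (CT.inl (tm k (jH (.single l 1)) (jB b))).toLinearMap ∘ₗ hE.emb)
    (g' := hE.emb ∘ₗ LinearMap.mulRight k (Uq.κ D q l * weval (Uq.e D q) b)) fun m c b' => ?_) y
  change E.ract (tm k (hE.emb _) _) = hE.emb (_ * _)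
  have e : weval (Uq.f D q) c * Uq.κ D q m * weval (Uq.e D q) b' *
      (Uq.κ D q l * weval (Uq.e D q) b) =
      weval (Uq.f D q) c * Uq.κ D q (m + l) * weval (Uq.e D q) (Words.mul (tw D q l b') b) := by
    rw [weval_mul, h.κ_add, ← mul_assoc, mul_assoc _ (weval (Uq.e D q) b'), h.weval_e_κ]
    simp only [← mul_assoc]
  rw [e, hE.emb_pt, hE.emb_pt]
  simp only [DBData.ract, BMap.comp_apply, CT.map_tm, CT.assoc_tm, BMap.id_apply,
    mulHB_model hE.toDBModel, CT.assocInv_tm]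

end TriEmb

/-! ### The cross relation and the product of the double bosonisation -/

section CrossModel

variable {k : Type*} [NormedField k] {I Φ : Type*} [AddCommGroup Φ]
  (D : RootDatum I Φ) (q : QNumber k)

/-- The inverse braiding on words. -/
def tswap : Words k I ⊗[k] Words k I →ₗ[k] Words k I ⊗[k] Words k I :=
  TensorProduct.lift <| Finsupp.linearCombination k fun u =>
    (TensorProduct.mk k _ _).flip (bw k u) ∘ₗ tw D q (-D.tK (D.wt u))

theorem tswap_bw_left (u : List I) (y : Words k I) :
    tswap D q (bw k u ⊗ₜ y) = tw D q (-D.tK (D.wt u)) y ⊗ₜ bw k u := by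
  simp [tswap, bw]

theorem tswap_bw_right (x : Words k I) (v : List I) :
    tswap D q (x ⊗ₜ bw k v) = bw k v ⊗ₜ tw D q (-D.tK (D.wt v)) x := by
  have : tswap D q ∘ₗ (TensorProduct.mk k _ _).flip (bw k v) =
      TensorProduct.mk k _ _ (bw k v) ∘ₗ tw D q (-D.tK (D.wt v)) := Words.hom_ext fun u => by
    simp only [LinearMap.comp_apply, LinearMap.flip_apply, TensorProduct.mk_apply, tswap_bw_left,
      tw_bw, LinearMap.neg_apply, D.tK_rt_comm u v, TensorProduct.tmul_smul,
      TensorProduct.smul_tmul']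
  exact LinearMap.congr_fun this x

/-- The braided reversal of the threefold tensor power. -/
def trev : (Words k I ⊗[k] Words k I) ⊗[k] Words k I →ₗ[k]
    Words k I ⊗[k] (Words k I ⊗[k] Words k I) :=
  TensorProduct.lift <| LinearMap.flip <| Finsupp.linearCombination k fun w =>
    TensorProduct.mk k _ _ (bw k w) ∘ₗ tswap D q ∘ₗ
      TensorProduct.map (tw D q (-D.tK (D.wt w))) (tw D q (-D.tK (D.wt w)))

theorem trev_tmul_bw (s : Words k I ⊗[k] Words k I) (w : List I) :
    trev D q (s ⊗ₜ bw k w) = bw k w ⊗ₜ tswap D q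
      (TensorProduct.map (tw D q (-D.tK (D.wt w))) (tw D q (-D.tK (D.wt w))) s) := by
  simp [trev, bw]

theorem trev_bw (u v w : List I) : trev D q ((bw k u ⊗ₜ bw k v) ⊗ₜ bw k w) =
    q.val ^ (-(D.tK (D.wt w) (D.rt u) + D.tK (D.wt w) (D.rt v) + D.tK (D.wt u) (D.rt v))) •
      bw k w ⊗ₜ (bw k v ⊗ₜ bw k u) := by
  simp only [trev_tmul_bw, TensorProduct.map_tmul, tw_bw, ← TensorProduct.smul_tmul',
    TensorProduct.tmul_smul, map_smul, tswap_bw_left, smul_smul, q.mul_zpow, LinearMap.neg_apply]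
  congr 2
  ring

/-- Because the coproduct preserves weights, the inverse braiding slides past it. The iterated
coproduct of C̄ is thus the braided reversal of the iterated coproduct of C. -/
theorem tswap_comul₃ (y : Words k I) :
    TensorProduct.map .id (tswap D q ∘ₗ Words.comul D q) (tswap D q (Words.comul D q y)) =
      trev D q ((TensorProduct.assoc k _ _ _).symm (Words.comul₃ D q y)) := by
  rw [Words.comul₃, LinearMap.comp_apply, ← Words.coassoc, LinearEquiv.symm_apply_apply]
  have : TensorProduct.map .id (tswap D q ∘ₗ Words.comul D q) ∘ₗ tswap D q =
      trev D q ∘ₗ TensorProduct.map (Words.comul D q) .id := by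
    refine TensorProduct.ext (Words.hom_ext₂ fun u v => ?_)
    simp only [LinearMap.compr₂ₛₗ_apply, TensorProduct.mk_apply, LinearMap.comp_apply,
      tswap_bw_right, TensorProduct.map_tmul, LinearMap.id_apply, trev_tmul_bw, Words.comul_tw]
  exact LinearMap.congr_fun this _

theorem form_eq_zero_of_weight {b : List I} {n : I →₀ ℤ} (hb : D.wt b ≠ n) {y : Words k I}
    (hy : y ∈ Submodule.span k (bw k '' {w | D.wt w = n})) : form D q (bw k b) y = 0 := by
  induction hy using Submodule.span_induction with
  | zero => simp
  | add x y _ _ hx hy => rw [map_add, hx, hy, add_zero]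
  | smul c x _ hx => rw [map_smul, hx, smul_zero]
  | mem y h =>
    obtain ⟨w, rfl, rfl⟩ := h
    by_contra h
    exact hb (D.wt_perm (perm_of_form_ne_zero D q h))

variable {D q} [IsUltrametricDist k] [CompleteSpace k]
variable {H A C B : Type*} [NormedAddCommGroup H] [NormedSpace k H] [CompleteSpace H]
  [IsUltrametricDist H] [NormedAddCommGroup A] [NormedSpace k A] [CompleteSpace A]
  [IsUltrametricDist A] [NormedAddCommGroup C] [NormedSpace k C] [CompleteSpace C]
  [IsUltrametricDist C] [NormedAddCommGroup B] [NormedSpace k B] [CompleteSpace B]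
  [IsUltrametricDist B]
variable {jH : (Module.Dual ℤ Φ →₀ k) →ₗ[k] H} {eA : (I →₀ ℤ) → A}
  {jC : Words k I →ₗ[k] C} {jB : Words k I →ₗ[k] B} {E : DBData k H A C B}

/-- The map defined by `Rbar` differs from the braiding by inverting the exponent of q, which on
words is the flip with the inverse twist. -/
theorem comulCbar_model (hE : DBModel D q jH eA jC jB E) (y : Words k I) :
    E.comulCbar (jC y) = CT.alg jC jC (tswap D q (Words.comul D q y)) := by
  rw [DBData.comulCbar, BMap.comp_apply, hE.C.comul]
  refine CT.comp_alg _ (CT.alg jC jC ∘ₗ tswap D q) (fun a b => ?_) _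
  refine LinearMap.congr_fun (Words.hom_ext (f := (psi E.ev E.Rbar E.hC.coact
    E.hC.coact).toLinearMap ∘ₗ (CT.inl (jC b)).toLinearMap ∘ₗ jC) (g := CT.alg jC jC ∘ₗ
      tswap D q ∘ₗ (TensorProduct.mk k _ _).flip b) fun u => ?_) a
  change psi E.ev E.Rbar E.hC.coact E.hC.coact (tm k (jC (bw k u)) (jC b)) =
    CT.alg jC jC (tswap D q (bw k u ⊗ₜ b))
  rw [psi_model (τ := fun n => -D.tK n) hE.cartan hE.cartan.Rbar hE.C, tswap_bw_left,
    CT.alg_tmul]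

/-- The second argument is allowed to be any homogeneous element, since it will be the inverse
antipode of a word. -/
theorem pairH_model (hE : DBModel D q jH eA jC jB E) {Q : BMap k A H}
    {τ : (I →₀ ℤ) → Module.Dual ℤ Φ} (hQ : ∀ n, Q (eA n) = jH (.single (τ n) 1)) (b : List I)
    {n : I →₀ ℤ} {c : Words k I} (hc : c ∈ Submodule.span k (bw k '' {w | D.wt w = n})) :
    E.pairH Q (tm k (jB (bw k b)) (jC c)) = form D q (bw k b) c •
      tm k (jH (.single (τ (D.wt b)) 1)) (jH (.single (τ n) 1)) := by
  simp only [DBData.pairH, BMap.comp_apply, CT.map_tm, hE.B.coact, coact_weight hE.C hc, CT.mid_tm,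
    hE.pair, hQ, CT.rid_tm]

theorem join_model (hE : DBModel D q jH eA jC jB E) (l l' m m' : Module.Dual ℤ Φ)
    (b c : Words k I) :
    E.join (tm k (tm k (jH (.single l 1)) (jH (.single l' 1))) (tm k (tm k (jB b) (jC c))
      (tm k (jH (.single m 1)) (jH (.single m' 1))))) =
    tm k (tm k (jC (tw D q l' c)) (jH (.single (l + m') 1))) (jB (tw D q m b)) := by
  simp only [DBData.join, BMap.comp_apply, CT.map_tm, BMap.id_apply, CT.mid_tm, CT.swap_tm,
    ract_model hE.cartan hE.B, act_model hE.cartan hE.C, CT.assocInv_tm, hE.cartan.H_mul]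

/-- The part of the cross relation which follows the two iterated comultiplications. -/
def DBData.crossJoin (E : DBData k H A C B) :
    BMap k (CT k (CT k B (CT k B B)) (CT k C (CT k C C))) (CT k (CT k C H) B) :=
  E.join.comp <|
  (CT.map (E.pairH E.R) (CT.map (BMap.id k (CT k B C))
    ((E.pairH E.Rbar).comp (CT.map (BMap.id k B) E.hC.antipodeInv)))).comp <|
  (CT.map (BMap.id k (CT k B C)) (CT.mid k B B C C)).comp (CT.mid k B (CT k B B) C (CT k C C))

theorem crossJoin_model (hE : DBModel D q jH eA jC jB E) (b₁ b₂ b₃ c₁ c₂ c₃ : List I) :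
    E.crossJoin (tm k (tm k (jB (bw k b₁)) (tm k (jB (bw k b₂)) (jB (bw k b₃))))
      (tm k (jC (bw k c₁)) (tm k (jC (bw k c₂)) (jC (bw k c₃))))) =
    (form D q (bw k b₃) (Words.S D q (-1) (bw k c₃)) * form D q (bw k b₁) (bw k c₁)) •
      tm k (tm k (jC (tw D q (D.tK (D.wt c₁)) (bw k c₂)))
        (jH (.single (D.tK (D.wt b₁) - D.tK (D.wt c₃)) 1)))
          (jB (tw D q (-D.tK (D.wt b₃)) (bw k b₂))) := by
  have h1 := pairH_model (τ := fun n => D.tK n) hE hE.cartan.R b₁ (n := D.wt c₁) (c := bw k c₁)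
    (Submodule.subset_span ⟨c₁, rfl, rfl⟩)
  have h2 := pairH_model (τ := fun n => -D.tK n) hE hE.cartan.Rbar b₃ (S_bw_mem D q (-1) c₃)
  simp only [DBData.crossJoin, BMap.comp_apply, CT.mid_tm, CT.map_tm, BMap.id_apply,
    hE.C.antipodeInv, h1, h2, tm_smul_left, tm_smul_right, map_smul, join_model hE, smul_smul,
    ← sub_eq_add_neg]

/-- Both sides are the same product of two form values times the same kind of tensor, up to powers
of q which must be compared. -/
theorem DBEmbedding.crossJoin_trev (hE : DBEmbedding D q jH eA jC jB E)
    (s t : Words k I ⊗[k] (Words k I ⊗[k] Words k I)) :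
    E.crossJoin (tm k (CT.alg jB (CT.alg jB jB) s) (CT.alg jC (CT.alg jC jC)
      (trev D q ((TensorProduct.assoc k _ _ _).symm t)))) = hE.tri (crossMap D q s t) := by
  let f : Words k I ⊗[k] (Words k I ⊗[k] Words k I) →ₗ[k]
      Words k I ⊗[k] (Words k I ⊗[k] Words k I) →ₗ[k] CT k (CT k C H) B :=
    LinearMap.mk₂ k (fun s t => E.crossJoin (tm k (CT.alg jB (CT.alg jB jB) s)
      (CT.alg jC (CT.alg jC jC) (trev D q ((TensorProduct.assoc k _ _ _).symm t)))))
      (fun _ _ _ => by rw [map_add, tm_add_left, map_add])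
      (fun _ _ _ => by rw [map_smul, tm_smul_left, map_smul])
      (fun _ _ _ => by rw [map_add, map_add, map_add, tm_add_right, map_add])
      (fun _ _ _ => by rw [map_smul, map_smul, map_smul, tm_smul_right, map_smul])
  have : f = (crossMap D q).compr₂ hE.tri := by
    refine Words.hom_ext₃ fun b₁ b₂ b₃ => Words.hom_ext₃ fun u v w => ?_
    change E.crossJoin (tm k (CT.alg jB (CT.alg jB jB) (bw k b₁ ⊗ₜ (bw k b₂ ⊗ₜ bw k b₃)))
      (CT.alg jC (CT.alg jC jC) (trev D q ((TensorProduct.assoc k _ _ _).symm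
        (bw k u ⊗ₜ (bw k v ⊗ₜ bw k w)))))) = hE.tri (crossMap D q _ _)
    rw [TensorProduct.assoc_symm_tmul, trev_bw, map_smul, tm_smul_right, map_smul, crossMap_bw,
      crossTerm, LinearMap.smul_apply, xi_tmul]
    simp only [CT.alg_tmul, crossJoin_model hE.toDBModel, LinearMap.comp_apply,
      LinearMap.flip_apply, tw_bw, map_smul, hE.tri_pt, tm_smul_left,
      tm_smul_right, smul_smul]
    -- The form values vanish unless b₁ and w, and likewise b₃ and u, have equal weight; under these
    -- equalities the exponents of q coincide.
    by_cases h1 : D.wt b₁ = D.wt w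
    · by_cases h3 : D.wt b₃ = D.wt u
      · have e1 : D.rt b₁ = D.rt w := congrArg D.toRoot h1
        rw [h1, h3, e1]
        congr 1
        rw [q.mul_zpow, mul_left_comm, q.mul_zpow, mul_left_comm (q.val ^ _), q.mul_zpow,
          D.tK_rt_comm w u]
        congr 2
        simp only [map_add, LinearMap.neg_apply]
        ring
      · rw [form_eq_zero_of_weight D q h3 (S_bw_mem D q (-1) u)]; simp
    · rw [form_eq_zero_of_weight D q (y := bw k w) h1 (Submodule.subset_span ⟨w, rfl, rfl⟩)]; simp
  exact LinearMap.congr_fun₂ this s t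

/-- The abstract cross relation becomes, on words, the formula obtained from the action of U_q(g) on
`TriMod`; the coproduct of C̄ accounts for the reversal of the components of c. -/
theorem DBEmbedding.cross_emb (hE : DBEmbedding D q jH eA jC jB E) (b c : Words k I) :
    E.cross (tm k (jB b) (jC c)) = hE.emb (weval (Uq.e D q) b * weval (Uq.f D q) c) := by
  have h1 : CT.map (BMap.id k B) E.hB.comul (E.hB.comul (jB b)) =
      CT.alg jB (CT.alg jB jB) (Words.comul₃ D q b) := by
    rw [hE.B.comul, CT.map_alg (i := jB) (i' := CT.alg jB jB) (f₀ := .id) (g₀ := Words.comul D q)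
      (fun a => rfl) hE.B.comul]
    rfl
  have h2 : CT.map (BMap.id k C) E.comulCbar (E.comulCbar (jC c)) = CT.alg jC (CT.alg jC jC)
      (trev D q ((TensorProduct.assoc k _ _ _).symm (Words.comul₃ D q c))) := by
    rw [comulCbar_model hE.toDBModel, CT.map_alg (i := jC) (i' := CT.alg jC jC) (f₀ := .id)
      (g₀ := tswap D q ∘ₗ Words.comul D q) (fun a => rfl) (comulCbar_model hE.toDBModel),
      tswap_comul₃]
  have h3 : E.cross (tm k (jB b) (jC c)) = E.crossJoin (tm k
      (CT.map (BMap.id k B) E.hB.comul (E.hB.comul (jB b)))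
      (CT.map (BMap.id k C) E.comulCbar (E.comulCbar (jC c)))) := by
    simp only [DBData.cross, DBData.crossJoin, DBData.split, BMap.comp_apply, CT.map_tm]
  rw [h3, h1, h2, hE.crossJoin_trev, DBEmbedding.emb, LinearMap.comp_apply, Uq.coord_e_mul_f]

/-- The product of the double bosonisation. -/
def DBData.bigMul (E : DBData k H A C B) :
    BMap k (CT k (CT k (CT k C H) B) (CT k (CT k C H) B)) (CT k (CT k C H) B) :=
  E.ract.comp <| (CT.map E.lact (BMap.id k (CT k H B))).comp <|
  (CT.map (CT.map (BMap.id k (CT k C H)) E.cross) (BMap.id k (CT k H B))).comp <|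
  (CT.map (CT.assoc k (CT k C H) B C) (BMap.id k (CT k H B))).comp <|
  (CT.assocInv k (CT k (CT k C H) B) C (CT k H B)).comp
    (CT.map (BMap.id k (CT k (CT k C H) B)) (CT.assoc k C H B))

/-- In (f_c κ_λ e_b)(f_c' κ_μ e_b') the inner product e_b f_c' is given by the cross relation, and
the outer factors act by the two one-sided actions. Every map in this recipe is bounded, so it
defines the product on the completion. -/
theorem DBEmbedding.mul_emb (hE : DBEmbedding D q jH eA jC jB E) (y y' : Uq D q) :
    E.bigMul (tm k (hE.emb y) (hE.emb y')) = hE.emb (y * y') := by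
  let f : Uq D q →ₗ[k] Uq D q →ₗ[k] CT k (CT k C H) B :=
    LinearMap.mk₂ k (fun y y' => E.bigMul (tm k (hE.emb y) (hE.emb y')))
      (fun _ _ _ => by rw [map_add, tm_add_left, map_add])
      (fun _ _ _ => by rw [map_smul, tm_smul_left, map_smul])
      (fun _ _ _ => by rw [map_add, tm_add_right, map_add])
      (fun _ _ _ => by rw [map_smul, tm_smul_right, map_smul])
  have : f = (LinearMap.mul k (Uq D q)).compr₂ hE.emb := by
    refine Uq.hom_ext_tri fun l c b => Uq.hom_ext_tri fun l' c' b' => ?_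
    change E.bigMul (tm k (hE.emb _) (hE.emb _)) = hE.emb (_ * _)
    rw [hE.emb_pt, hE.emb_pt]
    simp only [DBData.bigMul, BMap.comp_apply, CT.map_tm, CT.assoc_tm, CT.assocInv_tm,
      BMap.id_apply, hE.cross_emb, hE.lact_emb, hE.ract_emb]
    simp only [mul_assoc]
  exact LinearMap.congr_fun₂ this y y'

end CrossModel

/-! ### The Hopf algebra structure of the double bosonisation -/

section DBHopf

variable {k : Type*} [NormedField k] {I Φ : Type*} [AddCommGroup Φ]
  {D : RootDatum I Φ} {q : QNumber k} [IsUltrametricDist k] [CompleteSpace k]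
variable {H A C B : Type*} [NormedAddCommGroup H] [NormedSpace k H] [CompleteSpace H]
  [IsUltrametricDist H] [NormedAddCommGroup A] [NormedSpace k A] [CompleteSpace A]
  [IsUltrametricDist A] [NormedAddCommGroup C] [NormedSpace k C] [CompleteSpace C]
  [IsUltrametricDist C] [NormedAddCommGroup B] [NormedSpace k B] [CompleteSpace B]
  [IsUltrametricDist B]
variable {jH : (Module.Dual ℤ Φ →₀ k) →ₗ[k] H} {eA : (I →₀ ℤ) → A}
  {jC : Words k I →ₗ[k] C} {jB : Words k I →ₗ[k] B} {E : DBData k H A C B}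
  {Z : Type*} [NormedAddCommGroup Z] [NormedSpace k Z]

theorem DBModel.hom_ext_CH (hE : DBModel D q jH eA jC jB E) {f g : BMap k (CT k C H) Z}
    (h : ∀ c l, f (tm k (jC c) (jH (.single l 1))) = g (tm k (jC c) (jH (.single l 1)))) :
    f = g :=
  CT.hom_ext_dense hE.C.dense hE.cartan.dense fun c a =>
    LinearMap.congr_fun (Finsupp.lhom_ext' fun l => LinearMap.ext_ring (h c l) :
      f.toLinearMap ∘ₗ (CT.inr (jC c)).toLinearMap ∘ₗ jH =
      g.toLinearMap ∘ₗ (CT.inr (jC c)).toLinearMap ∘ₗ jH) a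

theorem DBModel.hom_ext_HB (hE : DBModel D q jH eA jC jB E) {f g : BMap k (CT k H B) Z}
    (h : ∀ l b, f (tm k (jH (.single l 1)) (jB b)) = g (tm k (jH (.single l 1)) (jB b))) :
    f = g :=
  CT.hom_ext_dense hE.cartan.dense hE.B.dense fun a b =>
    LinearMap.congr_fun (Finsupp.lhom_ext' fun l => LinearMap.ext_ring (h l b) :
      f.toLinearMap ∘ₗ (CT.inl (jB b)).toLinearMap ∘ₗ jH =
      g.toLinearMap ∘ₗ (CT.inl (jB b)).toLinearMap ∘ₗ jH) a

theorem DBEmbedding.hom_ext (hE : DBEmbedding D q jH eA jC jB E)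
    {f g : BMap k (CT k (CT k C H) B) Z} (h : ∀ y, f (hE.emb y) = g (hE.emb y)) : f = g :=
  BMap.ext_dense hE.denseRange_emb h

theorem DBEmbedding.emb_f_κ (hE : DBEmbedding D q jH eA jC jB E) (c : Words k I)
    (l : Module.Dual ℤ Φ) : hE.emb (weval (Uq.f D q) c * Uq.κ D q l) =
      E.inCH (tm k (jC c) (jH (.single l 1))) := by
  rw [inCH_tm, hE.B.one, ← hE.emb_pt, weval_nil, mul_one]

theorem DBEmbedding.emb_κ_e (hE : DBEmbedding D q jH eA jC jB E) (l : Module.Dual ℤ Φ)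
    (b : Words k I) : hE.emb (Uq.κ D q l * weval (Uq.e D q) b) =
      E.inHB (tm k (jH (.single l 1)) (jB b)) := by
  rw [inHB_tm, hE.C.one, ← hE.emb_pt, weval_nil, one_mul]

theorem DBEmbedding.emb_κ (hE : DBEmbedding D q jH eA jC jB E) (l : Module.Dual ℤ Φ) :
    hE.emb (Uq.κ D q l) = E.inH (jH (.single l 1)) := by
  have := hE.emb_f_κ (bw k []) l
  rwa [weval_nil, one_mul, ← hE.C.one] at this

theorem DBEmbedding.emb_f (hE : DBEmbedding D q jH eA jC jB E) (c : Words k I) :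
    hE.emb (weval (Uq.f D q) c) = E.inC (jC c) := by
  have := hE.emb_f_κ c 0
  rwa [(Uq.isTriple D q).κ_zero, mul_one, ← hE.cartan.H_one] at this

theorem DBEmbedding.emb_e (hE : DBEmbedding D q jH eA jC jB E) (b : Words k I) :
    hE.emb (weval (Uq.e D q) b) = E.inB (jB b) := by
  have := hE.emb_κ_e 0 b
  rwa [(Uq.isTriple D q).κ_zero, one_mul, ← hE.cartan.H_one] at this

theorem DBEmbedding.emb_one (hE : DBEmbedding D q jH eA jC jB E) :
    hE.emb 1 = tm k (tm k E.hC.one E.hH.one) E.hB.one := by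
  have := hE.emb_f (bw k [])
  rwa [weval_nil, ← hE.C.one] at this

theorem DBEmbedding.map_mul_emb (hE : DBEmbedding D q jH eA jC jB E)
    (s t : Uq D q ⊗[k] Uq D q) : CT.map E.bigMul E.bigMul (CT.mid k _ _ _ _
      (tm k (CT.alg hE.emb hE.emb s) (CT.alg hE.emb hE.emb t))) =
        CT.alg hE.emb hE.emb (s * t) := by
  induction s using TensorProduct.induction_on with
  | zero => rw [map_zero, tm_zero_left, map_zero, map_zero, zero_mul, map_zero]
  | add x y hx hy => rw [map_add, tm_add_left, map_add, map_add, hx, hy, add_mul, map_add]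
  | tmul a b =>
    induction t using TensorProduct.induction_on with
    | zero => rw [map_zero, tm_zero_right, map_zero, map_zero, mul_zero, map_zero]
    | add x y hx hy => rw [map_add, tm_add_right, map_add, map_add, hx, hy, mul_add, map_add]
    | tmul a' b' =>
      rw [CT.alg_tmul, CT.alg_tmul, CT.mid_tm, CT.map_tm, hE.mul_emb, hE.mul_emb,
        Algebra.TensorProduct.tmul_mul_tmul, CT.alg_tmul]

theorem psiCH_model (hE : DBModel D q jH eA jC jB E) (u : List I) (l : Module.Dual ℤ Φ) :
    E.psiCH (tm k (jC (bw k u)) (jH (.single l 1))) =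
      tm k (jH (.single (-D.tK (D.wt u) + l) 1)) (jC (bw k u)) := by
  simp only [DBData.psiCH, BMap.comp_apply, CT.map_tm, hE.C.coact, CT.assoc_tm, CT.swap_tm,
    BMap.id_apply, CT.assocInv_tm, hE.cartan.Rbar, hE.cartan.H_mul]

theorem psiHB_model (hE : DBModel D q jH eA jC jB E) (u : List I) (l : Module.Dual ℤ Φ) :
    E.psiHB (tm k (jH (.single l 1)) (jB (bw k u))) =
      tm k (jB (bw k u)) (jH (.single (l + D.tK (D.wt u)) 1)) := by
  simp only [DBData.psiHB, BMap.comp_apply, CT.map_tm, hE.B.coact, CT.swap_tm,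
    BMap.id_apply, CT.assocInv_tm, hE.cartan.R, hE.cartan.H_mul]

/-- On words, the coaction map `Rbar` inserts precisely the inverse Cartan element which bosonises
the f half of the coproduct of U_q(g). -/
theorem DBEmbedding.comulCH_emb (hE : DBEmbedding D q jH eA jC jB E) (c : Words k I)
    (l : Module.Dual ℤ Φ) : CT.map E.inCH E.inCH (E.comulCH (tm k (jC c) (jH (.single l 1)))) =
      CT.alg hE.emb hE.emb (Uq.comul D q (weval (Uq.f D q) c * Uq.κ D q l)) := by
  have h := Uq.isTriple D q
  rw [map_mul, Uq.comul_weval_f, Uq.comul_κ, DBData.comulCH, BMap.comp_apply, CT.map_tm,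
    comulCbar_model hE.toDBModel, hE.cartan.H_comul]
  generalize Words.comul D q c = z
  let f : Words k I ⊗[k] Words k I →ₗ[k] CT k (CT k (CT k C H) B) (CT k (CT k C H) B) :=
    (CT.map E.inCH E.inCH).toLinearMap ∘ₗ (CT.midWith E.psiCH).toLinearMap ∘ₗ
      (CT.inl (tm k (jH (.single l 1)) (jH (.single l 1)))).toLinearMap ∘ₗ CT.alg jC jC ∘ₗ
        tswap D q
  have : f = CT.alg hE.emb hE.emb ∘ₗ LinearMap.mulRight k (Uq.κ D q l ⊗ₜ[k] Uq.κ D q l) ∘ₗ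
      TensorProduct.lift (Uq.comulF D q) := by
    refine TensorProduct.ext (Words.hom_ext₂ fun u v => ?_)
    simp only [LinearMap.compr₂ₛₗ_apply, TensorProduct.mk_apply, LinearMap.comp_apply, f,
      tswap_bw_left, CT.alg_tmul, BMap.coe_toLinearMap, CT.inl_apply, TensorProduct.lift.tmul,
      Uq.comulF_bw, LinearMap.mulRight_apply, Algebra.TensorProduct.tmul_mul_tmul, CT.midWith,
      BMap.comp_apply, CT.assoc_tm, CT.map_tm, BMap.id_apply, CT.assocInv_tm,
      psiCH_model hE.toDBModel, hE.emb_f_κ, h.κ_weval_f]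
    rw [mul_assoc, ← h.κ_add, hE.emb_f_κ]
  exact LinearMap.congr_fun this z

theorem DBEmbedding.comulHB_emb (hE : DBEmbedding D q jH eA jC jB E) (l : Module.Dual ℤ Φ)
    (b : Words k I) : CT.map E.inHB E.inHB (E.comulHB (tm k (jH (.single l 1)) (jB b))) =
      CT.alg hE.emb hE.emb (Uq.comul D q (Uq.κ D q l * weval (Uq.e D q) b)) := by
  have h := Uq.isTriple D q
  rw [map_mul, Uq.comul_weval_e, Uq.comul_κ, DBData.comulHB, BMap.comp_apply, CT.map_tm,
    hE.B.comul, hE.cartan.H_comul]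
  generalize Words.comul D q b = z
  let f : Words k I ⊗[k] Words k I →ₗ[k] CT k (CT k (CT k C H) B) (CT k (CT k C H) B) :=
    (CT.map E.inHB E.inHB).toLinearMap ∘ₗ (CT.midWith E.psiHB).toLinearMap ∘ₗ
      (CT.inr (tm k (jH (.single l 1)) (jH (.single l 1)))).toLinearMap ∘ₗ CT.alg jB jB
  have : f = CT.alg hE.emb hE.emb ∘ₗ LinearMap.mulLeft k (Uq.κ D q l ⊗ₜ[k] Uq.κ D q l) ∘ₗ
      TensorProduct.lift (Uq.comulE D q) := by
    refine TensorProduct.ext (Words.hom_ext₂ fun u v => ?_)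
    simp only [LinearMap.compr₂ₛₗ_apply, TensorProduct.mk_apply, LinearMap.comp_apply, f,
      CT.alg_tmul, BMap.coe_toLinearMap, CT.inr_apply, TensorProduct.lift.tmul,
      Uq.comulE_bw, LinearMap.mulLeft_apply, Algebra.TensorProduct.tmul_mul_tmul, CT.midWith,
      BMap.comp_apply, CT.assoc_tm, CT.map_tm, BMap.id_apply, CT.assocInv_tm,
      psiHB_model hE.toDBModel, hE.emb_κ_e]
    rw [← mul_assoc, ← h.κ_add, hE.emb_κ_e]
  exact LinearMap.congr_fun this z

/-- The comultiplication of the double bosonisation. -/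
def DBData.bigComul (E : DBData k H A C B) :
    BMap k (CT k (CT k C H) B) (CT k (CT k (CT k C H) B) (CT k (CT k C H) B)) :=
  (CT.map E.bigMul E.bigMul).comp <| (CT.mid k _ _ _ _).comp <|
    CT.map ((CT.map E.inCH E.inCH).comp E.comulCH)
      ((CT.map E.inHB E.inHB).comp (E.comulHB.comp (CT.inr E.hH.one)))

/-- The coproduct of f_c κ_λ e_b is the product of the coproducts of f_c κ_λ and e_b, which are
given by the two bosonisations. -/
theorem DBEmbedding.comul_emb (hE : DBEmbedding D q jH eA jC jB E) (y : Uq D q) :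
    E.bigComul (hE.emb y) = CT.alg hE.emb hE.emb (Uq.comul D q y) := by
  refine LinearMap.congr_fun (Uq.hom_ext_tri (g := E.bigComul.toLinearMap ∘ₗ hE.emb)
    (g' := CT.alg hE.emb hE.emb ∘ₗ (Uq.comul D q).toLinearMap) fun l c b => ?_) y
  change E.bigComul (hE.emb _) = CT.alg hE.emb hE.emb (Uq.comul D q _)
  rw [hE.emb_pt, map_mul, ← hE.map_mul_emb, ← hE.comulCH_emb]
  have h1 : Uq.κ D q 0 * weval (Uq.e D q) b = weval (Uq.e D q) b := by
    rw [(Uq.isTriple D q).κ_zero, one_mul]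
  rw [← h1, ← hE.comulHB_emb, ← hE.cartan.H_one]
  simp only [DBData.bigComul, BMap.comp_apply, CT.map_tm, CT.inr_apply]

/-- The counit of the double bosonisation. -/
def DBData.bigCounit (E : DBData k H A C B) : BMap k (CT k (CT k C H) B) k :=
  (CT.lid k k).comp (CT.map ((CT.lid k k).comp (CT.map E.hC.counit E.hH.counit)) E.hB.counit)

theorem Uq.counit_weval_e (y : Words k I) :
    Uq.counit D q (weval (Uq.e D q) y) = Words.counit k I y := by
  rw [map_weval, ← weval_zero]
  simp only [Uq.counit_e]

theorem Uq.counit_weval_f (y : Words k I) :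
    Uq.counit D q (weval (Uq.f D q) y) = Words.counit k I y := by
  rw [map_weval, ← weval_zero]
  simp only [Uq.counit_f]

theorem DBEmbedding.counit_emb (hE : DBEmbedding D q jH eA jC jB E) (y : Uq D q) :
    E.bigCounit (hE.emb y) = Uq.counit D q y := by
  refine LinearMap.congr_fun (Uq.hom_ext_tri (g := E.bigCounit.toLinearMap ∘ₗ hE.emb)
    (g' := (Uq.counit D q).toLinearMap) fun l c b => ?_) y
  change E.bigCounit (hE.emb _) = Uq.counit D q _
  rw [hE.emb_pt, map_mul, map_mul, Uq.counit_weval_e, Uq.counit_weval_f, Uq.counit_κ]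
  simp only [DBData.bigCounit, BMap.comp_apply, CT.map_tm, CT.lid_tm, hE.C.counit, hE.B.counit,
    hE.cartan.H_counit, smul_eq_mul]

/-- The antipode of the double bosonisation. -/
def DBData.bigAntipode (E : DBData k H A C B) :
    BMap k (CT k (CT k C H) B) (CT k (CT k C H) B) :=
  E.bigMul.comp <| (CT.map
      (E.bigMul.comp <| (CT.map (E.inB.comp E.hB.antipode) (E.inH.comp E.Rbar)).comp <|
        (CT.swap k A B).comp E.hB.coact)
      (E.bigMul.comp <| (CT.map (E.inH.comp E.hH.antipode)
        (E.bigMul.comp <| (CT.map (E.inH.comp E.R) (E.inC.comp E.hC.antipodeInv)).comp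
          E.hC.coact)).comp (CT.swap k C H))).comp <|
    CT.swap k (CT k C H) B

/-- The antipode reverses f_c κ_λ e_b, and `bigAntipode` multiplies the three antipodes in that
order. It is enough to check words, for which the Cartan corrections are given by the coactions. -/
theorem DBEmbedding.antipode_emb (hE : DBEmbedding D q jH eA jC jB E) (y : Uq D q) :
    E.bigAntipode (hE.emb y) = hE.emb (Uq.antipode D q y) := by
  have : E.bigAntipode.toLinearMap ∘ₗ hE.tri =
      hE.emb ∘ₗ Uq.antipode D q ∘ₗ Uq.tri D q := TriMod.hom_ext_bw fun l c b => by
    change E.bigAntipode (hE.tri _) = hE.emb (Uq.antipode D q (Uq.tri D q _))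
    rw [hE.tri_pt, Uq.tri_pt, Uq.antipode_mul, Uq.antipode_mul, Uq.antipode_weval_e,
      Uq.antipode_weval_f, Uq.antipode_κ]
    simp only [DBData.bigAntipode, BMap.comp_apply, CT.swap_tm, CT.map_tm, hE.B.coact, hE.C.coact,
      hE.B.antipode, hE.C.antipodeInv, hE.cartan.R, hE.cartan.Rbar, hE.cartan.H_antipode,
      ← hE.emb_e, ← hE.emb_f, ← hE.emb_κ, hE.mul_emb]
  rw [← Uq.tri_coord D q y, hE.emb_tri]
  exact LinearMap.congr_fun this _

/-- The Hopf algebra structure of the double bosonisation. -/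
def DBData.bigHopf (E : DBData k H A C B) : HopfStr k (CT k (CT k C H) B) where
  one := tm k (tm k E.hC.one E.hH.one) E.hB.one
  mul := E.bigMul
  counit := E.bigCounit
  comul := E.bigComul
  antipode := E.bigAntipode

/-- All structure maps restrict to those of U_q(g) on a dense image, so the Hopf axioms of U_q(g)
carry over by continuity. -/
theorem DBEmbedding.isHopf (hE : DBEmbedding D q jH eA jC jB E) :
    IsHopf (CT.swap k (CT k (CT k C H) B) (CT k (CT k C H) B)) E.bigHopf := by
  have h := Uq.isUsualHopf D q
  refine IsHopf.of_dense hE.emb hE.denseRange_emb 1 (LinearMap.mul k (Uq D q))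
    (Uq.counit D q).toLinearMap (Uq.comul D q).toLinearMap (Uq.antipode D q)
    (LinearMap.mul k (Uq D q ⊗[k] Uq D q)) hE.emb_one hE.mul_emb hE.counit_emb hE.comul_emb
    hE.antipode_emb (fun a b c d => hE.map_mul_emb (a ⊗ₜ b) (c ⊗ₜ d)) mul_assoc one_mul mul_one
    h.coassoc h.counit_comul h.comul_counit (map_mul (Uq.comul D q)) (map_one (Uq.comul D q))
    (map_mul (Uq.counit D q)) (map_one (Uq.counit D q)) (fun a => ?_) (fun a => ?_)
  · exact (h.antipode_left a).trans (Algebra.algebraMap_eq_smul_one _)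
  · exact (h.antipode_right a).trans (Algebra.algebraMap_eq_smul_one _)

/-- On the dense image both sides are multiplication in U_q(g). The identification with the explicit
left action is what gives multiplicativity of the inclusion of C̄ ⋊ H̄ on the whole completion. -/
theorem DBEmbedding.bigMul_inCH (hE : DBEmbedding D q jH eA jC jB E) :
    E.bigMul.comp (CT.map E.inCH (BMap.id k _)) = E.lact := by
  refine CT.hom_ext fun z x => ?_
  refine DFunLike.congr_fun (hE.hom_ext (f := (E.bigMul.comp (CT.map E.inCH (BMap.id k _))).comp
    (CT.inr z)) (g := E.lact.comp (CT.inr z)) fun y => ?_) x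
  refine DFunLike.congr_fun (hE.hom_ext_CH (f := (E.bigMul.comp (CT.map E.inCH (BMap.id k _))).comp
    (CT.inl (hE.emb y))) (g := E.lact.comp (CT.inl (hE.emb y))) fun c l => ?_) z
  simp only [BMap.comp_apply, CT.inl_apply, CT.map_tm, ← hE.emb_f_κ, BMap.id_apply, hE.mul_emb,
    hE.lact_emb]

theorem DBEmbedding.bigMul_inHB (hE : DBEmbedding D q jH eA jC jB E) :
    E.bigMul.comp (CT.map (BMap.id k _) E.inHB) = E.ract := by
  refine CT.hom_ext fun x z => ?_
  refine DFunLike.congr_fun (hE.hom_ext (f := (E.bigMul.comp (CT.map (BMap.id k _) E.inHB)).comp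
    (CT.inl z)) (g := E.ract.comp (CT.inl z)) fun y => ?_) x
  refine DFunLike.congr_fun (hE.hom_ext_HB (f := (E.bigMul.comp (CT.map (BMap.id k _) E.inHB)).comp
    (CT.inr (hE.emb y))) (g := E.ract.comp (CT.inr (hE.emb y))) fun l b => ?_) z
  simp only [BMap.comp_apply, CT.inr_apply, CT.map_tm, ← hE.emb_κ_e, BMap.id_apply, hE.mul_emb,
    hE.ract_emb]

/-- Each defining property is an identity of bounded maps: it either unfolds from the construction
or holds in U_q(g) on dense subspaces. -/
theorem DBEmbedding.isDoubleBosonisation (hE : DBEmbedding D q jH eA jC jB E) :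
    E.IsDoubleBosonisation E.bigHopf where
  hopf := hE.isHopf
  one := rfl
  mul_inCH := CT.hom_ext fun z z' => by
    have h1 := DFunLike.congr_fun hE.bigMul_inCH (tm k z (E.inCH z'))
    rw [BMap.comp_apply, CT.map_tm, BMap.id_apply] at h1
    rw [BMap.comp_apply, CT.map_tm]
    refine h1.trans ?_
    rw [inCH_tm, DBData.lact, BMap.comp_apply, CT.assocInv_tm, CT.map_tm]
    rfl
  comul_inCH := hE.hom_ext_CH fun c l => by
    rw [BMap.comp_apply, BMap.comp_apply, hE.comulCH_emb, ← hE.comul_emb, hE.emb_f_κ]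
    rfl
  counit_inCH := hE.hom_ext_CH fun c l => by
    have h1 : E.hB.counit E.hB.one = 1 := by rw [hE.B.one, hE.B.counit, Words.counit_nil]
    change E.bigCounit (E.inCH _) = _
    simp only [inCH_tm, DBData.bigCounit, BMap.comp_apply, CT.map_tm, h1, CT.lid_tm, smul_eq_mul,
      mul_one]
  mul_inHB := CT.hom_ext fun z z' => by
    have h1 := DFunLike.congr_fun hE.bigMul_inHB (tm k (E.inHB z) z')
    rw [BMap.comp_apply, CT.map_tm, BMap.id_apply] at h1
    rw [BMap.comp_apply, CT.map_tm]
    refine h1.trans (CT.induction_eq (f := E.ract.comp ((CT.inl z').comp E.inHB))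
      (g := E.inHB.comp (E.mulHB.comp (CT.inl z'))) (fun h b => ?_) z)
    simp only [BMap.comp_apply, CT.inl_apply, inHB_tm, DBData.ract, CT.map_tm, CT.assoc_tm,
      BMap.id_apply]
    rfl
  comul_inHB := hE.hom_ext_HB fun l b => by
    rw [BMap.comp_apply, BMap.comp_apply, hE.comulHB_emb, ← hE.comul_emb, hE.emb_κ_e]
    rfl
  counit_inHB := hE.hom_ext_HB fun l b => by
    have h1 : E.hC.counit E.hC.one = 1 := by rw [hE.C.one, hE.C.counit, Words.counit_nil]
    change E.bigCounit (E.inHB _) = _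
    simp only [inHB_tm, DBData.bigCounit, BMap.comp_apply, CT.map_tm, h1, CT.lid_tm, smul_eq_mul,
      one_mul]
  mul_inCH_inB x b := by
    have h : E.bigMul.comp (CT.map E.inCH E.inB) = BMap.id k _ :=
      BMap.ext_dense hE.denseRange_tri fun m => by
        refine LinearMap.congr_fun (TriMod.hom_ext fun l c b => ?_ :
          (E.bigMul.comp (CT.map E.inCH E.inB)).toLinearMap ∘ₗ hE.tri = hE.tri) m
        change E.bigMul (CT.map E.inCH E.inB (hE.tri _)) = _
        rw [hE.tri_pt, CT.map_tm, ← hE.emb_f_κ, ← hE.emb_e, hE.mul_emb, hE.emb_pt]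
    rw [← CT.map_tm]
    exact DFunLike.congr_fun h (tm k x b)
  mul_inB_inC := CT.hom_ext_dense hE.B.dense hE.C.dense fun b c => by
    rw [BMap.comp_apply, CT.map_tm, hE.cross_emb, ← hE.mul_emb, hE.emb_e, hE.emb_f]
    rfl

end DBHopf

/-! ### The analytic quantum group -/

section Final

variable {k : Type*} [NormedField k] [IsUltrametricDist k] [CompleteSpace k]
  {I Φ : Type*} [AddCommGroup Φ] {D : RootDatum I Φ} {q : QNumber k} {r s : ℝ≥0}

theorem Nichols.v_eq (r : ℝ≥0) (i : I) : Nichols.v D q r i = Nichols.j D q r (bw k [i]) := rfl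

open scoped Classical in
theorem form_single_single (i j : I) :
    form D q (bw k [i]) (bw k [j]) = if i = j then (qDiff k D q i)⁻¹ else 0 := by
  rw [← cons_bw, form_cons_left, ← cons_bw, skew_cons, skew_nil, map_zero, smul_zero, add_zero]
  split_ifs
  · rw [form_nil_left', Words.counit_nil, mul_one]
  · rw [map_zero, mul_zero]

section
variable (hN : (nicholsIdeal D q r : Set (TA k I r)) = closure (jT k I r '' radical D q))
  (hN' : (nicholsIdeal D q s : Set (TA k I s)) = closure (jT k I s '' radical D q))
  (hrs : ∀ i, 1 ≤ ‖qDiff k D q i‖ * r * s)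

/-- The data of the analytic quantum group. -/
def quantumData : DBData k (Cartan k Φ) (GA k (I →₀ ℤ)) (Nichols D q r) (Nichols D q s) :=
  dbData D q (Nichols.str hN) (Nichols.str hN') (Nichols.pair hN hN' hrs)

theorem quantumData_embedding : DBEmbedding D q (Cop.ofFinsupp k _) (Cop.e k _) (Nichols.j D q r)
    (Nichols.j D q s) (quantumData hN hN' hrs) where
  cartan := cartanModel D q
  C := Nichols.str_model hN
  B := Nichols.str_model hN'
  pair := Nichols.pair_j hN hN' hrs
  C_radical := Nichols.j_radical hN
  B_radical := Nichols.j_radical hN'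
  coeff l := ⟨Cop.coeff (fun _ => one_pos) l, Cop.coeff_ofFinsupp (fun _ => one_pos) l⟩

/-- The analytic quantum group. -/
def quantumGroup : AnalyticQuantumGroup D q r s where
  C := Nichols.str hN
  B := Nichols.str hN'
  pair := Nichols.pair hN hN' hrs
  U := (quantumData hN hN' hrs).bigHopf
  isNichols_C := Nichols.isNichols hN
  isNichols_B := Nichols.isNichols hN'
  isPairing := (Nichols.str_model hN').isDualityPairing (cartanModel D q) (Nichols.str_model hN)
    (Nichols.pair_j hN hN' hrs)
  pair_v i j := by
    rw [Nichols.v_eq, Nichols.v_eq, Nichols.pair_j, form_single_single]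
  isDB := (quantumData_embedding hN hN' hrs).isDoubleBosonisation

/-- Uniqueness proceeds in the order of dependence: first the two Nichols algebras, then the pairing
between them, then the Hopf structure built from these. -/
theorem AnalyticQuantumGroup.eq_quantumGroup (Q : AnalyticQuantumGroup D q r s) :
    Q = quantumGroup hN hN' hrs := by
  have h1 : Q.C = Nichols.str hN := (Nichols.isNichols hN).eq Q.isNichols_C
  have h2 : Q.B = Nichols.str hN' := (Nichols.isNichols hN').eq Q.isNichols_B
  obtain ⟨QC, QB, Qp, QU, i1, i2, i3, i4, i5⟩ := Q
  simp only at h1 h2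
  subst h1 h2
  have h3 : Qp = Nichols.pair hN hN' hrs :=
    IsDualityPairing.eq (Nichols.str_model hN') (Nichols.str_model hN)
      (quantumGroup hN hN' hrs).isPairing i3 fun i j =>
        (i4 i j).trans ((quantumGroup hN hN' hrs).pair_v i j).symm
  subst h3
  have h4 : QU = (quantumData hN hN' hrs).bigHopf :=
    IsDoubleBosonisation.eq (quantumData_embedding hN hN' hrs).toDBModel
      (quantumData_embedding hN hN' hrs).isDoubleBosonisation i5
  subst h4
  rfl

/-- The embedding of `U_q(g)` into the analytic quantum group. -/
def quantumEmb : Uq D q →ₗ[k] UqSpace D q r s := (quantumData_embedding hN hN' hrs).emb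

theorem quantumGroup_data : (quantumGroup hN hN' hrs).data = quantumData hN hN' hrs := rfl

theorem quantumGroup_U : (quantumGroup hN hN' hrs).U = (quantumData hN hN' hrs).bigHopf := rfl

theorem quantumGroup_K (l : Module.Dual ℤ Φ) :
    (quantumGroup hN hN' hrs).K l = quantumEmb hN hN' hrs (Uq.κ D q l) := by
  rw [AnalyticQuantumGroup.K, quantumGroup_data, quantumEmb, DBEmbedding.emb_κ,
    Cop.ofFinsupp_single_one]

theorem quantumGroup_E (i : I) :
    (quantumGroup hN hN' hrs).E i = quantumEmb hN hN' hrs (Uq.e D q i) := by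
  rw [← mul_one (Uq.e D q i), ← weval_nil (k := k) (Uq.e D q), ← weval_cons, cons_bw,
    AnalyticQuantumGroup.E, quantumGroup_data, quantumEmb, DBEmbedding.emb_e, Nichols.v_eq]

theorem quantumGroup_F (i : I) :
    (quantumGroup hN hN' hrs).F i = quantumEmb hN hN' hrs (Uq.f D q i) := by
  rw [← mul_one (Uq.f D q i), ← weval_nil (k := k) (Uq.f D q), ← weval_cons, cons_bw,
    AnalyticQuantumGroup.F, quantumGroup_data, quantumEmb, DBEmbedding.emb_f, Nichols.v_eq]

theorem quantumGroup_mul (x y : Uq D q) : quantumEmb hN hN' hrs (x * y) =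
    (quantumGroup hN hN' hrs).U.mul
      (tm k (quantumEmb hN hN' hrs x) (quantumEmb hN hN' hrs y)) := by
  rw [quantumGroup_U, quantumEmb, DBData.bigHopf, DBEmbedding.mul_emb]

theorem quantumGroup_one : quantumEmb hN hN' hrs 1 = (quantumGroup hN hN' hrs).U.one := by
  rw [quantumGroup_U, quantumEmb, DBData.bigHopf, DBEmbedding.emb_one]

theorem quantumGroup_comul (x : Uq D q) :
    (quantumGroup hN hN' hrs).U.comul (quantumEmb hN hN' hrs x) =
      CT.alg (quantumEmb hN hN' hrs) (quantumEmb hN hN' hrs) (Uq.comul D q x) := by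
  rw [quantumGroup_U, quantumEmb, DBData.bigHopf, DBEmbedding.comul_emb]

theorem quantumGroup_counit (x : Uq D q) :
    (quantumGroup hN hN' hrs).U.counit (quantumEmb hN hN' hrs x) = Uq.counit D q x := by
  rw [quantumGroup_U, quantumEmb, DBData.bigHopf, DBEmbedding.counit_emb]

theorem quantumGroup_antipode (x : Uq D q) :
    (quantumGroup hN hN' hrs).U.antipode (quantumEmb hN hN' hrs x) =
      quantumEmb hN hN' hrs (Uq.antipode D q x) := by
  rw [quantumGroup_U, quantumEmb, DBData.bigHopf, DBEmbedding.antipode_emb]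

theorem isDenseSubHopf_quantumGroup : IsDenseSubHopf (quantumGroup hN hN' hrs) (Uq.comul D q)
    (Uq.counit D q) (Uq.antipode D q) (quantumEmb hN hN' hrs) where
  injective := (quantumData_embedding hN hN' hrs).injective_emb
  dense := (quantumData_embedding hN hN' hrs).denseRange_emb
  map_K l := by rw [Uq.K_eq, quantumGroup_K]
  map_E i := by rw [Uq.E_eq, quantumGroup_mul, quantumGroup_E, quantumGroup_K, D.ti_eq]
  map_F i := by rw [Uq.F_eq, map_neg, quantumGroup_mul, quantumGroup_F, quantumGroup_K, D.ti_eq]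
  map_one := quantumGroup_one hN hN' hrs
  map_mul := quantumGroup_mul hN hN' hrs
  map_comul := quantumGroup_comul hN hN' hrs
  map_counit := quantumGroup_counit hN hN' hrs
  map_antipode := quantumGroup_antipode hN hN' hrs

end

end Final

end QAn

end

/-- For `r, s > 0` with `|qᵢ - qᵢ⁻¹| r s ≥ 1` the analytic quantum group
`U(f_r, H, f_s)` exists and is unique, `U_q(g)` with its usual Hopf algebra structure embeds into it
with dense image, and the Hopf algebra structure restricts to the usual one on `U_q(g)`. -/
theorem proposition3p24 {k : Type*} [NormedField k] [IsUltrametricDist k] [CompleteSpace k]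
    {I Φ : Type*} [AddCommGroup Φ] [Module.Free ℤ Φ]
    (D : QAn.RootDatum I Φ) (q : QAn.QNumber k) (r s : NNReal) (hr : 0 < r) (hs : 0 < s)
    (hrs : ∀ i, 1 ≤ ‖QAn.qDiff k D q i‖ * r * s) :
    ∃ Q : QAn.AnalyticQuantumGroup D q r s, (∀ Q' : QAn.AnalyticQuantumGroup D q r s, Q' = Q) ∧
      ∃ (Δ : QAn.Uq D q →ₐ[k] TensorProduct k (QAn.Uq D q) (QAn.Uq D q)) (ε : QAn.Uq D q →ₐ[k] k)
        (S : QAn.Uq D q →ₗ[k] QAn.Uq D q) (ι : QAn.Uq D q →ₗ[k] QAn.UqSpace D q r s),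
        QAn.IsUsualHopf D q Δ ε S ∧ QAn.IsDenseSubHopf Q Δ ε S ι := by
  have hN := QAn.nicholsIdeal_eq_closure hr hrs
  -- The hypothesis is symmetric in the two radii, so the description of the Nichols ideal applies
  -- to f_s with r as the auxiliary radius.
  have hN' := QAn.nicholsIdeal_eq_closure (D := D) (q := q) hs (s := r) fun i => by
    rw [mul_right_comm]; exact hrs i
  exact ⟨QAn.quantumGroup hN hN' hrs, QAn.AnalyticQuantumGroup.eq_quantumGroup hN hN' hrs, _, _, _,
    _, QAn.Uq.isUsualHopf D q, QAn.isDenseSubHopf_quantumGroup hN hN' hrs⟩
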